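/- Let $d\in\{2,3,4\}$, let $\mathcal O\subset\mathbb R^d$ be a bounded open set (for instance a bounded domain with $\mathrm C^2$ boundary), and let $T,\mu,\beta>0$ and $r\in[1,3]$. Let $\mathcal V$ be the space of divergence-free fields in $\mathrm C_0^\infty(\mathcal O;\mathbb R^d)$, and let $\mathbb H$, $\mathbb V$, $\widetilde{\mathbb L}^p$ be the closures of $\mathcal V$ in $\mathrm L^2(\mathcal O;\mathbb R^d)$, $\mathrm H_0^1(\mathcal O;\mathbb R^d)$, $\mathrm L^p(\mathcal O;\mathbb R^d)$, with $\|\boldsymbol u\|_{\mathbb H}=\|\boldsymbol u\|_{\mathrm L^2}$, $\|\boldsymbol u\|_{\mathbb V}=\|\nabla\boldsymbol u\|_{\mathrm L^2}$, $\|\boldsymbol u\|_{\widetilde{\mathbb L}^{p}}=\|\boldsymbol u\|_{\mathrm L^{p}}$; $\widetilde{\mathbb L}^{(r+1)/r}$ is used below as the dual of $\widetilde{\mathbb L}^{r+1}$. Let $\mathcal V_T$ be the space of $\boldsymbol v\in\mathrm C_0^\infty(\mathcal O\times[0,T);\mathbb R^d)$ with $\nabla\cdot\boldsymbol v(\cdot,t)=0$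 for all $t$. Given $\boldsymbol u_0\in\mathbb H$ and $\boldsymbol f\in\mathrm L^2(0,T;\mathbb V')$, a \emph{weak solution} of the convective Brinkman--Forchheimer equations $$\partial_t\boldsymbol u-\mu\Delta\boldsymbol u+(\boldsymbol u\cdot\nabla)\boldsymbol u+\beta|\boldsymbol u|^{r-1}\boldsymbol u+\nabla p=\boldsymbol f,\quad \nabla\cdot\boldsymbol u=0,\quad \boldsymbol u|_{\partial\mathcal O}=0,\quad \boldsymbol u(0)=\boldsymbol u_0$$ is a function $\boldsymbol u\in\mathrm L^\infty(0,T;\mathbb H)\cap\mathrm L^2(0,T;\mathbb V)\cap\mathrm L^{r+1}(0,T;\widetilde{\mathbb L}^{r+1})$ with $\boldsymbol u(0)=\boldsymbol u_0$ and $\frac{\mathrm d\boldsymbol u}{\mathrm dt}\in\mathrm L^{q}(0,T;\mathbb V')+\mathrm L^{(r+1)/r}(0,T;\widetilde{\mathbb L}^{(r+1)/r})$, where $q=2$ if $r=3$ and $q=4/d$ if $r<3$, such that for every $\boldsymbol v\in\mathcal V_T$, for $t_0=0$ and for almost every $t_0\in(0,T)$, and for almost every $t_1\in(t_0,T)$,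 $$-\int_{t_0}^{t_1}\langle\boldsymbol u,\partial_t\boldsymbol v\rangle\,\mathrm ds+\mu\int_{t_0}^{t_1}(\nabla\boldsymbol u,\nabla\boldsymbol v)\,\mathrm ds+\int_{t_0}^{t_1}\langle(\boldsymbol u\cdot\nabla)\boldsymbol u,\boldsymbol v\rangle\,\mathrm ds+\beta\int_{t_0}^{t_1}\langle|\boldsymbol u|^{r-1}\boldsymbol u,\boldsymbol v\rangle\,\mathrm ds=-\langle\boldsymbol u(t_1),\boldsymbol v(t_1)\rangle+\langle\boldsymbol u(t_0),\boldsymbol v(t_0)\rangle+\int_{t_0}^{t_1}\langle\boldsymbol f,\boldsymbol v\rangle\,\mathrm ds.$$ Then there exists a weak solution $\boldsymbol u$, weakly continuous from $[0,T]$ to $\mathbb H$, which satisfies the energy inequality $$\|\boldsymbol u(t)\|_{\mathbb H}^2+2\mu\int_0^t\|\boldsymbol u(s)\|_{\mathbb V}^2\,\mathrm ds+2\beta\int_0^t\|\boldsymbol u(s)\|_{\widetilde{\mathbb L}^{r+1}}^{r+1}\,\mathrm ds\le\|\boldsymbol u_0\|_{\mathbb H}^2+2\int_0^t\langle\boldsymbol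 f(s),\boldsymbol u(s)\rangle\,\mathrm ds\qquad\text{for all }t\in[0,T],$$ and $\lim_{t\to0^+}\|\boldsymbol u(t)-\boldsymbol u_0\|_{\mathbb H}=0$. Moreover, if $d=2$, every weak solution, taken in its weakly continuous representative, satisfies the energy inequality with equality for all $t\in[0,T]$, and the weak solution is unique: any two weak solutions with the same data coincide for almost every $t\in(0,T)$. -/

import Mathlib

open MeasureTheory Set Filter Topology
open scoped ENNReal ContDiff

noncomputable section

namespace CBF

/-- The space `ℝ^d` with its Euclidean norm. -/
abbrev Vec (d : ℕ) : Type := EuclideanSpace ℝ (Fin d)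

/-- The values of the gradient of a vector field, with the Euclidean (Frobenius) norm; the entry
`(i, j)` of a gradient is `∂ u_j / ∂ x_i`. -/
abbrev Mat (d : ℕ) : Type := EuclideanSpace ℝ (Fin d × Fin d)

/-- Lebesgue measure on `O`. -/
abbrev volOn {d : ℕ} (O : Set (Vec d)) : Measure (Vec d) := volume.restrict O

/-- Lebesgue measure on the time interval `(0, T)`. -/
abbrev timeMeasure (T : ℝ) : Measure ℝ := volume.restrict (Ioo 0 T)

/-- The `i`-th partial derivative of a field. -/
def partialDeriv {d : ℕ} (φ : Vec d → Vec d) (i : Fin d) (x : Vec d) : Vec d :=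
  fderiv ℝ φ x (EuclideanSpace.single i 1)

/-- The classical gradient of a vector field. -/
def classicalGrad {d : ℕ} (φ : Vec d → Vec d) (x : Vec d) : Mat d :=
  WithLp.toLp 2 fun ij => partialDeriv φ ij.1 x ij.2

/-- The classical divergence of a vector field. -/
def divergence {d : ℕ} (φ : Vec d → Vec d) (x : Vec d) : ℝ :=
  ∑ i, partialDeriv φ i x i

theorem partialDeriv_add {d : ℕ} {φ ψ : Vec d → Vec d} (hφ : ContDiff ℝ ∞ φ)
    (hψ : ContDiff ℝ ∞ ψ) (i : Fin d) (x : Vec d) :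
    partialDeriv (φ + ψ) i x = partialDeriv φ i x + partialDeriv ψ i x := by
  unfold partialDeriv
  rw [fderiv_add (hφ.differentiable (by simp) x) (hψ.differentiable (by simp) x)]
  rfl

theorem partialDeriv_smul {d : ℕ} (c : ℝ) {φ : Vec d → Vec d} (hφ : ContDiff ℝ ∞ φ)
    (i : Fin d) (x : Vec d) :
    partialDeriv (c • φ) i x = c • partialDeriv φ i x := by
  unfold partialDeriv
  rw [fderiv_const_smul (hφ.differentiable (by simp) x)]
  rfl

theorem continuous_classicalGrad {d : ℕ} {φ : Vec d → Vec d} (hφ : ContDiff ℝ ∞ φ) :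
    Continuous (classicalGrad φ) := by
  have h : Continuous (fderiv ℝ φ) := hφ.continuous_fderiv (by simp)
  unfold classicalGrad partialDeriv
  fun_prop

theorem hasCompactSupport_classicalGrad {d : ℕ} {φ : Vec d → Vec d} (hc : HasCompactSupport φ) :
    HasCompactSupport (classicalGrad φ) := by
  have h := (hc.fderiv (𝕜 := ℝ)).comp_left (g := fun L : Vec d →L[ℝ] Vec d =>
    (WithLp.toLp 2 fun ij : Fin d × Fin d => L (EuclideanSpace.single ij.1 1) ij.2 : Mat d))
    (by ext ij; simp)
  exact h

/-- The space `𝒱` of smooth divergence-free fields with compact support in `O`. -/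
def divFreeTest {d : ℕ} (O : Set (Vec d)) : Submodule ℝ (Vec d → Vec d) where
  carrier := {φ | ContDiff ℝ ∞ φ ∧ HasCompactSupport φ ∧ tsupport φ ⊆ O ∧ ∀ x, divergence φ x = 0}
  zero_mem' := by
    refine ⟨contDiff_const, HasCompactSupport.zero, ?_, fun x => ?_⟩
    · simp [tsupport]
    · simp [divergence, partialDeriv]
  add_mem' := by
    rintro φ ψ ⟨h1, h2, h3, h4⟩ ⟨k1, k2, k3, k4⟩
    refine ⟨h1.add k1, h2.add k2, (tsupport_add φ ψ).trans (union_subset h3 k3), fun x => ?_⟩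
    have e : divergence (φ + ψ) x = divergence φ x + divergence ψ x := by
      simp [divergence, partialDeriv_add h1 k1, Finset.sum_add_distrib]
    rw [e, h4, k4, add_zero]
  smul_mem' := by
    rintro c φ ⟨h1, h2, h3, h4⟩
    refine ⟨h1.const_smul c, h2.smul_left (f := fun _ => c), ?_, fun x => ?_⟩
    · exact (closure_mono (Function.support_const_smul_subset c φ)).trans h3
    · have e : divergence (c • φ) x = c * divergence φ x := by
        simp [divergence, partialDeriv_smul c h1, Finset.mul_sum]
      rw [e, h4, mul_zero]

variable {d : ℕ} {O : Set (Vec d)}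

theorem memLp_test (φ : divFreeTest O) (p : ℝ≥0∞) : MemLp (φ : Vec d → Vec d) p (volOn O) :=
  φ.2.1.continuous.memLp_of_hasCompactSupport φ.2.2.1

theorem memLp_grad_test (φ : divFreeTest O) (p : ℝ≥0∞) :
    MemLp (classicalGrad (φ : Vec d → Vec d)) p (volOn O) :=
  (continuous_classicalGrad φ.2.1).memLp_of_hasCompactSupport
    (hasCompactSupport_classicalGrad φ.2.2.1)

/-- The class of a test field in `L²(O; ℝ^d)`. -/
def testToL2 (O : Set (Vec d)) : divFreeTest O →ₗ[ℝ] Lp (Vec d) 2 (volOn O) where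
  toFun φ := (memLp_test φ 2).toLp φ
  map_add' φ ψ := MemLp.toLp_add (memLp_test φ 2) (memLp_test ψ 2)
  map_smul' c φ := MemLp.toLp_const_smul c (memLp_test φ 2)

theorem classicalGrad_add (φ ψ : divFreeTest O) :
    classicalGrad ((φ + ψ : divFreeTest O) : Vec d → Vec d) =
      classicalGrad (φ : Vec d → Vec d) + classicalGrad (ψ : Vec d → Vec d) := by
  funext x
  ext ij
  simp [classicalGrad, partialDeriv_add φ.2.1 ψ.2.1]

theorem classicalGrad_smul (c : ℝ) (φ : divFreeTest O) :
    classicalGrad ((c • φ : divFreeTest O) : Vec d → Vec d) =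
      c • classicalGrad (φ : Vec d → Vec d) := by
  funext x
  ext ij
  simp [classicalGrad, partialDeriv_smul c φ.2.1]

/-- The class of the gradient of a test field in `L²(O; ℝ^{d × d})`. -/
def testGradToL2 (O : Set (Vec d)) : divFreeTest O →ₗ[ℝ] Lp (Mat d) 2 (volOn O) where
  toFun φ := (memLp_grad_test φ 2).toLp _
  map_add' φ ψ := by
    rw [← MemLp.toLp_add]
    exact MemLp.toLp_congr _ _ (by rw [classicalGrad_add])
  map_smul' c φ := by
    rw [RingHom.id_apply, ← MemLp.toLp_const_smul]
    exact MemLp.toLp_congr _ _ (by rw [classicalGrad_smul])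

/-- The closure of `𝒱` in `L²(O; ℝ^d)`. -/
def HSubmodule (O : Set (Vec d)) : Submodule ℝ (Lp (Vec d) 2 (volOn O)) :=
  (LinearMap.range (testToL2 O)).topologicalClosure

/-- The ambient space of pairs (field, gradient) in which the `H¹` norm is
`(‖u‖² + ‖∇u‖²)^{1/2}`. -/
abbrev H1Pair (O : Set (Vec d)) : Type :=
  WithLp 2 (Lp (Vec d) 2 (volOn O) × Lp (Mat d) 2 (volOn O))

/-- A test field together with its gradient. -/
def testToPair (O : Set (Vec d)) : divFreeTest O →ₗ[ℝ] H1Pair O :=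
  (WithLp.linearEquiv 2 ℝ _).symm.toLinearMap ∘ₗ (testToL2 O).prod (testGradToL2 O)

/-- The closure of `𝒱` in the norm of `H¹`. -/
def VSubmodule (O : Set (Vec d)) : Submodule ℝ (H1Pair O) :=
  (LinearMap.range (testToPair O)).topologicalClosure

/-- The Hilbert space `H`: the closure of `𝒱` in `L²(O; ℝ^d)`. -/
def HSpace (O : Set (Vec d)) : Type := HSubmodule O

/-- The Hilbert space `V`: the closure of `𝒱` in the norm of `H¹`. An element is a field of
`H¹_0` written as the pair of the field and its weak gradient. -/
def VSpace (O : Set (Vec d)) : Type := VSubmodule O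

instance instNormedAddCommGroupHSpace : NormedAddCommGroup (HSpace O) :=
  inferInstanceAs (NormedAddCommGroup (HSubmodule O))

instance instInnerProductSpaceHSpace : InnerProductSpace ℝ (HSpace O) :=
  inferInstanceAs (InnerProductSpace ℝ (HSubmodule O))

instance instCompleteSpaceHSpace : CompleteSpace (HSpace O) :=
  (Submodule.isClosed_topologicalClosure _).completeSpace_coe

instance instNormedAddCommGroupVSpace : NormedAddCommGroup (VSpace O) :=
  inferInstanceAs (NormedAddCommGroup (VSubmodule O))

instance instInnerProductSpaceVSpace : InnerProductSpace ℝ (VSpace O) :=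
  inferInstanceAs (InnerProductSpace ℝ (VSubmodule O))

instance instCompleteSpaceVSpace : CompleteSpace (VSpace O) :=
  (Submodule.isClosed_topologicalClosure _).completeSpace_coe

/-- The inclusion of `H` in `L²(O; ℝ^d)`. -/
def HSpace.toL2 : HSpace O →ₗᵢ[ℝ] Lp (Vec d) 2 (volOn O) := (HSubmodule O).subtypeₗᵢ

/-- The inclusion of `V` in the space of pairs. -/
def VSpace.toPair : VSpace O →ₗᵢ[ℝ] H1Pair O := (VSubmodule O).subtypeₗᵢ

/-- A test field as an element of `H`. -/
def testToH (φ : divFreeTest O) : HSpace O :=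
  ⟨testToL2 O φ, Submodule.le_topologicalClosure _ ⟨φ, rfl⟩⟩

/-- A test field as an element of `V`. -/
def testToV (φ : divFreeTest O) : VSpace O :=
  ⟨testToPair O φ, Submodule.le_topologicalClosure _ ⟨φ, rfl⟩⟩

/-- A closed property of pairs (field, gradient) that holds for test fields holds on `V`. -/
theorem VSpace_induction {P : H1Pair O → Prop} (hP : IsClosed {p | P p})
    (h : ∀ φ, P (testToPair O φ)) (v : VSpace O) : P v.toPair := by
  have hv : v.toPair ∈ closure (Set.range (testToPair O)) := v.2
  exact closure_minimal (by rintro _ ⟨φ, rfl⟩; exact h φ) hP hv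

theorem continuous_H1Pair_fst : Continuous (fun p : H1Pair O => p.fst) := by fun_prop

theorem continuous_H1Pair_snd : Continuous (fun p : H1Pair O => p.snd) := by fun_prop

theorem fst_mem_HSubmodule (v : VSpace O) : v.toPair.fst ∈ HSubmodule O :=
  VSpace_induction (P := fun p => p.fst ∈ HSubmodule O)
    ((Submodule.isClosed_topologicalClosure _).preimage continuous_H1Pair_fst)
    (fun φ => Submodule.le_topologicalClosure _ ⟨φ, rfl⟩) v

/-- The embedding of `V` into `H`. -/
def embV (v : VSpace O) : HSpace O := ⟨v.toPair.fst, fst_mem_HSubmodule v⟩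

/-- The weak gradient of an element of `V`. -/
def gradV (v : VSpace O) : Lp (Mat d) 2 (volOn O) := v.toPair.snd

theorem integral_by_parts_test (φ : divFreeTest O) {ψ : Vec d → ℝ} (hψ : ContDiff ℝ ∞ ψ)
    (hc : HasCompactSupport ψ) (i j : Fin d) :
    (∫ x in O, fderiv ℝ ψ x (EuclideanSpace.single i 1) * (φ : Vec d → Vec d) x j) +
      ∫ x in O, ψ x * classicalGrad (φ : Vec d → Vec d) x (i, j) = 0 := by
  have hφ := φ.2.1
  have hφc := φ.2.2.1
  have hφO := φ.2.2.2.1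
  set f : Vec d → ℝ := fun x => (φ : Vec d → Vec d) x j with hf
  have hfd : ContDiff ℝ ∞ f := by rw [hf]; fun_prop
  have hfderiv : ∀ x, classicalGrad (φ : Vec d → Vec d) x (i, j) =
      fderiv ℝ f x (EuclideanSpace.single i 1) := by
    intro x
    have h1 : HasFDerivAt (φ : Vec d → Vec d) (fderiv ℝ (φ : Vec d → Vec d) x) x :=
      (hφ.differentiable (by simp) x).hasFDerivAt
    have h2 := (EuclideanSpace.proj (𝕜 := ℝ) j).hasFDerivAt.comp x h1
    have h3 : fderiv ℝ f x = _ := h2.fderiv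
    rw [h3]
    rfl
  have hz : ∀ x, x ∉ O → (φ : Vec d → Vec d) x = 0 := fun x hx =>
    image_eq_zero_of_notMem_tsupport fun h => hx (hφO h)
  have hz' : ∀ x, x ∉ O → fderiv ℝ (φ : Vec d → Vec d) x = 0 := fun x hx =>
    Function.notMem_support.1 fun h => hx (hφO (support_fderiv_subset ℝ h))
  rw [setIntegral_eq_integral_of_forall_compl_eq_zero (by intro x hx; simp [hz x hx]),
    setIntegral_eq_integral_of_forall_compl_eq_zero
      (by intro x hx; simp [classicalGrad, partialDeriv, hz' x hx])]
  simp only [hfderiv]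
  have hψ' : Continuous (fun x => fderiv ℝ ψ x (EuclideanSpace.single i 1)) :=
    (hψ.continuous_fderiv (by simp)).clm_apply continuous_const
  have hf' : Continuous (fun x => fderiv ℝ f x (EuclideanSpace.single i 1)) :=
    (hfd.continuous_fderiv (by simp)).clm_apply continuous_const
  rw [integral_mul_fderiv_eq_neg_fderiv_mul_of_integrable (f := ψ) (g := f)
    (v := EuclideanSpace.single i 1) (μ := volume)]
  · simp [hf]
  · refine (hψ'.mul hfd.continuous).integrable_of_hasCompactSupport ?_
    exact (hc.fderiv_apply (𝕜 := ℝ) _).mul_right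
  · exact (hψ.continuous.mul hf').integrable_of_hasCompactSupport hc.mul_right
  · exact (hψ.continuous.mul hfd.continuous).integrable_of_hasCompactSupport hc.mul_right
  · exact fun x _ => hψ.differentiable (by simp) x
  · exact fun x _ => hfd.differentiable (by simp) x

/-- The second component of an element of `V` is the weak gradient of the first one. -/
theorem weakGrad_VSpace (v : VSpace O) {ψ : Vec d → ℝ} (hψ : ContDiff ℝ ∞ ψ)
    (hc : HasCompactSupport ψ) (i j : Fin d) :
    (∫ x in O, fderiv ℝ ψ x (EuclideanSpace.single i 1) * v.toPair.fst x j) +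
      ∫ x in O, ψ x * v.toPair.snd x (i, j) = 0 := by
  have hψ' : Continuous (fun x => fderiv ℝ ψ x (EuclideanSpace.single i 1)) :=
    (hψ.continuous_fderiv (by simp)).clm_apply continuous_const
  have hA : MemLp (fun x => (EuclideanSpace.single j
      (fderiv ℝ ψ x (EuclideanSpace.single i 1)) : Vec d)) 2 (volOn O) := by
    refine Continuous.memLp_of_hasCompactSupport ?_ ?_
    · exact (PiLp.continuous_toLp 2 _).comp ((continuous_single j).comp hψ')
    · exact (hc.fderiv_apply (𝕜 := ℝ) _).comp_left (g := fun c : ℝ =>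
        (EuclideanSpace.single j c : Vec d)) (by simp)
  have hB : MemLp (fun x => (EuclideanSpace.single (i, j) (ψ x) : Mat d)) 2 (volOn O) := by
    refine Continuous.memLp_of_hasCompactSupport ?_ ?_
    · exact (PiLp.continuous_toLp 2 _).comp ((continuous_single (i, j)).comp hψ.continuous)
    · exact hc.comp_left (g := fun c : ℝ => (EuclideanSpace.single (i, j) c : Mat d)) (by simp)
  have eA : ∀ w : Lp (Vec d) 2 (volOn O), inner ℝ (hA.toLp _) w =
      ∫ x in O, fderiv ℝ ψ x (EuclideanSpace.single i 1) * w x j := by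
    intro w
    rw [L2.inner_def]
    refine integral_congr_ae ?_
    filter_upwards [hA.coeFn_toLp] with x hx
    rw [hx, EuclideanSpace.inner_single_left]
    rfl
  have eB : ∀ w : Lp (Mat d) 2 (volOn O), inner ℝ (hB.toLp _) w =
      ∫ x in O, ψ x * w x (i, j) := by
    intro w
    rw [L2.inner_def]
    refine integral_congr_ae ?_
    filter_upwards [hB.coeFn_toLp] with x hx
    rw [hx, EuclideanSpace.inner_single_left]
    rfl
  rw [← eA, ← eB]
  refine VSpace_induction
    (P := fun p => inner ℝ (hA.toLp _) p.fst + inner ℝ (hB.toLp _) p.snd = 0) ?_ ?_ v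
  · exact isClosed_eq ((continuous_const.inner continuous_H1Pair_fst).add
      (continuous_const.inner continuous_H1Pair_snd)) continuous_const
  · intro φ
    rw [eA, eB, ← integral_by_parts_test φ hψ hc i j]
    congr 1
    · refine integral_congr_ae ?_
      filter_upwards [(memLp_test φ 2).coeFn_toLp] with x hx
      exact congrArg (fun y : Vec d => _ * y j) hx
    · refine integral_congr_ae ?_
      filter_upwards [(memLp_grad_test φ 2).coeFn_toLp] with x hx
      exact congrArg (fun y : Mat d => _ * y (i, j)) hx

/-- An element of `V` is determined by its field. -/
theorem embV_injective : Function.Injective (embV (O := O)) := by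
  intro v w h
  have h1 : v.toPair.fst = w.toPair.fst := congrArg Subtype.val h
  have h2 : v.toPair.snd = w.toPair.snd := by
    have key : ∀ ij : Fin d × Fin d, ∀ᵐ x ∂(volOn O),
        (v.toPair.snd x ij = w.toPair.snd x ij) := by
      rintro ⟨i, j⟩
      have hl : ∀ u : VSpace O,
          LocallyIntegrable (fun x => u.toPair.snd x (i, j)) (volOn O) := by
        intro u
        have := (EuclideanSpace.proj (𝕜 := ℝ) (i, j)).comp_memLp' (Lp.memLp u.toPair.snd)
        exact this.locallyIntegrable (by norm_num)
      refine ae_eq_of_integral_contDiff_smul_eq (hl v) (hl w) fun ψ hψ hc => ?_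
      have e1 := weakGrad_VSpace v hψ hc i j
      have e2 := weakGrad_VSpace w hψ hc i j
      rw [h1] at e1
      simp only [smul_eq_mul]
      linarith
    refine Lp.ext ?_
    filter_upwards [ae_all_iff.2 key] with x hx
    ext ij
    exact hx ij
  apply Subtype.ext
  exact (WithLp.equiv 2 _).injective (Prod.ext h1 h2)

/-- An element of `H` that lies in `V`, seen as an element of `V` (arbitrary outside `V`). -/
def asV (w : HSpace O) : VSpace O := Function.invFun embV w

theorem asV_embV (v : VSpace O) : asV (embV v) = v :=
  Function.leftInverse_invFun embV_injective v

/-- The norm of `V`: `‖w‖_V = ‖∇w‖_{L²}`. -/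
def normV (w : HSpace O) : ℝ := ‖gradV (asV w)‖

/-- A representative of an element of `H` as a vector field. -/
def field (w : HSpace O) : Vec d → Vec d := (w.toL2 : Vec d → Vec d)

/-- `w` belongs to `L̃^p`, the closure of `𝒱` in `L^p(O; ℝ^d)`. -/
def MemLtilde (p : ℝ) (w : HSpace O) : Prop :=
  ∀ ε : ℝ≥0∞, 0 < ε → ∃ φ : divFreeTest O,
    eLpNorm (field w - (φ : Vec d → Vec d)) (ENNReal.ofReal p) (volOn O) < ε

/-- `u ∈ L^∞(0, T; H)`. -/
def MemLinftyH (T : ℝ) (u : ℝ → HSpace O) : Prop := MemLp u (⊤ : ℝ≥0∞) (timeMeasure T)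

/-- `u ∈ L²(0, T; V)`. -/
def MemL2V (T : ℝ) (u : ℝ → HSpace O) : Prop :=
  (∀ᵐ t ∂timeMeasure T, u t ∈ Set.range (embV (O := O))) ∧
    MemLp (fun t => asV (u t)) 2 (timeMeasure T)

/-- `u ∈ L^p(0, T; L̃^p)`, for a strongly measurable `u` with values in `H` and `p ≥ 2`. -/
def MemLpLtilde (T p : ℝ) (u : ℝ → HSpace O) : Prop :=
  AEStronglyMeasurable u (timeMeasure T) ∧
    (∀ᵐ t ∂timeMeasure T, MemLtilde p (u t)) ∧
    ∫⁻ t in Ioo 0 T, eLpNorm (field (u t)) (ENNReal.ofReal p) (volOn O) ^ p < (⊤ : ℝ≥0∞)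

/-- `u : [0, T] → H` is weakly continuous. -/
def WeaklyContinuous (T : ℝ) (u : ℝ → HSpace O) : Prop :=
  ∀ ζ : HSpace O, ContinuousOn (fun t => inner ℝ (u t) ζ) (Icc 0 T)

/-- The time integrability exponent of the `V'`-part of `du/dt`. -/
def derivExponent (d : ℕ) (r : ℝ) : ℝ≥0∞ := if r < 3 then ENNReal.ofReal (4 / d) else 2

/-- `du/dt ∈ L^q(0, T; V') + L^{(r+1)/r}(0, T; L̃^{(r+1)/r})`, the derivative being taken in the
sense of distributions on `(0, T)`. Here `L̃^{(r+1)/r}` is the dual of `L̃^{r+1}`: its elements are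
the functionals `φ ↦ ∫ g · φ` with `g ∈ L^{(r+1)/r}(O; ℝ^d)`, and `L^p(0, T; L^p(O))` is
`L^p((0, T) × O)`. -/
def HasTimeDeriv (T r : ℝ) (u : ℝ → HSpace O) : Prop :=
  ∃ (g₁ : ℝ → StrongDual ℝ (VSpace O)) (g₂ : ℝ → Vec d → Vec d),
    MemLp g₁ (derivExponent d r) (timeMeasure T) ∧
    MemLp (Function.uncurry g₂) (ENNReal.ofReal ((r + 1) / r)) (volume.restrict (Ioo 0 T ×ˢ O)) ∧
    ∀ (θ : ℝ → ℝ) (φ : divFreeTest O), ContDiff ℝ ∞ θ → HasCompactSupport θ →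
      tsupport θ ⊆ Ioo 0 T →
      -∫ t in 0..T, deriv θ t * inner ℝ (u t) (testToH φ) =
        ∫ t in 0..T, θ t * (g₁ t (testToV φ) + ∫ x in O, inner ℝ (g₂ t x) ((φ : Vec d → Vec d) x))

/-- The space `𝒱_T` of divergence-free test fields in `C_0^∞(O × [0, T); ℝ^d)`, given by their
smooth extensions to all times (they may be nonzero at `t = 0`, and vanish near `t = T`). -/
structure SpaceTimeTest (O : Set (Vec d)) (T : ℝ) where
  /-- The field, as a function of time and position. -/
  toFun : ℝ × Vec d → Vec d
  smooth : ContDiff ℝ ∞ toFun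
  hasCompactSupport : HasCompactSupport toFun
  tsupport_subset : tsupport toFun ⊆ Iio T ×ˢ O
  divFree : ∀ t x, divergence (fun y => toFun (t, y)) x = 0

/-- The value `v(t) ∈ 𝒱` of a space-time test field. -/
def SpaceTimeTest.slice {T : ℝ} (v : SpaceTimeTest O T) (t : ℝ) : divFreeTest O :=
  ⟨fun x => v.toFun (t, x), by
    have hsub : tsupport (fun x => v.toFun (t, x)) ⊆ {x | (t, x) ∈ tsupport v.toFun} :=
      closure_minimal (fun x hx => subset_tsupport _ hx)
        ((isClosed_tsupport _).preimage (by fun_prop))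
    refine ⟨v.smooth.comp (by fun_prop), ?_, fun x hx => (v.tsupport_subset (hsub hx)).2,
      v.divFree t⟩
    exact (v.hasCompactSupport.isCompact.image continuous_snd).of_isClosed_subset
      (isClosed_tsupport _) fun x hx => ⟨(t, x), hsub hx, rfl⟩⟩

/-- The time derivative `∂_t v(t)`. -/
def SpaceTimeTest.timeDeriv {T : ℝ} (v : SpaceTimeTest O T) (t : ℝ) (x : Vec d) : Vec d :=
  deriv (fun s => v.toFun (s, x)) t

/-- `⟨(w · ∇)w, φ⟩ = ∑_{i,j} ∫ w_i (∂_i w_j) φ_j`, for `w ∈ V`. -/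
def convection (w : HSpace O) (φ : divFreeTest O) : ℝ :=
  ∫ x in O, ∑ i, ∑ j, field w x i * gradV (asV w) x (i, j) * (φ : Vec d → Vec d) x j

/-- `⟨|w|^{r-1} w, φ⟩`. -/
def damping (r : ℝ) (w : HSpace O) (φ : divFreeTest O) : ℝ :=
  ∫ x in O, ‖field w x‖ ^ (r - 1) * inner ℝ (field w x) ((φ : Vec d → Vec d) x)

/-- `‖w‖_{L^p}^p`. -/
def powNorm (p : ℝ) (w : HSpace O) : ℝ := ∫ x in O, ‖field w x‖ ^ p

/-- The weak form of the equations between the times `t₀` and `t₁`, tested with `v`. -/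
def WeakForm {T : ℝ} (μ β r : ℝ) (f : ℝ → StrongDual ℝ (VSpace O)) (u : ℝ → HSpace O)
    (v : SpaceTimeTest O T) (t₀ t₁ : ℝ) : Prop :=
  -(∫ s in t₀..t₁, ∫ x in O, inner ℝ (field (u s) x) (v.timeDeriv s x))
      + μ * (∫ s in t₀..t₁, inner ℝ (gradV (asV (u s))) (gradV (testToV (v.slice s))))
      + (∫ s in t₀..t₁, convection (u s) (v.slice s))
      + β * (∫ s in t₀..t₁, damping r (u s) (v.slice s)) =
    -inner ℝ (u t₁) (testToH (v.slice t₁)) + inner ℝ (u t₀) (testToH (v.slice t₀))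
      + ∫ s in t₀..t₁, f s (testToV (v.slice s))

/-- `u` is a weak solution on `(0, T)` of the convective Brinkman–Forchheimer equations
`du/dt + μ A u + B(u) + β C(u) = f`, `u(0) = u₀`. -/
structure IsWeakSolution (T μ β r : ℝ) (f : ℝ → StrongDual ℝ (VSpace O)) (u₀ : HSpace O)
    (u : ℝ → HSpace O) : Prop where
  memLinftyH : MemLinftyH T u
  memL2V : MemL2V T u
  memLpLtilde : MemLpLtilde T (r + 1) u
  hasTimeDeriv : HasTimeDeriv T r u
  initial : u 0 = u₀
  weak_zero : ∀ v : SpaceTimeTest O T, ∀ᵐ t₁ ∂timeMeasure T, WeakForm μ β r f u v 0 t₁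
  weak : ∀ v : SpaceTimeTest O T, ∀ᵐ t₀ ∂timeMeasure T, ∀ᵐ t₁ ∂volume.restrict (Ioo t₀ T),
    WeakForm μ β r f u v t₀ t₁

/-- The left-hand side of the energy inequality at time `t`. -/
def energy (μ β r : ℝ) (u : ℝ → HSpace O) (t : ℝ) : ℝ :=
  ‖u t‖ ^ 2 + 2 * μ * (∫ s in 0..t, normV (u s) ^ 2)
    + 2 * β * ∫ s in 0..t, powNorm (r + 1) (u s)

/-- The right-hand side of the energy inequality at time `t`. -/
def energyInput (f : ℝ → StrongDual ℝ (VSpace O)) (u₀ : HSpace O) (u : ℝ → HSpace O)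
    (t : ℝ) : ℝ :=
  ‖u₀‖ ^ 2 + 2 * ∫ s in 0..t, f s (asV (u s))

end CBF

end

/-! Everything rests on the operator `cbfOp`, v ↦ -μAv - B(v) - βC(v), being well behaved from V to
V'. For 2 ≤ d ≤ 4 Ladyzhenskaya's inequality ‖v‖_{L⁴} ≤ C‖v‖^{(4-d)/4}‖∇v‖^{d/4} embeds V in L⁴. The
trilinear form b(u, v, w) is therefore continuous on V, and b(u, v, v) = 0 by incompressibility.
Since r ≤ 3, the map a ↦ |a|^{r-1}a is monotone and locally Lipschitz from L⁴ to its dual L^{4/3}.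
So `cbfOp` is locally Lipschitz and its value at v, applied to v, is -μ‖∇v‖² - β‖v‖_{L^{r+1}}^{r+1}.

Existence is a Faedo–Galerkin argument (`exists_galerkin`). Dissipation makes the finite-dimensional
systems globally solvable and bounds their solutions in L^∞(H), L²(V) and L^{r+1}(L^{r+1}). Paired
with a fixed test field, the approximations are equicontinuous in time, so a diagonal subsequence
converges weakly in H at every time of [0, T]. Strong convergence in L²(0, T; H) follows from the
Ehrling-type inequality ‖v‖² ≤ 2ρ²‖∇v‖² + 2‖k * v‖² (`norm_embV_sq_le`): mollification at scale ρ
turns weak convergence into strong convergence, and the gradient term is small with ρ. Against a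
test field the two nonlinear terms are controlled by the distance in H and by the bounded energies,
so the equation passes to the limit; the energy inequality passes by lower semicontinuity. Weak
continuity and the energy inequality together force strong continuity at t = 0.

The limit satisfies ⟨u(t), z⟩ = ⟨u₀, z⟩ + ∫₀ᵗ F(s)z ds for all z in V, with F = f + `cbfOp` u
integrable with values in V'. A product rule for C¹ curves in V (`inner_sub_eq_integral_add`)
recovers from this the weak form and the time derivative. Conversely, every weak solution satisfies
the integrated identity at almost every time (`ae_inner_eq`), which is the starting point of the
planar theory.

In the plane the energy equality amounts to d/dt ‖u‖² = 2F(u). The argument does not ask F to be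
square integrable with values in V'; it uses the weaker bound |F(s)w| ≤ εg(s) + C‖w‖_V² for ‖w‖_H ≤
M with g integrable (`EnergyBound`), which the planar inequality ‖w‖_{L⁴}² ≤ L‖w‖‖∇w‖ supplies. The
equality then comes from the difference quotients of ‖u‖², whose increments are F applied to u(s +
h) + u(s), and from continuity of translations in L²(V). The same identity holds for the difference
w of two solutions. Damping is monotone there, the convection contributes only b(w, u₁, w), Young's
inequality absorbs ‖∇w‖², and Gronwall's lemma gives w = 0. -/

noncomputable section

/-! ### Ladyzhenskaya's inequality, from Gagliardo–Nirenberg–Sobolev. -/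

namespace CBF

variable {d : ℕ} {O : Set (Vec d)}

open scoped NNReal in
/-- The operator norm of the derivative is at most the Frobenius norm of the gradient. -/
theorem norm_fderiv_le_norm_classicalGrad (φ : Vec d → Vec d) (x : Vec d) :
    ‖fderiv ℝ φ x‖ ≤ ‖classicalGrad φ x‖ := by
  refine ContinuousLinearMap.opNorm_le_bound _ (norm_nonneg _) fun y => ?_
  have hy : y = ∑ i, y i • EuclideanSpace.single i (1 : ℝ) := by
    ext j
    simp [Pi.single_apply]
  have h1 : fderiv ℝ φ x y = ∑ i, y i • partialDeriv φ i x := by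
    conv_lhs => rw [hy]
    simp [partialDeriv]
  have h2 : ‖classicalGrad φ x‖ ^ 2 = ∑ i, ‖partialDeriv φ i x‖ ^ 2 := by
    rw [EuclideanSpace.norm_sq_eq, Fintype.sum_prod_type]
    refine Finset.sum_congr rfl fun i _ => ?_
    rw [EuclideanSpace.norm_sq_eq]
    rfl
  have h3 : ‖y‖ ^ 2 = ∑ i, ‖y i‖ ^ 2 := EuclideanSpace.norm_sq_eq y
  rw [h1]
  refine (norm_sum_le _ _).trans ?_
  simp_rw [norm_smul]
  have := Finset.sum_mul_sq_le_sq_mul_sq Finset.univ (fun i => ‖y i‖) (fun i => ‖partialDeriv φ i x‖)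
  rw [← h2, ← h3] at this
  refine abs_le_of_sq_le_sq' ?_ (by positivity) |>.2
  nlinarith

/-- Sobolev's inequality with exponent 2d/(d-2), which is 6 for d = 3 and 4 for d = 4. In dimension
three, L⁴ is interpolated between L² and L⁶ by Cauchy–Schwarz on |φ|⁴ = |φ|·|φ|³; in dimension four
the power of the L² norm is zero and nothing remains to be interpolated. -/
theorem lintegral_enorm_pow_four_le_of_three_le (hd₃ : 3 ≤ d) (hd₄ : d ≤ 4) :
    ∃ K : NNReal, ∀ φ : Vec d → Vec d, ContDiff ℝ ∞ φ → HasCompactSupport φ →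
      ∫⁻ x, ‖φ x‖ₑ ^ (4 : ℝ) ≤ K * (∫⁻ x, ‖φ x‖ₑ ^ (2 : ℝ)) ^ ((4 - d : ℝ) / 2) *
        (∫⁻ x, ‖fderiv ℝ φ x‖ₑ ^ (2 : ℝ)) ^ ((d : ℝ) / 2) := by
  set C := eLpNormLESNormFDerivOfEqInnerConst (volume : Measure (Vec d)) 2
  have key : ∀ {p : NNReal}, p ≠ 0 → (p : ℝ)⁻¹ = 2⁻¹ - (d : ℝ)⁻¹ →
      ∀ φ : Vec d → Vec d, ContDiff ℝ ∞ φ → HasCompactSupport φ →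
      (∫⁻ x, ‖φ x‖ₑ ^ (p : ℝ)) ≤
        (C * (∫⁻ x, ‖fderiv ℝ φ x‖ₑ ^ (2 : ℝ)) ^ (1 / (2 : ℝ))) ^ (p : ℝ) := by
    intro p hp0 hp φ h hc
    have := eLpNorm_le_eLpNorm_fderiv_of_eq_inner (μ := volume) (h.of_le (by simp)) hc
      (p := 2) (p' := p) (by norm_num) (by simp; omega) (by simpa using hp)
    rw [eLpNorm_eq_lintegral_rpow_enorm_toReal (by simpa using hp0) (by simp),
      eLpNorm_eq_lintegral_rpow_enorm_toReal (by simp) (by simp)] at this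
    have h2 := ENNReal.rpow_le_rpow this (z := (p : ℝ)) (by positivity)
    rw [← ENNReal.rpow_mul] at h2
    have hp1 : (p : ℝ) ≠ 0 := by exact_mod_cast hp0
    simpa [hp1] using h2
  obtain rfl | rfl : d = 3 ∨ d = 4 := by omega
  · refine ⟨C ^ (3 : ℕ), fun φ h hc => ?_⟩
    have h6 := key (p := 6) (by norm_num) (by norm_num) φ h hc
    have h4 : ∫⁻ x, ‖φ x‖ₑ * ‖φ x‖ₑ ^ (3 : ℝ) ≤ (∫⁻ x, ‖φ x‖ₑ ^ (2 : ℝ)) ^ (1 / (2 : ℝ)) *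
        (∫⁻ x, (‖φ x‖ₑ ^ (3 : ℝ)) ^ (2 : ℝ)) ^ (1 / (2 : ℝ)) :=
      ENNReal.lintegral_mul_le_Lp_mul_Lq volume Real.HolderConjugate.two_two
        h.continuous.enorm.aemeasurable (h.continuous.enorm.aemeasurable.pow_const _)
    have e1 : ∀ x, ‖φ x‖ₑ * ‖φ x‖ₑ ^ (3 : ℝ) = ‖φ x‖ₑ ^ (4 : ℝ) := fun x => by
      conv_lhs => rw [← ENNReal.rpow_one ‖φ x‖ₑ]
      rw [← ENNReal.rpow_mul, ← ENNReal.rpow_add_of_nonneg _ _ (by norm_num) (by norm_num)]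
      norm_num
    have e2 : ∀ x, (‖φ x‖ₑ ^ (3 : ℝ)) ^ (2 : ℝ) = ‖φ x‖ₑ ^ ((6 : NNReal) : ℝ) := fun x => by
      rw [← ENNReal.rpow_mul]; norm_num
    simp_rw [e1, e2] at h4
    refine h4.trans ?_
    have h7 := ENNReal.rpow_le_rpow h6 (z := (1 / 2 : ℝ)) (by norm_num)
    rw [← ENNReal.rpow_mul, ENNReal.mul_rpow_of_nonneg _ _ (by norm_num),
      ← ENNReal.rpow_mul] at h7
    refine (mul_le_mul_right h7 _).trans (le_of_eq ?_)
    rw [mul_left_comm, ← mul_assoc]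
    norm_num
  · refine ⟨C ^ (4 : ℕ), fun φ h hc => ?_⟩
    have h6 := key (p := 4) (by norm_num) (by norm_num) φ h hc
    rw [ENNReal.mul_rpow_of_nonneg _ _ (by norm_num), ← ENNReal.rpow_mul] at h6
    refine le_trans ?_ (h6.trans (le_of_eq ?_))
    · norm_num
    · norm_num

/-- The exponent of the previous lemma degenerates, so the planar inequality of W^{1,1} into L² is
applied to |φ|², whose gradient is at most 2|φ||∇φ|; Cauchy–Schwarz finishes, and the factor 4 is
the square of that 2. -/
theorem lintegral_enorm_pow_four_le_of_eq_two (hd : d = 2) :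
    ∃ K : NNReal, ∀ φ : Vec d → Vec d, ContDiff ℝ ∞ φ → HasCompactSupport φ →
      ∫⁻ x, ‖φ x‖ₑ ^ (4 : ℝ) ≤ K * (∫⁻ x, ‖φ x‖ₑ ^ (2 : ℝ)) ^ ((4 - d : ℝ) / 2) *
        (∫⁻ x, ‖fderiv ℝ φ x‖ₑ ^ (2 : ℝ)) ^ ((d : ℝ) / 2) := by
  subst hd
  refine ⟨lintegralPowLePowLIntegralFDerivConst (volume : Measure (Vec 2)) 2 * 4, fun φ h hc => ?_⟩
  set C := lintegralPowLePowLIntegralFDerivConst (volume : Measure (Vec 2)) 2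
  have hu : ContDiff ℝ 1 (fun x => ‖φ x‖ ^ 2) := (h.of_le (by simp)).norm_sq ℝ
  have huc : HasCompactSupport (fun x => ‖φ x‖ ^ 2) :=
    hc.comp_left (g := fun y : Vec 2 => ‖y‖ ^ 2) (by simp)
  have h1 := lintegral_pow_le_pow_lintegral_fderiv (μ := volume) hu huc (p := 2)
    (by simpa using Real.HolderConjugate.two_two)
  have h2 : ∀ x, ‖‖φ x‖ ^ 2‖ₑ ^ (2 : ℝ) = ‖φ x‖ₑ ^ (4 : ℝ) := by
    intro x
    rw [enorm_pow, enorm_norm, ← ENNReal.rpow_natCast, ← ENNReal.rpow_mul]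
    norm_num
  have h3 : ∀ x, ‖fderiv ℝ (fun x => ‖φ x‖ ^ 2) x‖ₑ ≤ 2 * (‖φ x‖ₑ * ‖fderiv ℝ φ x‖ₑ) := by
    intro x
    have e : HasFDerivAt (fun x => ‖φ x‖ ^ 2) _ x :=
      ((h.differentiable (by simp) x).hasFDerivAt).norm_sq
    rw [e.fderiv]
    have : ‖(2 : ℕ) • (innerSL ℝ (φ x)).comp (fderiv ℝ φ x)‖ ≤ 2 * (‖φ x‖ * ‖fderiv ℝ φ x‖) := by
      rw [two_smul, two_mul]
      have := ((innerSL ℝ (φ x)).opNorm_comp_le (fderiv ℝ φ x))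
      rw [innerSL_apply_norm] at this
      exact (norm_add_le _ _).trans (add_le_add this this)
    have h' := ENNReal.ofReal_le_ofReal this
    rw [ofReal_norm, ENNReal.ofReal_mul (by norm_num),
      ENNReal.ofReal_mul (norm_nonneg _), ofReal_norm, ofReal_norm] at h'
    simpa using h'
  have h4 : ∫⁻ x, ‖φ x‖ₑ * ‖fderiv ℝ φ x‖ₑ ≤ (∫⁻ x, ‖φ x‖ₑ ^ (2 : ℝ)) ^ (1 / (2 : ℝ)) *
      (∫⁻ x, ‖fderiv ℝ φ x‖ₑ ^ (2 : ℝ)) ^ (1 / (2 : ℝ)) :=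
    ENNReal.lintegral_mul_le_Lp_mul_Lq volume Real.HolderConjugate.two_two
      h.continuous.enorm.aemeasurable
      (h.continuous_fderiv (by simp)).enorm.aemeasurable
  simp_rw [h2] at h1
  refine h1.trans ?_
  have h5 : ∫⁻ x, ‖fderiv ℝ (fun x => ‖φ x‖ ^ 2) x‖ₑ ≤
      2 * ((∫⁻ x, ‖φ x‖ₑ ^ (2 : ℝ)) ^ (1 / (2 : ℝ)) *
      (∫⁻ x, ‖fderiv ℝ φ x‖ₑ ^ (2 : ℝ)) ^ (1 / (2 : ℝ))) := by
    refine (lintegral_mono h3).trans ?_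
    rw [lintegral_const_mul' _ _ (by norm_num)]
    gcongr
  calc _ ≤ C * (2 * ((∫⁻ x, ‖φ x‖ₑ ^ (2 : ℝ)) ^ (1 / (2 : ℝ)) *
      (∫⁻ x, ‖fderiv ℝ φ x‖ₑ ^ (2 : ℝ)) ^ (1 / (2 : ℝ)))) ^ (2 : ℝ) := by gcongr
    _ = _ := by
      rw [ENNReal.mul_rpow_of_nonneg _ _ (by norm_num), ENNReal.mul_rpow_of_nonneg _ _ (by norm_num),
        ← ENNReal.rpow_mul, ← ENNReal.rpow_mul]
      norm_num
      ring

/-- A convergent sequence of L² has an almost everywhere convergent subsequence, and Fatou's lemma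
applies to it. This lets bounds in L^p pass from test fields to their closure in L² without knowing
in advance that the limit lies in L^p. -/
theorem lowerSemicontinuous_eLpNorm {α E : Type*} {m : MeasurableSpace α} [NormedAddCommGroup E]
    {μ : Measure α} (p : ℝ≥0∞) :
    LowerSemicontinuous (fun w : Lp E 2 μ => eLpNorm w p μ) := by
  rw [lowerSemicontinuous_iff_isClosed_preimage]
  intro c
  refine IsSeqClosed.isClosed fun w w' hw hlim => ?_
  have h1 : TendstoInMeasure μ (fun n => (w n : α → E)) atTop w' :=
    tendstoInMeasure_of_tendsto_Lp hlim
  obtain ⟨ns, hns, hae⟩ := h1.exists_seq_tendsto_ae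
  refine (Lp.eLpNorm_lim_le_liminf_eLpNorm (fun n => Lp.aestronglyMeasurable _) _ hae).trans ?_
  exact (liminf_le_liminf (Eventually.of_forall fun n => hw (ns n))).trans (by simp)

/-- The standing assumptions on the dimension and the domain. -/
class Admissible {d : ℕ} (O : Set (Vec d)) : Prop where
  two_le : 2 ≤ d
  le_four : d ≤ 4
  isOpen : IsOpen O
  isBounded : Bornology.IsBounded O

instance [h : Admissible O] : IsFiniteMeasure (volOn O) :=
  ⟨by simpa using h.isBounded.measure_lt_top⟩

theorem lintegral_test_enorm_pow_four_le (hd₂ : 2 ≤ d) (hd₄ : d ≤ 4) :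
    ∃ K : NNReal, ∀ φ : Vec d → Vec d, ContDiff ℝ ∞ φ → HasCompactSupport φ →
      ∫⁻ x, ‖φ x‖ₑ ^ (4 : ℝ) ≤ K * (∫⁻ x, ‖φ x‖ₑ ^ (2 : ℝ)) ^ ((4 - d : ℝ) / 2) *
        (∫⁻ x, ‖fderiv ℝ φ x‖ₑ ^ (2 : ℝ)) ^ ((d : ℝ) / 2) := by
  rcases hd₂.eq_or_lt with h | h
  · exact lintegral_enorm_pow_four_le_of_eq_two h.symm
  · exact lintegral_enorm_pow_four_le_of_three_le h hd₄

theorem norm_toLp_two_eq {E F : Type*} [NormedAddCommGroup E] [MeasurableSpace F]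
    {μ : Measure F} (w : Lp E 2 μ) :
    ENNReal.ofReal ‖w‖ = (∫⁻ x, ‖w x‖ₑ ^ (2 : ℝ) ∂μ) ^ (1 / (2 : ℝ)) := by
  rw [ofReal_norm, Lp.enorm_def, eLpNorm_eq_lintegral_rpow_enorm_toReal (by simp) (by simp)]
  simp

/-- **Ladyzhenskaya's inequality** on `V`. -/
theorem exists_eLpNorm_four_le [h : Admissible O] : ∃ C : ℝ, 0 < C ∧ ∀ v : VSpace O,
    eLpNorm v.toPair.fst 4 (volOn O) ≤ ENNReal.ofReal
      (C * ‖embV v‖ ^ ((4 - d : ℝ) / 4) * ‖gradV v‖ ^ ((d : ℝ) / 4)) := by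
  obtain ⟨K, hK⟩ := lintegral_test_enorm_pow_four_le h.two_le h.le_four
  have hd4 : (0 : ℝ) ≤ (4 - d : ℝ) / 4 := by
    have : (d : ℝ) ≤ 4 := by exact_mod_cast h.le_four
    linarith
  refine ⟨(K : ℝ) ^ (1 / 4 : ℝ) + 1, by positivity, fun v => ?_⟩
  refine VSpace_induction (P := fun p => eLpNorm p.fst 4 (volOn O) ≤ ENNReal.ofReal
      (((K : ℝ) ^ (1 / 4 : ℝ) + 1) * ‖p.fst‖ ^ ((4 - d : ℝ) / 4) * ‖p.snd‖ ^ ((d : ℝ) / 4))) ?_ ?_ v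
  · have hc : Continuous fun p : H1Pair O => (p.fst, ENNReal.ofReal
      (((K : ℝ) ^ (1 / 4 : ℝ) + 1) * ‖p.fst‖ ^ ((4 - d : ℝ) / 4) * ‖p.snd‖ ^ ((d : ℝ) / 4))) := by
      refine continuous_H1Pair_fst.prodMk (ENNReal.continuous_ofReal.comp ?_)
      refine (continuous_const.mul ?_).mul ?_
      · exact continuous_H1Pair_fst.norm.rpow_const fun _ => Or.inr hd4
      · exact continuous_H1Pair_snd.norm.rpow_const fun _ => Or.inr (by positivity)
    -- The inequality says that the pair (field, right-hand side) lies in the epigraph of the L⁴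
    -- norm, which is closed by lower semicontinuity; hence it is enough to prove it for test
    -- fields.
    exact (lowerSemicontinuous_eLpNorm (E := Vec d) (μ := volOn O) 4).isClosed_epigraph.preimage hc
  · intro φ
    have hz : ∀ x, x ∉ O → (φ : Vec d → Vec d) x = 0 := fun x hx =>
      image_eq_zero_of_notMem_tsupport fun hx' => hx (φ.2.2.2.1 hx')
    have hz' : ∀ x, x ∉ O → classicalGrad (φ : Vec d → Vec d) x = 0 := fun x hx => by
      have : fderiv ℝ (φ : Vec d → Vec d) x = 0 :=
        Function.notMem_support.1 fun h => hx (φ.2.2.2.1 (support_fderiv_subset ℝ h))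
      ext ij; simp [classicalGrad, partialDeriv, this]
    have full : ∀ {E : Type} [NormedAddCommGroup E] (g : Vec d → E) (q : ℝ), 0 < q →
        (∀ x, x ∉ O → g x = 0) → ∫⁻ x in O, ‖g x‖ₑ ^ q = ∫⁻ x, ‖g x‖ₑ ^ q := by
      intro E _ g q hq hg
      exact setLIntegral_eq_of_support_subset fun x hx => by
        by_contra hxO
        exact hx (by simp [hg x hxO, hq])
    have e0 : (testToPair O φ).fst =ᵐ[volOn O] (φ : Vec d → Vec d) := (memLp_test φ 2).coeFn_toLp
    have e1 : (testToPair O φ).snd =ᵐ[volOn O] classicalGrad (φ : Vec d → Vec d) :=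
      (memLp_grad_test φ 2).coeFn_toLp
    have n0 : ENNReal.ofReal ‖(testToPair O φ).fst‖ =
        (∫⁻ x, ‖(φ : Vec d → Vec d) x‖ₑ ^ (2 : ℝ)) ^ (1 / (2 : ℝ)) := by
      rw [norm_toLp_two_eq, ← full _ 2 (by norm_num) hz]
      congr 1
      exact lintegral_congr_ae (e0.mono fun x hx => by simp only [hx])
    have n1 : ENNReal.ofReal ‖(testToPair O φ).snd‖ =
        (∫⁻ x, ‖classicalGrad (φ : Vec d → Vec d) x‖ₑ ^ (2 : ℝ)) ^ (1 / (2 : ℝ)) := by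
      rw [norm_toLp_two_eq, ← full _ 2 (by norm_num) hz']
      congr 1
      exact lintegral_congr_ae (e1.mono fun x hx => by simp only [hx])
    have n4 : eLpNorm (testToPair O φ).fst 4 (volOn O) =
        (∫⁻ x, ‖(φ : Vec d → Vec d) x‖ₑ ^ (4 : ℝ)) ^ (1 / (4 : ℝ)) := by
      rw [eLpNorm_congr_ae e0, eLpNorm_eq_lintegral_rpow_enorm_toReal (by simp) (by simp),
        ← full _ 4 (by norm_num) hz]
      simp
    rw [n4, ENNReal.ofReal_mul (by positivity), ENNReal.ofReal_mul (by positivity),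
      ← ENNReal.ofReal_rpow_of_nonneg (norm_nonneg _) hd4,
      ← ENNReal.ofReal_rpow_of_nonneg (norm_nonneg _) (by positivity), n0, n1]
    refine (ENNReal.rpow_le_rpow (hK φ φ.2.1 φ.2.2.1) (by norm_num)).trans ?_
    rw [ENNReal.mul_rpow_of_nonneg _ _ (by norm_num), ENNReal.mul_rpow_of_nonneg _ _ (by norm_num),
      ← ENNReal.rpow_mul, ← ENNReal.rpow_mul, ← ENNReal.rpow_mul, ← ENNReal.rpow_mul]
    have k0 : (K : ℝ≥0∞) ^ (1 / 4 : ℝ) ≤ ENNReal.ofReal ((K : ℝ) ^ (1 / 4 : ℝ) + 1) := by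
      rw [← ENNReal.ofReal_coe_nnreal, ENNReal.ofReal_rpow_of_nonneg (by positivity) (by norm_num)]
      exact ENNReal.ofReal_le_ofReal (by linarith)
    have k1 : (4 - d : ℝ) / 2 * (1 / 4) = 1 / 2 * ((4 - d : ℝ) / 4) := by ring
    have k2 : (d : ℝ) / 2 * (1 / 4) = 1 / 2 * ((d : ℝ) / 4) := by ring
    rw [k1, k2]
    gcongr with x
    rw [← ofReal_norm, ← ofReal_norm]
    exact ENNReal.ofReal_le_ofReal (norm_fderiv_le_norm_classicalGrad _ _)

end CBF

/-! ### The embeddings of V in H and in L⁴, and Poincaré's inequality. -/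

namespace CBF

variable {d : ℕ} {O : Set (Vec d)}

/-- The embedding of `V` into `H` as a continuous linear map. -/
def embVL (O : Set (Vec d)) : VSpace O →L[ℝ] HSpace O :=
  ((WithLp.fstL 2 ℝ (Lp (Vec d) 2 (volOn O)) (Lp (Mat d) 2 (volOn O))).comp
    (VSpace.toPair (O := O)).toContinuousLinearMap).codRestrict (HSubmodule O) fst_mem_HSubmodule

/-- The weak gradient as a continuous linear map. -/
def gradVL (O : Set (Vec d)) : VSpace O →L[ℝ] Lp (Mat d) 2 (volOn O) :=
  (WithLp.sndL 2 ℝ (Lp (Vec d) 2 (volOn O)) (Lp (Mat d) 2 (volOn O))).comp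
    (VSpace.toPair (O := O)).toContinuousLinearMap

@[simp] theorem embVL_apply (v : VSpace O) : embVL O v = embV v := rfl

@[simp] theorem gradVL_apply (v : VSpace O) : gradVL O v = gradV v := rfl

theorem norm_sq_VSpace (v : VSpace O) : ‖v‖ ^ 2 = ‖embV v‖ ^ 2 + ‖gradV v‖ ^ 2 :=
  WithLp.prod_norm_sq_eq_of_L2 v.toPair

theorem norm_embV_le (v : VSpace O) : ‖embV v‖ ≤ ‖v‖ :=
  abs_le_of_sq_le_sq' (by rw [norm_sq_VSpace]; nlinarith [sq_nonneg ‖gradV v‖]) (norm_nonneg _) |>.2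

theorem norm_gradV_le (v : VSpace O) : ‖gradV v‖ ≤ ‖v‖ :=
  abs_le_of_sq_le_sq' (by rw [norm_sq_VSpace]; nlinarith [sq_nonneg ‖embV v‖]) (norm_nonneg _) |>.2

/-- Test fields are dense in `V`. -/
theorem denseRange_testToV : DenseRange (testToV (O := O)) := by
  intro v
  rw [(VSpace.toPair (O := O)).isometry.isUniformInducing.isInducing.closure_eq_preimage_closure_image]
  have : (v.toPair : H1Pair O) ∈ closure (Set.range (testToPair O)) := v.2
  refine closure_mono ?_ this
  rintro _ ⟨φ, rfl⟩
  exact ⟨testToV φ, ⟨φ, rfl⟩, rfl⟩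

theorem denseRange_embVL : DenseRange (embVL O) := by
  intro w
  rw [(HSpace.toL2 (O := O)).isometry.isUniformInducing.isInducing.closure_eq_preimage_closure_image]
  have : (w.toL2 : Lp (Vec d) 2 (volOn O)) ∈ closure (Set.range (testToL2 O)) := w.2
  refine closure_mono ?_ this
  rintro _ ⟨φ, rfl⟩
  exact ⟨testToH φ, ⟨testToV φ, rfl⟩, rfl⟩

theorem memLp_four [h : Admissible O] (v : VSpace O) :
    MemLp (v.toPair.fst : Vec d → Vec d) 4 (volOn O) := by
  obtain ⟨C, -, hC⟩ := exists_eLpNorm_four_le (O := O)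
  exact ⟨Lp.aestronglyMeasurable _, (hC v).trans_lt ENNReal.ofReal_lt_top⟩

instance : Fact ((1 : ℝ≥0∞) ≤ 4) := ⟨by norm_num⟩

/-- The linear embedding of `V` in `L⁴`. -/
def embL4Lin (O : Set (Vec d)) [Admissible O] : VSpace O →ₗ[ℝ] Lp (Vec d) 4 (volOn O) where
  toFun v := (memLp_four v).toLp _
  map_add' v w := by
    rw [← MemLp.toLp_add]
    exact MemLp.toLp_congr _ _ (Lp.coeFn_add _ _)
  map_smul' c v := by
    rw [RingHom.id_apply, ← MemLp.toLp_const_smul]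
    exact MemLp.toLp_congr _ _ (Lp.coeFn_smul _ _)

theorem coeFn_embL4Lin [Admissible O] (v : VSpace O) :
    embL4Lin O v =ᵐ[volOn O] field (embV v) := (memLp_four v).coeFn_toLp

theorem exists_norm_embL4Lin_le [Admissible O] : ∃ C : ℝ, 0 < C ∧ ∀ v : VSpace O,
    ‖embL4Lin O v‖ ≤ C * ‖embV v‖ ^ ((4 - d : ℝ) / 4) * ‖gradV v‖ ^ ((d : ℝ) / 4) := by
  obtain ⟨C, hC0, hC⟩ := exists_eLpNorm_four_le (O := O)
  refine ⟨C, hC0, fun v => ?_⟩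
  have := hC v
  have e : eLpNorm (embL4Lin O v) 4 (volOn O) = eLpNorm v.toPair.fst 4 (volOn O) :=
    eLpNorm_congr_ae (coeFn_embL4Lin v)
  rw [← e,
    ← Lp.enorm_def, ← ofReal_norm] at this
  exact (ENNReal.ofReal_le_ofReal_iff (by positivity)).1 this

/-- The embedding of `V` in `L⁴`. -/
def embL4 (O : Set (Vec d)) [h : Admissible O] : VSpace O →L[ℝ] Lp (Vec d) 4 (volOn O) :=
  (embL4Lin O).mkContinuous (exists_norm_embL4Lin_le (O := O)).choose fun v => by
    have hC := (exists_norm_embL4Lin_le (O := O)).choose_spec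
    set C := (exists_norm_embL4Lin_le (O := O)).choose
    have hd4 : (0 : ℝ) ≤ (4 - d : ℝ) / 4 := by
      have : (d : ℝ) ≤ 4 := by exact_mod_cast h.le_four
      linarith
    have h0 := hC.1
    calc _ ≤ C * ‖embV v‖ ^ ((4 - d : ℝ) / 4) * ‖gradV v‖ ^ ((d : ℝ) / 4) := hC.2 v
      _ ≤ C * ‖v‖ ^ ((4 - d : ℝ) / 4) * ‖v‖ ^ ((d : ℝ) / 4) := by
        gcongr
        · exact norm_embV_le v
        · exact norm_gradV_le v
      _ = C * ‖v‖ := by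
        rw [mul_assoc, ← Real.rpow_add_of_nonneg (norm_nonneg _) hd4 (by positivity)]
        have : (4 - d : ℝ) / 4 + d / 4 = 1 := by ring
        rw [this, Real.rpow_one]

theorem coeFn_embL4 [Admissible O] (v : VSpace O) :
    embL4 O v =ᵐ[volOn O] field (embV v) := (memLp_four v).coeFn_toLp

theorem exists_norm_embL4_le [Admissible O] : ∃ C : ℝ, 0 < C ∧ ∀ v : VSpace O,
    ‖embL4 O v‖ ≤ C * ‖embV v‖ ^ ((4 - d : ℝ) / 4) * ‖gradV v‖ ^ ((d : ℝ) / 4) :=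
  exists_norm_embL4Lin_le

theorem memLp_field_four [Admissible O] (v : VSpace O) : MemLp (field (embV v)) 4 (volOn O) :=
  memLp_four v

/-- **Poincaré's inequality** on `V`. -/
theorem exists_norm_le_norm_gradV [h : Admissible O] : ∃ C : ℝ, 0 < C ∧ ∀ v : VSpace O,
    ‖v‖ ≤ C * ‖gradV v‖ := by
  obtain ⟨C, hC0, hC⟩ := exists_norm_embL4_le (O := O)
  have hd0 : (0 : ℝ) < d := by exact_mod_cast (by have := h.two_le; omega : 0 < d)
  set m : ℝ := (volOn O univ).toReal ^ (1 / 4 : ℝ)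
  have hm0 : 0 ≤ m := by positivity
  have h42 : ∀ v : VSpace O, ‖embV v‖ ≤ ‖embL4 O v‖ * m := by
    intro v
    have h1 := eLpNorm_le_eLpNorm_mul_rpow_measure_univ (p := 2) (q := 4) (by norm_num)
      (memLp_field_four v).1
    have h2 : ENNReal.ofReal ‖embV v‖ = eLpNorm (field (embV v)) 2 (volOn O) := by
      rw [ofReal_norm]; exact Lp.enorm_def _
    rw [← h2, ← eLpNorm_congr_ae (coeFn_embL4 v), ← Lp.enorm_def, ← ofReal_norm] at h1
    have h3 : volOn O univ ^ (1 / (2 : ℝ≥0∞).toReal - 1 / (4 : ℝ≥0∞).toReal) = ENNReal.ofReal m := by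
      rw [← ENNReal.ofReal_rpow_of_nonneg ENNReal.toReal_nonneg (by norm_num),
        ENNReal.ofReal_toReal (measure_ne_top _ _)]
      norm_num
    rw [h3, ← ENNReal.ofReal_mul (norm_nonneg _)] at h1
    exact (ENNReal.ofReal_le_ofReal_iff (by positivity)).1 h1
  -- On a set of finite measure ‖v‖ ≤ m‖v‖_{L⁴}, so ‖v‖ ≤ Cm‖v‖^{(4-d)/4}‖∇v‖^{d/4}. Dividing by the
  -- power of ‖v‖ leaves ‖v‖^{d/4} on the left, and raising to the power 4/d produces K.
  set K := (C * m) ^ (4 / d : ℝ)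
  have hK : ∀ v : VSpace O, ‖embV v‖ ≤ K * ‖gradV v‖ := by
    intro v
    rcases (norm_nonneg (embV v)).eq_or_lt with h0 | h0
    · rw [← h0]; positivity
    have h1 : ‖embV v‖ ≤ C * ‖embV v‖ ^ ((4 - d : ℝ) / 4) * ‖gradV v‖ ^ ((d : ℝ) / 4) * m :=
      (h42 v).trans (mul_le_mul_of_nonneg_right (hC v) hm0)
    have h2 : ‖embV v‖ = ‖embV v‖ ^ ((4 - d : ℝ) / 4) * ‖embV v‖ ^ ((d : ℝ) / 4) := by
      rw [← Real.rpow_add h0]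
      have : (4 - d : ℝ) / 4 + d / 4 = 1 := by ring
      rw [this, Real.rpow_one]
    have h3 : ‖embV v‖ ^ ((d : ℝ) / 4) ≤ (C * m) * ‖gradV v‖ ^ ((d : ℝ) / 4) := by
      have hp : 0 < ‖embV v‖ ^ ((4 - d : ℝ) / 4) := Real.rpow_pos_of_pos h0 _
      refine le_of_mul_le_mul_left ?_ hp
      rw [← h2]
      refine h1.trans (le_of_eq (by ring))
    have h4 := Real.rpow_le_rpow (by positivity) h3 (z := 4 / d) (by positivity)
    rw [Real.mul_rpow (by positivity) (by positivity), ← Real.rpow_mul h0.le,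
      ← Real.rpow_mul (norm_nonneg _)] at h4
    have h5 : (d : ℝ) / 4 * (4 / d) = 1 := by field_simp
    rwa [h5, Real.rpow_one, Real.rpow_one] at h4
  have hK0 : 0 ≤ K := by positivity
  refine ⟨K + 1, by positivity, fun v => ?_⟩
  refine abs_le_of_sq_le_sq' ?_ (by positivity) |>.2
  rw [norm_sq_VSpace]
  have := mul_self_le_mul_self (norm_nonneg _) (hK v)
  nlinarith [mul_nonneg hK0 (sq_nonneg ‖gradV v‖)]

end CBF

/-! ### The trilinear convection form. -/

namespace CBF

variable {d : ℕ} {O : Set (Vec d)}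

/-- The outer product `(a ⊗ b)_{ij} = a_i b_j`. -/
def outerLin (d : ℕ) : Vec d →ₗ[ℝ] Vec d →ₗ[ℝ] Mat d :=
  LinearMap.mk₂ ℝ (fun a b => WithLp.toLp 2 fun ij => a ij.1 * b ij.2)
    (fun a a' b => by ext; simp [add_mul]) (fun c a b => by ext; simp [mul_assoc])
    (fun a b b' => by ext; simp [mul_add]) (fun c a b => by ext; simp [mul_left_comm])

theorem norm_outerLin (a b : Vec d) : ‖outerLin d a b‖ = ‖a‖ * ‖b‖ := by
  have : ‖outerLin d a b‖ ^ 2 = (‖a‖ * ‖b‖) ^ 2 := by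
    rw [EuclideanSpace.norm_sq_eq, mul_pow, EuclideanSpace.norm_sq_eq, EuclideanSpace.norm_sq_eq,
      Finset.sum_mul_sum, Fintype.sum_prod_type]
    simp [outerLin, mul_pow]
  exact (sq_eq_sq₀ (norm_nonneg _) (by positivity)).1 this

/-- The outer product as a continuous bilinear map. -/
def outer (d : ℕ) : Vec d →L[ℝ] Vec d →L[ℝ] Mat d :=
  LinearMap.mkContinuous₂ (outerLin d) 1 fun a b => by rw [norm_outerLin, one_mul]

theorem norm_outer (a b : Vec d) : ‖outer d a b‖ = ‖a‖ * ‖b‖ := norm_outerLin a b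

@[simp] theorem outer_apply (a b : Vec d) (ij : Fin d × Fin d) :
    outer d a b ij = a ij.1 * b ij.2 := rfl

theorem norm_outer_le_one : ‖outer d‖ ≤ 1 := LinearMap.mkContinuous₂_norm_le _ (by norm_num) _

instance : ENNReal.HolderTriple 4 4 2 := ⟨by
  have : (4 : ℝ≥0∞) = 2 * 2 := by norm_num
  rw [this, ENNReal.mul_inv (by norm_num) (by norm_num), ← mul_add, ENNReal.inv_two_add_inv_two,
    mul_one]⟩

/-- The value of a test field has a classical representative. -/
theorem coeFn_testToV (φ : divFreeTest O) : field (embV (testToV φ)) =ᵐ[volOn O] φ :=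
  (memLp_test φ 2).coeFn_toLp

theorem coeFn_grad_testToV (φ : divFreeTest O) :
    gradV (testToV φ) =ᵐ[volOn O] classicalGrad (φ : Vec d → Vec d) :=
  (memLp_grad_test φ 2).coeFn_toLp

theorem embV_sub (v w : VSpace O) : embV (v - w) = embV v - embV w := map_sub (embVL O) v w
theorem gradV_add (v w : VSpace O) : gradV (v + w) = gradV v + gradV w := map_add (gradVL O) v w
theorem gradV_sub (v w : VSpace O) : gradV (v - w) = gradV v - gradV w := map_sub (gradVL O) v w

variable [Admissible O]

/-- The convection operator `w ↦ b(u, v, w) = ∑ ∫ u_i (∂_i v_j) w_j`. -/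
def convForm (u v : VSpace O) : StrongDual ℝ (VSpace O) :=
  (innerSL ℝ (gradV v)).comp
    ((((outer d).holderL (volOn O) 4 4 2) (embL4 O u)).comp (embL4 O))

theorem convForm_apply (u v w : VSpace O) : convForm u v w =
    ∫ x in O, ∑ i, ∑ j, field (embV u) x i * gradV v x (i, j) * field (embV w) x j := by
  change inner ℝ (gradV v) ((outer d).holder 2 (embL4 O u) (embL4 O w)) = _
  rw [L2.inner_def]
  refine integral_congr_ae ?_
  filter_upwards [(outer d).coeFn_holder (r := 2) (embL4 O u) (embL4 O w), coeFn_embL4 u,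
    coeFn_embL4 w] with x hx hu hw
  rw [hx, hu, hw, PiLp.inner_apply, Fintype.sum_prod_type]
  refine Finset.sum_congr rfl fun i _ => Finset.sum_congr rfl fun j _ => ?_
  simp
  ring

theorem norm_holderL_outer_le (u w : VSpace O) :
    ‖((outer d).holderL (volOn O) 4 4 2) (embL4 O u) (embL4 O w)‖ ≤ ‖embL4 O u‖ * ‖embL4 O w‖ := by
  refine ((outer d).norm_holder_apply_apply_le (r := 2) (embL4 O u) (embL4 O w)).trans ?_
  have := norm_outer_le_one (d := d)
  rw [mul_assoc]
  exact mul_le_of_le_one_left (by positivity) this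

theorem abs_convForm_le (u v w : VSpace O) :
    |convForm u v w| ≤ ‖embL4 O u‖ * ‖gradV v‖ * ‖embL4 O w‖ := by
  refine (abs_real_inner_le_norm (gradV v) _).trans ?_
  rw [mul_comm ‖embL4 O u‖, mul_assoc]
  exact mul_le_mul_of_nonneg_left (norm_holderL_outer_le u w) (norm_nonneg _)

theorem convForm_sub_left (u u' v : VSpace O) : convForm (u - u') v = convForm u v - convForm u' v := by
  ext w; simp [convForm]
theorem convForm_sub_right (u v v' : VSpace O) : convForm u (v - v') = convForm u v - convForm u v' := by
  ext w; simp [convForm, gradV_sub]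
theorem convForm_add_right (u v v' : VSpace O) : convForm u (v + v') = convForm u v + convForm u v' := by
  ext w; simp [convForm, gradV_add]

/-- The form is bounded and bilinear in its first two arguments. Being C¹ is the convenient way to
record both the joint continuity needed for density arguments and the local Lipschitz bound of v ↦
b(v, v, ·) needed for the differential equation. -/
theorem contDiff_convForm : ContDiff ℝ 1 (fun p : VSpace O × VSpace O => convForm p.1 p.2) := by
  have hI : ContDiff ℝ 1 (fun z : Lp (Mat d) 2 (volOn O) => innerSL ℝ z) :=
    IsBoundedLinearMap.contDiff
      { map_add := map_add _
        map_smul := fun c z => by ext; simp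
        bound := ⟨1, one_pos, fun z => by rw [innerSL_apply_norm, one_mul]⟩ }
  have h1 : ContDiff ℝ 1 (fun p : VSpace O × VSpace O => innerSL ℝ (gradVL O p.2)) :=
    hI.comp (by fun_prop)
  exact h1.clm_comp (by fun_prop)

theorem convection_eq (v : VSpace O) (φ : divFreeTest O) :
    convection (embV v) φ = convForm v v (testToV φ) := by
  rw [convForm_apply, convection, asV_embV]
  refine integral_congr_ae ?_
  filter_upwards [coeFn_testToV φ] with x hx
  rw [hx]

/-- With f = |ψ|²/2 the integrand is φ·∇f. Integration by parts moves the derivative to φ and leaves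
-∫ f div φ, which vanishes; there is no boundary term because φ has compact support in O. -/
theorem convForm_test_self (φ ψ : divFreeTest O) :
    convForm (testToV φ) (testToV ψ) (testToV ψ) = 0 := by
  rw [convForm_apply]
  have hφ := φ.2.1
  have hψ := ψ.2.1
  have hφc := φ.2.2.1
  have hdiv := φ.2.2.2.2
  set f : Vec d → ℝ := fun x => ‖(ψ : Vec d → Vec d) x‖ ^ 2 / 2 with hf
  have hfd : ContDiff ℝ ∞ f := (hψ.norm_sq ℝ).div_const 2
  have hfc : Continuous (fderiv ℝ f) := hfd.continuous_fderiv (by simp)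
  have hgrad : ∀ x, ∀ i, fderiv ℝ f x (EuclideanSpace.single i 1) =
      ∑ j, classicalGrad (ψ : Vec d → Vec d) x (i, j) * (ψ : Vec d → Vec d) x j := by
    intro x i
    have h1 : HasFDerivAt (fun x => ‖(ψ : Vec d → Vec d) x‖ ^ 2) _ x :=
      ((hψ.differentiable (by simp) x).hasFDerivAt).norm_sq
    have h2 : fderiv ℝ f x = (2⁻¹ : ℝ) • fderiv ℝ (fun x => ‖(ψ : Vec d → Vec d) x‖ ^ 2) x := by
      rw [← fderiv_const_smul h1.differentiableAt]
      congr 1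
      funext y
      simp [hf, div_eq_inv_mul]
    rw [h2, h1.fderiv]
    simp [PiLp.inner_apply, classicalGrad, partialDeriv]
  have hcomp : ∀ i, ContDiff ℝ ∞ (fun x => (φ : Vec d → Vec d) x i) := fun i => by fun_prop
  have hcompc : ∀ i, HasCompactSupport (fun x => (φ : Vec d → Vec d) x i) := fun i =>
    hφc.comp_left (g := fun y : Vec d => y i) (by simp)
  have hpart : ∀ x i, partialDeriv (φ : Vec d → Vec d) i x i =
      fderiv ℝ (fun x => (φ : Vec d → Vec d) x i) x (EuclideanSpace.single i 1) := by
    intro x i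
    have h1 : HasFDerivAt (φ : Vec d → Vec d) (fderiv ℝ (φ : Vec d → Vec d) x) x :=
      (hφ.differentiable (by simp) x).hasFDerivAt
    have h2 := (EuclideanSpace.proj (𝕜 := ℝ) i).hasFDerivAt.comp x h1
    have h3 : fderiv ℝ (fun x => (φ : Vec d → Vec d) x i) x = _ := h2.fderiv
    rw [h3]
    rfl
  have e1 : ∫ x in O, ∑ i, ∑ j, field (embV (testToV φ)) x i * gradV (testToV ψ) x (i, j) *
      field (embV (testToV ψ)) x j =
      ∫ x in O, ∑ i, (φ : Vec d → Vec d) x i * fderiv ℝ f x (EuclideanSpace.single i 1) := by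
    refine integral_congr_ae ?_
    filter_upwards [coeFn_testToV φ, coeFn_testToV ψ, coeFn_grad_testToV ψ] with x h1 h2 h3
    rw [h1, h2, h3]
    refine Finset.sum_congr rfl fun i _ => ?_
    rw [hgrad, Finset.mul_sum]
    exact Finset.sum_congr rfl fun j _ => by ring
  have hz : ∀ x, x ∉ O → (φ : Vec d → Vec d) x = 0 := fun x hx =>
    image_eq_zero_of_notMem_tsupport fun h => hx (φ.2.2.2.1 h)
  rw [e1, setIntegral_eq_integral_of_forall_compl_eq_zero (by intro x hx; simp [hz x hx])]
  have int1 : ∀ i, Integrable (fun x => (φ : Vec d → Vec d) x i *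
      fderiv ℝ f x (EuclideanSpace.single i 1)) := fun i =>
    ((hcomp i).continuous.mul (hfc.clm_apply continuous_const)).integrable_of_hasCompactSupport
      (hcompc i).mul_right
  have int2 : ∀ i, Integrable (fun x => fderiv ℝ (fun x => (φ : Vec d → Vec d) x i) x
      (EuclideanSpace.single i 1) * f x) := fun i =>
    ((((hcomp i).continuous_fderiv (by simp)).clm_apply continuous_const).mul
      hfd.continuous).integrable_of_hasCompactSupport
      ((hcompc i).fderiv_apply (𝕜 := ℝ) _).mul_right
  rw [integral_finsetSum _ fun i _ => int1 i]
  have e2 : ∀ i, ∫ x, (φ : Vec d → Vec d) x i * fderiv ℝ f x (EuclideanSpace.single i 1) =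
      -∫ x, fderiv ℝ (fun x => (φ : Vec d → Vec d) x i) x (EuclideanSpace.single i 1) * f x := by
    intro i
    refine integral_mul_fderiv_eq_neg_fderiv_mul_of_integrable (int2 i) (int1 i) ?_
      (fun x _ => (hcomp i).differentiable (by simp) x) (fun x _ => hfd.differentiable (by simp) x)
    exact ((hcomp i).continuous.mul hfd.continuous).integrable_of_hasCompactSupport
      (hcompc i).mul_right
  simp_rw [e2]
  rw [Finset.sum_neg_distrib, ← integral_finsetSum _ fun i _ => int2 i]
  simp_rw [← Finset.sum_mul, ← hpart]
  have : ∀ x, ∑ i, partialDeriv (φ : Vec d → Vec d) i x i = 0 := hdiv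
  simp [this]

/-- Both sides are continuous on V × V and pairs of test fields are dense there. -/
theorem convForm_self (u v : VSpace O) : convForm u v v = 0 := by
  have hc : Continuous fun p : VSpace O × VSpace O => convForm p.1 p.2 p.2 :=
    contDiff_convForm.continuous.clm_apply continuous_snd
  have hd := (denseRange_testToV (O := O)).prodMap (denseRange_testToV (O := O))
  have := hd.equalizer hc (continuous_const (y := (0 : ℝ))) (by
    funext p; exact convForm_test_self p.1 p.2)
  exact congrFun this (u, v)

theorem convForm_antisymm (u v w : VSpace O) : convForm u v w = -convForm u w v := by
  have h := convForm_self u (v + w)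
  have h1 := convForm_self u v
  have h2 := convForm_self u w
  simp only [convForm_add_right, add_apply, map_add] at h
  linarith

end CBF

/-! ### The damping term and the full operator from V to V'. -/

namespace CBF

variable {d : ℕ} {O : Set (Vec d)}

/-- The map `x ↦ |x|^{r-1} x`. -/
def powMap (r : ℝ) (x : Vec d) : Vec d := ‖x‖ ^ (r - 1) • x

theorem continuous_powMap {r : ℝ} (hr : 1 ≤ r) : Continuous (powMap (d := d) r) :=
  (continuous_norm.rpow_const fun _ => Or.inr (by linarith)).smul continuous_id

theorem norm_powMap {r : ℝ} (hr : 1 ≤ r) (x : Vec d) : ‖powMap r x‖ = ‖x‖ ^ r := by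
  rw [powMap, norm_smul, Real.norm_of_nonneg (by positivity)]
  rcases (norm_nonneg x).eq_or_lt with h | h
  · rw [← h, mul_zero, Real.zero_rpow (ne_of_gt (by linarith))]
  · rw [← Real.rpow_add_one h.ne']; simp

@[simp] theorem powMap_zero (r : ℝ) : powMap r (0 : Vec d) = 0 := by simp [powMap]

/-- With |y| ≤ |x|, the difference splits into |x|^{r-1}(x - y) and (|x|^{r-1} - |y|^{r-1})y; the
second part is at most 2|x|^{r-1}(|x| - |y|), so the constant is 1 + 2. -/
theorem norm_powMap_sub_le {r : ℝ} (hr₁ : 1 ≤ r) (hr₃ : r ≤ 3) (x y : Vec d) :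
    ‖powMap r x - powMap r y‖ ≤ 3 * (‖x‖ + ‖y‖) ^ (r - 1) * ‖x - y‖ := by
  wlog h : ‖y‖ ≤ ‖x‖ generalizing x y
  · rw [norm_sub_rev, norm_sub_rev x, add_comm ‖x‖]
    exact this y x (not_le.1 h).le
  have e : powMap r x - powMap r y =
      ‖x‖ ^ (r - 1) • (x - y) + (‖x‖ ^ (r - 1) - ‖y‖ ^ (r - 1)) • y := by
    simp only [powMap, smul_sub, sub_smul]; abel
  have hs : 0 ≤ r - 1 := by linarith
  have hm : ‖y‖ ^ (r - 1) ≤ ‖x‖ ^ (r - 1) := Real.rpow_le_rpow (norm_nonneg _) h hs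
  have key : (‖x‖ ^ (r - 1) - ‖y‖ ^ (r - 1)) * ‖y‖ ≤ 2 * ‖x‖ ^ (r - 1) * (‖x‖ - ‖y‖) := by
    rcases (norm_nonneg x).eq_or_lt with h0 | h0
    · have : ‖y‖ = 0 := le_antisymm (h0 ▸ h) (norm_nonneg _)
      rw [← h0, this]; simp
    obtain ⟨t, ht⟩ : ∃ t, t = ‖y‖ / ‖x‖ := ⟨_, rfl⟩
    have hy : ‖y‖ = t * ‖x‖ := by rw [ht]; field_simp
    have ht0 : 0 ≤ t := by rw [ht]; positivity
    have ht1 : t ≤ 1 := by rw [ht]; exact (div_le_one h0).2 h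
    rw [hy, Real.mul_rpow ht0 (norm_nonneg _)]
    -- By homogeneity only t = |y|/|x| in [0, 1] matters. Since r - 1 ≤ 2, (1 - t^{r-1})t ≤ (1 -
    -- t²)t = (1 - t)(t + t²) ≤ 2(1 - t).
    have h2 : t ^ 2 ≤ t ^ (r - 1) := by
      rcases ht0.eq_or_lt with h' | h'
      · rw [← h']; simpa using Real.rpow_nonneg le_rfl _
      · rw [← Real.rpow_two]
        exact Real.rpow_le_rpow_of_exponent_ge h' ht1 (by linarith)
    have h3 : (1 - t ^ (r - 1)) * t ≤ 2 * (1 - t) := by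
      nlinarith [mul_le_mul_of_nonneg_right h2 ht0, mul_nonneg (sq_nonneg (1 - t)) (by linarith : 0 ≤ t + 2)]
    have h4 : 0 ≤ ‖x‖ ^ (r - 1) * ‖x‖ := by positivity
    nlinarith [mul_le_mul_of_nonneg_left h3 h4]
  have hxy : ‖x‖ - ‖y‖ ≤ ‖x - y‖ := norm_sub_norm_le x y
  have hx : ‖x‖ ^ (r - 1) ≤ (‖x‖ + ‖y‖) ^ (r - 1) :=
    Real.rpow_le_rpow (norm_nonneg _) (by linarith [norm_nonneg y]) hs
  have hp : 0 ≤ ‖x‖ ^ (r - 1) := by positivity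
  rw [e]
  refine (norm_add_le _ _).trans ?_
  rw [norm_smul, norm_smul, Real.norm_of_nonneg hp, Real.norm_of_nonneg (by linarith)]
  calc _ ≤ ‖x‖ ^ (r - 1) * ‖x - y‖ + 2 * ‖x‖ ^ (r - 1) * ‖x - y‖ := by
        refine add_le_add le_rfl (key.trans ?_)
        gcongr
    _ = 3 * ‖x‖ ^ (r - 1) * ‖x - y‖ := by ring
    _ ≤ _ := by gcongr

/-- The quadratic weight is the worst case r = 3. Adding 1 to the base makes it dominate for every r
in [1, 3], so that one estimate in L⁴ covers the whole range. -/
theorem norm_powMap_sub_le' {r : ℝ} (hr₁ : 1 ≤ r) (hr₃ : r ≤ 3) (x y : Vec d) :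
    ‖powMap r x - powMap r y‖ ≤ 3 * (1 + ‖x‖ + ‖y‖) ^ 2 * ‖x - y‖ := by
  refine (norm_powMap_sub_le hr₁ hr₃ x y).trans ?_
  gcongr
  calc (‖x‖ + ‖y‖) ^ (r - 1) ≤ (1 + ‖x‖ + ‖y‖) ^ (r - 1) :=
        Real.rpow_le_rpow (by positivity) (by linarith) (by linarith)
    _ ≤ (1 + ‖x‖ + ‖y‖) ^ (2 : ℝ) :=
        Real.rpow_le_rpow_of_exponent_le (by linarith [norm_nonneg x, norm_nonneg y]) (by linarith)
    _ = _ := Real.rpow_two _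

/-- Cauchy–Schwarz bounds the product from below by (|x|^r - |y|^r)(|x| - |y|), here written as
|x|^{r-1}(|x| - |y|)² + (|x|^{r-1} - |y|^{r-1})(|x| - |y|)|y|. Both summands are nonnegative because
s ↦ s^{r-1} is increasing. -/
theorem inner_powMap_sub_nonneg {r : ℝ} (hr₁ : 1 ≤ r) (x y : Vec d) :
    0 ≤ inner ℝ (powMap r x - powMap r y) (x - y) := by
  have hx : 0 ≤ ‖x‖ ^ (r - 1) := by positivity
  have hy : 0 ≤ ‖y‖ ^ (r - 1) := by positivity
  have h : 0 ≤ (‖x‖ ^ (r - 1) - ‖y‖ ^ (r - 1)) * (‖x‖ - ‖y‖) := by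
    rcases le_total ‖x‖ ‖y‖ with h | h
    · have := Real.rpow_le_rpow (norm_nonneg _) h (by linarith : 0 ≤ r - 1)
      nlinarith
    · have := Real.rpow_le_rpow (norm_nonneg _) h (by linarith : 0 ≤ r - 1)
      nlinarith
  have hi := real_inner_le_norm x y
  simp only [powMap, inner_sub_left, inner_sub_right, inner_smul_left, RCLike.conj_to_real,
    real_inner_self_eq_norm_sq, real_inner_comm x y]
  nlinarith [mul_le_mul_of_nonneg_left hi hx, mul_le_mul_of_nonneg_left hi hy,
    mul_nonneg hx (sq_nonneg (‖x‖ - ‖y‖)), mul_nonneg h (norm_nonneg y)]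

instance : ENNReal.HolderTriple 2 4 (4 / 3) := ⟨by
  have e : ((4 : ℝ≥0∞) / 3)⁻¹ = 3 / 4 := ENNReal.inv_div (by simp) (by simp)
  rw [e, ← ENNReal.toReal_eq_toReal_iff' (by simp) (by simp [ENNReal.div_eq_top]), ENNReal.toReal_add (by simp) (by simp)]
  simp [ENNReal.toReal_div]
  norm_num⟩

instance : ENNReal.HolderConjugate (4 / 3) 4 := ⟨by
  have e : ((4 : ℝ≥0∞) / 3)⁻¹ = 3 / 4 := ENNReal.inv_div (by simp) (by simp)
  rw [e, ← ENNReal.toReal_eq_toReal_iff' (by simp [ENNReal.div_eq_top]) (by simp), ENNReal.toReal_add (by simp [ENNReal.div_eq_top]) (by simp)]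
  simp [ENNReal.toReal_div]
  norm_num⟩

instance : Fact ((1 : ℝ≥0∞) ≤ 4 / 3) := ⟨by
  rw [ENNReal.le_div_iff_mul_le (by simp) (by simp)]; norm_num⟩

/-- Hölder twice, following the pointwise bound: the two copies of the weight go from L⁴ × L⁴ to L²,
and the product with a - b from L² × L⁴ to L^{4/3}. -/
theorem eLpNorm_powMap_sub_le {r : ℝ} (hr₁ : 1 ≤ r) (hr₃ : r ≤ 3) {a b : Vec d → Vec d}
    (ha : AEStronglyMeasurable a (volOn O)) (hb : AEStronglyMeasurable b (volOn O)) :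
    eLpNorm (fun x => powMap r (a x) - powMap r (b x)) (4 / 3) (volOn O) ≤
      3 * (eLpNorm (fun x => 1 + ‖a x‖ + ‖b x‖) 4 (volOn O) *
        eLpNorm (fun x => 1 + ‖a x‖ + ‖b x‖) 4 (volOn O)) *
        eLpNorm (fun x => a x - b x) 4 (volOn O) := by
  have hg : AEStronglyMeasurable (fun x => 1 + ‖a x‖ + ‖b x‖) (volOn O) :=
    (aestronglyMeasurable_const.add ha.norm).add hb.norm
  have h1 := eLpNorm_smul_le_mul_eLpNorm (p := 4) (q := 4) (r := 2) (μ := volOn O) hg hg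
  have h2 := eLpNorm_smul_le_mul_eLpNorm (p := 2) (q := 4) (r := 4 / 3) (μ := volOn O)
    (ha.sub hb) (hg.smul hg)
  have h3 : eLpNorm (fun x => powMap r (a x) - powMap r (b x)) (4 / 3) (volOn O) ≤
      ENNReal.ofReal 3 * eLpNorm (((fun x => 1 + ‖a x‖ + ‖b x‖) • fun x => 1 + ‖a x‖ + ‖b x‖) •
        (a - b)) (4 / 3) (volOn O) := by
    refine eLpNorm_le_mul_eLpNorm_of_ae_le_mul (Eventually.of_forall fun x => ?_) _
    refine (norm_powMap_sub_le' hr₁ hr₃ _ _).trans (le_of_eq ?_)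
    change _ = 3 * ‖((1 + ‖a x‖ + ‖b x‖) * (1 + ‖a x‖ + ‖b x‖)) • (a x - b x)‖
    rw [norm_smul, Real.norm_of_nonneg (by positivity)]
    ring
  refine h3.trans ?_
  rw [mul_assoc]
  refine mul_le_mul' (by norm_num) (h2.trans (mul_le_mul_left h1 _))

theorem memLp_powMap {r : ℝ} (hr₁ : 1 ≤ r) (hr₃ : r ≤ 3) [IsFiniteMeasure (volOn O)]
    {a : Vec d → Vec d} (ha : MemLp a 4 (volOn O)) :
    MemLp (fun x => powMap r (a x)) (4 / 3) (volOn O) := by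
  refine ⟨(continuous_powMap hr₁).comp_aestronglyMeasurable ha.1, ?_⟩
  have := eLpNorm_powMap_sub_le (O := O) hr₁ hr₃ ha.1
    (aestronglyMeasurable_const (b := (0 : Vec d)))
  simp only [powMap_zero, sub_zero, norm_zero, add_zero] at this
  have h1 : MemLp (fun x => 1 + ‖a x‖) 4 (volOn O) :=
    MemLp.add (f := fun _ => (1 : ℝ)) (memLp_const 1) ha.norm
  have h2 : eLpNorm (fun x => 1 + ‖a x‖) 4 (volOn O) < ⊤ := h1.2
  have h3 : eLpNorm a 4 (volOn O) < ⊤ := ha.2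
  exact this.trans_lt (ENNReal.mul_lt_top (ENNReal.mul_lt_top (by finiteness)
    (ENNReal.mul_lt_top h2 h2)) h3)

variable [h : Admissible O]

/-- The superposition operator `a ↦ |a|^{r-1} a` from `L⁴` to `L^{4/3}`, for `1 ≤ r ≤ 3`. -/
def powLp {r : ℝ} (hr₁ : 1 ≤ r) (hr₃ : r ≤ 3) (a : Lp (Vec d) 4 (volOn O)) :
    Lp (Vec d) (4 / 3) (volOn O) := (memLp_powMap hr₁ hr₃ (Lp.memLp a)).toLp _

/-- The norm of the constant `1` in `L⁴(O)`. -/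
def oneNorm (O : Set (Vec d)) : ℝ := (eLpNorm (fun _ : Vec d => (1 : ℝ)) 4 (volOn O)).toReal

theorem norm_powLp_sub_le {r : ℝ} (hr₁ : 1 ≤ r) (hr₃ : r ≤ 3) (a b : Lp (Vec d) 4 (volOn O)) :
    ‖powLp hr₁ hr₃ a - powLp hr₁ hr₃ b‖ ≤
      3 * (oneNorm O + ‖a‖ + ‖b‖) ^ 2 * ‖a - b‖ := by
  have hO : 0 ≤ oneNorm O := ENNReal.toReal_nonneg
  have h0 := eLpNorm_powMap_sub_le (O := O) hr₁ hr₃ (Lp.aestronglyMeasurable a)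
    (Lp.aestronglyMeasurable b)
  have h1 : eLpNorm (fun x => 1 + ‖a x‖ + ‖b x‖) 4 (volOn O) ≤
      ENNReal.ofReal (oneNorm O + ‖a‖ + ‖b‖) := by
    have e1 : eLpNorm (fun _ : Vec d => (1 : ℝ)) 4 (volOn O) = ENNReal.ofReal (oneNorm O) :=
      (ENNReal.ofReal_toReal (memLp_const (1 : ℝ)).2.ne).symm
    have ha : ENNReal.ofReal ‖a‖ = eLpNorm (fun x => ‖a x‖) 4 (volOn O) := by
      rw [eLpNorm_norm, ofReal_norm, Lp.enorm_def]
    have hb : ENNReal.ofReal ‖b‖ = eLpNorm (fun x => ‖b x‖) 4 (volOn O) := by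
      rw [eLpNorm_norm, ofReal_norm, Lp.enorm_def]
    rw [ENNReal.ofReal_add (add_nonneg hO (norm_nonneg _)) (norm_nonneg _),
      ENNReal.ofReal_add hO (norm_nonneg _), ← e1, ha, hb]
    have m1 : AEStronglyMeasurable (fun _ : Vec d => (1 : ℝ)) (volOn O) :=
      aestronglyMeasurable_const
    have m2 := (Lp.aestronglyMeasurable a).norm
    have m3 := (Lp.aestronglyMeasurable b).norm
    exact (eLpNorm_add_le (m1.add m2) m3 (by norm_num)).trans
      (add_le_add_left (eLpNorm_add_le m1 m2 (by norm_num)) _)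
  have h2 : eLpNorm (fun x => a x - b x) 4 (volOn O) = ENNReal.ofReal ‖a - b‖ := by
    rw [ofReal_norm, Lp.enorm_def]
    exact eLpNorm_congr_ae (Lp.coeFn_sub a b).symm
  have h3 : ENNReal.ofReal ‖powLp hr₁ hr₃ a - powLp hr₁ hr₃ b‖ =
      eLpNorm (fun x => powMap r (a x) - powMap r (b x)) (4 / 3) (volOn O) := by
    rw [ofReal_norm, Lp.enorm_def]
    refine eLpNorm_congr_ae ?_
    filter_upwards [Lp.coeFn_sub (powLp hr₁ hr₃ a) (powLp hr₁ hr₃ b),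
      (memLp_powMap hr₁ hr₃ (Lp.memLp a)).coeFn_toLp,
      (memLp_powMap hr₁ hr₃ (Lp.memLp b)).coeFn_toLp] with x hx h1 h2
    rw [hx, Pi.sub_apply]
    exact congrArg₂ _ h1 h2
  rw [← ENNReal.ofReal_le_ofReal_iff (by positivity), h3]
  refine h0.trans ?_
  rw [h2, ENNReal.ofReal_mul (by positivity), ENNReal.ofReal_mul (by positivity), pow_two,
    ENNReal.ofReal_mul (by positivity)]
  gcongr
  norm_num

theorem locallyLipschitz_powLp {r : ℝ} (hr₁ : 1 ≤ r) (hr₃ : r ≤ 3) :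
    LocallyLipschitz (powLp (O := O) hr₁ hr₃) := by
  intro a
  set R : ℝ := oneNorm O + (‖a‖ + 1) + (‖a‖ + 1)
  have hO : 0 ≤ oneNorm O := ENNReal.toReal_nonneg
  refine ⟨(3 * R ^ 2).toNNReal, Metric.ball a 1, Metric.ball_mem_nhds a one_pos, ?_⟩
  refine LipschitzOnWith.of_dist_le_mul fun x hx y hy => ?_
  rw [dist_eq_norm, dist_eq_norm, Real.coe_toNNReal _ (by positivity)]
  have bound : ∀ z ∈ Metric.ball a 1, ‖z‖ ≤ ‖a‖ + 1 := fun z hz => by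
    have : ‖z - a‖ < 1 := by rwa [← dist_eq_norm]
    linarith [norm_le_norm_add_norm_sub' z a]
  refine (norm_powLp_sub_le hr₁ hr₃ x y).trans ?_
  have := bound x hx
  have := bound y hy
  gcongr
  change _ ≤ oneNorm O + (‖a‖ + 1) + (‖a‖ + 1)
  gcongr

/-- The damping operator `v ↦ |v|^{r-1} v` from `V` to `V'`. -/
def dampForm {r : ℝ} (hr₁ : 1 ≤ r) (hr₃ : r ≤ 3) (v : VSpace O) : StrongDual ℝ (VSpace O) :=
  ((innerSL ℝ : Vec d →L[ℝ] Vec d →L[ℝ] ℝ).lpPairing (volOn O) (4 / 3) 4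
    (powLp hr₁ hr₃ (embL4 O v))).comp (embL4 O)

theorem dampForm_apply {r : ℝ} (hr₁ : 1 ≤ r) (hr₃ : r ≤ 3) (v w : VSpace O) :
    dampForm hr₁ hr₃ v w =
      ∫ x in O, inner ℝ (powMap r (field (embV v) x)) (field (embV w) x) := by
  change ((innerSL ℝ : Vec d →L[ℝ] Vec d →L[ℝ] ℝ).lpPairing (volOn O) (4 / 3) 4
    (powLp hr₁ hr₃ (embL4 O v))) (embL4 O w) = _
  rw [ContinuousLinearMap.lpPairing_eq_integral]
  refine integral_congr_ae ?_
  filter_upwards [(memLp_powMap hr₁ hr₃ (Lp.memLp (embL4 O v))).coeFn_toLp, coeFn_embL4 v,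
    coeFn_embL4 w] with x h1 h2 h3
  rw [h3]
  have : powLp hr₁ hr₃ (embL4 O v) x = powMap r (field (embV v) x) := h1.trans (by rw [h2])
  rw [this]
  rfl

theorem integrable_dampForm {r : ℝ} (hr₁ : 1 ≤ r) (hr₃ : r ≤ 3) (v w : VSpace O) :
    Integrable (fun x => inner ℝ (powMap r (field (embV v) x)) (field (embV w) x)) (volOn O) :=
  memLp_one_iff_integrable.1 <|
    (innerSL ℝ : Vec d →L[ℝ] Vec d →L[ℝ] ℝ).memLp_of_bilin (p := 4 / 3) (q := 4) 1
      (memLp_powMap hr₁ hr₃ (memLp_field_four v)) (memLp_field_four w)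

theorem damping_eq {r : ℝ} (hr₁ : 1 ≤ r) (hr₃ : r ≤ 3) (v : VSpace O) (φ : divFreeTest O) :
    damping r (embV v) φ = dampForm hr₁ hr₃ v (testToV φ) := by
  rw [dampForm_apply, damping]
  refine integral_congr_ae ?_
  filter_upwards [coeFn_testToV φ] with x hx
  rw [hx, powMap, inner_smul_left]
  rfl

theorem inner_powMap_self {r : ℝ} (hr₁ : 1 ≤ r) (x : Vec d) :
    inner ℝ (powMap r x) x = ‖x‖ ^ (r + 1) := by
  rw [powMap, inner_smul_left, real_inner_self_eq_norm_sq, RCLike.conj_to_real]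
  rcases (norm_nonneg x).eq_or_lt with h | h
  · rw [← h, Real.zero_rpow (x := r + 1) (ne_of_gt (by linarith))]; simp
  · rw [← Real.rpow_two, ← Real.rpow_add h]; ring_nf

theorem dampForm_self {r : ℝ} (hr₁ : 1 ≤ r) (hr₃ : r ≤ 3) (v : VSpace O) :
    dampForm hr₁ hr₃ v v = powNorm (r + 1) (embV v) := by
  rw [dampForm_apply, powNorm]
  simp_rw [inner_powMap_self hr₁]

theorem integrable_powNorm {r : ℝ} (hr₁ : 1 ≤ r) (hr₃ : r ≤ 3) (v : VSpace O) :
    Integrable (fun x => ‖field (embV v) x‖ ^ (r + 1)) (volOn O) := by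
  simpa only [inner_powMap_self hr₁] using integrable_dampForm hr₁ hr₃ v v

theorem dampForm_monotone {r : ℝ} (hr₁ : 1 ≤ r) (hr₃ : r ≤ 3) (v w : VSpace O) :
    0 ≤ dampForm hr₁ hr₃ v (v - w) - dampForm hr₁ hr₃ w (v - w) := by
  rw [dampForm_apply, dampForm_apply,
    ← integral_sub (integrable_dampForm hr₁ hr₃ _ _) (integrable_dampForm hr₁ hr₃ _ _)]
  refine integral_nonneg_of_ae ?_
  have e : field (embV (v - w)) =ᵐ[volOn O] fun x => field (embV v) x - field (embV w) x := by
    rw [embV_sub]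
    exact Lp.coeFn_sub (HSpace.toL2 (embV v)) (HSpace.toL2 (embV w))
  filter_upwards [e] with x hx
  simp only [hx, ← inner_sub_left]
  exact inner_powMap_sub_nonneg hr₁ _ _

theorem locallyLipschitz_dampForm {r : ℝ} (hr₁ : 1 ≤ r) (hr₃ : r ≤ 3) :
    LocallyLipschitz (dampForm (O := O) hr₁ hr₃) := by
  set L := (innerSL ℝ : Vec d →L[ℝ] Vec d →L[ℝ] ℝ).lpPairing (volOn O) (4 / 3) 4
  have h1 : LipschitzWith _ (fun z : Lp (Vec d) (4 / 3) (volOn O) => (L z).comp (embL4 O)) :=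
    (((ContinuousLinearMap.compL ℝ (VSpace O) (Lp (Vec d) 4 (volOn O)) ℝ).flip
      (embL4 O)).comp L).lipschitz
  exact h1.locallyLipschitz.comp
    ((locallyLipschitz_powLp hr₁ hr₃).comp (embL4 O).lipschitz.locallyLipschitz)

/-- The viscous operator `(∇v, ∇w)`. -/
def viscForm (O : Set (Vec d)) : VSpace O →L[ℝ] StrongDual ℝ (VSpace O) :=
  (((ContinuousLinearMap.compL ℝ (VSpace O) (Lp (Mat d) 2 (volOn O)) ℝ).flip (gradVL O)).comp
    (InnerProductSpace.toDualMap ℝ (Lp (Mat d) 2 (volOn O))).toContinuousLinearMap).comp (gradVL O)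

@[simp] theorem viscForm_apply (v w : VSpace O) : viscForm O v w = inner ℝ (gradV v) (gradV w) := rfl

/-- The operator `v ↦ -μ A v - B(v) - β C(v)` from `V` to `V'`. -/
def cbfOp {r : ℝ} (hr₁ : 1 ≤ r) (hr₃ : r ≤ 3) (μ β : ℝ) (v : VSpace O) :
    StrongDual ℝ (VSpace O) :=
  -(μ • viscForm O v) - convForm v v - β • dampForm hr₁ hr₃ v

theorem cbfOp_apply {r : ℝ} (hr₁ : 1 ≤ r) (hr₃ : r ≤ 3) (μ β : ℝ) (v w : VSpace O) :
    cbfOp hr₁ hr₃ μ β v w =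
      -(μ * inner ℝ (gradV v) (gradV w)) - convForm v v w - β * dampForm hr₁ hr₃ v w := rfl

/-- The convection drops out and the other two terms have a sign. Every a priori bound comes from
this identity. -/
theorem cbfOp_self {r : ℝ} (hr₁ : 1 ≤ r) (hr₃ : r ≤ 3) (μ β : ℝ) (v : VSpace O) :
    cbfOp hr₁ hr₃ μ β v v = -(μ * ‖gradV v‖ ^ 2) - β * powNorm (r + 1) (embV v) := by
  rw [cbfOp_apply, convForm_self, dampForm_self, real_inner_self_eq_norm_sq, sub_zero]

theorem locallyLipschitz_cbfOp {r : ℝ} (hr₁ : 1 ≤ r) (hr₃ : r ≤ 3) (μ β : ℝ) :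
    LocallyLipschitz (cbfOp (O := O) hr₁ hr₃ μ β) := by
  have h1 : LocallyLipschitz fun v : VSpace O => -(μ • viscForm O v) :=
    (-(μ • viscForm O)).lipschitz.locallyLipschitz
  have h2 : LocallyLipschitz fun v : VSpace O => convForm v v :=
    (contDiff_convForm.comp (contDiff_id.prodMk contDiff_id)).locallyLipschitz
  have h3 : LocallyLipschitz fun v : VSpace O => β • dampForm hr₁ hr₃ v :=
    (β • ContinuousLinearMap.id ℝ (StrongDual ℝ (VSpace O))).lipschitz.locallyLipschitz.comp
      (locallyLipschitz_dampForm hr₁ hr₃)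
  exact (h1.sub h2).sub h3

end CBF

/-! ### Global solutions of dissipative equations and Galerkin systems. -/

namespace CBF

section ODE

variable {E : Type*} [NormedAddCommGroup E]

/-- A Lipschitz cutoff, equal to `1` on the ball of radius `R` and to `0` outside the ball of
radius `R + 1`. -/
def cutoff (R : ℝ) (x : E) : ℝ := max (min (R + 1 - ‖x‖) 1) 0

theorem cutoff_nonneg (R : ℝ) (x : E) : 0 ≤ cutoff R x := le_max_right _ _

theorem cutoff_le_one (R : ℝ) (x : E) : cutoff R x ≤ 1 := max_le (min_le_right _ _) zero_le_one

theorem cutoff_eq_one {R : ℝ} {x : E} (h : ‖x‖ ≤ R) : cutoff R x = 1 := by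
  rw [cutoff, min_eq_right (by linarith), max_eq_left zero_le_one]

theorem cutoff_eq_zero {R : ℝ} {x : E} (h : R + 1 ≤ ‖x‖) : cutoff R x = 0 :=
  max_eq_right ((min_le_left _ _).trans (by linarith))

theorem abs_cutoff_sub_le (R : ℝ) (x y : E) : |cutoff R x - cutoff R y| ≤ ‖x - y‖ := by
  have h1 := abs_max_sub_max_le_abs (min (R + 1 - ‖x‖) 1) (min (R + 1 - ‖y‖) 1) 0
  have h2 := abs_inf_sub_inf_le_abs (R + 1 - ‖x‖) (R + 1 - ‖y‖) 1
  have h3 : |(R + 1 - ‖x‖) - (R + 1 - ‖y‖)| ≤ ‖x - y‖ := by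
    have : (R + 1 - ‖x‖) - (R + 1 - ‖y‖) = -(‖x‖ - ‖y‖) := by ring
    rw [this, abs_neg]
    exact abs_norm_sub_norm_le x y
  exact h1.trans (h2.trans h3)

variable [NormedSpace ℝ E]

/-- A cutoff makes a locally Lipschitz field globally Lipschitz. With ‖x‖ ≤ ‖y‖, the variation of
the cutoff is multiplied by g at x, the point that lies in the ball whenever the difference is
nonzero, so the bound M applies to it. -/
theorem norm_cutoff_smul_sub_le {R L M : ℝ} (hL : 0 ≤ L) (hM : 0 ≤ M) {g : E → E}
    (hg : ∀ x y, ‖x‖ ≤ R + 1 → ‖y‖ ≤ R + 1 → ‖g x - g y‖ ≤ L * ‖x - y‖)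
    (hgM : ∀ x, ‖x‖ ≤ R + 1 → ‖g x‖ ≤ M) (x y : E) :
    ‖cutoff R x • g x - cutoff R y • g y‖ ≤ (L + M) * ‖x - y‖ := by
  wlog h : ‖x‖ ≤ ‖y‖ generalizing x y
  · rw [norm_sub_rev, norm_sub_rev x]
    exact this y x (not_le.1 h).le
  rcases le_or_gt ‖x‖ (R + 1) with hx | hx
  · have h1 : ‖(cutoff R x - cutoff R y) • g x‖ ≤ M * ‖x - y‖ := by
      rw [norm_smul, Real.norm_eq_abs, mul_comm]
      exact mul_le_mul (hgM x hx) (abs_cutoff_sub_le R x y) (abs_nonneg _) hM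
    rcases le_or_gt ‖y‖ (R + 1) with hy | hy
    · have e : cutoff R x • g x - cutoff R y • g y =
          (cutoff R x - cutoff R y) • g x + cutoff R y • (g x - g y) := by
        rw [sub_smul, smul_sub]; abel
      rw [e, add_mul, add_comm (L * _)]
      refine (norm_add_le _ _).trans (add_le_add h1 ?_)
      rw [norm_smul, Real.norm_of_nonneg (cutoff_nonneg _ _)]
      exact (mul_le_of_le_one_left (norm_nonneg _) (cutoff_le_one _ _)).trans (hg x y hx hy)
    · rw [cutoff_eq_zero hy.le, sub_zero] at h1
      rw [cutoff_eq_zero hy.le, zero_smul, sub_zero]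
      exact h1.trans (by gcongr; linarith)
  · rw [cutoff_eq_zero hx.le, cutoff_eq_zero (hx.le.trans h)]
    simp only [zero_smul, sub_self, norm_zero]
    positivity

end ODE

section ODE

variable {E : Type*} [NormedAddCommGroup E] [InnerProductSpace ℝ E] [FiniteDimensional ℝ E]

/-- Global solutions of dissipative ordinary differential equations. -/
theorem exists_forall_hasDerivWithinAt_of_dissipative {G : E → E} (hG : LocallyLipschitz G)
    {b : ℝ → E} (hb : Continuous b) {K T : ℝ} (hT : 0 < T) (hK : 0 ≤ K)
    (hdiss : ∀ t ∈ Icc 0 T, ∀ x, inner ℝ x (G x + b t) ≤ K) (x₀ : E) :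
    ∃ α : ℝ → E, α 0 = x₀ ∧
      ∀ t ∈ Icc 0 T, HasDerivWithinAt α (G (α t) + b t) (Icc 0 T) t := by
  have : CompleteSpace E := FiniteDimensional.complete ℝ E
  have : ProperSpace E := FiniteDimensional.proper_real E
  -- The a priori bound: dissipativity gives (‖α‖²)' ≤ 2K, hence ‖α(t)‖² ≤ ‖x₀‖² + 2KT on [0, T].
  set R : ℝ := √(‖x₀‖ ^ 2 + 2 * K * T) with hR
  have hcomp := isCompact_closedBall (0 : E) (R + 1)
  obtain ⟨L, hL⟩ := LocallyLipschitzOn.exists_lipschitzOnWith_of_compact hcomp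
    (hG.locallyLipschitzOn (s := Metric.closedBall (0 : E) (R + 1)))
  obtain ⟨M₁, hM₁⟩ := hcomp.exists_bound_of_continuousOn hG.continuous.continuousOn
  obtain ⟨M₂, hM₂⟩ := (isCompact_Icc (a := 0) (b := T)).exists_bound_of_continuousOn hb.continuousOn
  set M : ℝ := |M₁| + |M₂|
  have hM0 : 0 ≤ M := by positivity
  have hgM : ∀ t ∈ Icc 0 T, ∀ x : E, ‖x‖ ≤ R + 1 → ‖G x + b t‖ ≤ M := fun t ht x hx =>
    (norm_add_le _ _).trans (add_le_add ((hM₁ x (by simpa using hx)).trans (le_abs_self _))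
      ((hM₂ t ht).trans (le_abs_self _)))
  -- The truncated field is bounded by M and Lipschitz on the whole space, so Picard–Lindelöf on the
  -- ball of radius MT reaches the final time in one step.
  set f : ℝ → E → E := fun t x => cutoff R x • (G x + b t) with hf
  have hpl : IsPicardLindelof f (⟨0, left_mem_Icc.2 hT.le⟩ : Icc 0 T) x₀ (M.toNNReal * T.toNNReal) 0
      M.toNNReal (L + M.toNNReal) := by
    refine ⟨fun t ht => ?_, fun x _ => ?_, fun t ht x _ => ?_, ?_⟩
    · refine LipschitzOnWith.of_dist_le_mul fun x _ y _ => ?_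
      rw [dist_eq_norm, dist_eq_norm, NNReal.coe_add, Real.coe_toNNReal _ hM0]
      refine norm_cutoff_smul_sub_le L.2 hM0 (fun x y hx hy => ?_) (hgM t ht) x y
      rw [add_sub_add_right_eq_sub, ← dist_eq_norm, ← dist_eq_norm]
      exact hL.dist_le_mul x (by simpa using hx) y (by simpa using hy)
    · exact (continuous_const.smul (continuous_const.add hb)).continuousOn
    · rw [hf, Real.coe_toNNReal _ hM0]
      simp only [norm_smul, Real.norm_of_nonneg (cutoff_nonneg R x)]
      rcases le_or_gt ‖x‖ (R + 1) with hx | hx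
      · exact (mul_le_of_le_one_left (norm_nonneg _) (cutoff_le_one _ _)).trans (hgM t ht x hx)
      · rw [cutoff_eq_zero hx.le, zero_mul]; exact hM0
    · simp [hT.le]
  obtain ⟨α, hα0, hα⟩ := hpl.exists_eq_forall_mem_Icc_hasDerivWithinAt₀
  refine ⟨α, hα0, fun t ht => ?_⟩
  have hcont : ContinuousOn α (Icc 0 T) := fun t ht => (hα t ht).continuousWithinAt
  -- The truncated field is still dissipative with the same K, because the cutoff lies in [0, 1] and
  -- K ≥ 0. The solution therefore stays in the ball of radius R, where the cutoff equals 1, and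
  -- solves the original equation.
  have hanti : AntitoneOn (fun t => ‖α t‖ ^ 2 - 2 * K * t) (Icc 0 T) := by
    have hd : ∀ t ∈ interior (Icc 0 T), HasDerivAt (fun t => ‖α t‖ ^ 2 - 2 * K * t)
        (2 * inner ℝ (α t) (f t (α t)) - 2 * K) t := by
      intro t ht
      have h1 := (hα t (interior_subset ht)).hasDerivAt (mem_interior_iff_mem_nhds.1 ht)
      have h2 := (hasDerivAt_id t).const_mul (2 * K)
      rw [mul_one] at h2
      exact h1.norm_sq.sub h2
    refine antitoneOn_of_deriv_nonpos (convex_Icc _ _)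
      ((hcont.norm.pow 2).sub (by fun_prop)) (fun t ht => (hd t ht).differentiableAt.differentiableWithinAt) ?_
    intro t ht
    rw [(hd t ht).deriv, hf]
    simp only [inner_smul_right]
    have h1 := mul_le_mul_of_nonneg_left (hdiss t (interior_subset ht) (α t)) (cutoff_nonneg R (α t))
    have h2 := mul_le_mul_of_nonneg_right (cutoff_le_one R (α t)) hK
    linarith
  have hle : ‖α t‖ ≤ R := by
    have := hanti (left_mem_Icc.2 hT.le) ht ht.1
    simp only [hα0, mul_zero, sub_zero] at this
    refine Real.le_sqrt_of_sq_le ?_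
    have : 2 * K * t ≤ 2 * K * T := by gcongr; exact ht.2
    linarith
  have := hα t ht
  simp only [hf, cutoff_eq_one hle, one_smul] at this
  exact this

end ODE

section Galerkin

variable {V H : Type*} [NormedAddCommGroup V] [InnerProductSpace ℝ V]
  [NormedAddCommGroup H] [InnerProductSpace ℝ H]

/-- Galerkin approximations: solutions of the projection of `u' = N(u) + g` to a
finite-dimensional space. -/
theorem exists_galerkin (ι : V →L[ℝ] H) (hι : Function.Injective ι) (S : Submodule ℝ V)
    [FiniteDimensional ℝ S] {N : V → StrongDual ℝ V} (hN : LocallyLipschitz N)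
    {κ : ℝ} (hκ : 0 < κ) (hNκ : ∀ v, N v v ≤ -(κ * ‖v‖ ^ 2)) {g : ℝ → StrongDual ℝ V}
    (hg : Continuous g) (u₀ : H) {T : ℝ} (hT : 0 < T) :
    ∃ u : ℝ → V, Continuous u ∧ (∀ t, u t ∈ S) ∧
      (∀ φ ∈ S, inner ℝ (ι (u 0)) (ι φ) = inner ℝ u₀ (ι φ)) ∧
      (∀ φ ∈ S, ∀ s ∈ Icc 0 T, ∀ t ∈ Icc 0 T, inner ℝ (ι (u t)) (ι φ) =
        inner ℝ (ι (u s)) (ι φ) + ∫ τ in s..t, (N (u τ) + g τ) φ) ∧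
      (∀ t ∈ Icc 0 T, ‖ι (u t)‖ ^ 2 =
        ‖ι (u 0)‖ ^ 2 + 2 * ∫ τ in 0..t, (N (u τ) + g τ) (u τ)) := by
  -- The unknown is carried in the image of S with the inner product of H, where the time derivative
  -- acts; `Φ` goes back to S with the norm of V, where the operator is defined. Finite dimension
  -- makes `Φ` continuous.
  set E : Submodule ℝ H := S.map (ι : V →ₗ[ℝ] H)
  have : CompleteSpace E := FiniteDimensional.complete ℝ E
  set e : S ≃ₗ[ℝ] E := Submodule.equivMapOfInjective (ι : V →ₗ[ℝ] H) hι S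
  set Φ : E →L[ℝ] V := (S.subtype ∘ₗ e.symm.toLinearMap).toContinuousLinearMap
  have hΦS : ∀ x, Φ x ∈ S := fun x => (e.symm x).2
  have hιΦ : ∀ x, ι (Φ x) = x := fun x => by
    have : ((e (e.symm x) : E) : H) = ι ((e.symm x : S) : V) := rfl
    rw [LinearEquiv.apply_symm_apply] at this
    exact this.symm
  have hsurj : ∀ φ ∈ S, ∃ x, Φ x = φ := fun φ hφ => ⟨e ⟨φ, hφ⟩, by
    change ((e.symm (e ⟨φ, hφ⟩) : S) : V) = φ
    rw [LinearEquiv.symm_apply_apply]⟩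
  have hιiso : ∀ x y, inner ℝ (ι (Φ x)) (ι (Φ y)) = inner ℝ x y := fun x y => by
    rw [hιΦ, hιΦ]; rfl
  -- The Riesz representative in E of the restriction of a functional to S. It turns the equation
  -- tested on S into an ordinary differential equation in E.
  set D : StrongDual ℝ V →L[ℝ] E :=
    ((InnerProductSpace.toDual ℝ E).symm.toContinuousLinearEquiv.toContinuousLinearMap).comp
      ((ContinuousLinearMap.compL ℝ E V ℝ).flip Φ)
  have hD : ∀ ℓ x, inner ℝ (D ℓ) x = ℓ (Φ x) := fun ℓ x =>
    InnerProductSpace.toDual_symm_apply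
  have hG : LocallyLipschitz fun x : E => D (N (Φ x)) :=
    D.lipschitz.locallyLipschitz.comp (hN.comp Φ.lipschitz.locallyLipschitz)
  obtain ⟨M, hM⟩ := (isCompact_Icc (a := 0) (b := T)).exists_bound_of_continuousOn hg.continuousOn
  -- The constant M²/(4κ) is the maximum of -κs² + Ms.
  obtain ⟨α, hα0, hα⟩ := exists_forall_hasDerivWithinAt_of_dissipative hG
    (b := fun t => D (g t)) (D.continuous.comp hg) (K := M ^ 2 / (4 * κ)) hT (by positivity) (by
      intro t ht x
      rw [← map_add, real_inner_comm, hD, add_apply]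
      have h1 := hNκ (Φ x)
      have h2 : g t (Φ x) ≤ M * ‖Φ x‖ := (le_abs_self _).trans
        (((g t).le_opNorm _).trans (mul_le_mul_of_nonneg_right (hM t ht) (norm_nonneg _)))
      rw [le_div_iff₀ (by positivity)]
      nlinarith [sq_nonneg (M - 2 * κ * ‖Φ x‖)]) (E.orthogonalProjectionOnto u₀)
  have hαc : ContinuousOn α (Icc 0 T) := fun t ht => (hα t ht).continuousWithinAt
  -- Freezing the solution outside [0, T] makes it continuous on the whole line, which removes all
  -- measurability questions for the approximations.
  set a : ℝ → E := IccExtend hT.le ((Icc 0 T).domRestrict α)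
  have ha : Continuous a := (continuousOn_iff_continuous_domRestrict.1 hαc).Icc_extend'
  have haα : ∀ t ∈ Icc 0 T, a t = α t := fun t ht => IccExtend_of_mem _ _ ht
  have hderiv : ∀ t ∈ Ioo 0 T, HasDerivAt a (D (N (Φ (a t)) + g t)) t := by
    intro t ht
    rw [haα t (Ioo_subset_Icc_self ht), map_add]
    refine ((hα t (Ioo_subset_Icc_self ht)).hasDerivAt (Icc_mem_nhds ht.1 ht.2)).congr_of_eventuallyEq ?_
    filter_upwards [Icc_mem_nhds ht.1 ht.2] with s hs using haα s hs
  have hF : Continuous fun t => N (Φ (a t)) + g t :=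
    (hN.continuous.comp (Φ.continuous.comp ha)).add hg
  refine ⟨fun t => Φ (a t), Φ.continuous.comp ha, fun t => hΦS _, ?_, ?_, ?_⟩
  · intro φ hφ
    obtain ⟨x, rfl⟩ := hsurj φ hφ
    rw [hιiso, haα 0 (left_mem_Icc.2 hT.le), hα0, hιΦ]
    rw [real_inner_comm, real_inner_comm _ u₀]
    exact Submodule.inner_orthogonalProjectionOnto_eq_of_mem_left x u₀
  · intro φ hφ s hs t ht
    obtain ⟨x, rfl⟩ := hsurj φ hφ
    rw [hιiso, hιiso, ← sub_eq_iff_eq_add']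
    symm
    have hsub : uIcc s t ⊆ Icc 0 T := uIcc_subset_Icc hs ht
    refine intervalIntegral.integral_eq_sub_of_hasDeriv_right (f := fun t => inner ℝ (a t) x)
      ?_ ?_ ?_
    · exact (ha.inner continuous_const).continuousOn
    · intro τ hτ
      have hτ' : τ ∈ Ioo 0 T := ⟨(le_min hs.1 ht.1).trans_lt hτ.1, hτ.2.trans_le (max_le hs.2 ht.2)⟩
      have := (hderiv τ hτ').inner ℝ (hasDerivAt_const τ x)
      rw [inner_zero_right, zero_add, hD] at this
      exact this.hasDerivWithinAt
    · exact (hF.clm_apply continuous_const).intervalIntegrable _ _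
  · intro t ht
    have h0 : ∀ s, ‖ι (Φ (a s))‖ ^ 2 = ‖a s‖ ^ 2 := fun s => by rw [hιΦ]; rfl
    simp only [h0]
    rw [← sub_eq_iff_eq_add', ← intervalIntegral.integral_const_mul]
    symm
    refine intervalIntegral.integral_eq_sub_of_hasDeriv_right (f := fun t => ‖a t‖ ^ 2) ?_ ?_ ?_
    · exact (ha.norm.pow 2).continuousOn
    · intro τ hτ
      rw [min_eq_left ht.1, max_eq_right ht.1] at hτ
      have := (hderiv τ ⟨hτ.1, hτ.2.trans_le ht.2⟩).norm_sq
      rw [real_inner_comm, hD] at this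
      exact this.hasDerivWithinAt
    · exact (continuous_const.mul (hF.clm_apply (Φ.continuous.comp ha))).intervalIntegrable _ _

end Galerkin

end CBF

/-! ### Weak limits, the product rule, Gronwall's lemma, diagonal extraction. -/

namespace CBF

theorem aestronglyMeasurable_dual_apply {V α : Type*} [NormedAddCommGroup V] [NormedSpace ℝ V]
    {m : MeasurableSpace α} {ν : Measure α} {F : α → StrongDual ℝ V} {u : α → V}
    (hF : AEStronglyMeasurable F ν) (hu : AEStronglyMeasurable u ν) :
    AEStronglyMeasurable (fun s => F s (u s)) ν :=
  (ContinuousLinearMap.id ℝ (StrongDual ℝ V)).aestronglyMeasurable_comp₂ hF hu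

section Hilbert

variable {X : Type*} [NormedAddCommGroup X] [InnerProductSpace ℝ X] [CompleteSpace X]

/-- Weak compactness of balls of a Hilbert space, along an ultrafilter. -/
theorem exists_weakLimit_ultrafilter {ι : Type*} {x : ι → X} {M : ℝ} (hM : ∀ n, ‖x n‖ ≤ M)
    (g : Ultrafilter ι) :
    ∃ a : X, ‖a‖ ≤ M ∧ ∀ z, Tendsto (fun n => inner ℝ (x n) z) g (𝓝 (inner ℝ a z)) := by
  have hlim : ∀ z, ∃ c, Tendsto (fun n => inner ℝ (x n) z) g (𝓝 c) ∧ |c| ≤ M * ‖z‖ := by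
    intro z
    have hmem : ∀ n, inner ℝ (x n) z ∈ Icc (-(M * ‖z‖)) (M * ‖z‖) := fun n =>
      abs_le.1 ((abs_real_inner_le_norm _ _).trans (by gcongr; exact hM n))
    obtain ⟨c, hc, hle⟩ := (isCompact_Icc (a := -(M * ‖z‖)) (b := M * ‖z‖)).ultrafilter_le_nhds
      (g.map fun n => inner ℝ (x n) z)
      (le_principal_iff.2 (Filter.univ_mem' (f := (g : Filter ι)) hmem))
    exact ⟨c, hle, abs_le.2 hc⟩
  choose L hL hLM using hlim
  let Llin : X →ₗ[ℝ] ℝ :=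
    { toFun := L
      map_add' := fun z w => tendsto_nhds_unique (hL (z + w)) (by
        simpa only [inner_add_right] using (hL z).add (hL w))
      map_smul' := fun c z => tendsto_nhds_unique (hL (c • z)) (by
        simpa only [inner_smul_right, RingHom.id_apply, smul_eq_mul] using (hL z).const_mul c) }
  have hM0 : 0 ≤ M := by
    obtain ⟨n⟩ := (g : Filter ι).nonempty_of_neBot
    exact (norm_nonneg _).trans (hM n)
  let Lc : StrongDual ℝ X := Llin.mkContinuous M fun z => hLM z
  refine ⟨(InnerProductSpace.toDual ℝ X).symm Lc, ?_, fun z => ?_⟩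
  · rw [LinearIsometryEquiv.norm_map]
    exact LinearMap.mkContinuous_norm_le _ hM0 _
  · rw [InnerProductSpace.toDual_symm_apply]
    exact hL z

/-- A bounded sequence whose products with a dense family converge has a weak limit. -/
theorem exists_weakLimit_of_dense {x : ℕ → X} {M : ℝ} (hM : ∀ n, ‖x n‖ ≤ M) {κ : Type*}
    {ζ : κ → X} (hζ : DenseRange ζ)
    (h : ∀ k, ∃ c, Tendsto (fun n => inner ℝ (x n) (ζ k)) atTop (𝓝 c)) :
    ∃ a : X, ‖a‖ ≤ M ∧ ∀ z, Tendsto (fun n => inner ℝ (x n) z) atTop (𝓝 (inner ℝ a z)) := by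
  obtain ⟨a, haM, ha⟩ := exists_weakLimit_ultrafilter hM (hyperfilter ℕ)
  refine ⟨a, haM, fun z => ?_⟩
  -- A weak limit exists along every ultrafilter by compactness; all these limits have the same
  -- products with the dense family, so they coincide and the whole sequence converges.
  rw [tendsto_iff_ultrafilter]
  intro g hg
  obtain ⟨b, hbM, hb⟩ := exists_weakLimit_ultrafilter hM g
  have : a = b := by
    refine hζ.eq_of_inner_left (𝕜 := ℝ) fun k => ?_
    obtain ⟨c, hc⟩ := h k
    have h1 := tendsto_nhds_unique (ha (ζ k)) (hc.mono_left (Nat.hyperfilter_le_atTop))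
    have h2 := tendsto_nhds_unique (hb (ζ k)) (hc.mono_left hg)
    rw [h1, h2]
  rw [this]
  exact hb z

end Hilbert

section WeakL2

variable {V H : Type*} [NormedAddCommGroup V] [InnerProductSpace ℝ V]
  [NormedAddCommGroup H] [InnerProductSpace ℝ H]
  {α : Type*} {m : MeasurableSpace α} {ν : Measure α}

/-- Functions in `L²(V')` define functionals on `L²(V)`. -/
theorem exists_dual_Lp {F : α → StrongDual ℝ V} (hF : MemLp F 2 ν) :
    ∃ ℓ : StrongDual ℝ (Lp V 2 ν), ∀ (u : α → V) (hu : MemLp u 2 ν),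
      ℓ (hu.toLp u) = ∫ s, F s (u s) ∂ν := by
  refine ⟨(ContinuousLinearMap.id ℝ (StrongDual ℝ V)).lpPairing ν 2 2 (hF.toLp F), fun u hu => ?_⟩
  rw [ContinuousLinearMap.lpPairing_eq_integral]
  refine integral_congr_ae ?_
  filter_upwards [hF.coeFn_toLp, hu.coeFn_toLp] with s h1 h2
  rw [h1, h2]
  rfl

theorem integrable_dual_apply {F : α → StrongDual ℝ V} (hF : MemLp F 2 ν) {u : α → V}
    (hu : MemLp u 2 ν) : Integrable (fun s => F s (u s)) ν :=
  memLp_one_iff_integrable.1 <|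
    (ContinuousLinearMap.id ℝ (StrongDual ℝ V)).memLp_of_bilin (p := 2) (q := 2) 1 hF hu

/-- A bounded sequence in `L²(V)` that converges weakly in `H` almost everywhere converges weakly
in `L²(V)`. -/
theorem exists_weakLimit_L2 [CompleteSpace V] [IsFiniteMeasure ν] {ι : V →L[ℝ] H} (hι : Function.Injective ι)
    {ζ : ℕ → H} (hζ : DenseRange ζ) {u : ℕ → α → V} (hu : ∀ n, MemLp (u n) 2 ν) {M K : ℝ}
    (hM : ∀ n, ∫ s, ‖u n s‖ ^ 2 ∂ν ≤ M) (hK : ∀ n, ∀ᵐ s ∂ν, ‖ι (u n s)‖ ≤ K) {w : α → H}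
    (hw : ∀ᵐ s ∂ν, ∀ z, Tendsto (fun n => inner ℝ (ι (u n s)) z) atTop (𝓝 (inner ℝ (w s) z))) :
    ∃ v : α → V, MemLp v 2 ν ∧ (∀ᵐ s ∂ν, ι (v s) = w s) ∧
      ∀ F : α → StrongDual ℝ V, MemLp F 2 ν →
        Tendsto (fun n => ∫ s, F s (u n s) ∂ν) atTop (𝓝 (∫ s, F s (v s) ∂ν)) := by
  set x : ℕ → Lp V 2 ν := fun n => (hu n).toLp (u n) with hx
  have hxM : ∀ n, ‖x n‖ ≤ √M := by
    intro n
    refine Real.le_sqrt_of_sq_le ?_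
    refine le_trans (le_of_eq ?_) (hM n)
    rw [← real_inner_self_eq_norm_sq, L2.inner_def]
    refine integral_congr_ae ?_
    filter_upwards [(hu n).coeFn_toLp] with s hs
    rw [hs, real_inner_self_eq_norm_sq]
  have hdual : ∀ (g : Filter ℕ) (a : Lp V 2 ν),
      (∀ z, Tendsto (fun n => inner ℝ (x n) z) g (𝓝 (inner ℝ a z))) →
      ∀ F : α → StrongDual ℝ V, MemLp F 2 ν →
        Tendsto (fun n => ∫ s, F s (u n s) ∂ν) g (𝓝 (∫ s, F s (a s) ∂ν)) := by
    intro g a ha F hF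
    obtain ⟨ℓ, hℓ⟩ := exists_dual_Lp hF
    have h1 : ∀ y, ℓ y = inner ℝ y ((InnerProductSpace.toDual ℝ (Lp V 2 ν)).symm ℓ) := fun y => by
      rw [real_inner_comm, InnerProductSpace.toDual_symm_apply]
    have h2 := ha ((InnerProductSpace.toDual ℝ (Lp V 2 ν)).symm ℓ)
    simp only [← h1] at h2
    rw [← hℓ a (Lp.memLp a), Lp.toLp_coeFn]
    simpa only [hx, hℓ] using h2
  -- Any weak cluster point a in L²(V) is identified by testing with s ↦ 1_A(s)⟨ι ·, ζ k⟩: on one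
  -- side weak convergence in L²(V), on the other dominated convergence from the pointwise weak
  -- limit and the bound K. Hence ι a = w almost everywhere, and injectivity of ι leaves a single
  -- cluster point.
  have hident : ∀ (g : Filter ℕ) [NeBot g], g ≤ atTop → ∀ a : Lp V 2 ν,
      (∀ z, Tendsto (fun n => inner ℝ (x n) z) g (𝓝 (inner ℝ a z))) →
      ∀ᵐ s ∂ν, ι (a s) = w s := by
    intro g _ hg a ha
    have hk : ∀ k, ∀ᵐ s ∂ν, inner ℝ (ι (a s)) (ζ k) = inner ℝ (w s) (ζ k) := by
      intro k
      have hwm : AEStronglyMeasurable (fun s => inner ℝ (w s) (ζ k)) ν :=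
        aestronglyMeasurable_of_tendsto_ae atTop
          (fun n => (ι.continuous.comp_aestronglyMeasurable (hu n).1).inner
            aestronglyMeasurable_const) (hw.mono fun s hs => hs (ζ k))
      have hbd : ∀ᵐ s ∂ν, ‖inner ℝ (w s) (ζ k)‖ ≤ K * ‖ζ k‖ := by
        filter_upwards [hw, ae_all_iff.2 hK] with s h1 h2
        exact le_of_tendsto (h1 (ζ k)).norm (Eventually.of_forall fun n =>
          (norm_inner_le_norm _ _).trans (mul_le_mul_of_nonneg_right (h2 n) (norm_nonneg _)))
      have hint : Integrable (fun s => inner ℝ (w s) (ζ k)) ν := Integrable.of_bound hwm _ hbd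
      have haint : Integrable (fun s => inner ℝ (ι (a s)) (ζ k)) ν := by
        have h1 : Integrable (fun s => ι (a s)) ν :=
          ι.integrable_comp ((Lp.memLp a).integrable (by norm_num))
        exact h1.inner_const _
      refine Integrable.ae_eq_of_forall_setIntegral_eq _ _ haint hint fun A hA _ => ?_
      set ℓ : StrongDual ℝ V := (innerSL ℝ (ζ k)).comp ι
      have hℓ : ∀ y, ℓ y = inner ℝ (ι y) (ζ k) := fun y => real_inner_comm _ _
      have hF : MemLp (A.indicator fun _ => ℓ) 2 ν := (memLp_const ℓ).indicator hA
      have e : ∀ y : α → V, ∫ s, (A.indicator (fun _ => ℓ) s) (y s) ∂ν =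
          ∫ s in A, inner ℝ (ι (y s)) (ζ k) ∂ν := by
        intro y
        rw [← integral_indicator hA]
        congr 1
        funext s
        by_cases hs : s ∈ A <;> simp [hs, hℓ]
      have h1 := hdual g a ha _ hF
      simp only [e] at h1
      have h2 : Tendsto (fun n => ∫ s in A, inner ℝ (ι (u n s)) (ζ k) ∂ν) atTop
          (𝓝 (∫ s in A, inner ℝ (w s) (ζ k) ∂ν)) := by
        refine tendsto_integral_of_dominated_convergence (fun _ => K * ‖ζ k‖) (fun n =>
          ((ι.continuous.comp_aestronglyMeasurable (hu n).1).inner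
            aestronglyMeasurable_const).restrict) (integrable_const _) (fun n => ?_) ?_
        · filter_upwards [ae_restrict_of_ae (hK n)] with s hs
          exact (norm_inner_le_norm _ _).trans (mul_le_mul_of_nonneg_right hs (norm_nonneg _))
        · exact ae_restrict_of_ae (hw.mono fun s hs => hs (ζ k))
      exact tendsto_nhds_unique h1 (h2.mono_left hg)
    filter_upwards [ae_all_iff.2 hk] with s hs
    exact hζ.eq_of_inner_left (𝕜 := ℝ) hs
  obtain ⟨a, -, ha⟩ := exists_weakLimit_ultrafilter hxM (hyperfilter ℕ)
  have hia := hident _ Nat.hyperfilter_le_atTop a ha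
  refine ⟨a, Lp.memLp a, hia, fun F hF => ?_⟩
  rw [tendsto_iff_ultrafilter]
  intro g hg
  obtain ⟨b, -, hb⟩ := exists_weakLimit_ultrafilter hxM g
  have hib := hident _ hg b hb
  have : a = b := by
    refine Lp.ext ?_
    filter_upwards [hia, hib] with s h1 h2
    exact hι (h1.trans h2.symm)
  rw [this]
  exact hdual _ b hb F hF

end WeakL2

section ProductRule

variable {V H : Type*} [NormedAddCommGroup V] [NormedSpace ℝ V] [CompleteSpace V]
  [NormedAddCommGroup H] [InnerProductSpace ℝ H]

/-- Integration by parts for a pairing of an integral function and a `C¹` curve. -/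
theorem integral_integral_triangle {F : ℝ → StrongDual ℝ V} {a b : ℝ} (hab : a ≤ b)
    (hF : IntervalIntegrable F volume a b) {P P' : ℝ → V} (hP : ∀ s, HasDerivAt P (P' s) s)
    (hP' : Continuous P') :
    ∫ τ in a..b, (∫ s in a..τ, F s (P' τ)) = ∫ s in a..b, F s (P b - P s) := by
  set ν : Measure ℝ := volume.restrict (Ioc a b) with hν
  have hFν : Integrable F ν := (intervalIntegrable_iff_integrableOn_Ioc_of_le hab).1 hF
  have hPν : Integrable P' ν :=
    (intervalIntegrable_iff_integrableOn_Ioc_of_le hab).1 (hP'.intervalIntegrable a b)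
  -- The triangle s ≤ τ. Fubini exchanges the integrations over it, and the inner integral of P'
  -- over [s, b] is P b - P s.
  set A : Set (ℝ × ℝ) := {p | p.2 ≤ p.1}
  have hA : MeasurableSet A := measurableSet_le measurable_snd measurable_fst
  have hint : Integrable (fun p : ℝ × ℝ => F p.2 (P' p.1)) (ν.prod ν) := by
    have h1 : Integrable (fun p : ℝ × ℝ => ‖P' p.1‖ * ‖F p.2‖) (ν.prod ν) :=
      hPν.norm.mul_prod hFν.norm
    refine h1.mono ?_ (Eventually.of_forall fun p => ?_)
    · exact aestronglyMeasurable_dual_apply hFν.1.comp_snd hPν.1.comp_fst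
    · rw [Real.norm_of_nonneg (mul_nonneg (norm_nonneg _) (norm_nonneg _)), mul_comm]
      exact (F p.2).le_opNorm _
  have hint' : Integrable (Function.uncurry fun τ s =>
      A.indicator (fun p : ℝ × ℝ => F p.2 (P' p.1)) (τ, s)) (ν.prod ν) := hint.indicator hA
  have hsw := integral_integral_swap hint'
  rw [intervalIntegral.integral_of_le hab, intervalIntegral.integral_of_le hab]
  rw [← hν]
  refine Eq.trans ?_ (hsw.trans ?_)
  · refine setIntegral_congr_fun measurableSet_Ioc fun τ hτ => ?_
    rw [intervalIntegral.integral_of_le hτ.1.le]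
    have : (fun s => A.indicator (fun p : ℝ × ℝ => F p.2 (P' p.1)) (τ, s)) =
        (Iic τ).indicator fun s => F s (P' τ) := by
      funext s
      by_cases hs : s ≤ τ
      · rw [indicator_of_mem (show (τ, s) ∈ A from hs), indicator_of_mem (show s ∈ Iic τ from hs)]
      · rw [indicator_of_notMem (show (τ, s) ∉ A from hs),
          indicator_of_notMem (show s ∉ Iic τ from hs)]
    rw [this, integral_indicator measurableSet_Iic, hν, Measure.restrict_restrict measurableSet_Iic]
    congr 2
    ext s
    simp only [mem_Ioc, mem_inter_iff, mem_Iic]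
    constructor
    · rintro ⟨h1, h2⟩; exact ⟨h2, h1, h2.trans hτ.2⟩
    · rintro ⟨h1, h2, h3⟩; exact ⟨h2, h1⟩
  · refine setIntegral_congr_fun measurableSet_Ioc fun s hs => ?_
    have : (fun τ => A.indicator (fun p : ℝ × ℝ => F p.2 (P' p.1)) (τ, s)) =
        (Ici s).indicator fun τ => F s (P' τ) := by
      funext τ
      by_cases hs : s ≤ τ
      · rw [indicator_of_mem (show (τ, s) ∈ A from hs), indicator_of_mem (show τ ∈ Ici s from hs)]
      · rw [indicator_of_notMem (show (τ, s) ∉ A from hs),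
          indicator_of_notMem (show τ ∉ Ici s from hs)]
    rw [this, integral_indicator measurableSet_Ici, hν, Measure.restrict_restrict measurableSet_Ici]
    have e : Ici s ∩ Ioc a b = Icc s b := by
      ext τ
      simp only [mem_Ioc, mem_inter_iff, mem_Ici, mem_Icc]
      constructor
      · rintro ⟨h1, h2, h3⟩; exact ⟨h1, h3⟩
      · rintro ⟨h1, h2⟩; exact ⟨h1, hs.1.trans_le h1, h2⟩
    rw [e, integral_Icc_eq_integral_Ioc, ← intervalIntegral.integral_of_le hs.2,
      ContinuousLinearMap.intervalIntegral_comp_comm _ (hP'.intervalIntegrable _ _),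
      intervalIntegral.integral_eq_sub_of_hasDerivAt (fun τ _ => hP τ) (hP'.intervalIntegrable _ _)]

/-- The product rule d/dt ⟨U, P⟩ = ⟨U, P'⟩ + F(P) in integrated form. Since F is only integrable, U
is not differentiated; its integral formula is inserted in ∫⟨U, P'⟩ and the triangle identity does
the rest. It passes from fixed fields z to fields moving in time. -/
theorem inner_sub_eq_integral_add {ι : V →L[ℝ] H} {F : ℝ → StrongDual ℝ V} {U : ℝ → H} {a b : ℝ}
    (hab : a ≤ b) (hF : IntervalIntegrable F volume a b)
    (hU : ∀ z, ∀ τ ∈ Icc a b, inner ℝ (U τ) (ι z) = inner ℝ (U a) (ι z) + ∫ s in a..τ, F s z)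
    {P P' : ℝ → V} (hP : ∀ s, HasDerivAt P (P' s) s) (hP' : Continuous P') :
    inner ℝ (U b) (ι (P b)) - inner ℝ (U a) (ι (P a)) =
      (∫ τ in a..b, inner ℝ (U τ) (ι (P' τ))) + ∫ s in a..b, F s (P s) := by
  have hPc : Continuous P := continuous_iff_continuousAt.2 fun s => (hP s).continuousAt
  have hFap : ∀ {Q : ℝ → V}, Continuous Q → IntervalIntegrable (fun s => F s (Q s)) volume a b := by
    intro Q hQ
    rw [intervalIntegrable_iff_integrableOn_Ioc_of_le hab] at hF ⊢
    obtain ⟨C, hC⟩ := (isCompact_Icc (a := a) (b := b)).exists_bound_of_continuousOn hQ.continuousOn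
    refine (hF.norm.const_mul C).mono (aestronglyMeasurable_dual_apply hF.1 hQ.aestronglyMeasurable) ?_
    refine (ae_restrict_iff' measurableSet_Ioc).2 (Eventually.of_forall fun s hs => ?_)
    have h1 := hC s (Ioc_subset_Icc_self hs)
    have h0 : 0 ≤ C := (norm_nonneg _).trans h1
    rw [Real.norm_of_nonneg (mul_nonneg h0 (norm_nonneg _)), mul_comm C]
    exact ((F s).le_opNorm _).trans (mul_le_mul_of_nonneg_left h1 (norm_nonneg _))
  have h1 : ∫ τ in a..b, inner ℝ (U τ) (ι (P' τ)) =
      ∫ τ in a..b, (inner ℝ (U a) (ι (P' τ)) + ∫ s in a..τ, F s (P' τ)) := by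
    refine intervalIntegral.integral_congr fun τ hτ => ?_
    rw [uIcc_of_le hab] at hτ
    exact hU _ τ hτ
  have hGi : IntervalIntegrable (fun τ => ∫ s in a..τ, F s (P' τ)) volume a b := by
    have hc : ContinuousOn (fun τ => (∫ s in a..τ, F s) (P' τ)) (uIcc a b) := by
      refine ContinuousOn.clm_apply ?_ hP'.continuousOn
      rw [intervalIntegrable_iff_integrableOn_Ioc_of_le hab] at hF
      refine intervalIntegral.continuousOn_primitive_interval ?_
      rw [uIcc_of_le hab, integrableOn_Icc_iff_integrableOn_Ioc]
      exact hF
    refine hc.intervalIntegrable.congr fun τ hτ => ?_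
    rw [uIoc_of_le hab] at hτ
    rw [ContinuousLinearMap.intervalIntegral_apply]
    exact hF.mono_set (by rw [uIcc_of_le hτ.1.le, uIcc_of_le hab]; exact Icc_subset_Icc_right hτ.2)
  have hc0 : Continuous fun τ => inner ℝ (U a) (ι (P' τ)) :=
    continuous_const.inner (ι.continuous.comp hP')
  have h2 : ∫ τ in a..b, inner ℝ (U a) (ι (P' τ)) =
      inner ℝ (U a) (ι (P b)) - inner ℝ (U a) (ι (P a)) := by
    refine intervalIntegral.integral_eq_sub_of_hasDerivAt (f := fun τ => inner ℝ (U a) (ι (P τ)))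
      (fun τ _ => ?_) (hc0.intervalIntegrable _ _)
    exact ((innerSL ℝ (U a)).comp ι).hasFDerivAt.comp_hasDerivAt τ (hP τ)
  rw [h1, intervalIntegral.integral_add (hc0.intervalIntegrable _ _) hGi, h2,
    integral_integral_triangle hab hF hP hP', hU (P b) b (right_mem_Icc.2 hab)]
  have h3 : ∫ s in a..b, F s (P b - P s) =
      (∫ s in a..b, F s (P b)) - ∫ s in a..b, F s (P s) := by
    rw [← intervalIntegral.integral_sub (hFap continuous_const) (hFap hPc)]
    simp
  rw [h3]
  ring

end ProductRule

/-- **Gronwall's lemma** with an integrable kernel. -/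
theorem ae_eq_zero_of_le_integral {y k : ℝ → ℝ} {T : ℝ} (hT : 0 ≤ T) (hy : ∀ t, 0 ≤ y t)
    (hk : ∀ t, 0 ≤ k t) (hki : IntervalIntegrable k volume 0 T)
    (hkyi : IntervalIntegrable (fun t => k t * y t) volume 0 T)
    (hle : ∀ᵐ t ∂volume.restrict (Ioo 0 T), y t ≤ ∫ s in 0..t, k s * y s) :
    ∀ᵐ t ∂volume.restrict (Ioo 0 T), y t = 0 := by
  set Y : ℝ → ℝ := fun t => ∫ s in 0..t, k s * y s with hY
  have hky : ∀ s, 0 ≤ k s * y s := fun s => mul_nonneg (hk s) (hy s)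
  have hsub : ∀ {f : ℝ → ℝ}, IntervalIntegrable f volume 0 T → ∀ {s t}, s ∈ Icc 0 T → t ∈ Icc 0 T →
      IntervalIntegrable f volume s t := fun hf s t hs ht =>
    hf.mono_set (by rw [uIcc_of_le hT]; exact uIcc_subset_Icc hs ht)
  have h0 : (0 : ℝ) ∈ Icc 0 T := left_mem_Icc.2 hT
  have hmono : ∀ s ∈ Icc 0 T, ∀ t ∈ Icc 0 T, s ≤ t → Y s ≤ Y t := by
    intro s hs t ht hst
    have := intervalIntegral.integral_add_adjacent_intervals (hsub hkyi h0 hs) (hsub hkyi hs ht)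
    have h2 := intervalIntegral.integral_nonneg hst (fun u _ => hky u) (μ := volume)
    simp only [hY]
    linarith
  have hYc : ContinuousOn Y (Icc 0 T) := by
    have := intervalIntegral.continuousOn_primitive_interval' hkyi left_mem_uIcc
    rwa [uIcc_of_le hT] at this
  have hKc : ContinuousOn (fun t => ∫ s in 0..t, k s) (Icc 0 T) := by
    have := intervalIntegral.continuousOn_primitive_interval' hki left_mem_uIcc
    rwa [uIcc_of_le hT] at this
  -- The hypothesis on y holds only almost everywhere, so the argument runs on the continuous,
  -- nondecreasing majorant Y. The zeros of Y form a closed set, and if Y c = 0 then for t slightly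
  -- beyond c the kernel has integral at most 1/2 on [c, t], whence Y t ≤ Y t / 2.
  have key : Icc 0 T ⊆ {t | Y t = 0} := by
    refine IsClosed.Icc_subset_of_forall_exists_gt ?_ (by simp [hY]) ?_
    · rw [inter_comm]
      exact hYc.preimage_isClosed_of_isClosed isClosed_Icc isClosed_singleton
    · rintro c ⟨hc0, hc⟩ z hz
      have hcI : c ∈ Icc 0 T := Ico_subset_Icc_self hc
      have hnear : ∀ᶠ t in 𝓝[Icc 0 T] c, |(∫ s in 0..t, k s) - ∫ s in 0..c, k s| < 1 / 2 := by
        have : Tendsto _ _ _ := (hKc c hcI).tendsto.sub_const (∫ s in 0..c, k s)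
        rw [sub_self] at this
        have := this.abs
        rw [abs_zero] at this
        exact this.eventually_lt_const (by norm_num)
      have hgt : ∀ᶠ t in 𝓝[>] c, t ∈ Ioc c z ∧ t ∈ Icc 0 T ∧
          |(∫ s in 0..t, k s) - ∫ s in 0..c, k s| < 1 / 2 := by
        have h1 : 𝓝[>] c ≤ 𝓝[Icc 0 T] c := by
          refine nhdsWithin_le_of_mem ?_
          filter_upwards [Ioc_mem_nhdsGT hc.2] with t ht using ⟨hc.1.trans ht.1.le, ht.2⟩
        filter_upwards [Ioc_mem_nhdsGT hz, h1 hnear, h1 self_mem_nhdsWithin] with t a b c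
        exact ⟨a, c, b⟩
      obtain ⟨t, ht1, htI, ht2⟩ := hgt.exists
      refine ⟨t, ?_, ht1⟩
      have hct : ∫ s in c..t, k s ≤ 1 / 2 := by
        have := intervalIntegral.integral_add_adjacent_intervals (hsub hki h0 hcI) (hsub hki hcI htI)
        have := (abs_lt.1 ht2).2
        linarith
      have hYt : Y t = ∫ s in c..t, k s * y s := by
        have := intervalIntegral.integral_add_adjacent_intervals (hsub hkyi h0 hcI)
          (hsub hkyi hcI htI)
        have hc0' : Y c = 0 := hc0
        simp only [hY] at hc0' ⊢
        linarith
      have hbd : ∫ s in c..t, k s * y s ≤ ∫ s in c..t, k s * Y t := by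
        rw [intervalIntegral.integral_of_le ht1.1.le, intervalIntegral.integral_of_le ht1.1.le]
        have i1 := (hsub hkyi hcI htI)
        have i2 := ((hsub hki hcI htI).mul_const (Y t))
        rw [intervalIntegrable_iff_integrableOn_Ioc_of_le ht1.1.le] at i1 i2
        refine integral_mono_ae i1 i2 ?_
        have : ∀ᵐ s ∂volume.restrict (Ioc c t), y s ≤ Y s := by
          rw [← restrict_Ioo_eq_restrict_Ioc]
          exact ae_mono (Measure.restrict_mono (Ioo_subset_Ioo hcI.1 htI.2) le_rfl) hle
        filter_upwards [this, ae_restrict_mem measurableSet_Ioc] with s hs hs'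
        have : Y s ≤ Y t := hmono s ⟨hcI.1.trans hs'.1.le, hs'.2.trans htI.2⟩ t htI hs'.2
        exact mul_le_mul_of_nonneg_left (hs.trans this) (hk s)
      rw [intervalIntegral.integral_mul_const] at hbd
      have hY0 : 0 ≤ Y t := by
        have := hmono 0 h0 t htI htI.1
        simpa [hY] using this
      have : Y t = 0 := by nlinarith
      exact this
  filter_upwards [hle, ae_restrict_mem measurableSet_Ioo] with t ht ht'
  have : Y t = 0 := key (Ioo_subset_Icc_self ht')
  exact le_antisymm (ht.trans this.le) (hy t)

/-- Diagonal extraction from equicontinuous bounded families of functions on `[0, T]`. -/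
theorem exists_subseq_forall_tendsto {y : ℕ → ℕ → ℝ → ℝ} {T : ℝ} (hT : 0 < T) {M : ℕ → ℝ}
    (hM : ∀ n k, ∀ t ∈ Icc 0 T, |y n k t| ≤ M k)
    (heq : ∀ k, ∀ ε > 0, ∃ δ > 0, ∀ᶠ n in atTop, ∀ s ∈ Icc 0 T, ∀ t ∈ Icc 0 T, |s - t| < δ →
      |y n k s - y n k t| ≤ ε) :
    ∃ σ : ℕ → ℕ, StrictMono σ ∧ ∀ k, ∀ t ∈ Icc 0 T, ∃ c,
      Tendsto (fun n => y (σ n) k t) atTop (𝓝 c) := by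
  -- Countably many coordinates: the rational times of [0, T] and all indices k. A countable product
  -- of compact intervals is sequentially compact; equicontinuity then transfers the Cauchy property
  -- to every time.
  set D : Set (ℚ × ℕ) := {q | (q.1 : ℝ) ∈ Icc 0 T}
  set Z : ℕ → (D → ℝ) := fun n q => y n q.1.2 (q.1.1 : ℝ)
  have hcomp : IsCompact (Set.pi univ fun q : D => Icc (-(M q.1.2)) (M q.1.2)) :=
    isCompact_univ_pi fun q => isCompact_Icc
  obtain ⟨L, -, σ, hσ, hlim⟩ := hcomp.tendsto_subseq (x := Z) fun n q _ =>
    abs_le.1 (hM n q.1.2 _ q.2)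
  rw [tendsto_pi_nhds] at hlim
  refine ⟨σ, hσ, fun k t ht => ?_⟩
  refine cauchySeq_tendsto_of_complete (Metric.cauchySeq_iff'.2 fun ε hε => ?_)
  obtain ⟨δ, hδ, hev⟩ := heq k (ε / 4) (by positivity)
  -- The rational time is taken to the right of t, except at t = T where it must lie to the left.
  obtain ⟨q, hq1, hq2⟩ : ∃ q : ℚ, (q : ℝ) ∈ Icc 0 T ∧ |(q : ℝ) - t| < δ := by
    rcases ht.2.lt_or_eq with h | h
    · obtain ⟨q, h1, h2⟩ := exists_rat_btwn (lt_min h (by linarith : t < t + δ))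
      refine ⟨q, ⟨ht.1.trans h1.le, (h2.trans_le (min_le_left _ _)).le⟩, ?_⟩
      rw [abs_of_pos (by linarith)]
      have := h2.trans_le (min_le_right _ _)
      linarith
    · obtain ⟨q, h1, h2⟩ := exists_rat_btwn (max_lt (h ▸ hT) (by linarith : t - δ < t))
      refine ⟨q, ⟨(le_max_left _ _).trans h1.le, h2.le.trans ht.2⟩, ?_⟩
      rw [abs_of_neg (by linarith)]
      have := (le_max_right _ _).trans_lt h1
      linarith
  have hc : CauchySeq fun n => y (σ n) k q := (hlim ⟨(q, k), hq1⟩).cauchySeq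
  obtain ⟨N₁, hN₁⟩ := eventually_atTop.1 (hσ.tendsto_atTop.eventually hev)
  obtain ⟨N₂, hN₂⟩ := Metric.cauchySeq_iff.1 hc (ε / 4) (by positivity)
  refine ⟨max N₁ N₂, fun n hn => ?_⟩
  have a1 := hN₁ n ((le_max_left _ _).trans hn) q hq1 t ht hq2
  have a2 := hN₁ (max N₁ N₂) (le_max_left _ _) q hq1 t ht hq2
  have a3 := hN₂ n ((le_max_right _ _).trans hn) (max N₁ N₂) (le_max_right _ _)
  rw [Real.dist_eq] at a3 ⊢
  rw [abs_le] at a1 a2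
  rw [abs_lt] at a3 ⊢
  constructor <;> linarith [a1.1, a1.2, a2.1, a2.2, a3.1, a3.2]

end CBF

/-! ### Averages and difference quotients behind the energy identity. -/

namespace CBF

/-- Absolute continuity of the integral; the point is that δ does not depend on the position of the
window. -/
theorem exists_forall_setIntegral_Ioc_le {f : ℝ → ℝ} (hf : Integrable f) {ε : ℝ} (hε : 0 < ε) :
    ∃ δ > 0, ∀ c h : ℝ, 0 < h → h < δ → ∫ s in c..(c + h), |f s| ≤ ε := by
  obtain ⟨δ, hδ, H⟩ := exists_pos_setLIntegral_lt_of_measure_lt (μ := volume)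
    (f := fun s => ‖f s‖ₑ) hf.2.ne (ε := ENNReal.ofReal ε) (by simpa using hε)
  obtain ⟨δ', hδ'0, hδ'⟩ : ∃ δ' : ℝ, 0 < δ' ∧ ENNReal.ofReal δ' ≤ δ := by
    rcases eq_or_ne δ ⊤ with h | h
    · exact ⟨1, one_pos, h ▸ le_top⟩
    · exact ⟨δ.toReal, ENNReal.toReal_pos hδ.ne' h, ENNReal.ofReal_toReal_le⟩
  refine ⟨δ', hδ'0, fun c h h0 hh => ?_⟩
  have h1 := H (Ioc c (c + h)) (by
    rw [Real.volume_Ioc, add_sub_cancel_left]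
    exact ((ENNReal.ofReal_lt_ofReal_iff hδ'0).2 hh).trans_le hδ')
  rw [intervalIntegral.integral_of_le (by linarith)]
  have h2 : ENNReal.ofReal (∫ s in Ioc c (c + h), |f s|) = ∫⁻ s in Ioc c (c + h), ‖f s‖ₑ := by
    rw [ofReal_integral_eq_lintegral_ofReal hf.abs.integrableOn (ae_of_all _ fun _ => abs_nonneg _)]
    refine lintegral_congr fun s => ?_
    rw [← Real.norm_eq_abs, ofReal_norm]
  rw [← h2, ENNReal.ofReal_lt_ofReal_iff hε] at h1
  exact h1.le

section Energy

variable {V H : Type*} [NormedAddCommGroup V] [NormedSpace ℝ V]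
  [NormedAddCommGroup H] [InnerProductSpace ℝ H]

/-- Continuity of translations in `L²`. -/
theorem exists_forall_integral_translate_le {v : ℝ → V} (hv : MemLp v 2 volume) {η : ℝ}
    (hη : 0 < η) : ∃ δ > 0, ∀ σ : ℝ, |σ| < δ → ∫ s, ‖v (s + σ) - v s‖ ^ 2 ≤ η := by
  have : Fact ((2 : ℝ≥0∞) ≠ ⊤) := ⟨by norm_num⟩
  set x := hv.toLp v
  have hc : Continuous fun σ : ℝ => (DomAddAct.mk σ +ᵥ x : Lp V 2 (volume : Measure ℝ)) :=
    (continuous_vadd (M := ℝᵈᵃᵃ) (X := Lp V 2 (volume : Measure ℝ))).comp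
      ((DomAddAct.mkHomeomorph.continuous).prodMk continuous_const)
  have h0 : (DomAddAct.mk (0 : ℝ) +ᵥ x : Lp V 2 (volume : Measure ℝ)) = x := by
    rw [DomAddAct.mk_zero, zero_vadd]
  obtain ⟨δ, hδ, H⟩ := Metric.continuous_iff.1 hc 0 (√η) (Real.sqrt_pos.2 hη)
  refine ⟨δ, hδ, fun σ hσ => ?_⟩
  have h1 := H σ (by rwa [Real.dist_eq, sub_zero])
  rw [h0, dist_eq_norm] at h1
  have hvσ : MemLp (fun s => v (s + σ)) 2 volume :=
    hv.comp_measurePreserving (measurePreserving_add_right volume σ)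
  have h2 : (fun s => v (s + σ) - v s) =ᵐ[volume]
      (((DomAddAct.mk σ +ᵥ x) - x : Lp V 2 (volume : Measure ℝ)) : ℝ → V) := by
    have e1 : (DomAddAct.mk σ +ᵥ x : Lp V 2 (volume : Measure ℝ)) =ᵐ[volume] fun s => v (s + σ) := by
      rw [DomAddAct.mk_vadd_toLp]
      refine (MemLp.coeFn_toLp _).trans (ae_of_all _ fun s => ?_)
      simp [add_comm]
    filter_upwards [Lp.coeFn_sub (DomAddAct.mk σ +ᵥ x : Lp V 2 (volume : Measure ℝ)) x, e1,
      hv.coeFn_toLp] with s a1 a2 a3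
    rw [a1, Pi.sub_apply, a2, a3]
  have h3 : ENNReal.ofReal (∫ s, ‖v (s + σ) - v s‖ ^ 2) ≤ ENNReal.ofReal η := by
    have hi : Integrable fun s => ‖v (s + σ) - v s‖ ^ 2 :=
      (hvσ.sub hv).integrable_norm_pow (by norm_num)
    rw [ofReal_integral_eq_lintegral_ofReal hi
      (ae_of_all _ fun _ => by positivity)]
    have e := norm_toLp_two_eq ((DomAddAct.mk σ +ᵥ x) - x : Lp V 2 (volume : Measure ℝ))
    have e2 : ∫⁻ s, ENNReal.ofReal (‖v (s + σ) - v s‖ ^ 2) =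
        ENNReal.ofReal ‖(DomAddAct.mk σ +ᵥ x) - x‖ ^ 2 := by
      rw [e, ← ENNReal.rpow_natCast, ← ENNReal.rpow_mul,
        show (1 / 2 : ℝ) * (2 : ℕ) = 1 by norm_num, ENNReal.rpow_one]
      refine lintegral_congr_ae (h2.mono fun s hs => ?_)
      dsimp only at hs ⊢
      rw [← hs, ENNReal.ofReal_pow (norm_nonneg _), ofReal_norm, ENNReal.rpow_two]
    rw [e2, ← ENNReal.ofReal_pow (norm_nonneg _)]
    refine ENNReal.ofReal_le_ofReal ?_
    rw [← Real.sq_sqrt hη.le]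
    exact pow_le_pow_left₀ (norm_nonneg _) h1.le 2
  exact (ENNReal.ofReal_le_ofReal_iff hη.le).1 h3

/-- The bound on functionals used in the energy identity. -/
def EnergyBound (ι : V →L[ℝ] H) (F : ℝ → StrongDual ℝ V) (g : ℝ → ℝ) : Prop :=
  ∀ M ε : ℝ, 0 < ε → ∃ C : ℝ, 0 ≤ C ∧ ∀ᵐ s : ℝ, ∀ w : V, ‖ι w‖ ≤ M →
    |F s w| ≤ ε * g s + C * ‖w‖ ^ 2

/-- Short averages of ‖ι v‖² approach ‖y‖² although v is close to y only weakly. For z with ι z near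
y, ‖ι v‖² - ‖y‖² is the sum of the products of ι v - y with ι v, with ι z and with y - ι z. The
first two are bounded by ∫|F τ (v s)| and ∫|F τ z| over the window, hence small after averaging by
`EnergyBound` and absolute continuity; the third is small by the choice of z. -/
theorem exists_forall_abs_average_sub_le {ι : V →L[ℝ] H} (hι : DenseRange ι)
    {F : ℝ → StrongDual ℝ V} {g : ℝ → ℝ} (hF : Integrable F) (hg : Integrable g)
    (hFg : EnergyBound ι F g) {v : ℝ → V} (hv : MemLp v 2 volume) {M : ℝ}
    (hM : ∀ᵐ s : ℝ, ‖ι (v s)‖ ≤ M) (y : H) {ε : ℝ} (hε : 0 < ε) :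
    ∃ δ > 0, ∀ c h : ℝ, 0 < h → h < δ →
      (∀ᵐ s ∂volume.restrict (Ioc c (c + h)), ∀ z, |inner ℝ (ι (v s) - y) (ι z)| ≤
        ∫ τ in c..(c + h), |F τ z|) →
      |h⁻¹ * (∫ s in c..(c + h), ‖ι (v s)‖ ^ 2) - ‖y‖ ^ 2| ≤ ε := by
  obtain ⟨C, hC0, hC⟩ := hFg M 1 one_pos
  have hM0 : 0 ≤ M := by
    obtain ⟨s, hs⟩ := hM.exists
    exact (norm_nonneg _).trans hs
  obtain ⟨z, hz⟩ := hι.exists_dist_lt y (ε := ε / (2 * (M + ‖y‖ + 1))) (by positivity)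
  have hz' : (M + ‖y‖) * ‖y - ι z‖ ≤ ε / 2 := by
    rw [dist_eq_norm, lt_div_iff₀ (by positivity)] at hz
    nlinarith [norm_nonneg (y - ι z), norm_nonneg y]
  have hv2 : Integrable fun s => ‖v s‖ ^ 2 := hv.integrable_norm_pow (by norm_num)
  set k : ℝ → ℝ := fun s => |g s| + C * ‖v s‖ ^ 2 + ‖z‖ * ‖F s‖ with hk
  have hki : Integrable k := (hg.abs.add (hv2.const_mul C)).add (hF.norm.const_mul _)
  obtain ⟨δ, hδ, H⟩ := exists_forall_setIntegral_Ioc_le hki (ε := ε / 2) (by positivity)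
  refine ⟨δ, hδ, fun c h h0 hh hy => ?_⟩
  have hch : c ≤ c + h := by linarith
  have ii : ∀ {f : ℝ → ℝ}, Integrable f → IntervalIntegrable f volume c (c + h) :=
    fun hf => hf.intervalIntegrable
  have hkle : ∫ s in c..(c + h), k s ≤ ε / 2 := by
    refine le_trans ?_ (H c h h0 hh)
    exact intervalIntegral.integral_mono hch (ii hki) (ii hki.abs) fun s => le_abs_self _
  have hksplit : ∫ s in c..(c + h), k s = (∫ s in c..(c + h), |g s|) +
      C * (∫ s in c..(c + h), ‖v s‖ ^ 2) + ‖z‖ * ∫ s in c..(c + h), ‖F s‖ := by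
    have i1 : Integrable fun s => |g s| + C * ‖v s‖ ^ 2 := hg.abs.add (hv2.const_mul C)
    simp only [hk]
    rw [intervalIntegral.integral_add (ii i1)
      (ii (hF.norm.const_mul _)), intervalIntegral.integral_add (ii hg.abs) (ii (hv2.const_mul C)),
      intervalIntegral.integral_const_mul, intervalIntegral.integral_const_mul]
  set A : ℝ := (∫ s in c..(c + h), |g s|) + ‖z‖ * ∫ s in c..(c + h), ‖F s‖
  have hFint : ∀ w : V, Integrable fun τ => F τ w := fun w => hF.apply_continuousLinearMap w
  have hpt : ∀ᵐ s ∂volume.restrict (Ioc c (c + h)),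
      ‖‖ι (v s)‖ ^ 2 - ‖y‖ ^ 2‖ ≤ (A + ε / 2) + h * C * ‖v s‖ ^ 2 := by
    filter_upwards [hy, ae_restrict_of_ae hM] with s hs hMs
    have b1 : ∫ τ in c..(c + h), |F τ (v s)| ≤ (∫ τ in c..(c + h), |g τ|) + h * C * ‖v s‖ ^ 2 := by
      have : ∫ τ in c..(c + h), |F τ (v s)| ≤ ∫ τ in c..(c + h), (|g τ| + C * ‖v s‖ ^ 2) := by
        refine intervalIntegral.integral_mono_ae hch (ii (hFint _).abs)
          ((ii hg.abs).add intervalIntegrable_const) ?_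
        filter_upwards [hC] with τ hτ
        have := hτ (v s) hMs
        rw [one_mul] at this
        exact this.trans (add_le_add_left (le_abs_self _) _)
      rw [intervalIntegral.integral_add (ii hg.abs) intervalIntegrable_const,
        intervalIntegral.integral_const, add_sub_cancel_left, smul_eq_mul] at this
      linarith
    have b2 : ∫ τ in c..(c + h), |F τ z| ≤ ‖z‖ * ∫ τ in c..(c + h), ‖F τ‖ := by
      rw [← intervalIntegral.integral_const_mul]
      refine intervalIntegral.integral_mono hch (ii (hFint _).abs) (ii (hF.norm.const_mul _))
        fun τ => ?_
      rw [mul_comm]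
      exact (F τ).le_opNorm z
    have b3 : |inner ℝ (ι (v s) - y) (y - ι z)| ≤ ε / 2 := by
      refine (abs_real_inner_le_norm _ _).trans (le_trans ?_ hz')
      refine mul_le_mul_of_nonneg_right ((norm_sub_le _ _).trans ?_) (norm_nonneg _)
      linarith
    have e : ‖ι (v s)‖ ^ 2 - ‖y‖ ^ 2 = inner ℝ (ι (v s) - y) (ι (v s)) +
        inner ℝ (ι (v s) - y) (ι z) + inner ℝ (ι (v s) - y) (y - ι z) := by
      rw [← real_inner_self_eq_norm_sq, ← real_inner_self_eq_norm_sq]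
      simp only [inner_sub_left, inner_sub_right, real_inner_comm y]
      ring
    rw [e]
    refine (norm_add₃_le).trans ?_
    have := hs (v s)
    have := hs z
    simp only [Real.norm_eq_abs]
    linarith
  have hq : Integrable (fun s => ‖ι (v s)‖ ^ 2) :=
    (ι.comp_memLp' hv).integrable_norm_pow (by norm_num)
  have e1 : h⁻¹ * (∫ s in c..(c + h), ‖ι (v s)‖ ^ 2) - ‖y‖ ^ 2 =
      h⁻¹ * ∫ s in c..(c + h), (‖ι (v s)‖ ^ 2 - ‖y‖ ^ 2) := by
    rw [intervalIntegral.integral_sub (ii hq) intervalIntegrable_const,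
      intervalIntegral.integral_const, add_sub_cancel_left, smul_eq_mul]
    field_simp
  have e2 : ‖∫ s in c..(c + h), (‖ι (v s)‖ ^ 2 - ‖y‖ ^ 2)‖ ≤
      ∫ s in c..(c + h), ((A + ε / 2) + h * C * ‖v s‖ ^ 2) := by
    rw [ae_restrict_iff' measurableSet_Ioc] at hpt
    exact intervalIntegral.norm_integral_le_of_norm_le hch hpt
      (intervalIntegrable_const.add ((ii hv2).const_mul _))
  rw [intervalIntegral.integral_add intervalIntegrable_const ((ii hv2).const_mul _),
    intervalIntegral.integral_const_mul, intervalIntegral.integral_const, add_sub_cancel_left,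
    smul_eq_mul, Real.norm_eq_abs] at e2
  rw [e1, abs_mul, abs_of_pos (inv_pos.2 h0), inv_mul_le_iff₀ h0]
  refine e2.trans ?_
  rw [mul_assoc, ← mul_add]
  refine mul_le_mul_of_nonneg_left ?_ h0.le
  linarith

/-- After exchanging the integrals, each σ in (0, h] is treated separately: v(s + h) + v(s) is 2v(s
+ σ) plus an error w(s). The main part is a translate of ∫ F(v). The error is small in L²(V) by
continuity of translations, and `EnergyBound` makes F(s + σ)(w(s)) small in L¹ without requiring F
to be square integrable. -/
theorem exists_forall_abs_quotient_sub_le {ι : V →L[ℝ] H}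
    {F : ℝ → StrongDual ℝ V} {g : ℝ → ℝ} (hF : Integrable F) (hg : Integrable g)
    (hFg : EnergyBound ι F g) {v : ℝ → V} (hv : MemLp v 2 volume) (hv1 : Integrable v) {M : ℝ}
    (hM : ∀ᵐ s : ℝ, ‖ι (v s)‖ ≤ M) {t : ℝ} (ht : 0 ≤ t) {ε : ℝ} (hε : 0 < ε) :
    ∃ δ > 0, ∀ h : ℝ, 0 < h → h < δ →
      |h⁻¹ * (∫ s in 0..t, ∫ σ in 0..h, F (s + σ) (v (s + h) + v s)) -
        2 * ∫ s in 0..t, F s (v s)| ≤ ε := by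
  set Γ : ℝ := ∫ s, |g s|
  have hΓ : 0 ≤ Γ := integral_nonneg fun _ => abs_nonneg _
  -- The error w is a signed sum of four values of v, so its norm in H is at most 4M; the factor
  -- 1/(4(Γ + 1)) makes the contribution of g at most ε/4.
  obtain ⟨C, hC0, hC⟩ := hFg (4 * M) (ε / (4 * (Γ + 1))) (by positivity)
  obtain ⟨C₁, -, hC₁⟩ := hFg M 1 one_pos
  have hv2 : Integrable fun s => ‖v s‖ ^ 2 := hv.integrable_norm_pow (by norm_num)
  set G : ℝ → ℝ := fun s => F s (v s)
  have hG : Integrable G := by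
    refine (hg.add (hv2.const_mul C₁)).mono' (aestronglyMeasurable_dual_apply hF.1 hv.1) ?_
    filter_upwards [hC₁, hM] with s h1 h2
    simpa using h1 (v s) h2
  -- From ‖w‖² ≤ 2‖·‖² + 2‖·‖² the squared norm of w integrates to at most four times this quantity,
  -- and C times that is at most ε/4.
  obtain ⟨δ₁, hδ₁, H₁⟩ := exists_forall_integral_translate_le hv (η := ε / (16 * (C + 1)))
    (by positivity)
  obtain ⟨δ₂, hδ₂, H₂⟩ := exists_forall_setIntegral_Ioc_le hG (ε := ε / 8) (by positivity)
  refine ⟨min δ₁ δ₂, lt_min hδ₁ hδ₂, fun h h0 hh => ?_⟩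
  have hh1 : h < δ₁ := hh.trans_le (min_le_left _ _)
  have hh2 : h < δ₂ := hh.trans_le (min_le_right _ _)
  have mp : ∀ σ : ℝ, MeasurePreserving (fun s : ℝ => s + σ) volume volume :=
    fun σ => measurePreserving_add_right volume σ
  have vtr : ∀ σ, MemLp (fun s => v (s + σ)) 2 volume := fun σ => hv.comp_measurePreserving (mp σ)
  have hΘ : Integrable (Function.uncurry fun s σ : ℝ => F (s + σ) (v (s + h) + v s))
      (volume.prod volume) := by
    have hw : Integrable fun s => v (s + h) + v s := (hv1.comp_add_right h).add hv1
    have h1 : Integrable (fun p : ℝ × ℝ => F p.2 (v (p.1 + h) + v p.1)) (volume.prod volume) := by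
      refine (hw.norm.mul_prod hF.norm).mono'
        (aestronglyMeasurable_dual_apply hF.1.comp_snd hw.1.comp_fst) (ae_of_all _ fun p => ?_)
      rw [mul_comm]
      exact (F p.2).le_opNorm _
    -- The shear (s, σ) ↦ (s, s + σ) preserves Lebesgue measure and separates the variables of F and
    -- v.
    exact (measurePreserving_prod_add volume volume).integrable_comp_of_integrable h1
  have hΘ' : Integrable (Function.uncurry fun s σ : ℝ => F (s + σ) (v (s + h) + v s))
      ((volume.restrict (Ioc 0 t)).prod (volume.restrict (Ioc 0 h))) := by
    rw [Measure.prod_restrict]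
    exact hΘ.integrableOn
  have hswap : ∫ s in 0..t, ∫ σ in 0..h, F (s + σ) (v (s + h) + v s) =
      ∫ σ in 0..h, ∫ s in 0..t, F (s + σ) (v (s + h) + v s) := by
    simp only [intervalIntegral.integral_of_le ht, intervalIntegral.integral_of_le h0.le]
    exact integral_integral_swap hΘ'
  have hX : IntervalIntegrable (fun σ => ∫ s in 0..t, F (s + σ) (v (s + h) + v s)) volume 0 h := by
    rw [intervalIntegrable_iff_integrableOn_Ioc_of_le h0.le]
    simp only [intervalIntegral.integral_of_le ht]
    exact hΘ'.integral_prod_right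
  have key : ∀ σ ∈ Ioc 0 h, |(∫ s in 0..t, F (s + σ) (v (s + h) + v s)) -
      2 * ∫ s in 0..t, G s| ≤ ε := by
    intro σ hσ
    set w : ℝ → V := fun s => (v (s + h) - v (s + σ)) + (v s - v (s + σ))
    have hwm : MemLp w 2 volume := ((vtr h).sub (vtr σ)).add (hv.sub (vtr σ))
    have hdom : Integrable fun s => ε / (4 * (Γ + 1)) * |g (s + σ)| + C * ‖w s‖ ^ 2 :=
      ((hg.comp_add_right σ).abs.const_mul _).add ((hwm.integrable_norm_pow (by norm_num)).const_mul C)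
    have hbd : ∀ᵐ s, ‖F (s + σ) (w s)‖ ≤ ε / (4 * (Γ + 1)) * |g (s + σ)| + C * ‖w s‖ ^ 2 := by
      filter_upwards [(mp σ).quasiMeasurePreserving.ae hC, (mp σ).quasiMeasurePreserving.ae hM,
        (mp h).quasiMeasurePreserving.ae hM, hM] with s a1 a2 a3 a4
      refine (a1 (w s) ?_).trans (by gcongr; exact le_abs_self _)
      simp only [w, map_add, map_sub]
      have n1 := norm_sub_le (ι (v (s + h))) (ι (v (s + σ)))
      have n2 := norm_sub_le (ι (v s)) (ι (v (s + σ)))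
      refine (norm_add_le _ _).trans ?_
      linarith
    have hFw : Integrable fun s => F (s + σ) (w s) :=
      hdom.mono' (aestronglyMeasurable_dual_apply
        (hF.1.comp_measurePreserving (mp σ)) hwm.1) hbd
    have hGσ : Integrable fun s => G (s + σ) := hG.comp_add_right σ
    have e1 : ∫ s in 0..t, F (s + σ) (v (s + h) + v s) =
        (∫ s in 0..t, F (s + σ) (w s)) + 2 * ∫ s in 0..t, G (s + σ) := by
      rw [← intervalIntegral.integral_const_mul,
        ← intervalIntegral.integral_add hFw.intervalIntegrable (hGσ.intervalIntegrable.const_mul 2)]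
      refine intervalIntegral.integral_congr fun s _ => ?_
      simp only [w, G, map_add, map_sub]
      ring
    have b1 : |∫ s in 0..t, F (s + σ) (w s)| ≤ ε / 2 := by
      have i1 : ∫ s, ‖w s‖ ^ 2 ≤ ε / (4 * (C + 1)) := by
        have j1 : ∫ s, ‖v (s + h) - v (s + σ)‖ ^ 2 ≤ ε / (16 * (C + 1)) := by
          refine le_trans (le_of_eq ?_) (H₁ (h - σ) ?_)
          · rw [← integral_add_right_eq_self (fun s => ‖v (s + (h - σ)) - v s‖ ^ 2) σ]
            refine integral_congr_ae (ae_of_all _ fun s => ?_)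
            simp only
            congr 3
            ring_nf
          · rw [abs_of_nonneg (by linarith [hσ.2])]
            linarith [hσ.1]
        have j2 : ∫ s, ‖v s - v (s + σ)‖ ^ 2 ≤ ε / (16 * (C + 1)) := by
          have e (s : ℝ) : ‖v s - v (s + σ)‖ = ‖v (s + σ) - v s‖ := norm_sub_rev _ _
          simp only [e]
          exact H₁ σ (by rw [abs_of_pos hσ.1]; linarith [hσ.2])
        have k1 : Integrable fun s => ‖v (s + h) - v (s + σ)‖ ^ 2 :=
          ((vtr h).sub (vtr σ)).integrable_norm_pow (by norm_num)
        have k2 : Integrable fun s => ‖v s - v (s + σ)‖ ^ 2 :=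
          (hv.sub (vtr σ)).integrable_norm_pow (by norm_num)
        have : ∫ s, ‖w s‖ ^ 2 ≤ ∫ s, (2 * ‖v (s + h) - v (s + σ)‖ ^ 2 +
            2 * ‖v s - v (s + σ)‖ ^ 2) := by
          refine integral_mono (hwm.integrable_norm_pow (by norm_num))
            ((k1.const_mul 2).add (k2.const_mul 2)) fun s => ?_
          have := norm_add_le (v (s + h) - v (s + σ)) (v s - v (s + σ))
          have n0 := norm_nonneg (w s)
          simp only [w] at n0 ⊢
          nlinarith [sq_nonneg (‖v (s + h) - v (s + σ)‖ - ‖v s - v (s + σ)‖)]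
        rw [integral_add (k1.const_mul 2) (k2.const_mul 2), integral_const_mul,
          integral_const_mul] at this
        have e : ε / (4 * (C + 1)) = 4 * (ε / (16 * (C + 1))) := by field_simp; norm_num
        linarith
      rw [intervalIntegral.integral_of_le ht, ← Real.norm_eq_abs]
      refine (norm_integral_le_of_norm_le hdom.integrableOn (ae_restrict_of_ae hbd)).trans ?_
      refine (setIntegral_le_integral hdom (ae_of_all _ fun s => by positivity)).trans ?_
      rw [integral_add ((hg.comp_add_right σ).abs.const_mul _)
        ((hwm.integrable_norm_pow (by norm_num)).const_mul C), integral_const_mul,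
        integral_const_mul, integral_add_right_eq_self (fun s => |g s|) σ]
      have i2 : ε / (4 * (Γ + 1)) * Γ ≤ ε / 4 := by
        rw [div_mul_eq_mul_div, div_le_div_iff₀ (by positivity) (by norm_num)]
        nlinarith
      have i3 : C * ∫ s, ‖w s‖ ^ 2 ≤ ε / 4 := by
        refine (mul_le_mul_of_nonneg_left i1 hC0).trans ?_
        rw [mul_div_assoc', div_le_div_iff₀ (by positivity) (by norm_num)]
        nlinarith
      linarith
    have b2 : |(∫ s in 0..t, G (s + σ)) - ∫ s in 0..t, G s| ≤ ε / 4 := by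
      have hi : ∀ a b : ℝ, IntervalIntegrable G volume a b := fun a b => hG.intervalIntegrable
      have a1 := intervalIntegral.integral_add_adjacent_intervals (hi 0 σ) (hi σ (t + σ))
      have a2 := intervalIntegral.integral_add_adjacent_intervals (hi 0 t) (hi t (t + σ))
      have a3 := H₂ 0 σ hσ.1 (hσ.2.trans_lt hh2)
      have a4 := H₂ t σ hσ.1 (hσ.2.trans_lt hh2)
      have a5 := intervalIntegral.abs_integral_le_integral_abs (f := G) (μ := volume)
        (by linarith [hσ.1] : (0 : ℝ) ≤ 0 + σ)
      have a6 := intervalIntegral.abs_integral_le_integral_abs (f := G) (μ := volume)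
        (by linarith [hσ.1] : t ≤ t + σ)
      rw [zero_add] at a3 a5
      rw [intervalIntegral.integral_comp_add_right, zero_add]
      have a7 := abs_le.1 (a5.trans a3)
      have a8 := abs_le.1 (a6.trans a4)
      rw [abs_le]
      constructor <;> linarith [a7.1, a7.2, a8.1, a8.2]
    rw [e1]
    rw [abs_le] at b1 b2 ⊢
    constructor <;> linarith [b1.1, b1.2, b2.1, b2.2]
  have e2 : h⁻¹ * (∫ s in 0..t, ∫ σ in 0..h, F (s + σ) (v (s + h) + v s)) -
      2 * ∫ s in 0..t, G s = h⁻¹ * ∫ σ in 0..h,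
        ((∫ s in 0..t, F (s + σ) (v (s + h) + v s)) - 2 * ∫ s in 0..t, G s) := by
    rw [hswap, intervalIntegral.integral_sub hX intervalIntegrable_const,
      intervalIntegral.integral_const, sub_zero, smul_eq_mul]
    field_simp
  have e3 := intervalIntegral.norm_integral_le_of_norm_le_const (a := 0) (b := h) (C := ε)
    (f := fun σ => (∫ s in 0..t, F (s + σ) (v (s + h) + v s)) - 2 * ∫ s in 0..t, G s)
    (fun σ hσ => key σ (by rwa [uIoc_of_le h0.le] at hσ))
  rw [sub_zero, abs_of_pos h0, Real.norm_eq_abs] at e3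
  rw [e2, abs_mul, abs_of_pos (inv_pos.2 h0), inv_mul_le_iff₀ h0, mul_comm h]
  exact e3

end Energy

end CBF

/-! ### The energy identity. -/

namespace CBF

section EnergyIdentity

variable {V H : Type*} [NormedAddCommGroup V] [NormedSpace ℝ V]
  [NormedAddCommGroup H] [InnerProductSpace ℝ H]

/-- F in L¹(V') and v in L²(V) alone would not make F(v) integrable; the bound with ε = 1 and w =
v(s) does. -/
theorem EnergyBound.integrable_apply {ι : V →L[ℝ] H} {F : ℝ → StrongDual ℝ V} {g : ℝ → ℝ}
    (hFg : EnergyBound ι F g) (hF : Integrable F) (hg : Integrable g) {v : ℝ → V}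
    (hv : MemLp v 2 volume) {M : ℝ} (hM : ∀ᵐ s : ℝ, ‖ι (v s)‖ ≤ M) :
    Integrable fun s => F s (v s) := by
  obtain ⟨C₁, -, hC₁⟩ := hFg M 1 one_pos
  have hv2 : Integrable fun s => ‖v s‖ ^ 2 := hv.integrable_norm_pow (by norm_num)
  refine (hg.add (hv2.const_mul C₁)).mono' (aestronglyMeasurable_dual_apply hF.1 hv.1) ?_
  filter_upwards [hC₁, hM] with s h1 h2
  simpa using h1 (v s) h2

theorem abs_inner_sub_le_integral {ι : V →L[ℝ] H} {F : ℝ → StrongDual ℝ V} (hF : Integrable F)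
    {a b c h : ℝ} (ha : a ∈ Icc c (c + h)) (hb : b ∈ Icc c (c + h)) {x y u₀ : H}
    (hx : ∀ z, inner ℝ x (ι z) = inner ℝ u₀ (ι z) + ∫ τ in 0..a, F τ z)
    (hy : ∀ z, inner ℝ y (ι z) = inner ℝ u₀ (ι z) + ∫ τ in 0..b, F τ z) (z : V) :
    |inner ℝ (x - y) (ι z)| ≤ ∫ τ in c..(c + h), |F τ z| := by
  have hFz : Integrable fun τ => F τ z := hF.apply_continuousLinearMap z
  have i : ∀ a b : ℝ, IntervalIntegrable (fun τ => F τ z) volume a b :=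
    fun a b => hFz.intervalIntegrable
  rw [inner_sub_left, hx, hy, add_sub_add_left_eq_sub,
    intervalIntegral.integral_interval_sub_left (i _ _) (i _ _), ← Real.norm_eq_abs]
  refine intervalIntegral.norm_integral_le_integral_norm_uIoc.trans ?_
  rw [intervalIntegral.integral_of_le (ha.1.trans ha.2)]
  refine setIntegral_mono_set hFz.abs.integrableOn (ae_of_all _ fun _ => abs_nonneg _)
    (LE.le.eventuallyLE ?_)
  exact Ioc_subset_Ioc (le_min hb.1 ha.1) (max_le hb.2 ha.2)

/-- The energy identity at times before the end of the interval. -/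
theorem norm_sq_eq_add_integral_of_lt {ι : V →L[ℝ] H} (hι : DenseRange ι)
    {F : ℝ → StrongDual ℝ V} {g : ℝ → ℝ} (hF : Integrable F) (hg : Integrable g)
    (hFg : EnergyBound ι F g) {v : ℝ → V} (hv : MemLp v 2 volume) (hv1 : Integrable v) {M : ℝ}
    (hM : ∀ᵐ s : ℝ, ‖ι (v s)‖ ≤ M) {T : ℝ} {u₀ : H}
    (hvF : ∀ᵐ s ∂timeMeasure T, ∀ z, inner ℝ (ι (v s)) (ι z) =
      inner ℝ u₀ (ι z) + ∫ τ in 0..s, F τ z)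
    {t : ℝ} (ht : t ∈ Ico 0 T) {y : H}
    (hy : ∀ z, inner ℝ y (ι z) = inner ℝ u₀ (ι z) + ∫ τ in 0..t, F τ z) :
    ‖y‖ ^ 2 = ‖u₀‖ ^ 2 + 2 * ∫ s in 0..t, F s (v s) := by
  have hy0 : ∀ z, inner ℝ u₀ (ι z) = inner ℝ u₀ (ι z) + ∫ τ in (0 : ℝ)..0, F τ z := by simp
  have hq : Integrable (fun s => ‖ι (v s)‖ ^ 2) :=
    (ι.comp_memLp' hv).integrable_norm_pow (by norm_num)
  have iq : ∀ a b : ℝ, IntervalIntegrable (fun s => ‖ι (v s)‖ ^ 2) volume a b :=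
    fun a b => hq.intervalIntegrable
  rw [ae_restrict_iff' measurableSet_Ioo] at hvF
  refine eq_of_forall_dist_le fun ε hε => ?_
  obtain ⟨δ₁, hδ₁, H₁⟩ := exists_forall_abs_average_sub_le hι hF hg hFg hv hM u₀
    (ε := ε / 3) (by positivity)
  obtain ⟨δ₂, hδ₂, H₂⟩ := exists_forall_abs_average_sub_le hι hF hg hFg hv hM y
    (ε := ε / 3) (by positivity)
  obtain ⟨δ₃, hδ₃, H₃⟩ := exists_forall_abs_quotient_sub_le hF hg hFg hv hv1 hM ht.1
    (ε := ε / 3) (by positivity)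
  obtain ⟨h, h0, hh⟩ := exists_between (lt_min (lt_min hδ₁ hδ₂) (lt_min hδ₃ (sub_pos.2 ht.2)))
  simp only [lt_min_iff] at hh
  obtain ⟨⟨hh1, hh2⟩, hh3, hh4⟩ := hh
  have avg : ∀ c ∈ Icc 0 t, ∀ x : H,
      (∀ z, inner ℝ x (ι z) = inner ℝ u₀ (ι z) + ∫ τ in 0..c, F τ z) →
      ∀ᵐ s ∂volume.restrict (Ioc c (c + h)), ∀ z, |inner ℝ (ι (v s) - x) (ι z)| ≤
        ∫ τ in c..(c + h), |F τ z| := by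
    intro c hc x hx
    rw [ae_restrict_iff' measurableSet_Ioc]
    filter_upwards [hvF] with s hs hsI
    exact abs_inner_sub_le_integral hF (Ioc_subset_Icc_self hsI) ⟨le_rfl, by linarith⟩
      (hs ⟨hc.1.trans_lt hsI.1, hsI.2.trans_lt (by linarith [hc.2])⟩) hx
  have k1 := H₁ 0 h h0 hh1 (avg 0 ⟨le_rfl, ht.1⟩ u₀ hy0)
  have k2 := H₂ t h h0 hh2 (avg t ⟨ht.1, le_rfl⟩ y hy)
  have k3 := H₃ h h0 hh3
  have hvF' : ∀ᵐ s : ℝ, s + h ∈ Ioo 0 T → ∀ z, inner ℝ (ι (v (s + h))) (ι z) =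
      inner ℝ u₀ (ι z) + ∫ τ in 0..(s + h), F τ z :=
    (measurePreserving_add_right volume h).quasiMeasurePreserving.ae hvF
  -- The difference of squares is the product of ι v(s + h) - ι v(s) with ι(v(s + h) + v(s)), and
  -- the increment of v is the integral of F over [s, s + h]. The condition h < T - t keeps s + h
  -- inside the interval.
  have e1 : ∫ s in 0..t, (‖ι (v (s + h))‖ ^ 2 - ‖ι (v s)‖ ^ 2) =
      ∫ s in 0..t, ∫ σ in 0..h, F (s + σ) (v (s + h) + v s) := by
    refine intervalIntegral.integral_congr_ae ?_
    filter_upwards [hvF, hvF'] with s a1 a2 hs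
    rw [uIoc_of_le ht.1] at hs
    have b1 := a1 ⟨hs.1, hs.2.trans_lt ht.2⟩ (v (s + h) + v s)
    have b2 := a2 ⟨by linarith [hs.1], by linarith [hs.2]⟩ (v (s + h) + v s)
    have i : ∀ a b : ℝ, IntervalIntegrable (fun τ => F τ (v (s + h) + v s)) volume a b :=
      fun a b => (hF.apply_continuousLinearMap _).intervalIntegrable
    have b3 := intervalIntegral.integral_interval_sub_left (i 0 (s + h)) (i 0 s)
    have b4 := intervalIntegral.integral_comp_add_left (a := 0) (b := h)
      (fun τ => F τ (v (s + h) + v s)) s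
    rw [add_zero] at b4
    rw [b4, ← b3, ← real_inner_self_eq_norm_sq, ← real_inner_self_eq_norm_sq]
    rw [map_add, inner_add_right] at b1 b2
    have c := real_inner_comm (ι (v s)) (ι (v (s + h)))
    linarith
  -- The shifted integrals cancel except over the windows after t and after 0; divided by h these
  -- are averages tending to ‖y‖² and ‖u₀‖².
  have e2 : ∫ s in 0..t, (‖ι (v (s + h))‖ ^ 2 - ‖ι (v s)‖ ^ 2) =
      (∫ s in t..(t + h), ‖ι (v s)‖ ^ 2) - ∫ s in 0..(0 + h), ‖ι (v s)‖ ^ 2 := by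
    rw [intervalIntegral.integral_sub (hq.comp_add_right h).intervalIntegrable (iq _ _),
      intervalIntegral.integral_comp_add_right (fun s => ‖ι (v s)‖ ^ 2) h]
    have j1 := intervalIntegral.integral_add_adjacent_intervals (iq 0 t) (iq t (t + h))
    have j2 := intervalIntegral.integral_add_adjacent_intervals (iq 0 (0 + h)) (iq (0 + h) (t + h))
    linarith
  rw [← e1, e2, mul_sub] at k3
  rw [Real.dist_eq]
  rw [abs_le] at k1 k2 k3 ⊢
  constructor <;> linarith [k1.1, k1.2, k2.1, k2.2, k3.1, k3.2]

/-- The energy identity. -/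
theorem norm_sq_eq_add_integral {ι : V →L[ℝ] H} (hι : DenseRange ι)
    {F : ℝ → StrongDual ℝ V} {g : ℝ → ℝ} (hF : Integrable F) (hg : Integrable g)
    (hFg : EnergyBound ι F g) {v : ℝ → V} (hv : MemLp v 2 volume) (hv1 : Integrable v) {M : ℝ}
    (hM : ∀ᵐ s : ℝ, ‖ι (v s)‖ ≤ M) {T : ℝ} (hT : 0 < T) {u₀ : H}
    (hvF : ∀ᵐ s ∂timeMeasure T, ∀ z, inner ℝ (ι (v s)) (ι z) =
      inner ℝ u₀ (ι z) + ∫ τ in 0..s, F τ z)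
    {t : ℝ} (ht : t ∈ Icc 0 T) {y : H}
    (hy : ∀ z, inner ℝ y (ι z) = inner ℝ u₀ (ι z) + ∫ τ in 0..t, F τ z) :
    ‖y‖ ^ 2 = ‖u₀‖ ^ 2 + 2 * ∫ s in 0..t, F s (v s) := by
  rcases ht.2.lt_or_eq with htT | rfl
  · exact norm_sq_eq_add_integral_of_lt hι hF hg hFg hv hv1 hM hvF ⟨ht.1, htT⟩ hy
  have hG := hFg.integrable_apply hF hg hv hM
  set E : ℝ → ℝ := fun τ => ‖u₀‖ ^ 2 + 2 * ∫ s in 0..τ, F s (v s)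
  have hE : Continuous E := continuous_const.add (continuous_const.mul
    (intervalIntegral.continuous_primitive (fun a b => hG.intervalIntegrable) 0))
  have hEv : ∀ᵐ s ∂timeMeasure t, ‖ι (v s)‖ ^ 2 = E s := by
    filter_upwards [hvF, ae_restrict_mem measurableSet_Ioo] with s hs hsI
    exact norm_sq_eq_add_integral_of_lt hι hF hg hFg hv hv1 hM hvF ⟨hsI.1.le, hsI.2⟩ hs
  refine eq_of_forall_dist_le fun ε hε => ?_
  -- At the final time there is no room to the right. The window (t - h, t] is used instead: there
  -- the identity at earlier times replaces ‖ι v‖² by the continuous function E, while the averages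
  -- tend to ‖y‖².
  obtain ⟨δ₁, hδ₁, H₁⟩ := exists_forall_abs_average_sub_le hι hF hg hFg hv hM y
    (ε := ε / 2) (by positivity)
  obtain ⟨δ₂, hδ₂, H₂⟩ := Metric.continuous_iff.1 hE t (ε / 2) (by positivity)
  obtain ⟨h, h0, hh⟩ := exists_between (lt_min (lt_min hδ₁ hδ₂) hT)
  simp only [lt_min_iff] at hh
  obtain ⟨⟨hh1, hh2⟩, hh3⟩ := hh
  rw [ae_restrict_iff' measurableSet_Ioo] at hvF hEv
  have hne : ∀ᵐ s : ℝ, s ≠ t := by simp [ae_iff]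
  have k1 := H₁ (t - h) h h0 hh1 (by
    rw [ae_restrict_iff' measurableSet_Ioc]
    filter_upwards [hvF, hne] with s hs hst hsI
    have hst' : s < t := lt_of_le_of_ne (by linarith [hsI.2]) hst
    exact abs_inner_sub_le_integral hF (Ioc_subset_Icc_self hsI)
      ⟨by linarith, by linarith⟩ (hs ⟨by linarith [hsI.1], hst'⟩) hy)
  rw [sub_add_cancel] at k1
  have e1 : ∫ s in (t - h)..t, ‖ι (v s)‖ ^ 2 = ∫ s in (t - h)..t, E s := by
    refine intervalIntegral.integral_congr_ae ?_
    filter_upwards [hEv, hne] with s hs hst hsI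
    rw [uIoc_of_le (by linarith)] at hsI
    exact hs ⟨by linarith [hsI.1], lt_of_le_of_ne hsI.2 hst⟩
  have e2 : h⁻¹ * (∫ s in (t - h)..t, E s) - E t = h⁻¹ * ∫ s in (t - h)..t, (E s - E t) := by
    rw [intervalIntegral.integral_sub (hE.intervalIntegrable _ _) intervalIntegrable_const,
      intervalIntegral.integral_const, sub_sub_cancel, smul_eq_mul]
    field_simp
  have k2 : |h⁻¹ * (∫ s in (t - h)..t, E s) - E t| ≤ ε / 2 := by
    rw [e2, abs_mul, abs_of_pos (inv_pos.2 h0), inv_mul_le_iff₀ h0]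
    have := intervalIntegral.norm_integral_le_of_norm_le_const (a := t - h) (b := t) (C := ε / 2)
      (f := fun s => E s - E t) (fun s hs => by
        rw [uIoc_of_le (by linarith)] at hs
        rw [← dist_eq_norm]
        refine (H₂ s ?_).le
        rw [Real.dist_eq, abs_lt]
        constructor <;> linarith [hs.1, hs.2])
    rw [sub_sub_cancel, abs_of_pos h0, Real.norm_eq_abs] at this
    linarith
  rw [e1] at k1
  rw [Real.dist_eq]
  change |‖y‖ ^ 2 - E t| ≤ ε
  rw [abs_le] at k1 k2 ⊢
  constructor <;> linarith [k1.1, k1.2, k2.1, k2.2]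

theorem intervalIntegral_indicator_Ioo {E : Type*} [NormedAddCommGroup E] [NormedSpace ℝ E]
    {T t : ℝ} (ht : t ∈ Icc 0 T) (f : ℝ → E) :
    ∫ s in 0..t, (Ioo 0 T).indicator f s = ∫ s in 0..t, f s := by
  refine intervalIntegral.integral_congr_ae ?_
  have hne : ∀ᵐ s : ℝ, s ≠ T := by simp [ae_iff]
  filter_upwards [hne] with s hs hsI
  rw [uIoc_of_le ht.1] at hsI
  have hsT : s ∈ Ioo 0 T := ⟨hsI.1, lt_of_le_of_ne (hsI.2.trans ht.2) hs⟩
  exact indicator_of_mem hsT f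

theorem integrable_indicator_Ioo {E : Type*} [NormedAddCommGroup E] {T : ℝ} {f : ℝ → E}
    (hf : Integrable f (timeMeasure T)) : Integrable ((Ioo 0 T).indicator f) :=
  (integrable_indicator_iff measurableSet_Ioo).2 hf

/-- The energy identity for functions on a time interval. -/
theorem norm_sq_eq_add_integral_timeMeasure {ι : V →L[ℝ] H} (hι : DenseRange ι) {T : ℝ}
    (hT : 0 < T) {F : ℝ → StrongDual ℝ V} {g : ℝ → ℝ} (hF : Integrable F (timeMeasure T))
    (hg : Integrable g (timeMeasure T))
    (hFg : ∀ M ε : ℝ, 0 < ε → ∃ C : ℝ, 0 ≤ C ∧ ∀ᵐ s ∂timeMeasure T, ∀ w : V, ‖ι w‖ ≤ M →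
      |F s w| ≤ ε * g s + C * ‖w‖ ^ 2)
    {v : ℝ → V} (hv : MemLp v 2 (timeMeasure T)) {M : ℝ}
    (hM : ∀ᵐ s ∂timeMeasure T, ‖ι (v s)‖ ≤ M) {u₀ : H}
    (hvF : ∀ᵐ s ∂timeMeasure T, ∀ z, inner ℝ (ι (v s)) (ι z) =
      inner ℝ u₀ (ι z) + ∫ τ in 0..s, F τ z)
    {t : ℝ} (ht : t ∈ Icc 0 T) {y : H}
    (hy : ∀ z, inner ℝ y (ι z) = inner ℝ u₀ (ι z) + ∫ τ in 0..t, F τ z) :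
    ‖y‖ ^ 2 = ‖u₀‖ ^ 2 + 2 * ∫ s in 0..t, F s (v s) := by
  have hI : MeasurableSet (Ioo 0 T) := measurableSet_Ioo
  have hFz : ∀ (z : V) (s : ℝ), (Ioo 0 T).indicator F s z =
      (Ioo 0 T).indicator (fun τ => F τ z) s := by
    intro z s
    by_cases hs : s ∈ Ioo 0 T <;> simp [hs]
  have hFz' : ∀ z : V, ∀ s ∈ Icc 0 T, ∫ τ in 0..s, (Ioo 0 T).indicator F τ z =
      ∫ τ in 0..s, F τ z := by
    intro z s hs
    simp only [hFz]
    exact intervalIntegral_indicator_Ioo hs _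
  have iF : Integrable ((Ioo 0 T).indicator F) :=
    integrable_indicator_Ioo hF
  have ig : Integrable ((Ioo 0 T).indicator g) :=
    integrable_indicator_Ioo hg
  have iv : MemLp ((Ioo 0 T).indicator v) 2 volume := (memLp_indicator_iff_restrict hI).2 hv
  have iv1 : Integrable ((Ioo 0 T).indicator v) :=
    integrable_indicator_Ioo (hv.integrable (by norm_num))
  have hb : EnergyBound ι ((Ioo 0 T).indicator F) ((Ioo 0 T).indicator g) := by
    intro M ε hε
    obtain ⟨C, hC0, hC⟩ := hFg M ε hε
    rw [ae_restrict_iff' hI] at hC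
    refine ⟨C, hC0, ?_⟩
    filter_upwards [hC] with s hs w hw
    by_cases hsI : s ∈ Ioo 0 T
    · rw [indicator_of_mem hsI, indicator_of_mem hsI]
      exact hs hsI w hw
    · rw [indicator_of_notMem hsI, indicator_of_notMem hsI, zero_apply,
        abs_zero, mul_zero, zero_add]
      positivity
  have hM' : ∀ᵐ s : ℝ, ‖ι ((Ioo 0 T).indicator v s)‖ ≤ max M 0 := by
    rw [ae_restrict_iff' hI] at hM
    filter_upwards [hM] with s hs
    by_cases hsI : s ∈ Ioo 0 T
    · rw [indicator_of_mem hsI]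
      exact (hs hsI).trans (le_max_left _ _)
    · simp [indicator_of_notMem hsI]
  have hv' : ∀ᵐ s ∂timeMeasure T, ∀ z, inner ℝ (ι ((Ioo 0 T).indicator v s)) (ι z) =
      inner ℝ u₀ (ι z) + ∫ τ in 0..s, (Ioo 0 T).indicator F τ z := by
    filter_upwards [hvF, ae_restrict_mem hI] with s hs hsI z
    rw [indicator_of_mem hsI, hFz' z s (Ioo_subset_Icc_self hsI), hs z]
  rw [norm_sq_eq_add_integral hι iF ig hb iv iv1 hM' hT hv' ht
      (fun z => by rw [hFz' z t ht, hy z]),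
    ← intervalIntegral_indicator_Ioo ht fun s => F s (v s)]
  congr 2
  refine intervalIntegral.integral_congr fun s _ => ?_
  by_cases hs : s ∈ Ioo 0 T <;> simp [hs]

end EnergyIdentity

end CBF

/-! ### Space-time test fields as C¹ curves in V. -/

namespace CBF

variable {d : ℕ} {O : Set (Vec d)}

instance : TopologicalSpace.SeparableSpace (VSpace O) := by
  have : Fact ((2 : ℝ≥0∞) ≠ ⊤) := ⟨by norm_num⟩
  have : SecondCountableTopology (Lp (Vec d) 2 (volOn O)) := inferInstance
  have : SecondCountableTopology (Lp (Mat d) 2 (volOn O)) := inferInstance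
  have h : SecondCountableTopology (H1Pair O) :=
    (WithLp.homeomorphProd 2 _ _).secondCountableTopology
  have : SecondCountableTopology (VSubmodule O) := inferInstance
  exact inferInstanceAs (TopologicalSpace.SeparableSpace (VSubmodule O))

/-- A countable family of test fields which is dense in `V`. -/
theorem exists_denseRange_testToV : ∃ φ : ℕ → divFreeTest O,
    DenseRange fun n => testToV (φ n) := by
  have : SecondCountableTopology (VSpace O) := UniformSpace.secondCountable_of_separable _
  have : Nonempty (range (testToV (O := O))) := ⟨⟨_, 0, rfl⟩⟩
  obtain ⟨x, hx⟩ := TopologicalSpace.exists_dense_seq (range (testToV (O := O)))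
  choose φ hφ using fun n => (x n).2
  refine ⟨φ, ?_⟩
  simp only [hφ]
  exact (denseRange_testToV.denseRange_val).comp hx continuous_subtype_val

theorem testToV_smul (c : ℝ) (φ : divFreeTest O) : testToV (c • φ) = c • testToV φ :=
  Subtype.ext (map_smul (testToPair O) c φ)

theorem testToV_sub (φ ψ : divFreeTest O) : testToV (φ - ψ) = testToV φ - testToV ψ :=
  Subtype.ext (map_sub (testToPair O) φ ψ)

theorem embV_testToV (φ : divFreeTest O) : embV (testToV φ) = testToH φ := rfl

/-- The gradient as a linear image of the derivative. -/
def gradOfFDeriv (d : ℕ) : (Vec d →L[ℝ] Vec d) →L[ℝ] Mat d :=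
  LinearMap.toContinuousLinearMap
    { toFun := fun L => WithLp.toLp 2 fun ij => L (EuclideanSpace.single ij.1 1) ij.2
      map_add' := fun _ _ => rfl
      map_smul' := fun _ _ => rfl }

theorem classicalGrad_eq (φ : Vec d → Vec d) (x : Vec d) :
    classicalGrad φ x = gradOfFDeriv d (fderiv ℝ φ x) := rfl

/-- On a bounded domain uniform bounds on a field and its derivative bound the norm of V, so uniform
Taylor estimates become differentiability in V. -/
theorem exists_norm_testToV_le [h : Admissible O] : ∃ C : ℝ, 0 ≤ C ∧ ∀ (φ : divFreeTest O) (a : ℝ),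
    0 ≤ a → (∀ x, ‖(φ : Vec d → Vec d) x‖ ≤ a) →
    (∀ x, ‖fderiv ℝ (φ : Vec d → Vec d) x‖ ≤ a) → ‖testToV φ‖ ≤ C * a := by
  set m : ℝ := (measureUnivNNReal (volOn O) : ℝ) ^ ((2 : ℝ≥0∞).toReal)⁻¹
  have hm : 0 ≤ m := by positivity
  set K := ‖gradOfFDeriv d‖
  refine ⟨m + m * K, by positivity, fun φ a ha h1 h2 => ?_⟩
  have e1 : ‖embV (testToV φ)‖ ≤ m * a := by
    refine Lp.norm_le_of_ae_bound (f := (embV (testToV φ)).toL2) ha ?_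
    filter_upwards [coeFn_testToV φ] with x hx
    exact (congrArg norm hx).trans_le (h1 x)
  have e2 : ‖gradV (testToV φ)‖ ≤ m * (K * a) := by
    refine Lp.norm_le_of_ae_bound (by positivity) ?_
    filter_upwards [coeFn_grad_testToV φ] with x hx
    rw [hx, classicalGrad_eq]
    exact ((gradOfFDeriv d).le_opNorm _).trans (by gcongr; exact h2 x)
  have e3 := norm_sq_VSpace (testToV φ)
  have n1 := norm_nonneg (embV (testToV φ))
  have n2 := norm_nonneg (gradV (testToV φ))
  have : ‖testToV φ‖ ≤ ‖embV (testToV φ)‖ + ‖gradV (testToV φ)‖ := by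
    refine abs_le_of_sq_le_sq' ?_ (by positivity) |>.2
    nlinarith
  linarith

/-- The time derivative is continuous with compact support, hence uniformly continuous, and the mean
value inequality makes the first-order remainder small uniformly in s and x. -/
theorem exists_forall_norm_sub_sub_le {X Y : Type*} [NormedAddCommGroup X] [NormedSpace ℝ X]
    [NormedAddCommGroup Y] [NormedSpace ℝ Y] {Ψ : ℝ × X → Y} (hΨ : ContDiff ℝ 1 Ψ)
    (hc : HasCompactSupport Ψ) {ε : ℝ} (hε : 0 < ε) : ∃ δ > 0, ∀ s h : ℝ, |h| < δ → ∀ x,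
    ‖Ψ (s + h, x) - Ψ (s, x) - h • fderiv ℝ Ψ (s, x) (1, 0)‖ ≤ ε * |h| := by
  have hcont : Continuous fun p => fderiv ℝ Ψ p ((1 : ℝ), (0 : X)) :=
    (hΨ.continuous_fderiv (by simp)).clm_apply continuous_const
  have hu : UniformContinuous fun p => fderiv ℝ Ψ p ((1 : ℝ), (0 : X)) :=
    (hc.fderiv_apply (𝕜 := ℝ) _).uniformContinuous_of_continuous hcont
  obtain ⟨δ, hδ, H⟩ := Metric.uniformContinuous_iff.1 hu ε hε
  refine ⟨δ, hδ, fun s h hh x => ?_⟩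
  have hd : ∀ τ : ℝ, HasDerivAt (fun τ => Ψ (s + τ, x) - τ • fderiv ℝ Ψ (s, x) (1, 0))
      (fderiv ℝ Ψ (s + τ, x) (1, 0) - fderiv ℝ Ψ (s, x) (1, 0)) τ := by
    intro τ
    have h1 : HasFDerivAt Ψ (fderiv ℝ Ψ (s + τ, x)) (s + τ, x) :=
      (hΨ.differentiable (by simp) _).hasFDerivAt
    have h2 : HasDerivAt (fun τ : ℝ => (s + τ, x)) ((1 : ℝ), (0 : X)) τ :=
      ((hasDerivAt_id τ).const_add s).prodMk (hasDerivAt_const τ x)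
    have h3 := (hasDerivAt_id τ).smul_const (fderiv ℝ Ψ (s, x) (1, 0))
    rw [one_smul] at h3
    exact (h1.comp_hasDerivAt τ h2).sub h3
  have := (convex_uIcc (0 : ℝ) h).norm_image_sub_le_of_norm_hasDerivWithin_le
    (f := fun τ => Ψ (s + τ, x) - τ • fderiv ℝ Ψ (s, x) (1, 0)) (C := ε)
    (fun τ _ => (hd τ).hasDerivWithinAt) (fun τ hτ => ?_) left_mem_uIcc right_mem_uIcc
  · simpa [sub_right_comm] using this
  · rw [← dist_eq_norm]
    refine (H ?_).le
    rw [Prod.dist_eq, dist_self, Real.dist_eq, add_sub_cancel_left, max_eq_left (abs_nonneg _)]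
    refine lt_of_le_of_lt ?_ hh
    rcases le_total 0 h with h0 | h0
    · rw [uIcc_of_le h0] at hτ
      rw [abs_of_nonneg hτ.1, abs_of_nonneg h0]
      exact hτ.2
    · rw [uIcc_of_ge h0] at hτ
      rw [abs_of_nonpos hτ.2, abs_of_nonpos h0]
      linarith [hτ.1]

namespace SpaceTimeTest

variable {T : ℝ}

theorem fderiv_slice {Y : Type*} [NormedAddCommGroup Y] [NormedSpace ℝ Y] {Ψ : ℝ × Vec d → Y}
    (hΨ : Differentiable ℝ Ψ) (t : ℝ) (x y : Vec d) :
    fderiv ℝ (fun x => Ψ (t, x)) x y = fderiv ℝ Ψ (t, x) (0, y) := by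
  have h2 : HasFDerivAt (fun x : Vec d => (t, x)) (ContinuousLinearMap.inr ℝ ℝ (Vec d)) x :=
    hasFDerivAt_prodMk_right t x
  have h3 : HasFDerivAt (fun x => Ψ (t, x)) _ x := (hΨ (t, x)).hasFDerivAt.comp x h2
  rw [h3.fderiv]
  rfl

/-- Symmetry of the second derivative: time and space differentiation commute, so ∂_t v remains
divergence-free and ∇∂_t v = ∂_t ∇v. -/
theorem fderiv_fderiv_comm {Y : Type*} [NormedAddCommGroup Y] [NormedSpace ℝ Y]
    {Ψ : ℝ × Vec d → Y} (hΨ : ContDiff ℝ ∞ Ψ) (q : ℝ × Vec d) (y : Vec d) :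
    fderiv ℝ (fun p => fderiv ℝ Ψ p (1, 0)) q (0, y) = fderiv ℝ (fderiv ℝ Ψ) q (1, 0) (0, y) := by
  have hD2 : ContDiff ℝ ∞ (fderiv ℝ Ψ) := hΨ.fderiv_right (by simp)
  rw [fderiv_clm_apply (hD2.differentiable (by simp) _) (differentiableAt_const _)]
  simp only [fderiv_fun_const, Pi.zero_apply, ContinuousLinearMap.comp_zero, zero_add,
    ContinuousLinearMap.flip_apply]
  exact ((hΨ.contDiffAt (x := q)).isSymmSndFDerivAt
    (by simpa using (WithTop.coe_le_coe.2 (le_top : (2 : ℕ∞) ≤ ⊤) : (2 : ℕ∞ω) ≤ (∞ : ℕ∞ω)))).eq _ _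

/-- The time derivative of a space-time test field is a space-time test field. -/
def deriv (v : SpaceTimeTest O T) : SpaceTimeTest O T where
  toFun p := fderiv ℝ v.toFun p (1, 0)
  smooth := (v.smooth.fderiv_right (m := ∞) (by simp)).clm_apply contDiff_const
  hasCompactSupport := v.hasCompactSupport.fderiv_apply (𝕜 := ℝ) _
  tsupport_subset := (tsupport_fderiv_apply_subset ℝ _).trans v.tsupport_subset
  divFree t x := by
    have hD : Differentiable ℝ v.toFun := v.smooth.differentiable (by simp)
    have hD2 : ContDiff ℝ ∞ (fderiv ℝ v.toFun) := v.smooth.fderiv_right (by simp)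
    have hDD : Differentiable ℝ (fderiv ℝ v.toFun) := hD2.differentiable (by simp)
    have hD1 : Differentiable ℝ fun p => fderiv ℝ v.toFun p (1, 0) :=
      (hD2.clm_apply contDiff_const).differentiable (by simp)
    have h0 : ∀ s, ∑ i, fderiv ℝ v.toFun (s, x) (0, EuclideanSpace.single i 1) i = 0 := by
      intro s
      refine Eq.trans ?_ (v.divFree s x)
      refine Finset.sum_congr rfl fun i _ => ?_
      rw [partialDeriv, fderiv_slice hD]
    -- The vanishing divergence is differentiated in time at the fixed point x.
    have h1 : HasDerivAt (fun s => ∑ i, fderiv ℝ v.toFun (s, x) (0, EuclideanSpace.single i 1) i)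
        (∑ i, fderiv ℝ (fderiv ℝ v.toFun) (t, x) (1, 0) (0, EuclideanSpace.single i 1) i) t := by
      refine HasDerivAt.fun_sum fun i _ => ?_
      have a1 : HasDerivAt (fun s : ℝ => (s, x)) ((1 : ℝ), (0 : Vec d)) t :=
        (hasDerivAt_id t).prodMk (hasDerivAt_const t x)
      have a2 := (hDD (t, x)).hasFDerivAt.comp_hasDerivAt t a1
      have a3 := a2.clm_apply (hasDerivAt_const t ((0 : ℝ), (EuclideanSpace.single i 1 : Vec d)))
      have a4 : HasDerivAt (fun s => fderiv ℝ v.toFun (s, x) (0, EuclideanSpace.single i 1) i) _ t :=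
        (EuclideanSpace.proj (𝕜 := ℝ) i).hasFDerivAt.comp_hasDerivAt t a3
      exact a4.congr_deriv (by simp)
    simp only [h0] at h1
    rw [divergence, ← h1.unique (hasDerivAt_const t 0)]
    refine Finset.sum_congr rfl fun i _ => ?_
    rw [partialDeriv, fderiv_slice hD1, fderiv_fderiv_comm v.smooth]

theorem fderiv_slice_sub_sub (v : SpaceTimeTest O T) (s h : ℝ) (x : Vec d) :
    fderiv ℝ ((v.slice (s + h) - v.slice s - h • v.deriv.slice s : divFreeTest O) :
      Vec d → Vec d) x = fderiv ℝ (fun x => v.toFun (s + h, x)) x -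
        fderiv ℝ (fun x => v.toFun (s, x)) x - h • fderiv ℝ (fun x => v.deriv.toFun (s, x)) x := by
  have d1 : ∀ (w : SpaceTimeTest O T) (t : ℝ),
      DifferentiableAt ℝ (fun x => w.toFun (t, x)) x := fun w t =>
    ((w.slice t).2.1.differentiable (by simp)) x
  have e : ((v.slice (s + h) - v.slice s - h • v.deriv.slice s : divFreeTest O) : Vec d → Vec d) =
    fun x => v.toFun (s + h, x) - v.toFun (s, x) - h • v.deriv.toFun (s, x) := rfl
  rw [e, fderiv_fun_sub ((d1 v _).fun_sub (d1 v _)) ((d1 v.deriv s).fun_const_smul h),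
    fderiv_fun_sub (d1 v _) (d1 v _), fderiv_fun_const_smul (d1 v.deriv s)]

/-- The uniform Taylor estimate is applied twice, to v and to its spatial derivative; together they
control the remainder in V. -/
theorem hasDerivAt_testToV_slice [Admissible O] (v : SpaceTimeTest O T) (s : ℝ) :
    HasDerivAt (fun s => testToV (v.slice s)) (testToV (v.deriv.slice s)) s := by
  obtain ⟨C, hC0, hC⟩ := exists_norm_testToV_le (O := O)
  have hD : Differentiable ℝ v.toFun := v.smooth.differentiable (by simp)
  have hD2 : ContDiff ℝ ∞ (fderiv ℝ v.toFun) := v.smooth.fderiv_right (by simp)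
  -- Restriction of a derivative in (t, x) to the spatial directions.
  set R : (ℝ × Vec d →L[ℝ] Vec d) →L[ℝ] (Vec d →L[ℝ] Vec d) :=
    (ContinuousLinearMap.compL ℝ (Vec d) (ℝ × Vec d) (Vec d)).flip
      (ContinuousLinearMap.inr ℝ ℝ (Vec d))
  have hR : ∀ L y, R L y = L (0, y) := fun L y => rfl
  set Ψ : ℝ × Vec d → (Vec d →L[ℝ] Vec d) := fun p => R (fderiv ℝ v.toFun p)
  have hΨ : ContDiff ℝ ∞ Ψ := R.contDiff.comp hD2
  have hΨc : HasCompactSupport Ψ :=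
    (v.hasCompactSupport.fderiv (𝕜 := ℝ)).comp_left (g := R) (map_zero R)
  have hΨ' : ∀ q, fderiv ℝ Ψ q (1, 0) = R (fderiv ℝ (fderiv ℝ v.toFun) q (1, 0)) := by
    intro q
    have : HasFDerivAt Ψ _ q :=
      R.hasFDerivAt.comp q (hD2.differentiable (by simp) q).hasFDerivAt
    rw [this.fderiv]
    rfl
  rw [hasDerivAt_iff_isLittleO_nhds_zero, Asymptotics.isLittleO_iff]
  intro c hc
  have hε : 0 < c / (C + 1) := by positivity
  obtain ⟨δ₁, hδ₁, H₁⟩ := exists_forall_norm_sub_sub_le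
    (v.smooth.of_le (by simp)) v.hasCompactSupport hε
  obtain ⟨δ₂, hδ₂, H₂⟩ := exists_forall_norm_sub_sub_le (hΨ.of_le (by simp)) hΨc hε
  filter_upwards [Metric.ball_mem_nhds (0 : ℝ) (lt_min hδ₁ hδ₂)] with h hh
  rw [mem_ball_zero_iff, Real.norm_eq_abs, lt_min_iff] at hh
  set ψ : divFreeTest O := v.slice (s + h) - v.slice s - h • v.deriv.slice s with hψ
  have e : testToV (v.slice (s + h)) - testToV (v.slice s) - h • testToV (v.deriv.slice s) =
      testToV ψ := by
    rw [hψ, testToV_sub, testToV_sub, testToV_smul]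
  have b1 : ∀ x, ‖(ψ : Vec d → Vec d) x‖ ≤ c / (C + 1) * |h| := H₁ s h hh.1
  have b2 : ∀ x, ‖fderiv ℝ (ψ : Vec d → Vec d) x‖ ≤ c / (C + 1) * |h| := by
    intro x
    have e2 : fderiv ℝ (ψ : Vec d → Vec d) x =
        Ψ (s + h, x) - Ψ (s, x) - h • fderiv ℝ Ψ (s, x) (1, 0) := by
      rw [hψ, fderiv_slice_sub_sub, hΨ']
      ext1 y
      have a1 := fderiv_slice hD (s + h) x y
      have a2 := fderiv_slice hD s x y
      have a3 := fderiv_slice (v.deriv.smooth.differentiable (by simp)) s x y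
      have a4 := fderiv_fderiv_comm v.smooth (s, x) y
      have a5 := a3.trans a4
      simp only [sub_apply, smul_apply, a1, a2, a5, Ψ, hR]
    rw [e2]
    exact H₂ s h hh.2 x
  rw [e]
  refine (hC ψ (c / (C + 1) * |h|) (by positivity) b1 b2).trans ?_
  rw [Real.norm_eq_abs, ← mul_assoc]
  refine mul_le_mul_of_nonneg_right ?_ (abs_nonneg h)
  rw [mul_div_assoc', div_le_iff₀ (by positivity)]
  nlinarith

theorem continuous_testToV_slice [Admissible O] (v : SpaceTimeTest O T) :
    Continuous fun s => testToV (v.slice s) :=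
  continuous_iff_continuousAt.2 fun s => (v.hasDerivAt_testToV_slice s).continuousAt

theorem timeDeriv_eq (v : SpaceTimeTest O T) (s : ℝ) (x : Vec d) :
    v.timeDeriv s x = (v.deriv.slice s : Vec d → Vec d) x := by
  have h1 : HasFDerivAt v.toFun (fderiv ℝ v.toFun (s, x)) (s, x) :=
    (v.smooth.differentiable (by simp) _).hasFDerivAt
  have h2 : HasDerivAt (fun s : ℝ => (s, x)) ((1 : ℝ), (0 : Vec d)) s :=
    (hasDerivAt_id s).prodMk (hasDerivAt_const s x)
  exact (h1.comp_hasDerivAt s h2).deriv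

theorem integral_inner_timeDeriv (v : SpaceTimeTest O T) (w : HSpace O) (s : ℝ) :
    ∫ x in O, inner ℝ (field w x) (v.timeDeriv s x) = inner ℝ w (testToH (v.deriv.slice s)) := by
  change _ = inner ℝ w.toL2 (testToL2 O (v.deriv.slice s))
  rw [L2.inner_def]
  refine integral_congr_ae ?_
  filter_upwards [(memLp_test (v.deriv.slice s) 2).coeFn_toLp] with x hx
  rw [timeDeriv_eq]
  exact congrArg (fun y => inner ℝ (field w x) y) hx.symm

/-- The product of a function of time and a test field. -/
def ofMul (θ : ℝ → ℝ) (hθ : ContDiff ℝ ∞ θ) (hc : HasCompactSupport θ)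
    (hT : tsupport θ ⊆ Iio T) (φ : divFreeTest O) : SpaceTimeTest O T where
  toFun p := θ p.1 • (φ : Vec d → Vec d) p.2
  smooth := (hθ.comp contDiff_fst).smul (φ.2.1.comp contDiff_snd)
  hasCompactSupport := by
    refine HasCompactSupport.of_support_subset_isCompact
      (hc.isCompact.prod φ.2.2.1.isCompact) fun p hp => ?_
    rw [Function.mem_support] at hp
    exact ⟨subset_tsupport _ fun h => hp (by simp [h]), subset_tsupport _ fun h => hp (by simp [h])⟩
  tsupport_subset := by
    refine Subset.trans (closure_minimal (t := tsupport θ ×ˢ tsupport (φ : Vec d → Vec d))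
      (fun p hp => ?_) ((isClosed_tsupport _).prod (isClosed_tsupport _)))
      (prod_mono hT φ.2.2.2.1)
    rw [Function.mem_support] at hp
    exact ⟨subset_tsupport _ fun h => hp (by simp [h]), subset_tsupport _ fun h => hp (by simp [h])⟩
  divFree t x := (θ t • φ).2.2.2.2 x

theorem slice_ofMul (θ : ℝ → ℝ) (hθ : ContDiff ℝ ∞ θ) (hc : HasCompactSupport θ)
    (hT : tsupport θ ⊆ Iio T) (φ : divFreeTest O) (t : ℝ) :
    (ofMul θ hθ hc hT φ).slice t = θ t • φ := rfl

theorem timeDeriv_ofMul (θ : ℝ → ℝ) (hθ : ContDiff ℝ ∞ θ) (hc : HasCompactSupport θ)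
    (hT : tsupport θ ⊆ Iio T) (φ : divFreeTest O) (t : ℝ) (x : Vec d) :
    (ofMul θ hθ hc hT φ).timeDeriv t x = _root_.deriv θ t • (φ : Vec d → Vec d) x := by
  have h : HasDerivAt (fun s => θ s • (φ : Vec d → Vec d) x) _ t :=
    ((hθ.differentiable (by simp) t).hasDerivAt).smul_const _
  exact h.deriv

end SpaceTimeTest

end CBF

/-! ### Integrability of the operator in time; the integrated equation. -/

namespace CBF

variable {d : ℕ} {O : Set (Vec d)} [Admissible O]

/-- Young's inequality without optimal constants: either b ≤ εa and the first term suffices, or a ≤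
b/ε and the second does. -/
theorem rpow_mul_le_of_pos {r ε a b : ℝ} (hr : 0 ≤ r) (hε : 0 < ε) (ha : 0 ≤ a) (hb : 0 ≤ b) :
    a ^ r * b ≤ ε * a ^ (r + 1) + ε⁻¹ ^ r * b ^ (r + 1) := by
  have p1 : 0 ≤ ε * a ^ (r + 1) := by positivity
  have p2 : 0 ≤ ε⁻¹ ^ r * b ^ (r + 1) := by positivity
  have e : ∀ {c : ℝ}, 0 ≤ c → c ^ (r + 1) = c ^ r * c := fun hc => by
    rw [Real.rpow_add_one' hc (by linarith)]
  rcases le_total b (ε * a) with h | h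
  · have : a ^ r * b ≤ ε * a ^ (r + 1) := by
      rw [e ha]
      calc a ^ r * b ≤ a ^ r * (ε * a) := by gcongr
        _ = _ := by ring
    linarith
  · have : a ^ r * b ≤ ε⁻¹ ^ r * b ^ (r + 1) := by
      have : a ≤ ε⁻¹ * b := by rwa [inv_mul_eq_div, le_div_iff₀' hε]
      rw [e hb, ← mul_assoc, ← Real.mul_rpow (by positivity) hb]
      gcongr
    linarith

theorem powNorm_nonneg (p : ℝ) (w : HSpace O) : 0 ≤ powNorm p w :=
  integral_nonneg fun _ => by positivity

theorem ofReal_powNorm {r : ℝ} (hr₁ : 1 ≤ r) (hr₃ : r ≤ 3) (v : VSpace O) :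
    ENNReal.ofReal (powNorm (r + 1) (embV v)) =
      eLpNorm (field (embV v)) (ENNReal.ofReal (r + 1)) (volOn O) ^ (r + 1) := by
  have hp0 : ENNReal.ofReal (r + 1) ≠ 0 := by simpa using by linarith
  rw [eLpNorm_eq_lintegral_rpow_enorm_toReal hp0 ENNReal.ofReal_ne_top,
    ENNReal.toReal_ofReal (by linarith), ← ENNReal.rpow_mul, one_div,
    inv_mul_cancel₀ (by linarith), ENNReal.rpow_one, powNorm,
    ofReal_integral_eq_lintegral_ofReal (integrable_powNorm hr₁ hr₃ _)
      (ae_of_all _ fun x => by positivity)]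
  refine lintegral_congr fun x => ?_
  rw [← ofReal_norm, ENNReal.ofReal_rpow_of_nonneg (norm_nonneg _) (by linarith)]

theorem abs_dampForm_le {r : ℝ} (hr₁ : 1 ≤ r) (hr₃ : r ≤ 3) {ε : ℝ} (hε : 0 < ε)
    (v w : VSpace O) : |dampForm hr₁ hr₃ v w| ≤
      ε * powNorm (r + 1) (embV v) + ε⁻¹ ^ r * powNorm (r + 1) (embV w) := by
  rw [dampForm_apply, powNorm, powNorm, ← integral_const_mul, ← integral_const_mul,
    ← integral_add ((integrable_powNorm hr₁ hr₃ v).const_mul _)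
      ((integrable_powNorm hr₁ hr₃ w).const_mul _), ← Real.norm_eq_abs]
  refine norm_integral_le_of_norm_le (((integrable_powNorm hr₁ hr₃ v).const_mul _).add
      ((integrable_powNorm hr₁ hr₃ w).const_mul _)) (ae_of_all _ fun x => ?_)
  refine (abs_real_inner_le_norm _ _).trans ?_
  rw [norm_powMap hr₁]
  exact rpow_mul_le_of_pos (by linarith) hε (norm_nonneg _) (norm_nonneg _)

theorem norm_embL4_pow_four (v : VSpace O) :
    ‖embL4 O v‖ ^ 4 = ∫ x in O, ‖field (embV v) x‖ ^ 4 := by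
  have h : eLpNorm (field (embV v)) 4 (volOn O) =
      ENNReal.ofReal ((∫ x in O, ‖field (embV v) x‖ ^ (4 : ℝ≥0∞).toReal) ^
        ((4 : ℝ≥0∞).toReal)⁻¹) :=
    (memLp_field_four v).eLpNorm_eq_integral_rpow_norm (by norm_num) (by norm_num)
  have h1 : ‖embL4 O v‖ = (∫ x in O, ‖field (embV v) x‖ ^ (4 : ℝ≥0∞).toReal) ^
        ((4 : ℝ≥0∞).toReal)⁻¹ := by
    rw [Lp.norm_def, eLpNorm_congr_ae (coeFn_embL4 v), h, ENNReal.toReal_ofReal]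
    positivity
  rw [h1, ← Real.rpow_natCast, ← Real.rpow_mul (by positivity)]
  norm_num

theorem norm_embV_sq (v : VSpace O) : ‖embV v‖ ^ 2 = ∫ x in O, ‖field (embV v) x‖ ^ 2 := by
  change ‖(embV v).toL2‖ ^ 2 = _
  rw [← real_inner_self_eq_norm_sq, L2.inner_def]
  simp only [real_inner_self_eq_norm_sq]
  rfl

/-- Since 2 ≤ r + 1 ≤ 4, pointwise s^{r+1} ≤ s² when s ≤ 1 and s^{r+1} ≤ s⁴ otherwise. -/
theorem powNorm_le {r : ℝ} (hr₁ : 1 ≤ r) (hr₃ : r ≤ 3) (v : VSpace O) :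
    powNorm (r + 1) (embV v) ≤ ‖embV v‖ ^ 2 + ‖embL4 O v‖ ^ 4 := by
  have i2 : Integrable (fun x => ‖field (embV v) x‖ ^ 2) (volOn O) :=
    ((memLp_field_four v).mono_exponent (p := 2) (by norm_num)).integrable_norm_pow (by norm_num)
  have i4 : Integrable (fun x => ‖field (embV v) x‖ ^ 4) (volOn O) :=
    (memLp_field_four v).integrable_norm_pow (by norm_num)
  rw [norm_embV_sq, norm_embL4_pow_four, ← integral_add i2 i4]
  refine integral_mono (integrable_powNorm hr₁ hr₃ v) (i2.add i4) fun x => ?_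
  have h0 := norm_nonneg (field (embV v) x)
  change ‖field (embV v) x‖ ^ (r + 1) ≤ ‖field (embV v) x‖ ^ 2 + ‖field (embV v) x‖ ^ 4
  rcases le_total ‖field (embV v) x‖ 1 with h | h
  · have : ‖field (embV v) x‖ ^ (r + 1) ≤ ‖field (embV v) x‖ ^ (2 : ℝ) :=
      Real.rpow_le_rpow_of_exponent_ge' h0 h (by norm_num) (by linarith)
    rw [Real.rpow_two] at this
    have := pow_nonneg h0 4
    linarith
  · have : ‖field (embV v) x‖ ^ (r + 1) ≤ ‖field (embV v) x‖ ^ (4 : ℝ) :=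
      Real.rpow_le_rpow_of_exponent_le h (by linarith)
    rw [show (4 : ℝ) = (4 : ℕ) by norm_num, Real.rpow_natCast] at this
    have := pow_nonneg h0 2
    linarith

theorem continuous_powNorm_embV {r : ℝ} (hr₁ : 1 ≤ r) (hr₃ : r ≤ 3) :
    Continuous fun v : VSpace O => powNorm (r + 1) (embV v) := by
  simp only [← dampForm_self hr₁ hr₃]
  exact (locallyLipschitz_dampForm hr₁ hr₃).continuous.clm_apply continuous_id

/-- Young's inequality on the unit sphere of V. The bound is linear in ‖v‖_{L^{r+1}}^{r+1}, so the
damping is integrable in time with values in V' as soon as the energy is finite. -/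
theorem exists_norm_dampForm_le_powNorm {r : ℝ} (hr₁ : 1 ≤ r) (hr₃ : r ≤ 3) : ∃ C : ℝ, 0 ≤ C ∧
    ∀ v : VSpace O, ‖dampForm hr₁ hr₃ v‖ ≤ powNorm (r + 1) (embV v) + C := by
  refine ⟨1 + ‖embL4 O‖ ^ 4, by positivity, fun v => ?_⟩
  refine ContinuousLinearMap.opNorm_le_of_unit_norm (by have := powNorm_nonneg (r + 1) (embV v); positivity) fun w hw => ?_
  have h1 := abs_dampForm_le hr₁ hr₃ one_pos v w
  rw [one_mul, inv_one, Real.one_rpow, one_mul] at h1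
  refine h1.trans (add_le_add_right ((powNorm_le hr₁ hr₃ w).trans (add_le_add ?_ ?_)) _)
  · exact pow_le_one₀ (norm_nonneg _) ((norm_embV_le w).trans hw.le)
  · refine pow_le_pow_left₀ (norm_nonneg _) ?_ 4
    simpa [hw] using (embL4 O).le_opNorm w

/-- Antisymmetry puts the gradient on the test element, leaving two factors in L⁴ and no gradient of
v. -/
theorem norm_convForm_le (v : VSpace O) : ‖convForm v v‖ ≤ ‖embL4 O v‖ ^ 2 := by
  refine ContinuousLinearMap.opNorm_le_bound _ (by positivity) fun w => ?_
  rw [convForm_antisymm, norm_neg, Real.norm_eq_abs]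
  refine (abs_convForm_le v w v).trans ?_
  calc ‖embL4 O v‖ * ‖gradV w‖ * ‖embL4 O v‖ = ‖embL4 O v‖ ^ 2 * ‖gradV w‖ := by ring
    _ ≤ _ := by gcongr; exact norm_gradV_le w

section Time

variable {α : Type*} {m : MeasurableSpace α} {ν : Measure α} {v : α → VSpace O}

theorem integrable_convForm (hv : MemLp v 2 ν) :
    Integrable (fun s => convForm (v s) (v s)) ν := by
  have hc : Continuous fun w : VSpace O => convForm w w :=
    Continuous.comp (g := fun p : VSpace O × VSpace O => convForm p.1 p.2)
      (f := fun w => (w, w)) contDiff_convForm.continuous (continuous_id.prodMk continuous_id)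
  have h2 : Integrable (fun s => ‖v s‖ ^ 2) ν := hv.integrable_norm_pow (by norm_num)
  have hb : ∀ s, ‖convForm (v s) (v s)‖ ≤ ‖embL4 O‖ ^ 2 * ‖v s‖ ^ 2 := fun s => by
    refine (norm_convForm_le (v s)).trans ?_
    rw [← mul_pow]
    exact pow_le_pow_left₀ (norm_nonneg _) ((embL4 O).le_opNorm _) 2
  exact (h2.const_mul (‖embL4 O‖ ^ 2)).mono' (hc.comp_aestronglyMeasurable hv.1) (ae_of_all _ hb)

theorem integrable_dampForm_time [IsFiniteMeasure ν] {r : ℝ} (hr₁ : 1 ≤ r) (hr₃ : r ≤ 3)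
    (hv : AEStronglyMeasurable v ν) (hp : Integrable (fun s => powNorm (r + 1) (embV (v s))) ν) :
    Integrable (fun s => dampForm hr₁ hr₃ (v s)) ν := by
  obtain ⟨C, -, hC⟩ := exists_norm_dampForm_le_powNorm (O := O) hr₁ hr₃
  exact (hp.add (integrable_const C)).mono'
    ((locallyLipschitz_dampForm hr₁ hr₃).continuous.comp_aestronglyMeasurable hv)
    (ae_of_all _ fun s => hC (v s))

theorem integrable_viscForm [IsFiniteMeasure ν] (hv : MemLp v 2 ν) :
    Integrable (fun s => viscForm O (v s)) ν :=
  ((viscForm O).comp_memLp' hv).integrable (by norm_num)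

theorem integrable_add_cbfOp [IsFiniteMeasure ν] {r : ℝ} (hr₁ : 1 ≤ r) (hr₃ : r ≤ 3) (μ β : ℝ)
    {f : α → StrongDual ℝ (VSpace O)} (hf : Integrable f ν) (hv : MemLp v 2 ν)
    (hp : Integrable (fun s => powNorm (r + 1) (embV (v s))) ν) :
    Integrable (fun s => f s + cbfOp hr₁ hr₃ μ β (v s)) ν :=
  hf.add ((((integrable_viscForm hv).smul μ).neg.sub (integrable_convForm hv)).sub
    ((integrable_dampForm_time hr₁ hr₃ hv.1 hp).smul β))

end Time

theorem intervalIntegrable_of_timeMeasure {E : Type*} [NormedAddCommGroup E] {T : ℝ} {G : ℝ → E}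
    (hG : Integrable G (timeMeasure T)) {a b : ℝ} (ha : a ∈ Icc 0 T) (hb : b ∈ Icc 0 T) :
    IntervalIntegrable G volume a b := by
  have h1 : IntegrableOn G (Icc 0 T) := by
    rw [integrableOn_Icc_iff_integrableOn_Ioo]
    exact hG
  refine ⟨h1.mono_set ?_, h1.mono_set ?_⟩
  · exact Ioc_subset_Icc_self.trans (Icc_subset_Icc ha.1 hb.2)
  · exact Ioc_subset_Icc_self.trans (Icc_subset_Icc hb.1 ha.2)

theorem intervalIntegrable_dual_apply {V : Type*} [NormedAddCommGroup V] [NormedSpace ℝ V] {T : ℝ}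
    {G : ℝ → StrongDual ℝ V} (hG : Integrable G (timeMeasure T)) {P : ℝ → V} (hP : Continuous P)
    {a b : ℝ} (ha : a ∈ Icc 0 T) (hb : b ∈ Icc 0 T) :
    IntervalIntegrable (fun s => G s (P s)) volume a b := by
  obtain ⟨C, hC⟩ := (isCompact_Icc (a := 0) (b := T)).exists_bound_of_continuousOn hP.continuousOn
  refine intervalIntegrable_of_timeMeasure ?_ ha hb
  refine (hG.norm.const_mul C).mono' (aestronglyMeasurable_dual_apply hG.1
    hP.aestronglyMeasurable) ?_
  filter_upwards [ae_restrict_mem measurableSet_Ioo] with s hs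
  rw [mul_comm]
  exact ((G s).le_opNorm _).trans
    (mul_le_mul_of_nonneg_left (hC s (Ioo_subset_Icc_self hs)) (norm_nonneg _))

/-- The weak form in terms of the operator `f - μ A - B - β C`. -/
theorem weakForm_iff {T : ℝ} {r : ℝ} (hr₁ : 1 ≤ r) (hr₃ : r ≤ 3) (μ β : ℝ)
    {f : ℝ → StrongDual ℝ (VSpace O)} (hf : Integrable f (timeMeasure T)) {u : ℝ → HSpace O}
    (hu : ∀ᵐ s ∂timeMeasure T, embV (asV (u s)) = u s)
    (hv : MemLp (fun s => asV (u s)) 2 (timeMeasure T))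
    (hp : Integrable (fun s => powNorm (r + 1) (embV (asV (u s)))) (timeMeasure T))
    (w : SpaceTimeTest O T) {a b : ℝ} (ha : a ∈ Icc 0 T) (hb : b ∈ Icc 0 T) (hab : a ≤ b) :
    WeakForm μ β r f u w a b ↔
      inner ℝ (u b) (testToH (w.slice b)) - inner ℝ (u a) (testToH (w.slice a)) =
        (∫ s in a..b, inner ℝ (u s) (testToH (w.deriv.slice s))) +
          ∫ s in a..b, (f s + cbfOp hr₁ hr₃ μ β (asV (u s))) (testToV (w.slice s)) := by
  have hP := w.continuous_testToV_slice
  have hu' : ∀ᵐ s : ℝ, s ∈ uIoc a b → embV (asV (u s)) = u s := by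
    rw [ae_restrict_iff' measurableSet_Ioo] at hu
    have hne : ∀ᵐ s : ℝ, s ≠ T := by simp [ae_iff]
    filter_upwards [hu, hne] with s hs hsT hsI
    rw [uIoc_of_le hab] at hsI
    exact hs ⟨ha.1.trans_lt hsI.1, lt_of_le_of_ne (hsI.2.trans hb.2) hsT⟩
  have e1 : ∫ s in a..b, convection (u s) (w.slice s) =
      ∫ s in a..b, convForm (asV (u s)) (asV (u s)) (testToV (w.slice s)) := by
    refine intervalIntegral.integral_congr_ae (hu'.mono fun s hs hsI => ?_)
    rw [← convection_eq, hs hsI]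
  have e2 : ∫ s in a..b, damping r (u s) (w.slice s) =
      ∫ s in a..b, dampForm hr₁ hr₃ (asV (u s)) (testToV (w.slice s)) := by
    refine intervalIntegral.integral_congr_ae (hu'.mono fun s hs hsI => ?_)
    rw [← damping_eq, hs hsI]
  have i1 : IntervalIntegrable (fun s => inner ℝ (gradV (asV (u s)))
      (gradV (testToV (w.slice s)))) volume a b :=
    intervalIntegrable_dual_apply (integrable_viscForm hv) hP ha hb
  have i2 := intervalIntegrable_dual_apply (integrable_convForm hv) hP ha hb
  have i3 := intervalIntegrable_dual_apply (integrable_dampForm_time hr₁ hr₃ hv.1 hp) hP ha hb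
  have i4 := intervalIntegrable_dual_apply hf hP ha hb
  have e3 : ∫ s in a..b, (f s + cbfOp hr₁ hr₃ μ β (asV (u s))) (testToV (w.slice s)) =
      (∫ s in a..b, f s (testToV (w.slice s))) +
        ((-(μ * ∫ s in a..b, inner ℝ (gradV (asV (u s))) (gradV (testToV (w.slice s)))) -
          ∫ s in a..b, convForm (asV (u s)) (asV (u s)) (testToV (w.slice s))) -
          β * ∫ s in a..b, dampForm hr₁ hr₃ (asV (u s)) (testToV (w.slice s))) := by
    have j1 : IntervalIntegrable (fun s => -(μ * inner ℝ (gradV (asV (u s)))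
      (gradV (testToV (w.slice s))))) volume a b := (i1.const_mul μ).neg
    have j2 : IntervalIntegrable (fun s => -(μ * inner ℝ (gradV (asV (u s)))
      (gradV (testToV (w.slice s)))) - convForm (asV (u s)) (asV (u s)) (testToV (w.slice s)))
      volume a b := j1.sub i2
    have j3 : IntervalIntegrable (fun s => -(μ * inner ℝ (gradV (asV (u s)))
      (gradV (testToV (w.slice s)))) - convForm (asV (u s)) (asV (u s)) (testToV (w.slice s)) -
      β * dampForm hr₁ hr₃ (asV (u s)) (testToV (w.slice s))) volume a b := j2.sub (i3.const_mul β)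
    rw [← intervalIntegral.integral_const_mul, ← intervalIntegral.integral_const_mul,
      ← intervalIntegral.integral_neg, ← intervalIntegral.integral_sub j1 i2,
      ← intervalIntegral.integral_sub j2 (i3.const_mul β), ← intervalIntegral.integral_add i4 j3]
    rfl
  rw [WeakForm, e1, e2, e3]
  simp only [SpaceTimeTest.integral_inner_timeDeriv]
  constructor <;> intro h <;> linarith

namespace IsWeakSolution

variable {T μ β r : ℝ} {f : ℝ → StrongDual ℝ (VSpace O)} {u₀ : HSpace O} {u : ℝ → HSpace O}

theorem ae_embV_asV (h : IsWeakSolution T μ β r f u₀ u) :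
    ∀ᵐ s ∂timeMeasure T, embV (asV (u s)) = u s := by
  filter_upwards [h.memL2V.1] with s ⟨v, hv⟩
  rw [← hv, asV_embV]

theorem exists_ae_norm_le (h : IsWeakSolution T μ β r f u₀ u) :
    ∃ M, ∀ᵐ s ∂timeMeasure T, ‖u s‖ ≤ M := by
  have h1 : eLpNormEssSup u (timeMeasure T) ≠ ⊤ := by
    simpa using h.memLinftyH.2.ne
  refine ⟨(eLpNormEssSup u (timeMeasure T)).toReal, ?_⟩
  filter_upwards [enorm_ae_le_eLpNormEssSup u (timeMeasure T)] with s hs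
  rw [← ENNReal.ofReal_le_iff_le_toReal h1, ofReal_norm]
  exact hs

theorem integrable_powNorm (h : IsWeakSolution T μ β r f u₀ u) (hr₁ : 1 ≤ r) (hr₃ : r ≤ 3) :
    Integrable (fun s => powNorm (r + 1) (embV (asV (u s)))) (timeMeasure T) := by
  refine ⟨(continuous_powNorm_embV hr₁ hr₃).comp_aestronglyMeasurable h.memL2V.2.1, ?_⟩
  refine lt_of_le_of_lt (le_of_eq ?_) h.memLpLtilde.2.2
  refine lintegral_congr_ae ?_
  filter_upwards [h.ae_embV_asV] with s hs
  rw [← hs, ← ofReal_powNorm hr₁ hr₃, asV_embV]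
  exact Real.enorm_of_nonneg (powNorm_nonneg _ _)

/-- The integrated form of the equation in `V'`. -/
theorem ae_inner_eq (h : IsWeakSolution T μ β r f u₀ u) (hr₁ : 1 ≤ r) (hr₃ : r ≤ 3) (hT : 0 < T)
    (hf : Integrable f (timeMeasure T)) :
    ∀ᵐ t ∂timeMeasure T, ∀ z : VSpace O, inner ℝ (u t) (embV z) = inner ℝ u₀ (embV z) +
      ∫ s in 0..t, (f s + cbfOp hr₁ hr₃ μ β (asV (u s))) z := by
  have hF := integrable_add_cbfOp hr₁ hr₃ μ β hf h.memL2V.2 (h.integrable_powNorm hr₁ hr₃)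
  obtain ⟨φ, hφ⟩ := exists_denseRange_testToV (O := O)
  -- A field constant in time is not an admissible test field, since test fields vanish near T. It
  -- is multiplied by a cutoff in time equal to 1 near [0, T(1 - 1/(n + 2))]; these intervals
  -- exhaust [0, T).
  have hb : ∀ n : ℕ, ∃ w : divFreeTest O → SpaceTimeTest O T,
      ∀ (ψ : divFreeTest O), ∀ t ∈ Icc (0 : ℝ) (T * (1 - 1 / (n + 2))),
        (w ψ).slice t = ψ ∧ ∀ x, (w ψ).timeDeriv t x = 0 := by
    intro n
    have h1 : (0 : ℝ) < 1 - 1 / (n + 2) := by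
      rw [sub_pos, div_lt_one (by positivity)]
      linarith [(n.cast_nonneg : (0 : ℝ) ≤ n)]
    have h2 : (1 : ℝ) - 1 / (n + 2) < 1 - 1 / (n + 3) := by
      refine sub_lt_sub_left (one_div_lt_one_div_of_lt (by positivity) (by linarith)) _
    have h3 : (1 : ℝ) - 1 / (n + 3) < 1 := by
      have : (0 : ℝ) < 1 / (n + 3) := by positivity
      linarith
    have h4 : (1 : ℝ) - 1 / (n + 4) < 1 := by
      have : (0 : ℝ) < 1 / (n + 4) := by positivity
      linarith
    have h5 : (1 : ℝ) - 1 / (n + 3) < 1 - 1 / (n + 4) := by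
      refine sub_lt_sub_left (one_div_lt_one_div_of_lt (by positivity) (by linarith)) _
    -- The three consecutive values n + 2, n + 3, n + 4 leave a gap on each side: the cutoff is 1 on
    -- a neighbourhood of the interval, so its derivative vanishes there, and its support ends
    -- before T.
    let b : ContDiffBump (0 : ℝ) := ⟨T * (1 - 1 / (n + 3)), T * (1 - 1 / (n + 4)),
      mul_pos hT (h1.trans h2), mul_lt_mul_of_pos_left h5 hT⟩
    have hbT : tsupport b ⊆ Iio T := by
      rw [b.tsupport_eq]
      intro t ht
      rw [Metric.mem_closedBall, dist_zero_right] at ht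
      refine ((le_abs_self t).trans ht).trans_lt ?_
      calc T * (1 - 1 / (n + 4)) < T * 1 := mul_lt_mul_of_pos_left h4 hT
        _ = T := mul_one T
    refine ⟨fun ψ => SpaceTimeTest.ofMul b b.contDiff b.hasCompactSupport hbT ψ,
      fun ψ t ht => ?_⟩
    have hev : (b : ℝ → ℝ) =ᶠ[𝓝 t] fun _ => 1 := by
      have : t ∈ Metric.ball (0 : ℝ) (T * (1 - 1 / (n + 3))) := by
        rw [Metric.mem_ball, dist_zero_right, Real.norm_of_nonneg ht.1]
        exact ht.2.trans_lt (mul_lt_mul_of_pos_left h2 hT)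
      filter_upwards [Metric.isOpen_ball.mem_nhds this] with s hs
      exact b.one_of_mem_closedBall (Metric.ball_subset_closedBall hs)
    refine ⟨?_, fun x => ?_⟩
    · rw [SpaceTimeTest.slice_ofMul, hev.eq_of_nhds, one_smul]
    · rw [SpaceTimeTest.timeDeriv_ofMul, hev.deriv_eq, deriv_const, zero_smul]
  choose w hw using hb
  -- The exceptional set of times depends on the test field; countably many cutoffs and a countable
  -- dense family give a common null set.
  have hae : ∀ᵐ t ∂timeMeasure T, ∀ n k : ℕ, WeakForm μ β r f u (w n (φ k)) 0 t :=
    ae_all_iff.2 fun n => ae_all_iff.2 fun k => h.weak_zero _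
  filter_upwards [hae, ae_restrict_mem measurableSet_Ioo] with t ht htT z
  have htI : t ∈ Icc 0 T := Ioo_subset_Icc_self htT
  obtain ⟨n, hn⟩ : ∃ n : ℕ, t ≤ T * (1 - 1 / (n + 2)) := by
    obtain ⟨n, hn⟩ := exists_nat_gt (T / (T - t))
    refine ⟨n, ?_⟩
    have h0 : 0 < T - t := sub_pos.2 htT.2
    rw [div_lt_iff₀ h0] at hn
    have : T * (1 / (n + 2)) ≤ T - t := by
      rw [mul_one_div, div_le_iff₀ (by positivity)]
      nlinarith
    linarith
  refine hφ.induction_on (p := fun z => inner ℝ (u t) (embV z) = inner ℝ u₀ (embV z) +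
      ∫ s in 0..t, (f s + cbfOp hr₁ hr₃ μ β (asV (u s))) z) z ?_ fun k => ?_
  · refine isClosed_eq (continuous_const.inner (embVL O).continuous)
      ((continuous_const.inner (embVL O).continuous).add ?_)
    have : ∀ z, ∫ s in 0..t, (f s + cbfOp hr₁ hr₃ μ β (asV (u s))) z =
        (∫ s in 0..t, (f s + cbfOp hr₁ hr₃ μ β (asV (u s)))) z := fun z =>
      ((ContinuousLinearMap.intervalIntegral_apply
        (intervalIntegrable_of_timeMeasure hF ⟨le_rfl, hT.le⟩ htI) z)).symm
    simp only [this]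
    exact ContinuousLinearMap.continuous _
  · have e := (weakForm_iff hr₁ hr₃ μ β hf h.ae_embV_asV h.memL2V.2
      (h.integrable_powNorm hr₁ hr₃) (w n (φ k)) ⟨le_rfl, hT.le⟩ htI htT.1.le).1 (ht n k)
    have hs : ∀ s ∈ uIcc 0 t, (w n (φ k)).slice s = φ k ∧ ∀ x, (w n (φ k)).timeDeriv s x = 0 := by
      intro s hs
      rw [uIcc_of_le htT.1.le] at hs
      exact hw n (φ k) s ⟨hs.1, hs.2.trans hn⟩
    rw [(hs t right_mem_uIcc).1, (hs 0 left_mem_uIcc).1, h.initial] at e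
    have e1 : ∫ s in 0..t, inner ℝ (u s) (testToH ((w n (φ k)).deriv.slice s)) = 0 := by
      rw [intervalIntegral.integral_congr (g := fun _ => (0 : ℝ)), intervalIntegral.integral_zero]
      intro s hsI
      simp only [← SpaceTimeTest.integral_inner_timeDeriv, (hs s hsI).2, inner_zero_right,
        integral_zero]
    have e2 : ∫ s in 0..t, (f s + cbfOp hr₁ hr₃ μ β (asV (u s))) (testToV ((w n (φ k)).slice s)) =
        ∫ s in 0..t, (f s + cbfOp hr₁ hr₃ μ β (asV (u s))) (testToV (φ k)) := by
      refine intervalIntegral.integral_congr fun s hsI => ?_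
      simp only [(hs s hsI).1]
    rw [e1, e2, zero_add] at e
    rw [embV_testToV]
    linarith

end IsWeakSolution

end CBF

/-! ### The plane: energy equality and uniqueness. -/

namespace CBF

variable {d : ℕ} {O : Set (Vec d)} [Admissible O]

theorem exists_norm_embL4_sq_le_of_two (hd : d = 2) : ∃ C : ℝ, 0 < C ∧ ∀ v : VSpace O,
    ‖embL4 O v‖ ^ 2 ≤ C * (‖embV v‖ * ‖gradV v‖) := by
  obtain ⟨C, hC0, hC⟩ := exists_norm_embL4_le (O := O)
  refine ⟨C ^ 2, by positivity, fun v => ?_⟩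
  refine (pow_le_pow_left₀ (norm_nonneg _) (hC v) 2).trans (le_of_eq ?_)
  have e : ∀ {x : ℝ}, 0 ≤ x → (x ^ ((2 : ℝ) / 4)) ^ 2 = x := fun hx => by
    rw [← Real.rpow_natCast, ← Real.rpow_mul hx]
    norm_num
  have e1 : ((4 : ℝ) - d) / 4 = 2 / 4 := by rw [hd]; norm_num
  have e2 : (d : ℝ) / 4 = 2 / 4 := by rw [hd]; norm_num
  rw [e1, e2, mul_pow, mul_pow, e (norm_nonneg _), e (norm_nonneg _), mul_assoc]

theorem mul_le_mul_sq_add {ε a b : ℝ} (hε : 0 < ε) : a * b ≤ ε * a ^ 2 + ε⁻¹ * b ^ 2 := by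
  have h : 0 ≤ ε⁻¹ * (ε * a - b) ^ 2 := by positivity
  have e : ε⁻¹ * (ε * a - b) ^ 2 = ε * a ^ 2 + ε⁻¹ * b ^ 2 - 2 * (a * b) := by
    field_simp
    ring
  have h2 : 0 ≤ ε * a ^ 2 + ε⁻¹ * b ^ 2 := by positivity
  linarith

/-- The bound on `f - μ A v - B(v) - β C(v)` which gives the energy identity in the plane. -/
theorem exists_abs_add_cbfOp_le (hd : d = 2) {r : ℝ} (hr₁ : 1 ≤ r) (hr₃ : r ≤ 3) {μ β : ℝ}
    (hμ : 0 < μ) (hβ : 0 < β) {M₀ : ℝ} (M : ℝ) {ε : ℝ} (hε : 0 < ε) :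
    ∃ C : ℝ, 0 ≤ C ∧ ∀ (ℓ : StrongDual ℝ (VSpace O)) (v w : VSpace O), ‖embV v‖ ≤ M₀ →
      ‖embV w‖ ≤ M → |(ℓ + cbfOp hr₁ hr₃ μ β v) w| ≤
        ε * (‖ℓ‖ ^ 2 + 2 * ‖v‖ ^ 2 + powNorm (r + 1) (embV v)) + C * ‖w‖ ^ 2 := by
  obtain ⟨L, hL0, hL⟩ := exists_norm_embL4_sq_le_of_two (O := O) hd
  -- The four terms come from Young's inequality for the force, the viscosity, the convection and
  -- the damping, the last one at scale ε/β to absorb the factor β.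
  refine ⟨ε⁻¹ + ε⁻¹ * μ ^ 2 + ε⁻¹ * (L * M₀) ^ 2 +
    β * ((ε / β)⁻¹ ^ r * (1 + L ^ 2 * M ^ 2)), by positivity, fun ℓ v w hv hw => ?_⟩
  have n1 := norm_nonneg w
  have n2 := norm_nonneg v
  have gw := norm_gradV_le w
  have gv := norm_gradV_le v
  have b1 : |ℓ w| ≤ ε * ‖ℓ‖ ^ 2 + ε⁻¹ * ‖w‖ ^ 2 := (ℓ.le_opNorm w).trans (mul_le_mul_sq_add hε)
  have b2 : |μ * inner ℝ (gradV v) (gradV w)| ≤ ε * ‖v‖ ^ 2 + ε⁻¹ * μ ^ 2 * ‖w‖ ^ 2 := by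
    rw [abs_mul, abs_of_pos hμ]
    have : |inner ℝ (gradV v) (gradV w)| ≤ ‖v‖ * ‖w‖ :=
      (abs_real_inner_le_norm _ _).trans (mul_le_mul gv gw (norm_nonneg _) n2)
    calc μ * |inner ℝ (gradV v) (gradV w)| ≤ ‖v‖ * (μ * ‖w‖) := by nlinarith
      _ ≤ ε * ‖v‖ ^ 2 + ε⁻¹ * (μ * ‖w‖) ^ 2 := mul_le_mul_sq_add hε
      _ = _ := by ring
  have b3 : |convForm v v w| ≤ ε * ‖v‖ ^ 2 + ε⁻¹ * (L * M₀) ^ 2 * ‖w‖ ^ 2 := by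
    have : ‖embL4 O v‖ ^ 2 ≤ L * (M₀ * ‖v‖) := by
      refine (hL v).trans ?_
      gcongr
      exact (norm_nonneg _).trans hv
    calc |convForm v v w| ≤ ‖embL4 O v‖ ^ 2 * ‖w‖ :=
          ((convForm v v).le_opNorm w).trans (by gcongr; exact norm_convForm_le v)
      _ ≤ L * (M₀ * ‖v‖) * ‖w‖ := by gcongr
      _ = ‖v‖ * (L * M₀ * ‖w‖) := by ring
      _ ≤ ε * ‖v‖ ^ 2 + ε⁻¹ * (L * M₀ * ‖w‖) ^ 2 := mul_le_mul_sq_add hε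
      _ = _ := by ring
  have b4 : |β * dampForm hr₁ hr₃ v w| ≤ ε * powNorm (r + 1) (embV v) +
      β * ((ε / β)⁻¹ ^ r * (1 + L ^ 2 * M ^ 2)) * ‖w‖ ^ 2 := by
    rw [abs_mul, abs_of_pos hβ]
    have h1 := abs_dampForm_le hr₁ hr₃ (show 0 < ε / β by positivity) v w
    -- The planar inequality gives ‖w‖_{L⁴}⁴ ≤ L²M²‖w‖_V²: a quartic quantity becomes quadratic in
    -- the norm of V once w is bounded in H.
    have h2 : powNorm (r + 1) (embV w) ≤ (1 + L ^ 2 * M ^ 2) * ‖w‖ ^ 2 := by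
      refine (powNorm_le hr₁ hr₃ w).trans ?_
      have h3 : ‖embV w‖ ^ 2 ≤ ‖w‖ ^ 2 := pow_le_pow_left₀ (norm_nonneg _) (norm_embV_le w) 2
      have h4 : ‖embL4 O w‖ ^ 4 ≤ (L * (M * ‖w‖)) ^ 2 := by
        have : ‖embL4 O w‖ ^ 2 ≤ L * (M * ‖w‖) := by
          refine (hL w).trans ?_
          gcongr
          exact (norm_nonneg _).trans hw
        calc ‖embL4 O w‖ ^ 4 = (‖embL4 O w‖ ^ 2) ^ 2 := by ring
          _ ≤ _ := pow_le_pow_left₀ (by positivity) this 2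
      calc _ ≤ ‖w‖ ^ 2 + (L * (M * ‖w‖)) ^ 2 := add_le_add h3 h4
        _ = _ := by ring
    calc β * |dampForm hr₁ hr₃ v w| ≤ β * (ε / β * powNorm (r + 1) (embV v) +
          (ε / β)⁻¹ ^ r * ((1 + L ^ 2 * M ^ 2) * ‖w‖ ^ 2)) := by
          gcongr
          exact h1.trans (by gcongr)
      _ = _ := by
        field_simp
  rw [add_apply, cbfOp_apply]
  rw [abs_le] at b1 b2 b3 b4 ⊢
  constructor <;> linarith [b1.1, b1.2, b2.1, b2.2, b3.1, b3.2, b4.1, b4.2]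

namespace IsWeakSolution

variable {T μ β r : ℝ} {f : ℝ → StrongDual ℝ (VSpace O)} {u₀ : HSpace O}

/-- Both sides are continuous on [0, T], the left one by weak continuity, so the identity valid
almost everywhere holds at every time, the endpoints included. -/
theorem inner_eq {u : ℝ → HSpace O} (h : IsWeakSolution T μ β r f u₀ u)
    (hw : WeaklyContinuous T u) (hr₁ : 1 ≤ r) (hr₃ : r ≤ 3) (hT : 0 < T)
    (hf : Integrable f (timeMeasure T)) {t : ℝ} (ht : t ∈ Icc 0 T) (z : VSpace O) :
    inner ℝ (u t) (embV z) = inner ℝ u₀ (embV z) +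
      ∫ s in 0..t, (f s + cbfOp hr₁ hr₃ μ β (asV (u s))) z := by
  have hF := integrable_add_cbfOp hr₁ hr₃ μ β hf h.memL2V.2 (h.integrable_powNorm hr₁ hr₃)
  have hi := intervalIntegrable_dual_apply hF (P := fun _ => z) continuous_const
    (left_mem_Icc.2 hT.le) (right_mem_Icc.2 hT.le)
  have hc := intervalIntegral.continuousOn_primitive_interval' hi left_mem_uIcc
  rw [uIcc_of_le hT.le] at hc
  refine Measure.eqOn_Icc_of_ae_eq (μ := volume) hT.ne ?_ (hw (embV z))
    (continuousOn_const.add hc) ht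
  rw [← restrict_Ioo_eq_restrict_Icc]
  filter_upwards [h.ae_inner_eq hr₁ hr₃ hT hf] with s hs
  exact hs z

theorem exists_bound (hd : d = 2) {u : ℝ → HSpace O} (h : IsWeakSolution T μ β r f u₀ u)
    (hr₁ : 1 ≤ r) (hr₃ : r ≤ 3) (hμ : 0 < μ) (hβ : 0 < β) (M : ℝ) {ε : ℝ} (hε : 0 < ε) :
    ∃ C : ℝ, 0 ≤ C ∧ ∀ᵐ s ∂timeMeasure T, ∀ w : VSpace O, ‖embVL O w‖ ≤ M →
      |(f s + cbfOp hr₁ hr₃ μ β (asV (u s))) w| ≤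
        ε * (‖f s‖ ^ 2 + 2 * ‖asV (u s)‖ ^ 2 + powNorm (r + 1) (embV (asV (u s)))) +
          C * ‖w‖ ^ 2 := by
  obtain ⟨M₀, hM₀⟩ := h.exists_ae_norm_le
  obtain ⟨C, hC0, hC⟩ := exists_abs_add_cbfOp_le (O := O) hd hr₁ hr₃ hμ hβ (M₀ := M₀) M hε
  refine ⟨C, hC0, ?_⟩
  filter_upwards [hM₀, h.ae_embV_asV] with s hs hse w hw
  exact hC (f s) (asV (u s)) w (by rwa [hse]) hw

theorem integrable_bound {u : ℝ → HSpace O} (h : IsWeakSolution T μ β r f u₀ u)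
    (hr₁ : 1 ≤ r) (hr₃ : r ≤ 3) (hf : MemLp f 2 (timeMeasure T)) :
    Integrable (fun s => ‖f s‖ ^ 2 + 2 * ‖asV (u s)‖ ^ 2 + powNorm (r + 1) (embV (asV (u s))))
      (timeMeasure T) :=
  ((hf.integrable_norm_pow (by norm_num)).add
    ((h.memL2V.2.integrable_norm_pow (by norm_num)).const_mul 2)).add
    (h.integrable_powNorm hr₁ hr₃)

/-- The energy equality in the plane. -/
theorem energy_eq (hd : d = 2) {u : ℝ → HSpace O} (h : IsWeakSolution T μ β r f u₀ u)
    (hw : WeaklyContinuous T u) (hr₁ : 1 ≤ r) (hr₃ : r ≤ 3) (hT : 0 < T) (hμ : 0 < μ) (hβ : 0 < β)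
    (hf : MemLp f 2 (timeMeasure T)) {t : ℝ} (ht : t ∈ Icc 0 T) :
    energy μ β r u t = energyInput f u₀ u t := by
  have hf1 : Integrable f (timeMeasure T) := hf.integrable (by norm_num)
  have hv := h.memL2V.2
  have hp := h.integrable_powNorm hr₁ hr₃
  have hu := h.ae_embV_asV
  obtain ⟨M₀, hM₀⟩ := h.exists_ae_norm_le
  have h0 : (0 : ℝ) ∈ Icc 0 T := left_mem_Icc.2 hT.le
  have key := norm_sq_eq_add_integral_timeMeasure (ι := embVL O) (u₀ := u₀) (y := u t) (M := M₀)
    denseRange_embVL hT (integrable_add_cbfOp hr₁ hr₃ μ β hf1 hv hp)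
    (h.integrable_bound hr₁ hr₃ hf) (fun M ε hε => h.exists_bound hd hr₁ hr₃ hμ hβ M hε) hv
    (by filter_upwards [hM₀, hu] with s hs hse; rwa [embVL_apply, hse])
    (by
      filter_upwards [h.ae_inner_eq hr₁ hr₃ hT hf1, hu] with s hs hse z
      rw [embVL_apply, hse]
      exact hs z) ht (fun z => h.inner_eq hw hr₁ hr₃ hT hf1 ht z)
  have i1 : IntervalIntegrable (fun s => f s (asV (u s))) volume 0 t :=
    intervalIntegrable_of_timeMeasure (integrable_dual_apply hf hv) h0 ht
  have i2 : IntervalIntegrable (fun s => normV (u s) ^ 2) volume 0 t := by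
    have : MemLp (fun s => gradVL O (asV (u s))) 2 (timeMeasure T) := (gradVL O).comp_memLp' hv
    exact intervalIntegrable_of_timeMeasure (this.integrable_norm_pow (by norm_num)) h0 ht
  have i3 := intervalIntegrable_of_timeMeasure hp h0 ht
  have e1 : ∫ s in 0..t, powNorm (r + 1) (embV (asV (u s))) =
      ∫ s in 0..t, powNorm (r + 1) (u s) := by
    refine intervalIntegral.integral_congr_ae ?_
    have hne : ∀ᵐ s : ℝ, s ≠ T := by simp [ae_iff]
    rw [ae_restrict_iff' measurableSet_Ioo] at hu
    filter_upwards [hu, hne] with s hs hsT hsI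
    rw [uIoc_of_le ht.1] at hsI
    rw [hs ⟨hsI.1, lt_of_le_of_ne (hsI.2.trans ht.2) hsT⟩]
  have e2 : ∫ s in 0..t, (f s + cbfOp hr₁ hr₃ μ β (asV (u s))) (asV (u s)) =
      (∫ s in 0..t, f s (asV (u s))) + (-(μ * ∫ s in 0..t, normV (u s) ^ 2) -
        β * ∫ s in 0..t, powNorm (r + 1) (embV (asV (u s)))) := by
    have j1 : IntervalIntegrable (fun s => -(μ * normV (u s) ^ 2)) volume 0 t :=
      (i2.const_mul μ).neg
    have j2 : IntervalIntegrable (fun s => -(μ * normV (u s) ^ 2) -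
        β * powNorm (r + 1) (embV (asV (u s)))) volume 0 t := j1.sub (i3.const_mul β)
    rw [← intervalIntegral.integral_const_mul, ← intervalIntegral.integral_const_mul,
      ← intervalIntegral.integral_neg, ← intervalIntegral.integral_sub j1 (i3.const_mul β),
      ← intervalIntegral.integral_add i1 j2]
    refine intervalIntegral.integral_congr fun s _ => ?_
    exact congrArg (f s (asV (u s)) + ·) (cbfOp_self hr₁ hr₃ μ β (asV (u s)))
  rw [energy, energyInput, key, e2, e1]
  ring

/-- Uniqueness of weak solutions in the plane. -/
theorem ae_eq_of_two (hd : d = 2) {u₁ u₂ : ℝ → HSpace O} (h₁ : IsWeakSolution T μ β r f u₀ u₁)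
    (h₂ : IsWeakSolution T μ β r f u₀ u₂) (hr₁ : 1 ≤ r) (hr₃ : r ≤ 3) (hT : 0 < T) (hμ : 0 < μ)
    (hβ : 0 < β) (hf : MemLp f 2 (timeMeasure T)) : ∀ᵐ t ∂timeMeasure T, u₁ t = u₂ t := by
  have hf1 : Integrable f (timeMeasure T) := hf.integrable (by norm_num)
  obtain ⟨M₁, hM₁⟩ := h₁.exists_ae_norm_le
  obtain ⟨M₂, hM₂⟩ := h₂.exists_ae_norm_le
  obtain ⟨L, hL0, hL⟩ := exists_norm_embL4_sq_le_of_two (O := O) hd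
  have h0 : (0 : ℝ) ∈ Icc 0 T := left_mem_Icc.2 hT.le
  set v₁ : ℝ → VSpace O := fun s => asV (u₁ s)
  set v₂ : ℝ → VSpace O := fun s => asV (u₂ s)
  set F₁ : ℝ → StrongDual ℝ (VSpace O) := fun s => f s + cbfOp hr₁ hr₃ μ β (v₁ s)
  set F₂ : ℝ → StrongDual ℝ (VSpace O) := fun s => f s + cbfOp hr₁ hr₃ μ β (v₂ s)
  have hF₁ : Integrable F₁ (timeMeasure T) :=
    integrable_add_cbfOp hr₁ hr₃ μ β hf1 h₁.memL2V.2 (h₁.integrable_powNorm hr₁ hr₃)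
  have hF₂ : Integrable F₂ (timeMeasure T) :=
    integrable_add_cbfOp hr₁ hr₃ μ β hf1 h₂.memL2V.2 (h₂.integrable_powNorm hr₁ hr₃)
  have hF : Integrable (fun s => F₁ s - F₂ s) (timeMeasure T) := hF₁.sub hF₂
  set w : ℝ → VSpace O := fun s => v₁ s - v₂ s
  have hwm : MemLp w 2 (timeMeasure T) := h₁.memL2V.2.sub h₂.memL2V.2
  have hwM : ∀ᵐ s ∂timeMeasure T, ‖embVL O (w s)‖ ≤ M₁ + M₂ := by
    filter_upwards [hM₁, hM₂, h₁.ae_embV_asV, h₂.ae_embV_asV] with s a1 a2 a3 a4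
    change ‖embV (asV (u₁ s) - asV (u₂ s))‖ ≤ _
    rw [embV_sub, a3, a4]
    exact (norm_sub_le _ _).trans (add_le_add a1 a2)
  have hwF : ∀ᵐ s ∂timeMeasure T, ∀ z, inner ℝ (embVL O (w s)) (embVL O z) =
      inner ℝ (0 : HSpace O) (embVL O z) + ∫ τ in 0..s, (F₁ τ - F₂ τ) z := by
    filter_upwards [h₁.ae_inner_eq hr₁ hr₃ hT hf1, h₂.ae_inner_eq hr₁ hr₃ hT hf1,
      h₁.ae_embV_asV, h₂.ae_embV_asV, ae_restrict_mem measurableSet_Ioo] with s a1 a2 a3 a4 hs z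
    have hs' : s ∈ Icc 0 T := Ioo_subset_Icc_self hs
    have i1 := intervalIntegrable_dual_apply hF₁ (P := fun _ => z) continuous_const h0 hs'
    have i2 := intervalIntegrable_dual_apply hF₂ (P := fun _ => z) continuous_const h0 hs'
    change inner ℝ (embV (asV (u₁ s) - asV (u₂ s))) (embV z) = _
    rw [embV_sub, a3, a4, inner_sub_left, a1 z, a2 z, inner_zero_left, zero_add,
      add_sub_add_left_eq_sub, ← intervalIntegral.integral_sub i1 i2]
    rfl
  have hb : ∀ M ε : ℝ, 0 < ε → ∃ C : ℝ, 0 ≤ C ∧ ∀ᵐ s ∂timeMeasure T, ∀ z : VSpace O,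
      ‖embVL O z‖ ≤ M → |(F₁ s - F₂ s) z| ≤
        ε * ((‖f s‖ ^ 2 + 2 * ‖v₁ s‖ ^ 2 + powNorm (r + 1) (embV (v₁ s))) +
          (‖f s‖ ^ 2 + 2 * ‖v₂ s‖ ^ 2 + powNorm (r + 1) (embV (v₂ s)))) + C * ‖z‖ ^ 2 := by
    intro M ε hε
    obtain ⟨C₁, hC₁, H₁⟩ := h₁.exists_bound hd hr₁ hr₃ hμ hβ M hε
    obtain ⟨C₂, hC₂, H₂⟩ := h₂.exists_bound hd hr₁ hr₃ hμ hβ M hε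
    refine ⟨C₁ + C₂, by positivity, ?_⟩
    filter_upwards [H₁, H₂] with s a1 a2 z hz
    have b1 := abs_sub (F₁ s z) (F₂ s z)
    have b2 := a1 z hz
    have b3 := a2 z hz
    change |F₁ s z - F₂ s z| ≤ _
    change |F₁ s z| ≤ ε * (‖f s‖ ^ 2 + 2 * ‖v₁ s‖ ^ 2 + powNorm (r + 1) (embV (v₁ s))) + _ at b2
    change |F₂ s z| ≤ ε * (‖f s‖ ^ 2 + 2 * ‖v₂ s‖ ^ 2 + powNorm (r + 1) (embV (v₂ s))) + _ at b3
    linarith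
  -- The Gronwall kernel, integrable because one solution lies in L²(V). Its constant is what is
  -- left after the viscosity absorbs ‖∇w‖².
  set k : ℝ → ℝ := fun s => L ^ 2 * (2 * μ)⁻¹ * ‖gradV (v₁ s)‖ ^ 2
  have hk : Integrable k (timeMeasure T) := by
    have : MemLp (fun s => gradVL O (v₁ s)) 2 (timeMeasure T) := (gradVL O).comp_memLp' h₁.memL2V.2
    exact (this.integrable_norm_pow (by norm_num)).const_mul _
  set y : ℝ → ℝ := fun s => ‖embVL O (w s)‖ ^ 2
  have hym : AEStronglyMeasurable y (timeMeasure T) :=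
    (((embVL O).comp_memLp' hwm).1.norm.pow 2)
  have hky : Integrable (fun s => k s * y s) (timeMeasure T) := by
    refine (hk.mul_const ((M₁ + M₂) ^ 2)).mono' (hk.1.mul hym) ?_
    filter_upwards [hwM] with s hs
    have : 0 ≤ k s := by positivity
    rw [Real.norm_of_nonneg (by positivity)]
    exact mul_le_mul_of_nonneg_left (pow_le_pow_left₀ (norm_nonneg _) hs 2) this
  have hgi := (h₁.integrable_bound hr₁ hr₃ hf).add (h₂.integrable_bound hr₁ hr₃ hf)
  -- The force cancels. The convection terms differ by b(w, v₁, w) + b(v₂, w, w), whose second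
  -- summand is zero, and the difference of the damping terms has the favourable sign by
  -- monotonicity.
  have hpt : ∀ s, 2 * (F₁ s - F₂ s) (w s) ≤ k s * y s := by
    intro s
    have e1 : (F₁ s - F₂ s) (w s) = -(μ * ‖gradV (w s)‖ ^ 2) - convForm (w s) (v₁ s) (w s) -
        β * (dampForm hr₁ hr₃ (v₁ s) (w s) - dampForm hr₁ hr₃ (v₂ s) (w s)) := by
      have c1 : convForm (v₁ s) (v₁ s) (w s) - convForm (v₂ s) (v₂ s) (w s) =
          convForm (w s) (v₁ s) (w s) + convForm (v₂ s) (w s) (w s) := by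
        have a1 : convForm (w s) (v₁ s) = convForm (v₁ s) (v₁ s) - convForm (v₂ s) (v₁ s) :=
          convForm_sub_left _ _ _
        have a2 : convForm (v₂ s) (w s) = convForm (v₂ s) (v₁ s) - convForm (v₂ s) (v₂ s) :=
          convForm_sub_right _ _ _
        have a3 := congrArg (fun ℓ : StrongDual ℝ (VSpace O) => ℓ (w s)) a1
        have a4 := congrArg (fun ℓ : StrongDual ℝ (VSpace O) => ℓ (w s)) a2
        simp only [sub_apply] at a3 a4
        rw [a3, a4]
        ring
      rw [convForm_self, add_zero] at c1
      have c2 : inner ℝ (gradV (v₁ s)) (gradV (w s)) - inner ℝ (gradV (v₂ s)) (gradV (w s)) =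
          ‖gradV (w s)‖ ^ 2 := by
        rw [← inner_sub_left, ← gradV_sub, ← real_inner_self_eq_norm_sq]
      have c3 : (F₁ s - F₂ s) (w s) = (f s (w s) + cbfOp hr₁ hr₃ μ β (v₁ s) (w s)) -
        (f s (w s) + cbfOp hr₁ hr₃ μ β (v₂ s) (w s)) := rfl
      rw [c3, cbfOp_apply, cbfOp_apply, ← c1, ← c2]
      ring
    have m := dampForm_monotone hr₁ hr₃ (v₁ s) (v₂ s)
    have hc : |convForm (w s) (v₁ s) (w s)| ≤
        L * (‖embVL O (w s)‖ * ‖gradV (w s)‖) * ‖gradV (v₁ s)‖ := by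
      refine (abs_convForm_le _ _ _).trans ?_
      calc _ = ‖embL4 O (w s)‖ ^ 2 * ‖gradV (v₁ s)‖ := by ring
        _ ≤ _ := by gcongr; exact hL (w s)
    have hm : 0 ≤ β * (dampForm hr₁ hr₃ (v₁ s) (w s) - dampForm hr₁ hr₃ (v₂ s) (w s)) :=
      mul_nonneg hβ.le m
    have hc' := (abs_le.1 hc).1
    -- Completing the square so that exactly the available μ‖∇w‖² is consumed.
    have hsq : L * (‖embVL O (w s)‖ * ‖gradV (w s)‖) * ‖gradV (v₁ s)‖ ≤
        μ * ‖gradV (w s)‖ ^ 2 + (4 * μ)⁻¹ * (L * ‖embVL O (w s)‖ * ‖gradV (v₁ s)‖) ^ 2 := by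
      have hh : 0 ≤ μ⁻¹ * (μ * ‖gradV (w s)‖ - L * ‖embVL O (w s)‖ * ‖gradV (v₁ s)‖ / 2) ^ 2 := by
        positivity
      have he : μ⁻¹ * (μ * ‖gradV (w s)‖ - L * ‖embVL O (w s)‖ * ‖gradV (v₁ s)‖ / 2) ^ 2 =
          μ * ‖gradV (w s)‖ ^ 2 + (4 * μ)⁻¹ * (L * ‖embVL O (w s)‖ * ‖gradV (v₁ s)‖) ^ 2 -
            L * (‖embVL O (w s)‖ * ‖gradV (w s)‖) * ‖gradV (v₁ s)‖ := by
        field_simp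
        ring
      linarith
    have hk2 : k s * y s = 2 * ((4 * μ)⁻¹ * (L * ‖embVL O (w s)‖ * ‖gradV (v₁ s)‖) ^ 2) := by
      simp only [k, y]
      field_simp
      ring
    rw [hk2, e1]
    linarith
  have hFw : Integrable (fun s => (F₁ s - F₂ s) (w s)) (timeMeasure T) := by
    obtain ⟨C, -, hC⟩ := hb (M₁ + M₂) 1 one_pos
    refine ((hgi.const_mul 1).add ((hwm.integrable_norm_pow (by norm_num)).const_mul C)).mono'
      (aestronglyMeasurable_dual_apply hF.1 hwm.1) ?_
    filter_upwards [hC, hwM] with s a1 a2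
    exact a1 (w s) a2
  have hle : ∀ᵐ t ∂timeMeasure T, y t ≤ ∫ s in 0..t, k s * y s := by
    filter_upwards [hwF, ae_restrict_mem measurableSet_Ioo] with t ht htI
    have htI' : t ∈ Icc 0 T := Ioo_subset_Icc_self htI
    have key := norm_sq_eq_add_integral_timeMeasure (ι := embVL O) denseRange_embVL hT hF hgi hb
      hwm hwM hwF htI' ht
    change ‖embVL O (w t)‖ ^ 2 ≤ _
    rw [key, norm_zero, zero_pow (by norm_num), zero_add, ← intervalIntegral.integral_const_mul]
    exact intervalIntegral.integral_mono htI.1.le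
      ((intervalIntegrable_of_timeMeasure hFw h0 htI').const_mul 2)
      (intervalIntegrable_of_timeMeasure hky h0 htI') hpt
  have hTT : T ∈ Icc 0 T := right_mem_Icc.2 hT.le
  have hy0 := ae_eq_zero_of_le_integral (y := y) (k := k) hT.le (fun t => by positivity)
    (fun t => by positivity) (intervalIntegrable_of_timeMeasure hk h0 hTT)
    (intervalIntegrable_of_timeMeasure hky h0 hTT) hle
  filter_upwards [hy0, h₁.ae_embV_asV, h₂.ae_embV_asV] with s a1 a2 a3
  have : embV (asV (u₁ s) - asV (u₂ s)) = 0 := norm_eq_zero.1 (pow_eq_zero_iff (two_ne_zero) |>.1 a1)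
  rwa [embV_sub, a2, a3, sub_eq_zero] at this

end IsWeakSolution

end CBF

/-! ### Continuity of the tested nonlinear terms with respect to the norm of H. -/

namespace CBF

variable {d : ℕ} {O : Set (Vec d)} [Admissible O]

/-- Approximation by test fields in V is also approximation in L⁴, hence in L^p for p ≤ 4 on a
bounded domain. For elements of V the membership in L̃^{r+1} is thus automatic. -/
theorem memLtilde_embV {p : ℝ} (hp₁ : 1 ≤ p) (hp : p ≤ 4) (v : VSpace O) :
    MemLtilde p (embV v) := by
  intro ε hε
  have hp4 : ENNReal.ofReal p ≤ 4 := by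
    rw [show (4 : ℝ≥0∞) = ENNReal.ofReal 4 by norm_num]
    exact ENNReal.ofReal_le_ofReal hp
  set K : ℝ≥0∞ := volOn O univ ^ (1 / (ENNReal.ofReal p).toReal - 1 / (4 : ℝ≥0∞).toReal)
  have hK : K ≠ ⊤ := by
    refine ENNReal.rpow_ne_top_of_nonneg ?_ (measure_ne_top _ _)
    rw [ENNReal.toReal_ofReal (by linarith), ENNReal.toReal_ofNat, sub_nonneg]
    exact one_div_le_one_div_of_le (by linarith) hp
  have hc : Tendsto (fun w : VSpace O => ENNReal.ofReal ‖embL4 O (v - w)‖ * K) (𝓝 v) (𝓝 0) := by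
    have h1 : Continuous fun w : VSpace O => ENNReal.ofReal ‖embL4 O (v - w)‖ :=
      ENNReal.continuous_ofReal.comp (by fun_prop)
    have h2 := ENNReal.Tendsto.mul_const (b := K) (h1.tendsto v) (Or.inr hK)
    simpa using h2
  obtain ⟨φ, hφ⟩ := (denseRange_testToV (O := O)).exists_mem_open isOpen_interior
    ⟨v, mem_interior_iff_mem_nhds.2 (hc.eventually (gt_mem_nhds hε))⟩
  have hφ' : ENNReal.ofReal ‖embL4 O (v - testToV φ)‖ * K < ε :=
    mem_ofPred.1 (interior_subset (s := {w : VSpace O | ENNReal.ofReal ‖embL4 O (v - w)‖ * K < ε}) hφ)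
  refine ⟨φ, lt_of_le_of_lt ?_ hφ'⟩
  have hae : field (embV v) - (φ : Vec d → Vec d) =ᵐ[volOn O] embL4 O (v - testToV φ) := by
    rw [map_sub]
    filter_upwards [Lp.coeFn_sub (embL4 O v) (embL4 O (testToV φ)), coeFn_embL4 v,
      coeFn_embL4 (testToV φ), coeFn_testToV φ] with x h1 h2 h3 h4
    rw [h1, Pi.sub_apply, Pi.sub_apply, h2, h3, h4]
  rw [eLpNorm_congr_ae hae]
  refine (eLpNorm_le_eLpNorm_mul_rpow_measure_univ hp4 (Lp.aestronglyMeasurable _)).trans ?_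
  rw [← Lp.enorm_def, ← ofReal_norm]

theorem integral_norm_mul_norm_le (v w : VSpace O) :
    ∫ x in O, ‖field (embV v) x‖ * ‖field (embV w) x‖ ≤ ‖embV v‖ * ‖embV w‖ := by
  have h2 : ∀ v : VSpace O, MemLp (field (embV v)) 2 (volOn O) := fun v => Lp.memLp _
  have h := integral_mul_le_Lp_mul_Lq_of_nonneg (μ := volOn O) Real.HolderConjugate.two_two
    (f := fun x => ‖field (embV v) x‖) (g := fun x => ‖field (embV w) x‖)
    (ae_of_all _ fun _ => norm_nonneg _) (ae_of_all _ fun _ => norm_nonneg _)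
    (by simpa using (h2 v).norm) (by simpa using (h2 w).norm)
  refine h.trans (le_of_eq ?_)
  simp only [Real.rpow_two, ← norm_embV_sq]
  rw [← Real.sqrt_eq_rpow, ← Real.sqrt_eq_rpow, Real.sqrt_sq (norm_nonneg _),
    Real.sqrt_sq (norm_nonneg _)]

theorem exists_norm_le_of_hasCompactSupport {X E : Type*} [TopologicalSpace X]
    [NormedAddCommGroup E] {g : X → E} (hg : Continuous g) (hc : HasCompactSupport g) :
    ∃ K : ℝ, 0 ≤ K ∧ ∀ x, ‖g x‖ ≤ K := by
  obtain ⟨K, hK⟩ := hc.exists_bound_of_continuous hg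
  exact ⟨max K 0, le_max_right _ _, fun x => (hK x).trans (le_max_left _ _)⟩

/-- The gradient of a test field is bounded, so only L² norms of the other two factors remain. This
is why strong convergence in H suffices for the convection. -/
theorem exists_abs_convForm_test_le (φ : divFreeTest O) : ∃ K : ℝ, 0 ≤ K ∧ ∀ v w : VSpace O,
    |convForm v (testToV φ) w| ≤ K * (‖embV v‖ * ‖embV w‖) := by
  obtain ⟨K, hK0, hK⟩ := exists_norm_le_of_hasCompactSupport (continuous_classicalGrad φ.2.1)
    (hasCompactSupport_classicalGrad φ.2.2.1)
  refine ⟨K, hK0, fun v w => ?_⟩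
  have hi : Integrable (fun x => ‖field (embV v) x‖ * ‖field (embV w) x‖) (volOn O) :=
    (((memLp_field_four v).mono_exponent (p := 2) (by norm_num)).norm).integrable_mul
      (((memLp_field_four w).mono_exponent (p := 2) (by norm_num)).norm)
  refine le_trans ?_ (mul_le_mul_of_nonneg_left (integral_norm_mul_norm_le v w) hK0)
  rw [convForm_apply, ← integral_const_mul, ← Real.norm_eq_abs]
  refine norm_integral_le_of_norm_le (hi.const_mul K) ?_
  filter_upwards [coeFn_grad_testToV φ] with x hx
  have e : ∑ i, ∑ j, field (embV v) x i * gradV (testToV φ) x (i, j) * field (embV w) x j =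
      inner ℝ (gradV (testToV φ) x) (outer d (field (embV v) x) (field (embV w) x)) := by
    rw [PiLp.inner_apply, ← Finset.univ_product_univ, Finset.sum_product]
    refine Finset.sum_congr rfl fun i _ => Finset.sum_congr rfl fun j _ => ?_
    rw [outer_apply, Real.inner_apply]
    ring
  rw [e, hx]
  refine (norm_inner_le_norm _ _).trans ?_
  rw [norm_outer]
  exact mul_le_mul_of_nonneg_right (hK x) (by positivity)

/-- Continuity of the convection term in the norm of `H`, when tested with a test field. -/
theorem exists_abs_convForm_sub_le (φ : divFreeTest O) : ∃ K : ℝ, 0 ≤ K ∧ ∀ v w : VSpace O,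
    |convForm v v (testToV φ) - convForm w w (testToV φ)| ≤
      K * (‖embV v - embV w‖ * (‖embV v‖ + ‖embV w‖)) := by
  obtain ⟨K, hK0, hK⟩ := exists_abs_convForm_test_le φ
  refine ⟨K, hK0, fun v w => ?_⟩
  have h1 := hK (v - w) v
  have h2 := hK w (v - w)
  rw [embV_sub] at h1 h2
  -- The derivative is moved to φ in both terms before the bilinear difference is split.
  have e : convForm v v (testToV φ) - convForm w w (testToV φ) =
      -(convForm (v - w) (testToV φ) v + convForm w (testToV φ) (v - w)) := by
    rw [convForm_antisymm v v, convForm_antisymm w w, convForm_sub_left, map_sub, sub_apply]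
    ring
  rw [e, abs_neg]
  refine (abs_add_le _ _).trans ((add_le_add h1 h2).trans (le_of_eq (by ring)))

/-- Young's inequality separates the weight (|a| + |b|)^{r-1} from |a - b|. Its square is controlled
by 1 + (|a| + |b|)^{r+1} because 2(r - 1) ≤ r + 1 when r ≤ 3, so the weight is paid by the bounded
energies; 16 = 2⁴ bounds 2^{r+1}. -/
theorem powMap_sub_le_of_pos {r ε : ℝ} (hr₁ : 1 ≤ r) (hr₃ : r ≤ 3) (hε : 0 < ε) (a b : Vec d) :
    ‖powMap r a - powMap r b‖ ≤
      3 * (ε * (1 + 16 * (‖a‖ ^ (r + 1) + ‖b‖ ^ (r + 1))) + ε⁻¹ * ‖a - b‖ ^ 2) := by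
  refine (norm_powMap_sub_le hr₁ hr₃ a b).trans ?_
  have n1 := norm_nonneg a
  have n2 := norm_nonneg b
  set X := ‖a‖ + ‖b‖
  have hX : 0 ≤ X := by positivity
  have h1 : X ^ (r - 1) * ‖a - b‖ ≤ ε * (X ^ (r - 1)) ^ 2 + ε⁻¹ * ‖a - b‖ ^ 2 :=
    mul_le_mul_sq_add hε
  have h2 : (X ^ (r - 1)) ^ 2 ≤ 1 + X ^ (r + 1) := by
    rw [← Real.rpow_natCast, ← Real.rpow_mul hX]
    have := Real.rpow_nonneg hX (r + 1)
    rcases le_total X 1 with h | h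
    · have := Real.rpow_le_one hX h (show 0 ≤ (r - 1) * (2 : ℕ) by push_cast; linarith)
      linarith
    · have := Real.rpow_le_rpow_of_exponent_le h (show (r - 1) * (2 : ℕ) ≤ r + 1 by
        push_cast; linarith)
      linarith
  have h3 : X ^ (r + 1) ≤ 16 * (‖a‖ ^ (r + 1) + ‖b‖ ^ (r + 1)) := by
    have key : ∀ m : ℝ, 0 ≤ m → X ≤ 2 * m → X ^ (r + 1) ≤ 16 * m ^ (r + 1) := by
      intro m hm hXm
      refine (Real.rpow_le_rpow hX hXm (by linarith)).trans ?_
      rw [Real.mul_rpow (by norm_num) hm]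
      gcongr
      refine (Real.rpow_le_rpow_of_exponent_le (by norm_num) (show r + 1 ≤ (4 : ℕ) by
        push_cast; linarith)).trans ?_
      rw [Real.rpow_natCast]
      norm_num
    have p1 := Real.rpow_nonneg n1 (r + 1)
    have p2 := Real.rpow_nonneg n2 (r + 1)
    rcases le_total ‖a‖ ‖b‖ with h | h
    · have := key ‖b‖ n2 (by simp only [X]; linarith)
      linarith
    · have := key ‖a‖ n1 (by simp only [X]; linarith)
      linarith
  have h4 : ε * (X ^ (r - 1)) ^ 2 ≤ ε * (1 + 16 * (‖a‖ ^ (r + 1) + ‖b‖ ^ (r + 1))) := by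
    gcongr
    linarith
  rw [mul_assoc]
  refine mul_le_mul_of_nonneg_left ?_ (by norm_num)
  linarith

/-- Continuity of the damping term in the norm of `H`, when tested with a test field. -/
theorem exists_abs_dampForm_sub_le {r : ℝ} (hr₁ : 1 ≤ r) (hr₃ : r ≤ 3) (φ : divFreeTest O) :
    ∃ K : ℝ, 0 ≤ K ∧ ∀ ε : ℝ, 0 < ε → ∀ v w : VSpace O,
      |dampForm hr₁ hr₃ v (testToV φ) - dampForm hr₁ hr₃ w (testToV φ)| ≤
        K * (ε * (1 + powNorm (r + 1) (embV v) + powNorm (r + 1) (embV w)) +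
          ε⁻¹ * ‖embV v - embV w‖ ^ 2) := by
  obtain ⟨S, hS0, hS⟩ := exists_norm_le_of_hasCompactSupport φ.2.1.continuous φ.2.2.1
  set m : ℝ := (volOn O).real univ
  have hm : 0 ≤ m := measureReal_nonneg
  refine ⟨S * 3 * (16 + m), by positivity, fun ε hε v w => ?_⟩
  have iv := integrable_powNorm hr₁ hr₃ v
  have iw := integrable_powNorm hr₁ hr₃ w
  have iD : Integrable (fun x => ‖field (embV (v - w)) x‖ ^ 2) (volOn O) :=
    ((memLp_field_four (v - w)).mono_exponent (p := 2) (by norm_num)).integrable_norm_pow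
      (by norm_num)
  have i0 : Integrable (fun x => 16 * (‖field (embV v) x‖ ^ (r + 1) +
      ‖field (embV w) x‖ ^ (r + 1))) (volOn O) := (iv.add iw).const_mul 16
  have i1 : Integrable (fun x => 1 + 16 * (‖field (embV v) x‖ ^ (r + 1) +
      ‖field (embV w) x‖ ^ (r + 1))) (volOn O) := (integrable_const 1).add i0
  have i2 : Integrable (fun x => ε * (1 + 16 * (‖field (embV v) x‖ ^ (r + 1) +
      ‖field (embV w) x‖ ^ (r + 1))) + ε⁻¹ * ‖field (embV (v - w)) x‖ ^ 2) (volOn O) :=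
    (i1.const_mul ε).add (iD.const_mul _)
  have e1 : dampForm hr₁ hr₃ v (testToV φ) - dampForm hr₁ hr₃ w (testToV φ) =
      ∫ x in O, inner ℝ (powMap r (field (embV v) x) - powMap r (field (embV w) x))
        (field (embV (testToV φ)) x) := by
    rw [dampForm_apply, dampForm_apply, ← integral_sub (integrable_dampForm hr₁ hr₃ _ _)
      (integrable_dampForm hr₁ hr₃ _ _)]
    simp only [inner_sub_left]
  have e2 : ∫ x in O, S * (3 * (ε * (1 + 16 * (‖field (embV v) x‖ ^ (r + 1) +
      ‖field (embV w) x‖ ^ (r + 1))) + ε⁻¹ * ‖field (embV (v - w)) x‖ ^ 2)) =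
      S * (3 * (ε * (m + 16 * (powNorm (r + 1) (embV v) + powNorm (r + 1) (embV w))) +
        ε⁻¹ * ‖embV v - embV w‖ ^ 2)) := by
    rw [integral_const_mul, integral_const_mul, integral_add (i1.const_mul ε) (iD.const_mul _),
      integral_const_mul, integral_const_mul, ← norm_embV_sq, embV_sub,
      integral_add (integrable_const 1) i0, integral_const_mul,
      integral_add iv iw, integral_const, smul_eq_mul, mul_one]
    rfl
  have h1 : |dampForm hr₁ hr₃ v (testToV φ) - dampForm hr₁ hr₃ w (testToV φ)| ≤
      S * (3 * (ε * (m + 16 * (powNorm (r + 1) (embV v) + powNorm (r + 1) (embV w))) +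
        ε⁻¹ * ‖embV v - embV w‖ ^ 2)) := by
    rw [e1, ← e2, ← Real.norm_eq_abs]
    refine norm_integral_le_of_norm_le ((i2.const_mul 3).const_mul S) ?_
    have hsub : field (embV (v - w)) =ᵐ[volOn O] fun x => field (embV v) x - field (embV w) x := by
      rw [embV_sub]
      exact Lp.coeFn_sub (embV v).toL2 (embV w).toL2
    filter_upwards [coeFn_testToV φ, hsub] with x hx hxs
    refine (norm_inner_le_norm _ _).trans ?_
    rw [hx, hxs, mul_comm]
    exact mul_le_mul (hS x) (powMap_sub_le_of_pos hr₁ hr₃ hε _ _) (norm_nonneg _) hS0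
  refine h1.trans ?_
  have p1 := powNorm_nonneg (r + 1) (embV v)
  have p2 := powNorm_nonneg (r + 1) (embV w)
  have h2 : ε * (m + 16 * (powNorm (r + 1) (embV v) + powNorm (r + 1) (embV w))) +
      ε⁻¹ * ‖embV v - embV w‖ ^ 2 ≤ (16 + m) * (ε * (1 + powNorm (r + 1) (embV v) +
        powNorm (r + 1) (embV w)) + ε⁻¹ * ‖embV v - embV w‖ ^ 2) := by
    have q1 : 0 ≤ ε⁻¹ * ‖embV v - embV w‖ ^ 2 := by positivity
    have q2 : 0 ≤ m * powNorm (r + 1) (embV v) := by positivity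
    have q3 : 0 ≤ m * powNorm (r + 1) (embV w) := by positivity
    have q4 : m + 16 * (powNorm (r + 1) (embV v) + powNorm (r + 1) (embV w)) ≤
      (16 + m) * (1 + powNorm (r + 1) (embV v) + powNorm (r + 1) (embV w)) := by nlinarith
    have q5 := mul_le_mul_of_nonneg_left q4 hε.le
    have q6 : 0 ≤ m * (ε⁻¹ * ‖embV v - embV w‖ ^ 2) := by positivity
    nlinarith
  calc _ ≤ S * (3 * ((16 + m) * (ε * (1 + powNorm (r + 1) (embV v) +
        powNorm (r + 1) (embV w)) + ε⁻¹ * ‖embV v - embV w‖ ^ 2))) := by gcongr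
    _ = _ := by ring

end CBF

/-! ### Mollification and an inequality of Ehrling type. -/

namespace CBF

theorem enorm_integral_sq_le {α E : Type*} {m : MeasurableSpace α} {ν : Measure α}
    [IsProbabilityMeasure ν] [NormedAddCommGroup E] [NormedSpace ℝ E] {g : α → E}
    (hg : AEStronglyMeasurable g ν) :
    ‖∫ y, g y ∂ν‖ₑ ^ (2 : ℝ) ≤ ∫⁻ y, ‖g y‖ₑ ^ (2 : ℝ) ∂ν := by
  have h1 : ‖∫ y, g y ∂ν‖ₑ ≤ eLpNorm g 2 ν := by
    refine (enorm_integral_le_lintegral_enorm g).trans ?_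
    rw [← eLpNorm_one_eq_lintegral_enorm]
    exact eLpNorm_le_eLpNorm_of_exponent_le (by norm_num) hg
  refine (ENNReal.rpow_le_rpow h1 (by norm_num)).trans (le_of_eq ?_)
  rw [eLpNorm_eq_lintegral_rpow_enorm_toReal (by norm_num) (by norm_num), ← ENNReal.rpow_mul]
  norm_num

/-- Translations of a smooth function are controlled in `L²` by its derivative. -/
theorem lintegral_translate_sub_sq_le {d : ℕ} {E : Type*} [NormedAddCommGroup E] [NormedSpace ℝ E]
    [CompleteSpace E] {φ : Vec d → E} (hφ : ContDiff ℝ 1 φ) (y : Vec d) :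
    ∫⁻ x, ‖φ x - φ (x - y)‖ₑ ^ (2 : ℝ) ≤
      ‖y‖ₑ ^ (2 : ℝ) * ∫⁻ x, ‖fderiv ℝ φ x‖ₑ ^ (2 : ℝ) := by
  have hD : Continuous (fderiv ℝ φ) := hφ.continuous_fderiv (by simp)
  set ν : Measure ℝ := volume.restrict (Ioc 0 1)
  have : IsProbabilityMeasure ν := ⟨by simp [ν]⟩
  have h1 : ∀ x, ‖φ x - φ (x - y)‖ₑ ^ (2 : ℝ) ≤
      ∫⁻ s, ‖fderiv ℝ φ (x - y + s • y) y‖ₑ ^ (2 : ℝ) ∂ν := by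
    intro x
    have hd : ∀ s ∈ uIcc (0 : ℝ) 1, HasDerivAt (fun s : ℝ => φ (x - y + s • y))
        (fderiv ℝ φ (x - y + s • y) y) s := by
      intro s _
      have a1 : HasDerivAt (fun s : ℝ => x - y + s • y) y s := by
        simpa using ((hasDerivAt_id s).smul_const y).const_add (x - y)
      exact (hφ.differentiable (by simp) _).hasFDerivAt.comp_hasDerivAt s a1
    have hc : Continuous fun s : ℝ => fderiv ℝ φ (x - y + s • y) y := by fun_prop
    have e := intervalIntegral.integral_eq_sub_of_hasDerivAt hd (hc.intervalIntegrable 0 1)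
    rw [one_smul, sub_add_cancel, zero_smul, add_zero,
      intervalIntegral.integral_of_le zero_le_one] at e
    rw [← e]
    exact enorm_integral_sq_le hc.aestronglyMeasurable
  refine (lintegral_mono h1).trans ?_
  have hm : Measurable (Function.uncurry fun (x : Vec d) (s : ℝ) =>
      ‖fderiv ℝ φ (x - y + s • y) y‖ₑ ^ (2 : ℝ)) := by
    have : Continuous fun p : Vec d × ℝ => fderiv ℝ φ (p.1 - y + p.2 • y) y := by fun_prop
    exact (this.enorm.measurable.pow_const _)
  rw [lintegral_lintegral_swap hm.aemeasurable]
  have h2 : ∀ s : ℝ, ∫⁻ x, ‖fderiv ℝ φ (x - y + s • y) y‖ₑ ^ (2 : ℝ) ≤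
      ‖y‖ₑ ^ (2 : ℝ) * ∫⁻ x, ‖fderiv ℝ φ x‖ₑ ^ (2 : ℝ) := by
    intro s
    have a1 : ∀ x, ‖fderiv ℝ φ (x - y + s • y) y‖ₑ ^ (2 : ℝ) ≤
        ‖y‖ₑ ^ (2 : ℝ) * ‖fderiv ℝ φ (x + (s • y - y))‖ₑ ^ (2 : ℝ) := by
      intro x
      rw [← ENNReal.mul_rpow_of_nonneg _ _ (by norm_num), mul_comm,
        show x + (s • y - y) = x - y + s • y by abel]
      exact ENNReal.rpow_le_rpow ((fderiv ℝ φ _).le_opENorm y) (by norm_num)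
    refine (lintegral_mono a1).trans (le_of_eq ?_)
    rw [lintegral_const_mul _ (by fun_prop),
      lintegral_add_right_eq_self (fun x => ‖fderiv ℝ φ x‖ₑ ^ (2 : ℝ))]
  refine (lintegral_mono h2).trans (le_of_eq ?_)
  rw [lintegral_const, measure_univ, mul_one]

variable {d : ℕ} {O : Set (Vec d)} [Admissible O]

theorem integrable_field (w : HSpace O) : Integrable (field w) (volOn O) :=
  (Lp.memLp w.toL2).integrable (by norm_num)

theorem integral_norm_field_le (w : HSpace O) :
    ∫ x in O, ‖field w x‖ ≤ (volOn O univ).toReal ^ ((1 : ℝ) / 2) * ‖w‖ := by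
  have h1 := eLpNorm_le_eLpNorm_mul_rpow_measure_univ (μ := volOn O) (p := 1) (q := 2)
    (f := field w) (by norm_num) (Lp.aestronglyMeasurable _)
  have h2 : eLpNorm (field w) 2 (volOn O) = ENNReal.ofReal ‖w‖ := by
    change _ = ENNReal.ofReal ‖w.toL2‖
    rw [ofReal_norm, Lp.enorm_def]
    rfl
  rw [h2, eLpNorm_one_eq_lintegral_enorm] at h1
  rw [integral_norm_eq_lintegral_enorm (integrable_field w).1]
  refine (ENNReal.toReal_mono (ENNReal.mul_ne_top ENNReal.ofReal_ne_top
    (ENNReal.rpow_ne_top_of_nonneg (by norm_num) (measure_ne_top _ _))) h1).trans (le_of_eq ?_)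
  rw [ENNReal.toReal_mul, ENNReal.toReal_ofReal (norm_nonneg _), ← ENNReal.toReal_rpow]
  norm_num
  ring

variable (k : ContDiffBump (0 : Vec d))

/-- A bound for the mollifying kernel. -/
def kernelBound : ℝ :=
  1 / (volume : Measure (Vec d)).real (Metric.closedBall 0 k.rIn)

theorem norm_kernel_smul_le {E : Type*} [NormedAddCommGroup E] [NormedSpace ℝ E] (x : Vec d)
    (a : E) : ‖k.normed volume x • a‖ ≤ kernelBound k * ‖a‖ := by
  rw [norm_smul, Real.norm_of_nonneg (k.nonneg_normed x)]
  exact mul_le_mul_of_nonneg_right (k.normed_le_div_measure_closedBall_rIn volume x) (norm_nonneg _)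

theorem integrable_kernel_smul (w : HSpace O) (x : Vec d) :
    Integrable (fun y => k.normed volume (x - y) • field w y) (volOn O) := by
  refine ((integrable_field w).norm.const_mul (kernelBound k)).mono' ?_
    (ae_of_all _ fun y => norm_kernel_smul_le k _ _)
  exact (k.continuous_normed.comp (continuous_const.sub continuous_id)).aestronglyMeasurable.smul
    (integrable_field w).1

/-- The mollification of the extension by zero of a field, evaluated at a point. -/
def mollify (x : Vec d) : HSpace O →L[ℝ] Vec d :=
  LinearMap.mkContinuous
    { toFun := fun w => ∫ y in O, k.normed volume (x - y) • field w y
      map_add' := fun w w' => by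
        rw [← integral_add (integrable_kernel_smul k w x) (integrable_kernel_smul k w' x)]
        refine integral_congr_ae ?_
        filter_upwards [Lp.coeFn_add w.toL2 w'.toL2] with y hy
        rw [← smul_add]
        exact congrArg _ hy
      map_smul' := fun c w => by
        rw [RingHom.id_apply, ← integral_smul]
        refine integral_congr_ae ?_
        filter_upwards [Lp.coeFn_smul c w.toL2] with y hy
        rw [smul_comm]
        exact congrArg _ hy }
    (kernelBound k * (volOn O univ).toReal ^ ((1 : ℝ) / 2)) fun w => by
      refine (norm_integral_le_of_norm_le ((integrable_field w).norm.const_mul (kernelBound k))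
        (ae_of_all _ fun y => norm_kernel_smul_le k _ _)).trans ?_
      rw [integral_const_mul, mul_assoc]
      refine mul_le_mul_of_nonneg_left (integral_norm_field_le w) ?_
      unfold kernelBound
      positivity

theorem mollify_apply (x : Vec d) (w : HSpace O) :
    mollify k x w = ∫ y in O, k.normed volume (x - y) • field w y := rfl

theorem exists_norm_mollify_le : ∃ C : ℝ, 0 ≤ C ∧ ∀ (x : Vec d) (w : HSpace O),
    ‖mollify k x w‖ ≤ C * ‖w‖ := by
  have h0 : 0 ≤ kernelBound k * (volOn O univ).toReal ^ ((1 : ℝ) / 2) := by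
    unfold kernelBound
    positivity
  exact ⟨_, h0, fun x w => ContinuousLinearMap.le_of_opNorm_le _
    (LinearMap.mkContinuous_norm_le _ h0 _) w⟩

theorem continuous_mollify (w : HSpace O) : Continuous fun x => mollify k x w := by
  simp only [mollify_apply]
  refine continuous_of_dominated (fun x => (integrable_kernel_smul k w x).1)
    (fun x => ae_of_all _ fun y => norm_kernel_smul_le k _ _)
    ((integrable_field w).norm.const_mul (kernelBound k)) (ae_of_all _ fun y => ?_)
  exact (k.continuous_normed.comp (continuous_id.sub continuous_const)).smul continuous_const

/-- The square of the `L²(O)` norm of the mollification. -/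
def mollifySq (w : HSpace O) : ℝ := ∫ x in O, ‖mollify k x w‖ ^ 2

theorem continuous_mollifySq : Continuous (mollifySq (O := O) k) := by
  obtain ⟨C, hC0, hC⟩ := exists_norm_mollify_le (O := O) k
  refine continuous_iff_continuousAt.2 fun w₀ => ?_
  refine continuousAt_of_dominated (bound := fun _ => (C * (‖w₀‖ + 1)) ^ 2)
    (Eventually.of_forall fun w => ((continuous_mollify k w).norm.pow 2).aestronglyMeasurable) ?_
    (integrable_const _)
    (ae_of_all _ fun x => (((mollify k x).continuous.norm.pow 2)).continuousAt)
  filter_upwards [Metric.ball_mem_nhds w₀ one_pos] with w hw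
  refine ae_of_all _ fun x => ?_
  rw [Real.norm_of_nonneg (by positivity)]
  refine pow_le_pow_left₀ (norm_nonneg _) ((hC x w).trans ?_) 2
  refine mul_le_mul_of_nonneg_left ?_ hC0
  have := norm_le_norm_add_norm_sub' w w₀
  rw [Metric.mem_ball, dist_eq_norm] at hw
  linarith

theorem exists_mollifySq_le : ∃ C : ℝ, 0 ≤ C ∧ ∀ w : HSpace O, mollifySq k w ≤ C * ‖w‖ ^ 2 := by
  obtain ⟨C, hC0, hC⟩ := exists_norm_mollify_le (O := O) k
  refine ⟨C ^ 2 * (volOn O).real univ, by positivity, fun w => ?_⟩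
  have h := norm_integral_le_of_norm_le_const (μ := volOn O) (f := fun x => ‖mollify k x w‖ ^ 2)
    (C := (C * ‖w‖) ^ 2) (ae_of_all _ fun x => by
      rw [Real.norm_of_nonneg (by positivity)]
      exact pow_le_pow_left₀ (norm_nonneg _) (hC x w) 2)
  refine (le_abs_self _).trans (h.trans (le_of_eq (by ring)))

/-- Weakly null sequences have strongly null mollifications. -/
theorem tendsto_mollifySq {w : ℕ → HSpace O} {M : ℝ} (hM : ∀ n, ‖w n‖ ≤ M)
    (hw : ∀ z, Tendsto (fun n => inner ℝ (w n) z) atTop (𝓝 0)) :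
    Tendsto (fun n => mollifySq k (w n)) atTop (𝓝 0) := by
  obtain ⟨C, hC0, hC⟩ := exists_norm_mollify_le (O := O) k
  have h : Tendsto (fun n => mollifySq k (w n)) atTop (𝓝 (∫ _ in O, (0 : ℝ))) := by
    refine tendsto_integral_of_dominated_convergence (fun _ => (C * M) ^ 2)
      (fun n => ((continuous_mollify k (w n)).norm.pow 2).aestronglyMeasurable)
      (integrable_const _) (fun n => ae_of_all _ fun x => ?_) (ae_of_all _ fun x => ?_)
    · rw [Real.norm_of_nonneg (by positivity)]
      exact pow_le_pow_left₀ (norm_nonneg _)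
        ((hC x _).trans (mul_le_mul_of_nonneg_left (hM n) hC0)) 2
    -- At each point x the components of the mollification are continuous linear functionals on H,
    -- so weak convergence gives pointwise convergence; the uniform bound allows dominated
    -- convergence.
    · have h1 : Tendsto (fun n => mollify k x (w n)) atTop (𝓝 0) := by
        rw [(EuclideanSpace.equiv (Fin d) ℝ).toHomeomorph.isInducing.tendsto_nhds_iff,
          tendsto_pi_nhds]
        intro i
        have h2 := hw ((InnerProductSpace.toDual ℝ (HSpace O)).symm
          ((EuclideanSpace.proj (𝕜 := ℝ) i).comp (mollify k x)))
        refine h2.congr fun n => ?_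
        rw [real_inner_comm, InnerProductSpace.toDual_symm_apply]
        rfl
      simpa using (h1.norm.pow 2)
  simpa using h

theorem mollify_test (φ : divFreeTest O) (x : Vec d) : mollify k x (testToH φ) =
    ∫ y, k.normed volume y • (φ : Vec d → Vec d) (x - y) := by
  have h1 : mollify k x (testToH φ) =
      ∫ y in O, k.normed volume (x - y) • (φ : Vec d → Vec d) y := by
    rw [mollify_apply]
    refine integral_congr_ae ?_
    filter_upwards [coeFn_testToV φ] with y hy
    exact congrArg _ hy
  have hz : ∀ x, x ∉ O → (φ : Vec d → Vec d) x = 0 := fun x hx =>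
    image_eq_zero_of_notMem_tsupport fun h => hx (φ.2.2.2.1 h)
  rw [h1, setIntegral_eq_integral_of_forall_compl_eq_zero (fun y hy => by rw [hz y hy, smul_zero]),
    ← integral_sub_left_eq_self _ volume x]
  simp only [sub_sub_cancel]

/-- The difference is the mean of φ(x) - φ(x - y) over the probability measure with density the
kernel. Jensen's inequality and Tonelli reduce it to translations by vectors y of length at most the
outer radius. -/
theorem lintegral_sub_mollify_test_le (φ : divFreeTest O) :
    ∫⁻ x, ‖(φ : Vec d → Vec d) x - mollify k x (testToH φ)‖ₑ ^ (2 : ℝ) ≤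
      ENNReal.ofReal k.rOut ^ (2 : ℝ) *
        ∫⁻ x, ‖fderiv ℝ (φ : Vec d → Vec d) x‖ₑ ^ (2 : ℝ) := by
  have hφ := φ.2.1
  have hρ : Continuous (k.normed (volume : Measure (Vec d))) := k.continuous_normed
  have hρm : Measurable fun y => ENNReal.ofReal (k.normed (volume : Measure (Vec d)) y) :=
    (ENNReal.continuous_ofReal.comp hρ).measurable
  set ν : Measure (Vec d) := volume.withDensity fun y => ENNReal.ofReal (k.normed volume y)
  have hν : IsProbabilityMeasure ν := ⟨by
    rw [withDensity_apply _ MeasurableSet.univ, Measure.restrict_univ,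
      ← ofReal_integral_eq_lintegral_ofReal k.integrable_normed
        (ae_of_all _ fun y => k.nonneg_normed y), k.integral_normed, ENNReal.ofReal_one]⟩
  have hνI : ∀ g : Vec d → Vec d, ∫ y, g y ∂ν = ∫ y, k.normed volume y • g y := by
    intro g
    rw [integral_withDensity_eq_integral_toReal_smul hρm (ae_of_all _ fun _ => ENNReal.ofReal_lt_top)]
    simp only [ENNReal.toReal_ofReal (k.nonneg_normed _)]
  have hνs : ∀ᵐ y ∂ν, ‖y‖ₑ ≤ ENNReal.ofReal k.rOut := by
    rw [ae_withDensity_iff hρm]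
    refine ae_of_all _ fun y hy => ?_
    have : y ∈ Function.support (k.normed (volume : Measure (Vec d))) := fun h => hy (by simp [h])
    rw [k.support_normed_eq, Metric.mem_ball, dist_zero_right] at this
    rw [← ofReal_norm]
    exact ENNReal.ofReal_le_ofReal this.le
  have hi : ∀ x, Integrable (fun y => (φ : Vec d → Vec d) (x - y)) ν := by
    intro x
    obtain ⟨K, hK0, hK⟩ := exists_norm_le_of_hasCompactSupport hφ.continuous φ.2.2.1
    exact (integrable_const K).mono'
      (hφ.continuous.comp (continuous_const.sub continuous_id)).aestronglyMeasurable
      (ae_of_all _ fun y => hK _)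
  have e1 : ∀ x, (φ : Vec d → Vec d) x - mollify k x (testToH φ) =
      ∫ y, ((φ : Vec d → Vec d) x - (φ : Vec d → Vec d) (x - y)) ∂ν := by
    intro x
    rw [integral_sub (integrable_const _) (hi x), hνI (fun y => (φ : Vec d → Vec d) (x - y)),
      mollify_test]
    simp
  have e2 : ∀ x, ‖(φ : Vec d → Vec d) x - mollify k x (testToH φ)‖ₑ ^ (2 : ℝ) ≤
      ∫⁻ y, ‖(φ : Vec d → Vec d) x - (φ : Vec d → Vec d) (x - y)‖ₑ ^ (2 : ℝ) ∂ν := by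
    intro x
    rw [e1]
    exact enorm_integral_sq_le ((integrable_const _).sub (hi x)).1
  refine (lintegral_mono e2).trans ?_
  have hm : Measurable (Function.uncurry fun (x y : Vec d) =>
      ‖(φ : Vec d → Vec d) x - (φ : Vec d → Vec d) (x - y)‖ₑ ^ (2 : ℝ)) := by
    have := hφ.continuous
    have : Continuous fun p : Vec d × Vec d =>
      (φ : Vec d → Vec d) p.1 - (φ : Vec d → Vec d) (p.1 - p.2) := by fun_prop
    exact this.enorm.measurable.pow_const _
  rw [lintegral_lintegral_swap hm.aemeasurable]
  have h3 : ∀ᵐ y ∂ν, ∫⁻ x, ‖(φ : Vec d → Vec d) x - (φ : Vec d → Vec d) (x - y)‖ₑ ^ (2 : ℝ) ≤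
      ENNReal.ofReal k.rOut ^ (2 : ℝ) * ∫⁻ x, ‖fderiv ℝ (φ : Vec d → Vec d) x‖ₑ ^ (2 : ℝ) := by
    filter_upwards [hνs] with y hy
    refine (lintegral_translate_sub_sq_le (hφ.of_le (by simp)) y).trans ?_
    gcongr
  refine (lintegral_mono_ae h3).trans (le_of_eq ?_)
  rw [lintegral_const, measure_univ, mul_one]

theorem norm_gradV_sq_eq (φ : divFreeTest O) : ENNReal.ofReal (‖gradV (testToV φ)‖ ^ 2) =
    ∫⁻ x in O, ‖classicalGrad (φ : Vec d → Vec d) x‖ₑ ^ (2 : ℝ) := by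
  rw [ENNReal.ofReal_pow (norm_nonneg _), norm_toLp_two_eq, ← ENNReal.rpow_natCast,
    ← ENNReal.rpow_mul, show (1 / 2 : ℝ) * (2 : ℕ) = 1 by norm_num, ENNReal.rpow_one]
  refine lintegral_congr_ae ?_
  filter_upwards [coeFn_grad_testToV φ] with x hx
  rw [hx]

/-- The norm of `H` is controlled by a small multiple of the gradient and a compact seminorm. -/
theorem norm_embV_sq_le (v : VSpace O) :
    ‖embV v‖ ^ 2 ≤ 2 * k.rOut ^ 2 * ‖gradV v‖ ^ 2 + 2 * mollifySq k (embV v) := by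
  -- All terms are continuous on V, so test fields suffice; for them ‖φ‖² ≤ 2‖φ - k * φ‖² + 2‖k *
  -- φ‖² and the first term is controlled by the gradient.
  refine denseRange_testToV.induction_on (p := fun v => ‖embV v‖ ^ 2 ≤
    2 * k.rOut ^ 2 * ‖gradV v‖ ^ 2 + 2 * mollifySq k (embV v)) v ?_ fun φ => ?_
  · have c1 : Continuous fun v : VSpace O => embV v := (embVL O).continuous
    have c2 : Continuous fun v : VSpace O => gradV v := (gradVL O).continuous
    exact isClosed_le (c1.norm.pow 2) ((continuous_const.mul (c2.norm.pow 2)).add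
      (continuous_const.mul ((continuous_mollifySq k).comp c1)))
  obtain ⟨C, hC0, hC⟩ := exists_norm_mollify_le (O := O) k
  set w := embV (testToV φ)
  have cA := continuous_mollify k w
  have cφ := φ.2.1.continuous
  have mA : MemLp (fun x => mollify k x w) 2 (volOn O) :=
    MemLp.of_bound cA.aestronglyMeasurable (C * ‖w‖) (ae_of_all _ fun x => hC x w)
  have mφ : MemLp (φ : Vec d → Vec d) 2 (volOn O) := memLp_test φ 2
  have iA : Integrable (fun x => ‖mollify k x w‖ ^ 2) (volOn O) :=
    mA.integrable_norm_pow (by norm_num)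
  have iD : Integrable (fun x => ‖(φ : Vec d → Vec d) x - mollify k x w‖ ^ 2) (volOn O) :=
    (mφ.sub mA).integrable_norm_pow (by norm_num)
  have iφ : Integrable (fun x => ‖(φ : Vec d → Vec d) x‖ ^ 2) (volOn O) :=
    mφ.integrable_norm_pow (by norm_num)
  have h1 : ‖w‖ ^ 2 = ∫ x in O, ‖(φ : Vec d → Vec d) x‖ ^ 2 := by
    rw [norm_embV_sq]
    refine integral_congr_ae ?_
    filter_upwards [coeFn_testToV φ] with x hx
    rw [hx]
  have h2 : ∫ x in O, ‖(φ : Vec d → Vec d) x‖ ^ 2 ≤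
      2 * (∫ x in O, ‖(φ : Vec d → Vec d) x - mollify k x w‖ ^ 2) + 2 * mollifySq k w := by
    rw [mollifySq, ← integral_const_mul, ← integral_const_mul,
      ← integral_add (iD.const_mul 2) (iA.const_mul 2)]
    refine integral_mono iφ ((iD.const_mul 2).add (iA.const_mul 2)) fun x => ?_
    have := norm_add_le ((φ : Vec d → Vec d) x - mollify k x w) (mollify k x w)
    rw [sub_add_cancel] at this
    have n0 := norm_nonneg ((φ : Vec d → Vec d) x)
    change ‖(φ : Vec d → Vec d) x‖ ^ 2 ≤ 2 * ‖(φ : Vec d → Vec d) x - mollify k x w‖ ^ 2 +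
      2 * ‖mollify k x w‖ ^ 2
    nlinarith [sq_nonneg (‖(φ : Vec d → Vec d) x - mollify k x w‖ - ‖mollify k x w‖)]
  have h4 : ∫⁻ x, ‖fderiv ℝ (φ : Vec d → Vec d) x‖ₑ ^ (2 : ℝ) ≤
      ∫⁻ x in O, ‖classicalGrad (φ : Vec d → Vec d) x‖ₑ ^ (2 : ℝ) := by
    have hz : Function.support (fun x => ‖fderiv ℝ (φ : Vec d → Vec d) x‖ₑ ^ (2 : ℝ)) ⊆ O := by
      intro x hx
      by_contra hxO
      have : fderiv ℝ (φ : Vec d → Vec d) x = 0 :=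
        Function.notMem_support.1 fun h => hxO (φ.2.2.2.1 (support_fderiv_subset ℝ h))
      have e : ‖fderiv ℝ (φ : Vec d → Vec d) x‖ₑ = 0 := by
        rw [← ofReal_norm, this, norm_zero, ENNReal.ofReal_zero]
      exact hx (by simp [e])
    rw [← setLIntegral_eq_of_support_subset hz]
    refine lintegral_mono fun x => ENNReal.rpow_le_rpow ?_ (by norm_num)
    rw [← ofReal_norm, ← ofReal_norm]
    exact ENNReal.ofReal_le_ofReal (norm_fderiv_le_norm_classicalGrad _ x)
  have h3 : ∫ x in O, ‖(φ : Vec d → Vec d) x - mollify k x w‖ ^ 2 ≤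
      k.rOut ^ 2 * ‖gradV (testToV φ)‖ ^ 2 := by
    rw [← ENNReal.ofReal_le_ofReal_iff (by positivity),
      ofReal_integral_eq_lintegral_ofReal iD (ae_of_all _ fun _ => by positivity),
      ENNReal.ofReal_mul (by positivity), norm_gradV_sq_eq, ENNReal.ofReal_pow k.rOut_pos.le,
      ← ENNReal.rpow_two]
    calc ∫⁻ x in O, ENNReal.ofReal (‖(φ : Vec d → Vec d) x - mollify k x w‖ ^ 2)
        ≤ ∫⁻ x, ENNReal.ofReal (‖(φ : Vec d → Vec d) x - mollify k x w‖ ^ 2) :=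
          setLIntegral_le_lintegral _ _
      _ = ∫⁻ x, ‖(φ : Vec d → Vec d) x - mollify k x (testToH φ)‖ₑ ^ (2 : ℝ) := by
          refine lintegral_congr fun x => ?_
          rw [ENNReal.ofReal_pow (norm_nonneg _), ofReal_norm, ENNReal.rpow_two]
          rfl
      _ ≤ _ := lintegral_sub_mollify_test_le k φ
      _ ≤ _ := mul_le_mul' le_rfl h4
  rw [h1]
  linarith

end CBF

/-! ### Strong convergence in L²(0, T; H), and jointly measurable representatives. -/

namespace CBF

variable {d : ℕ} {O : Set (Vec d)} [Admissible O]

/-- A bump function of a given size. -/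
def bumpOfRadius (d : ℕ) (h : ℝ) (hh : 0 < h) : ContDiffBump (0 : Vec d) :=
  ⟨h / 2, h, half_pos hh, half_lt_self hh⟩

/-- Weak convergence in `H` at almost every time, together with a bound in `L²(0, T; V)`, implies
strong convergence in `L²(0, T; H)`. -/
theorem tendsto_integral_norm_embV_sub_sq {α : Type*} {m : MeasurableSpace α} {ν : Measure α}
    [IsFiniteMeasure ν] {u : ℕ → α → VSpace O} {v : α → VSpace O} (hu : ∀ n, MemLp (u n) 2 ν)
    (hv : MemLp v 2 ν) {K M : ℝ} (hK : ∀ n, ∀ᵐ s ∂ν, ‖embV (u n s)‖ ≤ K)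
    (hKv : ∀ᵐ s ∂ν, ‖embV (v s)‖ ≤ K) (hM : ∀ n, ∫ s, ‖u n s - v s‖ ^ 2 ∂ν ≤ M)
    (hw : ∀ᵐ s ∂ν, ∀ z, Tendsto (fun n => inner ℝ (embV (u n s)) z) atTop
      (𝓝 (inner ℝ (embV (v s)) z))) :
    Tendsto (fun n => ∫ s, ‖embV (u n s) - embV (v s)‖ ^ 2 ∂ν) atTop (𝓝 0) := by
  have hM0 : 0 ≤ M := (integral_nonneg fun _ => by positivity).trans (hM 0)
  have hsub : ∀ n, MemLp (fun s => u n s - v s) 2 ν := fun n => (hu n).sub hv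
  have hE : ∀ n, MemLp (fun s => embV (u n s) - embV (v s)) 2 ν := fun n =>
    ((embVL O).comp_memLp' (hu n)).sub ((embVL O).comp_memLp' hv)
  have hsm : ∀ k : ContDiffBump (0 : Vec d),
      Tendsto (fun n => ∫ s, mollifySq k (embV (u n s) - embV (v s)) ∂ν) atTop (𝓝 0) := by
    intro k
    obtain ⟨C, hC0, hC⟩ := exists_mollifySq_le (O := O) k
    have hnn : ∀ w : HSpace O, 0 ≤ mollifySq k w := fun w => integral_nonneg fun _ => by positivity
    have h : Tendsto (fun n => ∫ s, mollifySq k (embV (u n s) - embV (v s)) ∂ν) atTop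
        (𝓝 (∫ _, (0 : ℝ) ∂ν)) := by
      refine tendsto_integral_of_dominated_convergence (fun _ => C * (K + K) ^ 2)
        (fun n => (continuous_mollifySq k).comp_aestronglyMeasurable (hE n).1)
        (integrable_const _) (fun n => ?_) ?_
      · filter_upwards [hK n, hKv] with s a1 a2
        rw [Real.norm_of_nonneg (hnn _)]
        refine (hC _).trans (mul_le_mul_of_nonneg_left ?_ hC0)
        exact pow_le_pow_left₀ (norm_nonneg _) ((norm_sub_le _ _).trans (add_le_add a1 a2)) 2
      · filter_upwards [ae_all_iff.2 hK, hKv, hw] with s a1 a2 a3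
        refine tendsto_mollifySq k (M := K + K)
          (fun n => (norm_sub_le _ _).trans (add_le_add (a1 n) a2)) fun z => ?_
        simp only [inner_sub_left]
        simpa using (a3 z).sub_const (inner ℝ (embV (v s)) z)
    simpa using h
  rw [Metric.tendsto_atTop]
  intro ε hε
  -- The mollification scale is fixed first, making the gradient part at most ε/2 uniformly in n;
  -- only then is n chosen for the mollified part.
  set h : ℝ := √(ε / (4 * (M + 1)))
  have hh : 0 < h := Real.sqrt_pos.2 (by positivity)
  have hh2 : 2 * h ^ 2 * M ≤ ε / 2 := by
    rw [Real.sq_sqrt (by positivity)]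
    have : ε / (4 * (M + 1)) * M ≤ ε / 4 := by
      rw [div_mul_eq_mul_div, div_le_div_iff₀ (by positivity) (by norm_num)]
      nlinarith
    linarith
  set k := bumpOfRadius d h hh
  obtain ⟨N, hN⟩ := Metric.tendsto_atTop.1 (hsm k) (ε / 4) (by positivity)
  refine ⟨N, fun n hn => ?_⟩
  have h1 := hN n hn
  rw [Real.dist_eq, sub_zero] at h1 ⊢
  have i1 : Integrable (fun s => ‖u n s - v s‖ ^ 2) ν := (hsub n).integrable_norm_pow (by norm_num)
  have i2 : Integrable (fun s => mollifySq k (embV (u n s) - embV (v s))) ν := by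
    obtain ⟨C, hC0, hC⟩ := exists_mollifySq_le (O := O) k
    have hnn : ∀ w : HSpace O, 0 ≤ mollifySq k w := fun w => integral_nonneg fun _ => by positivity
    refine (((hE n).integrable_norm_pow (p := 2) (by norm_num)).const_mul C).mono'
      ((continuous_mollifySq k).comp_aestronglyMeasurable (hE n).1) (ae_of_all _ fun s => ?_)
    rw [Real.norm_of_nonneg (hnn _)]
    exact hC _
  have h2 : ∫ s, ‖embV (u n s) - embV (v s)‖ ^ 2 ∂ν ≤
      2 * h ^ 2 * (∫ s, ‖u n s - v s‖ ^ 2 ∂ν) +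
        2 * ∫ s, mollifySq k (embV (u n s) - embV (v s)) ∂ν := by
    rw [← integral_const_mul, ← integral_const_mul,
      ← integral_add (i1.const_mul _) (i2.const_mul 2)]
    refine integral_mono ((hE n).integrable_norm_pow (by norm_num))
      ((i1.const_mul _).add (i2.const_mul 2)) fun s => ?_
    have h3 := norm_embV_sq_le k (u n s - v s)
    rw [embV_sub] at h3
    refine h3.trans (add_le_add_left ?_ _)
    exact mul_le_mul_of_nonneg_left
      (pow_le_pow_left₀ (norm_nonneg _) (norm_gradV_le _) 2) (by positivity)
  have h4 : 2 * h ^ 2 * (∫ s, ‖u n s - v s‖ ^ 2 ∂ν) ≤ ε / 2 :=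
    (mul_le_mul_of_nonneg_left (hM n) (by positivity)).trans hh2
  rw [abs_of_nonneg (integral_nonneg fun _ => by positivity)]
  have := (abs_lt.1 h1).2
  linarith

/-- A sequence of bump functions concentrating at the origin. -/
def bumpSeq (d : ℕ) (n : ℕ) : ContDiffBump (0 : Vec d) :=
  bumpOfRadius d (1 / ((n : ℝ) + 1)) (by positivity)

/-- Lebesgue differentiation for the extension by zero, with kernels whose outer radius is at most
twice the inner one. It expresses a representative of w as a pointwise limit of quantities depending
continuously on w in H. -/
theorem ae_tendsto_mollify (w : HSpace O) : ∀ᵐ x ∂volOn O, Tendsto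
    (fun n : ℕ => mollify (bumpSeq d n) x w) atTop (𝓝 (field w x)) := by
  have hOm : MeasurableSet O := (‹Admissible O›).isOpen.measurableSet
  set g : Vec d → Vec d := O.indicator (field w)
  have hg : Integrable g := (integrable_indicator_iff hOm).2 (integrable_field w)
  have h0 : Tendsto (fun n => (bumpSeq d n).rOut) atTop (𝓝 0) :=
    tendsto_one_div_add_atTop_nhds_zero_nat (𝕜 := ℝ)
  have h1 : ∀ᶠ n in atTop, (bumpSeq d n).rOut ≤ 2 * (bumpSeq d n).rIn :=
    Eventually.of_forall fun n => by
      change 1 / ((n : ℝ) + 1) ≤ 2 * (1 / ((n : ℝ) + 1) / 2)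
      linarith
  have h := ContDiffBump.ae_convolution_tendsto_right_of_locallyIntegrable (μ := volume) (K := 2)
    (φ := bumpSeq d) (l := atTop) h0 h1 hg.locallyIntegrable
  rw [ae_restrict_iff' hOm]
  filter_upwards [h] with x hx hxO
  have e : g x = field w x := indicator_of_mem hxO _
  rw [e] at hx
  refine hx.congr fun n => ?_
  rw [convolution_eq_swap, mollify_apply, ← integral_indicator hOm]
  refine integral_congr_ae (ae_of_all _ fun y => ?_)
  by_cases hy : y ∈ O <;> simp [g, hy]

/-- A curve in `H` has a jointly measurable representative. -/
theorem exists_stronglyMeasurable_uncurry {u : ℝ → HSpace O} (hu : StronglyMeasurable u) :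
    ∃ U : ℝ → Vec d → Vec d, StronglyMeasurable (Function.uncurry U) ∧
      ∀ t, U t =ᵐ[volOn O] field (u t) := by
  have hk : ∀ n, StronglyMeasurable fun p : ℝ × Vec d => mollify (bumpSeq d n) p.2 (u p.1) := by
    intro n
    -- Continuous in x and measurable in t, hence jointly measurable; the limit in n keeps this.
    set U : Vec d → ℝ → Vec d := fun x t => mollify (bumpSeq d n) x (u t) with hU
    have h1 : ∀ t, Continuous fun x => U x t := fun t => continuous_mollify (bumpSeq d n) (u t)
    have h2 : ∀ x, StronglyMeasurable (U x) := fun x =>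
      (mollify (bumpSeq d n) x).continuous.comp_stronglyMeasurable hu
    have h3 : StronglyMeasurable (Function.uncurry U) :=
      stronglyMeasurable_uncurry_of_continuous_of_stronglyMeasurable h1 h2
    have h4 : StronglyMeasurable fun p : ℝ × Vec d => Function.uncurry U (p.2, p.1) :=
      h3.comp_measurable measurable_swap
    exact h4
  have hl : StronglyMeasurable fun p : ℝ × Vec d =>
      limUnder atTop fun n => mollify (bumpSeq d n) p.2 (u p.1) :=
    StronglyMeasurable.limUnder (f := fun n (p : ℝ × Vec d) => mollify (bumpSeq d n) p.2 (u p.1)) hk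
  refine ⟨fun t x => limUnder atTop fun n => mollify (bumpSeq d n) x (u t), hl, fun t => ?_⟩
  filter_upwards [ae_tendsto_mollify (u t)] with x hx
  exact hx.limUnder_eq

end CBF

/-! ### From the integrated equation to a weak solution. -/

namespace CBF

variable {d : ℕ} {O : Set (Vec d)} [Admissible O]

/-- The norm in V' is at most ‖v‖_{L⁴}². For r < 3 Ladyzhenskaya's inequality and the bound in H
leave ‖∇v‖^{d/2}, which is in L^{4/d}. For r = 3 the damping energy is itself the fourth power of
the L⁴ norm, which gives L² in time. -/
theorem memLp_convForm {α : Type*} {m : MeasurableSpace α} {ν : Measure α} [IsFiniteMeasure ν]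
    {v : α → VSpace O} {r K : ℝ} (hr₃ : r ≤ 3) (hv : MemLp v 2 ν)
    (hp : Integrable (fun s => powNorm (r + 1) (embV (v s))) ν)
    (hK : ∀ᵐ s ∂ν, ‖embV (v s)‖ ≤ K) :
    MemLp (fun s => convForm (v s) (v s)) (derivExponent d r) ν := by
  have hm := (integrable_convForm hv).1
  unfold derivExponent
  split_ifs with hr
  · obtain ⟨C, hC0, hC⟩ := exists_norm_embL4_le (O := O)
    have hd2 : (2 : ℝ) ≤ d := by exact_mod_cast (‹Admissible O›).two_le
    have hd4 : (d : ℝ) ≤ 4 := by exact_mod_cast (‹Admissible O›).le_four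
    have h1 := hv.norm_rpow_div (ENNReal.ofReal (d / 2))
    rw [ENNReal.toReal_ofReal (by positivity), show (2 : ℝ≥0∞) = ENNReal.ofReal 2 by norm_num,
      ← ENNReal.ofReal_div_of_pos (by positivity), show (2 : ℝ) / (d / 2) = 4 / d by
        field_simp; norm_num] at h1
    refine (h1.const_mul (C ^ 2 * K ^ ((4 - d : ℝ) / 2))).mono hm ?_
    filter_upwards [hK] with s hs
    have hK0 : 0 ≤ K := (norm_nonneg _).trans hs
    refine (norm_convForm_le (v s)).trans ((pow_le_pow_left₀ (norm_nonneg _) (hC (v s)) 2).trans ?_)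
    have e : ∀ {x y : ℝ}, 0 ≤ x → (x ^ (y / 4)) ^ 2 = x ^ (y / 2) := fun hx => by
      rw [← Real.rpow_natCast, ← Real.rpow_mul hx]
      congr 1
      push_cast
      ring
    rw [mul_pow, mul_pow, e (norm_nonneg _), e (norm_nonneg _), Real.norm_of_nonneg (by positivity)]
    have a1 : ‖embV (v s)‖ ^ ((4 - d : ℝ) / 2) ≤ K ^ ((4 - d : ℝ) / 2) :=
      Real.rpow_le_rpow (norm_nonneg _) hs (by linarith)
    have a2 : ‖gradV (v s)‖ ^ ((d : ℝ) / 2) ≤ ‖v s‖ ^ ((d : ℝ) / 2) :=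
      Real.rpow_le_rpow (norm_nonneg _) (norm_gradV_le _) (by positivity)
    gcongr
  · have hr' : r = 3 := le_antisymm hr₃ (not_lt.1 hr)
    have h1 : MemLp (fun s => ‖embL4 O (v s)‖ ^ 2) 2 ν := by
      have hmeas : AEStronglyMeasurable (fun s => ‖embL4 O (v s)‖ ^ 2) ν :=
        ((embL4 O).continuous.comp_aestronglyMeasurable hv.1).norm.pow 2
      refine (memLp_two_iff_integrable_sq hmeas).2 ?_
      refine hp.congr (ae_of_all _ fun s => ?_)
      have := norm_embL4_pow_four (v s)
      simp only
      rw [← pow_mul, this, powNorm, hr']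
      norm_num
    exact h1.mono hm (ae_of_all _ fun s => by simpa using norm_convForm_le (v s))

theorem derivExponent_le_two {d : ℕ} (hd : 2 ≤ d) {r : ℝ} : derivExponent d r ≤ 2 := by
  unfold derivExponent
  split_ifs with hr
  · have hd2 : (2 : ℝ) ≤ d := by exact_mod_cast hd
    rw [show (2 : ℝ≥0∞) = ENNReal.ofReal 2 by norm_num]
    refine ENNReal.ofReal_le_ofReal ?_
    rw [div_le_iff₀ (by linarith)]
    linarith
  · exact le_rfl

variable {T μ β r K : ℝ} {f : ℝ → StrongDual ℝ (VSpace O)} {u₀ : HSpace O} {u : ℝ → HSpace O}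

/-- The power (r + 1)/r of |u|^r is |u|^{r+1}, so Tonelli reduces the claim to the time integral of
the damping energy. -/
theorem memLp_powMap_uncurry (hr₁ : 1 ≤ r) (hr₃ : r ≤ 3) (hβ : 0 < β)
    (hu : ∀ᵐ s ∂timeMeasure T, embV (asV (u s)) = u s)
    (hp : Integrable (fun s => powNorm (r + 1) (embV (asV (u s)))) (timeMeasure T))
    {U : ℝ → Vec d → Vec d} (hU : StronglyMeasurable (Function.uncurry U))
    (hUu : ∀ᵐ t ∂timeMeasure T, U t =ᵐ[volOn O] field (u t)) :
    MemLp (Function.uncurry fun t x => -(β • powMap r (U t x))) (ENNReal.ofReal ((r + 1) / r))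
      (volume.restrict (Ioo 0 T ×ˢ O)) := by
  have hr0 : 0 < r := by linarith
  have hm : StronglyMeasurable (Function.uncurry fun t x => -(β • powMap r (U t x))) :=
    (((continuous_powMap hr₁).comp_stronglyMeasurable hU).const_smul β).neg
  refine ⟨hm.aestronglyMeasurable, ?_⟩
  rw [Measure.volume_eq_prod, ← Measure.prod_restrict,
    eLpNorm_lt_top_iff_lintegral_rpow_enorm_lt_top (by simpa using by positivity)
      ENNReal.ofReal_ne_top, ENNReal.toReal_ofReal (by positivity)]
  have e1 : ∀ p : ℝ × Vec d, ‖Function.uncurry (fun t x => -(β • powMap r (U t x))) p‖ₑ ^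
      ((r + 1) / r) = ENNReal.ofReal (β ^ ((r + 1) / r) * ‖U p.1 p.2‖ ^ (r + 1)) := by
    rintro ⟨t, x⟩
    rw [Function.uncurry_apply_pair, enorm_neg, ← ofReal_norm, norm_smul, norm_powMap hr₁,
      ENNReal.ofReal_rpow_of_nonneg (by positivity) (by positivity),
      Real.mul_rpow (by positivity) (by positivity), ← Real.rpow_mul (norm_nonneg _),
      Real.norm_of_nonneg hβ.le, mul_div_cancel₀ _ hr0.ne']
  have hm2 : Measurable fun p : ℝ × Vec d =>
      ENNReal.ofReal (β ^ ((r + 1) / r) * ‖U p.1 p.2‖ ^ (r + 1)) :=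
    ((hU.norm.measurable.pow_const _).const_mul _).ennreal_ofReal
  simp only [e1]
  rw [lintegral_prod _ hm2.aemeasurable]
  have e2 : ∀ᵐ t ∂timeMeasure T,
      ∫⁻ x in O, ENNReal.ofReal (β ^ ((r + 1) / r) * ‖U t x‖ ^ (r + 1)) =
        ENNReal.ofReal (β ^ ((r + 1) / r) * powNorm (r + 1) (embV (asV (u t)))) := by
    filter_upwards [hu, hUu] with t a1 a2
    rw [powNorm, ← integral_const_mul, ofReal_integral_eq_lintegral_ofReal
      ((integrable_powNorm hr₁ hr₃ _).const_mul _) (ae_of_all _ fun x => by positivity), a1]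
    refine lintegral_congr_ae (a2.mono fun x hx => ?_)
    simp only [hx]
  rw [lintegral_congr_ae e2]
  exact (hp.const_mul _).lintegral_lt_top

/-- F is split into f - μAu - B(u), whose values are functionals on V, and -β|u|^{r-1}u, a function
on the cylinder. The distributional identity is the product rule `hsub` along the curve s ↦ θ(s)φ,
whose end values vanish. -/
theorem hasTimeDeriv_of_inner_eq (hr₁ : 1 ≤ r) (hr₃ : r ≤ 3) (hβ : 0 < β) (hT : 0 < T)
    (hf : MemLp f 2 (timeMeasure T)) (hu : ∀ᵐ s ∂timeMeasure T, embV (asV (u s)) = u s)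
    (hv : MemLp (fun s => asV (u s)) 2 (timeMeasure T))
    (hp : Integrable (fun s => powNorm (r + 1) (embV (asV (u s)))) (timeMeasure T))
    (hK : ∀ᵐ s ∂timeMeasure T, ‖u s‖ ≤ K)
    (hsub : ∀ (P P' : ℝ → VSpace O), (∀ s, HasDerivAt P (P' s) s) → Continuous P' →
      ∀ a ∈ Icc 0 T, ∀ b ∈ Icc 0 T, a ≤ b →
      inner ℝ (u b) (embV (P b)) - inner ℝ (u a) (embV (P a)) =
        (∫ s in a..b, inner ℝ (u s) (embV (P' s))) +
          ∫ s in a..b, (f s + cbfOp hr₁ hr₃ μ β (asV (u s))) (P s)) :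
    HasTimeDeriv T r u := by
  have hum : AEStronglyMeasurable u (timeMeasure T) :=
    (((embVL O).continuous.comp_aestronglyMeasurable hv.1)).congr hu
  -- The representatives of u(t) are chosen independently at each time, so a jointly measurable
  -- choice is needed to speak of a function on (0, T) × O.
  obtain ⟨U, hU, hUu⟩ := exists_stronglyMeasurable_uncurry hum.stronglyMeasurable_mk
  have hUu' : ∀ᵐ t ∂timeMeasure T, U t =ᵐ[volOn O] field (u t) := by
    filter_upwards [hum.ae_eq_mk] with t ht
    rw [ht]
    exact hUu t
  refine ⟨fun s => f s - μ • viscForm O (asV (u s)) - convForm (asV (u s)) (asV (u s)),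
    fun t x => -(β • powMap r (U t x)), ?_, memLp_powMap_uncurry hr₁ hr₃ hβ hu hp hU hUu', ?_⟩
  · have h1 : MemLp (fun s => f s - μ • viscForm O (asV (u s))) 2 (timeMeasure T) :=
      hf.sub (((viscForm O).comp_memLp' hv).const_smul μ)
    refine (h1.mono_exponent (derivExponent_le_two (‹Admissible O›).two_le)).sub (memLp_convForm hr₃ hv hp (K := K) ?_)
    filter_upwards [hu, hK] with s a1 a2
    rwa [a1]
  · intro θ φ hθ hθc hθT
    have hθ0 : ∀ s, s ∉ Ioo 0 T → θ s = 0 := fun s hs =>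
      image_eq_zero_of_notMem_tsupport fun h => hs (hθT h)
    have h0 := left_mem_Icc.2 hT.le
    have hTT := right_mem_Icc.2 hT.le
    have key := hsub (fun s => θ s • testToV φ) (fun s => deriv θ s • testToV φ)
      (fun s => ((hθ.differentiable (by simp) s).hasDerivAt).smul_const _)
      ((hθ.continuous_deriv (by simp)).smul continuous_const) 0 h0 T hTT hT.le
    rw [hθ0 0 (by simp), hθ0 T (by simp), zero_smul, ← embVL_apply, map_zero, inner_zero_right,
      inner_zero_right, sub_zero] at key
    have e1 : ∫ s in 0..T, inner ℝ (u s) (embVL O (deriv θ s • testToV φ)) =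
        ∫ s in 0..T, deriv θ s * inner ℝ (u s) (testToH φ) := by
      refine intervalIntegral.integral_congr fun s _ => ?_
      simp only [map_smul, inner_smul_right, embVL_apply, embV_testToV]
    have e2 : ∫ s in 0..T, (f s + cbfOp hr₁ hr₃ μ β (asV (u s))) (θ s • testToV φ) =
        ∫ s in 0..T, θ s * ((f s - μ • viscForm O (asV (u s)) - convForm (asV (u s)) (asV (u s)))
          (testToV φ) + ∫ x in O, inner ℝ (-(β • powMap r (U s x))) ((φ : Vec d → Vec d) x)) := by
      refine intervalIntegral.integral_congr_ae ?_
      rw [ae_restrict_iff' measurableSet_Ioo] at hu hUu'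
      have hne : ∀ᵐ s : ℝ, s ≠ T := by simp [ae_iff]
      filter_upwards [hu, hUu', hne] with s a1 a2 a3 hs
      rw [uIoc_of_le hT.le] at hs
      have hsI : s ∈ Ioo 0 T := ⟨hs.1, lt_of_le_of_ne hs.2 a3⟩
      have e3 : ∫ x in O, inner ℝ (-(β • powMap r (U s x))) ((φ : Vec d → Vec d) x) =
          -(β * dampForm hr₁ hr₃ (asV (u s)) (testToV φ)) := by
        rw [dampForm_apply, ← integral_const_mul, ← integral_neg]
        refine integral_congr_ae ?_
        filter_upwards [a2 hsI, coeFn_testToV φ] with x b1 b2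
        rw [b1, b2, a1 hsI, inner_neg_left, real_inner_smul_left]
      rw [map_smul, smul_eq_mul, e3]
      change θ s * (f s (testToV φ) + cbfOp hr₁ hr₃ μ β (asV (u s)) (testToV φ)) =
        θ s * (f s (testToV φ) - μ * inner ℝ (gradV (asV (u s))) (gradV (testToV φ)) -
          convForm (asV (u s)) (asV (u s)) (testToV φ) + _)
      rw [cbfOp_apply]
      ring
    have key2 : (0 : ℝ) = (∫ s in 0..T, deriv θ s * inner ℝ (u s) (testToH φ)) +
        ∫ s in 0..T, θ s * ((f s - μ • viscForm O (asV (u s)) - convForm (asV (u s)) (asV (u s)))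
          (testToV φ) + ∫ x in O, inner ℝ (-(β • powMap r (U s x))) ((φ : Vec d → Vec d) x)) := by
      rw [← e1, ← e2]
      exact key
    linarith

/-- The product rule upgrades the identity against fixed elements of V to curves in V, and
space-time test fields are such curves. The weak form then holds for all pairs of times, not merely
for almost all. -/
theorem isWeakSolution_of_inner_eq (hr₁ : 1 ≤ r) (hr₃ : r ≤ 3) (hβ : 0 < β) (hT : 0 < T)
    (hf : MemLp f 2 (timeMeasure T)) (hu : ∀ᵐ s ∂timeMeasure T, embV (asV (u s)) = u s)
    (hv : MemLp (fun s => asV (u s)) 2 (timeMeasure T))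
    (hp : Integrable (fun s => powNorm (r + 1) (embV (asV (u s)))) (timeMeasure T))
    (hK : ∀ᵐ s ∂timeMeasure T, ‖u s‖ ≤ K)
    (hw : ∀ t ∈ Icc 0 T, ∀ z : VSpace O, inner ℝ (u t) (embV z) = inner ℝ u₀ (embV z) +
      ∫ s in 0..t, (f s + cbfOp hr₁ hr₃ μ β (asV (u s))) z) :
    IsWeakSolution T μ β r f u₀ u := by
  have hf1 : Integrable f (timeMeasure T) := hf.integrable (by norm_num)
  have hF := integrable_add_cbfOp hr₁ hr₃ μ β hf1 hv hp
  have h0 : (0 : ℝ) ∈ Icc 0 T := left_mem_Icc.2 hT.le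
  have hum : AEStronglyMeasurable u (timeMeasure T) :=
    (((embVL O).continuous.comp_aestronglyMeasurable hv.1)).congr hu
  have hsub : ∀ (P P' : ℝ → VSpace O), (∀ s, HasDerivAt P (P' s) s) → Continuous P' →
      ∀ a ∈ Icc 0 T, ∀ b ∈ Icc 0 T, a ≤ b →
      inner ℝ (u b) (embV (P b)) - inner ℝ (u a) (embV (P a)) =
        (∫ s in a..b, inner ℝ (u s) (embV (P' s))) +
          ∫ s in a..b, (f s + cbfOp hr₁ hr₃ μ β (asV (u s))) (P s) := by
    intro P P' hP hP' a ha b hb hab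
    refine inner_sub_eq_integral_add (ι := embVL O) hab (intervalIntegrable_of_timeMeasure hF ha hb)
      (fun z τ hτ => ?_) hP hP'
    have hτ' : τ ∈ Icc 0 T := ⟨ha.1.trans hτ.1, hτ.2.trans hb.2⟩
    have i : ∀ t ∈ Icc 0 T, IntervalIntegrable
        (fun s => (f s + cbfOp hr₁ hr₃ μ β (asV (u s))) z) volume 0 t := fun t ht =>
      intervalIntegrable_dual_apply hF (P := fun _ => z) continuous_const h0 ht
    rw [embVL_apply, hw τ hτ' z, hw a ha z, add_assoc,
      ← intervalIntegral.integral_interval_sub_left (i τ hτ') (i a ha)]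
    ring
  have hweak : ∀ (w : SpaceTimeTest O T), ∀ a ∈ Icc 0 T, ∀ b ∈ Icc 0 T, a ≤ b →
      WeakForm μ β r f u w a b := by
    intro w a ha b hb hab
    rw [weakForm_iff hr₁ hr₃ μ β hf1 hu hv hp w ha hb hab]
    exact hsub _ _ w.hasDerivAt_testToV_slice w.deriv.continuous_testToV_slice a ha b hb hab
  refine ⟨?_, ⟨?_, hv⟩, ⟨hum, ?_, ?_⟩, ?_, ?_, fun w => ?_, fun w => ?_⟩
  · exact MemLp.of_bound hum K hK
  · filter_upwards [hu] with s hs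
    exact ⟨_, hs⟩
  · filter_upwards [hu] with s hs
    rw [← hs]
    exact memLtilde_embV (by linarith) (by linarith) _
  · refine lt_of_le_of_lt (le_of_eq ?_) hp.lintegral_lt_top
    refine lintegral_congr_ae ?_
    filter_upwards [hu] with s hs
    rw [← hs, ← ofReal_powNorm hr₁ hr₃, asV_embV]
  · exact hasTimeDeriv_of_inner_eq hr₁ hr₃ hβ hT hf hu hv hp hK hsub
  · refine (denseRange_embVL (O := O)).eq_of_inner_left (𝕜 := ℝ) fun z => ?_
    have := hw 0 h0 z
    rwa [intervalIntegral.integral_same, add_zero] at this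
  · filter_upwards [ae_restrict_mem measurableSet_Ioo] with t ht
    exact hweak w 0 h0 t (Ioo_subset_Icc_self ht) ht.1.le
  · filter_upwards [ae_restrict_mem measurableSet_Ioo] with a ha
    filter_upwards [ae_restrict_mem measurableSet_Ioo] with b hb
    exact hweak w a (Ioo_subset_Icc_self ha) b ⟨ha.1.le.trans hb.1.le, hb.2.le⟩ hb.1.le

/-- Against elements of V the right-hand side is a primitive. Since V is dense in H and u is
bounded, the pairing with any ζ in H is a uniform limit of such continuous functions. -/
theorem weaklyContinuous_of_inner_eq (hr₁ : 1 ≤ r) (hr₃ : r ≤ 3) (hT : 0 < T)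
    (hf : Integrable f (timeMeasure T))
    (hv : MemLp (fun s => asV (u s)) 2 (timeMeasure T))
    (hp : Integrable (fun s => powNorm (r + 1) (embV (asV (u s)))) (timeMeasure T))
    (hK : ∀ t ∈ Icc 0 T, ‖u t‖ ≤ K)
    (hw : ∀ t ∈ Icc 0 T, ∀ z : VSpace O, inner ℝ (u t) (embV z) = inner ℝ u₀ (embV z) +
      ∫ s in 0..t, (f s + cbfOp hr₁ hr₃ μ β (asV (u s))) z) :
    WeaklyContinuous T u := by
  have hF := integrable_add_cbfOp hr₁ hr₃ μ β hf hv hp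
  have hK0 : 0 ≤ K := (norm_nonneg _).trans (hK 0 (left_mem_Icc.2 hT.le))
  have hc : ∀ z : VSpace O, ContinuousOn (fun t => inner ℝ (u t) (embV z)) (Icc 0 T) := by
    intro z
    have hi := intervalIntegrable_dual_apply hF (P := fun _ => z) continuous_const
      (left_mem_Icc.2 hT.le) (right_mem_Icc.2 hT.le)
    have h1 := intervalIntegral.continuousOn_primitive_interval' hi left_mem_uIcc
    rw [uIcc_of_le hT.le] at h1
    exact (continuousOn_const.add h1).congr fun t ht => hw t ht z
  intro ζ
  refine continuousOn_of_uniform_approx_of_continuousOn fun W hW => ?_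
  obtain ⟨ε, hε, hεW⟩ := Metric.mem_uniformity_dist.1 hW
  obtain ⟨z, hz⟩ := (denseRange_embVL (O := O)).exists_dist_lt ζ (ε := ε / (K + 1)) (by positivity)
  refine ⟨_, hc z, fun t ht => hεW ?_⟩
  rw [Real.dist_eq, ← inner_sub_right]
  rw [dist_eq_norm, lt_div_iff₀ (by positivity)] at hz
  refine (abs_real_inner_le_norm _ _).trans_lt ?_
  calc ‖u t‖ * ‖ζ - embV z‖ ≤ K * ‖ζ - embV z‖ := by gcongr; exact hK t ht
    _ ≤ ‖ζ - embVL O z‖ * (K + 1) := by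
        rw [embVL_apply]
        nlinarith [norm_nonneg (ζ - embV z)]
    _ < ε := hz

/-- Expanding the square and using the energy inequality, ‖u(t) - u₀‖² ≤ 2‖u₀‖² + 2∫₀ᵗ f(u) -
2⟨u(t), u₀⟩, and the right-hand side tends to 0 by weak continuity. -/
theorem tendsto_norm_sub_of_energy_le (hT : 0 < T) (hμ : 0 < μ) (hβ : 0 < β)
    (hf : MemLp f 2 (timeMeasure T)) (hv : MemLp (fun s => asV (u s)) 2 (timeMeasure T))
    (hc : WeaklyContinuous T u) (h0 : u 0 = u₀)
    (he : ∀ t ∈ Icc 0 T, energy μ β r u t ≤ energyInput f u₀ u t) :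
    Tendsto (fun t => ‖u t - u₀‖) (𝓝[>] 0) (𝓝 0) := by
  have hI : Ioc 0 T ∈ 𝓝[>] (0 : ℝ) := Ioc_mem_nhdsGT hT
  have hle : 𝓝[>] (0 : ℝ) ≤ 𝓝[Icc 0 T] 0 := by
    refine le_trans ?_ (nhdsWithin_mono 0 Ioc_subset_Icc_self)
    exact (nhdsWithin_Ioc_eq_nhdsGT hT).ge
  have hi := intervalIntegrable_of_timeMeasure (integrable_dual_apply hf hv)
    (left_mem_Icc.2 hT.le) (right_mem_Icc.2 hT.le)
  have h1 := intervalIntegral.continuousOn_primitive_interval' hi left_mem_uIcc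
  rw [uIcc_of_le hT.le] at h1
  have t1 : Tendsto (fun t => ∫ s in 0..t, f s (asV (u s))) (𝓝[>] 0) (𝓝 0) := by
    simpa using (h1 0 (left_mem_Icc.2 hT.le)).tendsto.mono_left hle
  have t2 : Tendsto (fun t => inner ℝ (u t) u₀) (𝓝[>] 0) (𝓝 (‖u₀‖ ^ 2)) := by
    have := (hc u₀ 0 (left_mem_Icc.2 hT.le)).tendsto.mono_left hle
    simpa [h0] using this
  have t3 : Tendsto (fun t => 2 * ‖u₀‖ ^ 2 + 2 * (∫ s in 0..t, f s (asV (u s))) -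
      2 * inner ℝ (u t) u₀) (𝓝[>] 0) (𝓝 0) := by
    have := ((t1.const_mul 2).const_add (2 * ‖u₀‖ ^ 2)).sub (t2.const_mul 2)
    simpa using this
  have t4 : Tendsto (fun t => ‖u t - u₀‖ ^ 2) (𝓝[>] 0) (𝓝 0) := by
    refine tendsto_of_tendsto_of_tendsto_of_le_of_le' tendsto_const_nhds t3
      (Eventually.of_forall fun t => by positivity) ?_
    filter_upwards [hI] with t ht
    have e := he t ⟨ht.1.le, ht.2⟩
    have p1 : 0 ≤ ∫ s in 0..t, normV (u s) ^ 2 :=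
      intervalIntegral.integral_nonneg ht.1.le fun _ _ => by positivity
    have p2 : 0 ≤ ∫ s in 0..t, powNorm (r + 1) (u s) :=
      intervalIntegral.integral_nonneg ht.1.le fun _ _ => powNorm_nonneg _ _
    have q1 : 0 ≤ 2 * μ * ∫ s in 0..t, normV (u s) ^ 2 := by positivity
    have q2 : 0 ≤ 2 * β * ∫ s in 0..t, powNorm (r + 1) (u s) := by positivity
    rw [energy, energyInput] at e
    rw [norm_sub_sq_real]
    linarith
  have t5 := t4.sqrt
  simpa [Real.sqrt_sq (norm_nonneg _)] using t5

end CBF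

/-! ### Galerkin approximations and their a priori bounds. -/

namespace CBF

variable {d : ℕ} {O : Set (Vec d)}

theorem continuous_gradV : Continuous (gradV (O := O)) := (gradVL O).continuous

variable [Admissible O] {T μ β r : ℝ}

theorem exists_galerkin_cbf (hr₁ : 1 ≤ r) (hr₃ : r ≤ 3) (hT : 0 < T) (hμ : 0 < μ) (hβ : 0 < β)
    (u₀ : HSpace O) {g : ℝ → StrongDual ℝ (VSpace O)} (hg : Continuous g)
    (S : Submodule ℝ (VSpace O)) [FiniteDimensional ℝ S] :
    ∃ u : ℝ → VSpace O, Continuous u ∧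
      (∀ φ ∈ S, ∀ s ∈ Icc 0 T, ∀ t ∈ Icc 0 T, inner ℝ (embV (u t)) (embV φ) =
        inner ℝ (embV (u s)) (embV φ) + ∫ τ in s..t, (g τ + cbfOp hr₁ hr₃ μ β (u τ)) φ) ∧
      (∀ φ ∈ S, inner ℝ (embV (u 0)) (embV φ) = inner ℝ u₀ (embV φ)) ∧
      (∀ t ∈ Icc 0 T, ‖embV (u t)‖ ^ 2 + 2 * μ * (∫ s in 0..t, ‖gradV (u s)‖ ^ 2) +
        2 * β * (∫ s in 0..t, powNorm (r + 1) (embV (u s))) ≤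
          ‖u₀‖ ^ 2 + 2 * ∫ s in 0..t, g s (u s)) := by
  obtain ⟨C, hC0, hC⟩ := exists_norm_le_norm_gradV (O := O)
  obtain ⟨u, hu, huS, hu0, hueq, hue⟩ := exists_galerkin (embVL O) embV_injective S
    -- Coercivity in the full norm of V, by Poincaré's inequality with constant C.
    (locallyLipschitz_cbfOp hr₁ hr₃ μ β) (κ := μ / C ^ 2) (by positivity) (fun v => by
      have h1 := pow_le_pow_left₀ (norm_nonneg _) (hC v) 2
      have h2 := mul_nonneg hβ.le (powNorm_nonneg (r + 1) (embV v))
      have h3 : μ / C ^ 2 * ‖v‖ ^ 2 ≤ μ * ‖gradV v‖ ^ 2 := by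
        rw [div_mul_eq_mul_div, div_le_iff₀ (by positivity)]
        nlinarith
      rw [cbfOp_self]
      linarith) hg u₀ hT
  refine ⟨u, hu, fun φ hφ s hs t ht => ?_, hu0, fun t ht => ?_⟩
  · simp only [add_comm (g _)]
    exact hueq φ hφ s hs t ht
  -- The initial value is a projection of u₀. Replacing its norm by that of u₀ is what turns the
  -- energy equality of the approximation into an inequality.
  · have h0 : ‖embV (u 0)‖ ≤ ‖u₀‖ := by
      have h1 := hu0 (u 0) (huS 0)
      rw [embVL_apply, real_inner_self_eq_norm_sq] at h1
      have h2 := real_inner_le_norm u₀ (embV (u 0))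
      rw [← h1, sq] at h2
      rcases (norm_nonneg (embV (u 0))).eq_or_lt with h | h
      · rw [← h]
        exact norm_nonneg _
      · exact le_of_mul_le_mul_right h2 h
    have c1 : Continuous fun s => μ * ‖gradV (u s)‖ ^ 2 :=
      ((continuous_gradV.comp hu).norm.pow 2).const_mul μ
    have c2 : Continuous fun s => β * powNorm (r + 1) (embV (u s)) :=
      ((continuous_powNorm_embV hr₁ hr₃).comp hu).const_mul β
    have c3 : Continuous fun s => g s (u s) := hg.clm_apply hu
    have c4 : Continuous fun s => g s (u s) - μ * ‖gradV (u s)‖ ^ 2 := c3.sub c1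
    have e : ∫ s in 0..t, (cbfOp hr₁ hr₃ μ β (u s) + g s) (u s) =
        (∫ s in 0..t, g s (u s)) - μ * (∫ s in 0..t, ‖gradV (u s)‖ ^ 2) -
          β * ∫ s in 0..t, powNorm (r + 1) (embV (u s)) := by
      rw [← intervalIntegral.integral_const_mul, ← intervalIntegral.integral_const_mul,
        ← intervalIntegral.integral_sub (c3.intervalIntegrable _ _) (c1.intervalIntegrable _ _),
        ← intervalIntegral.integral_sub (c4.intervalIntegrable _ _)
          (c2.intervalIntegrable _ _)]
      refine intervalIntegral.integral_congr fun s _ => ?_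
      simp only [add_apply, cbfOp_self]
      ring
    have h1 := hue t ht
    rw [e] at h1
    have h2 := pow_le_pow_left₀ (norm_nonneg _) h0 2
    simp only [embVL_apply] at h1
    linarith

theorem intervalIntegral_le_integral_timeMeasure {F : ℝ → ℝ} (hF : Integrable F (timeMeasure T))
    (h0 : ∀ s, 0 ≤ F s) {a b : ℝ} (ha : a ∈ Icc 0 T) (hb : b ∈ Icc 0 T) (hab : a ≤ b) :
    ∫ s in a..b, F s ≤ ∫ s, F s ∂timeMeasure T := by
  have h1 : IntegrableOn F (Icc 0 T) := by
    rw [integrableOn_Icc_iff_integrableOn_Ioo]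
    exact hF
  rw [intervalIntegral.integral_of_le hab, ← integral_Icc_eq_integral_Ioo]
  exact setIntegral_mono_set h1 (ae_of_all _ h0)
    (Ioc_subset_Icc_self.trans (Icc_subset_Icc ha.1 hb.2)).eventuallyLE

theorem integral_timeMeasure_eq (hT : 0 ≤ T) (F : ℝ → ℝ) :
    ∫ s, F s ∂timeMeasure T = ∫ s in 0..T, F s := by
  rw [intervalIntegral.integral_of_le hT, ← integral_Ioc_eq_integral_Ioo]

theorem integrable_timeMeasure_of_continuous {F : ℝ → ℝ} (hF : Continuous F) :
    Integrable F (timeMeasure T) :=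
  (hF.integrableOn_Icc (a := 0) (b := T)).mono_set Ioo_subset_Icc_self

/-- The a priori bounds given by the energy inequality. -/
theorem exists_bound_of_energy_le (hr₁ : 1 ≤ r) (hr₃ : r ≤ 3) (hT : 0 < T) (hμ : 0 < μ)
    (hβ : 0 < β) (u₀ : HSpace O) (G : ℝ) :
    ∃ K : ℝ, 0 ≤ K ∧ ∀ (g : ℝ → StrongDual ℝ (VSpace O)) (u : ℝ → VSpace O), Continuous g →
      Continuous u → ∫ s, ‖g s‖ ^ 2 ∂timeMeasure T ≤ G →
      (∀ t ∈ Icc 0 T, ‖embV (u t)‖ ^ 2 + 2 * μ * (∫ s in 0..t, ‖gradV (u s)‖ ^ 2) +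
        2 * β * (∫ s in 0..t, powNorm (r + 1) (embV (u s))) ≤
          ‖u₀‖ ^ 2 + 2 * ∫ s in 0..t, g s (u s)) →
      (∀ t ∈ Icc 0 T, ‖embV (u t)‖ ≤ K) ∧ (∫ s, ‖u s‖ ^ 2 ∂timeMeasure T ≤ K) ∧
        ∫ s, powNorm (r + 1) (embV (u s)) ∂timeMeasure T ≤ K := by
  obtain ⟨C, hC0, hC⟩ := exists_norm_le_norm_gradV (O := O)
  -- From 2g(u) ≤ μ‖∇u‖² + (C²/μ)‖g‖², which uses up half of the viscous term.
  set B : ℝ := ‖u₀‖ ^ 2 + C ^ 2 / μ * max G 0 with hB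
  have hB0 : 0 ≤ B := by positivity
  refine ⟨1 + B + C ^ 2 * (B / μ) + B / (2 * β), by positivity, fun g u hg hu hG he => ?_⟩
  have c1 : Continuous fun s => ‖gradV (u s)‖ ^ 2 := (continuous_gradV.comp hu).norm.pow 2
  have c2 : Continuous fun s => powNorm (r + 1) (embV (u s)) :=
    (continuous_powNorm_embV hr₁ hr₃).comp hu
  have c3 : Continuous fun s => g s (u s) := hg.clm_apply hu
  have c4 : Continuous fun s => ‖g s‖ ^ 2 := hg.norm.pow 2
  have hb : ∀ t ∈ Icc 0 T, ‖embV (u t)‖ ^ 2 + μ * (∫ s in 0..t, ‖gradV (u s)‖ ^ 2) +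
      2 * β * (∫ s in 0..t, powNorm (r + 1) (embV (u s))) ≤ B := by
    intro t ht
    have h1 : 2 * ∫ s in 0..t, g s (u s) ≤ μ * (∫ s in 0..t, ‖gradV (u s)‖ ^ 2) +
        C ^ 2 / μ * ∫ s in 0..t, ‖g s‖ ^ 2 := by
      rw [← intervalIntegral.integral_const_mul, ← intervalIntegral.integral_const_mul,
        ← intervalIntegral.integral_const_mul, ← intervalIntegral.integral_add
          ((c1.const_mul μ).intervalIntegrable _ _) ((c4.const_mul _).intervalIntegrable _ _)]
      refine intervalIntegral.integral_mono_on ht.1 ((c3.const_mul 2).intervalIntegrable _ _)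
        (((c1.const_mul μ).add (c4.const_mul _)).intervalIntegrable _ _) fun s _ => ?_
      have a1 : g s (u s) ≤ ‖g s‖ * (C * ‖gradV (u s)‖) :=
        (le_abs_self _).trans (((g s).le_opNorm (u s)).trans
          (mul_le_mul_of_nonneg_left (hC _) (norm_nonneg _)))
      have a2 : 0 ≤ (μ * ‖gradV (u s)‖ - C * ‖g s‖) ^ 2 / μ := by positivity
      have a3 : (μ * ‖gradV (u s)‖ - C * ‖g s‖) ^ 2 / μ = μ * ‖gradV (u s)‖ ^ 2 +
          C ^ 2 / μ * ‖g s‖ ^ 2 - 2 * (‖g s‖ * (C * ‖gradV (u s)‖)) := by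
        field_simp
        ring
      linarith
    have h2 := intervalIntegral_le_integral_timeMeasure (T := T)
      (integrable_timeMeasure_of_continuous c4) (fun s => by positivity)
      (left_mem_Icc.2 hT.le) ht ht.1
    have h3 : C ^ 2 / μ * ∫ s in 0..t, ‖g s‖ ^ 2 ≤ C ^ 2 / μ * max G 0 :=
      mul_le_mul_of_nonneg_left ((h2.trans hG).trans (le_max_left _ _)) (by positivity)
    have := he t ht
    linarith
  have p1 : ∀ t ∈ Icc 0 T, 0 ≤ μ * ∫ s in 0..t, ‖gradV (u s)‖ ^ 2 := fun t ht =>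
    mul_nonneg hμ.le (intervalIntegral.integral_nonneg ht.1 fun _ _ => by positivity)
  have p2 : ∀ t ∈ Icc 0 T, 0 ≤ 2 * β * ∫ s in 0..t, powNorm (r + 1) (embV (u s)) := fun t ht =>
    mul_nonneg (by positivity) (intervalIntegral.integral_nonneg ht.1 fun _ _ => powNorm_nonneg _ _)
  have q1 : 0 ≤ C ^ 2 * (B / μ) := by positivity
  have q2 : 0 ≤ B / (2 * β) := by positivity
  have hTT := right_mem_Icc.2 hT.le
  refine ⟨fun t ht => ?_, ?_, ?_⟩
  · have h1 := hb t ht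
    have h2 := p1 t ht
    have h3 := p2 t ht
    nlinarith [sq_nonneg (‖embV (u t)‖ - 1)]
  · have h1 : ∫ s in 0..T, ‖gradV (u s)‖ ^ 2 ≤ B / μ := by
      rw [le_div_iff₀ hμ]
      have := hb T hTT
      have := p2 T hTT
      nlinarith [sq_nonneg ‖embV (u T)‖]
    have h2 : ∫ s, ‖u s‖ ^ 2 ∂timeMeasure T ≤ C ^ 2 * ∫ s in 0..T, ‖gradV (u s)‖ ^ 2 := by
      rw [integral_timeMeasure_eq hT.le, ← intervalIntegral.integral_const_mul]
      refine intervalIntegral.integral_mono_on hT.le ((hu.norm.pow 2).intervalIntegrable _ _)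
        ((c1.const_mul _).intervalIntegrable _ _) fun s _ => ?_
      rw [← mul_pow]
      exact pow_le_pow_left₀ (norm_nonneg _) (hC _) 2
    have h3 := mul_le_mul_of_nonneg_left h1 (sq_nonneg C)
    linarith
  · rw [integral_timeMeasure_eq hT.le]
    have h1 : ∫ s in 0..T, powNorm (r + 1) (embV (u s)) ≤ B / (2 * β) := by
      rw [le_div_iff₀ (by positivity)]
      have := hb T hTT
      have := p1 T hTT
      nlinarith [sq_nonneg ‖embV (u T)‖]
    linarith

/-- An arbitrarily small multiple of quantities bounded in L¹(0, T), plus a constant: its integral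
over a short interval is small uniformly over all approximations. This gives equicontinuity in time.
-/
theorem exists_abs_cbfOp_test_le (hr₁ : 1 ≤ r) (hr₃ : r ≤ 3) (μ : ℝ) (hβ : 0 < β)
    (φ : divFreeTest O) (M : ℝ) {ε : ℝ} (hε : 0 < ε) :
    ∃ C : ℝ, 0 ≤ C ∧ ∀ (ℓ : StrongDual ℝ (VSpace O)) (v : VSpace O), ‖embV v‖ ≤ M →
      |(ℓ + cbfOp hr₁ hr₃ μ β v) (testToV φ)| ≤
        ε * (‖ℓ‖ ^ 2 + ‖v‖ ^ 2 + powNorm (r + 1) (embV v)) + C := by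
  obtain ⟨K, hK0, hK⟩ := exists_abs_convForm_test_le φ
  set z := testToV φ
  have hε' : 0 < ε / β := by positivity
  have hp := powNorm_nonneg (r + 1) (embV z)
  refine ⟨ε⁻¹ * ‖z‖ ^ 2 + ε⁻¹ * (|μ| * ‖gradV z‖) ^ 2 + K * M ^ 2 +
    β * ((ε / β)⁻¹ ^ r * powNorm (r + 1) (embV z)), by positivity, fun ℓ v hv => ?_⟩
  have h1 : |ℓ z| ≤ ε * ‖ℓ‖ ^ 2 + ε⁻¹ * ‖z‖ ^ 2 := (ℓ.le_opNorm z).trans (mul_le_mul_sq_add hε)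
  have h2 : |μ * inner ℝ (gradV v) (gradV z)| ≤ ε * ‖v‖ ^ 2 + ε⁻¹ * (|μ| * ‖gradV z‖) ^ 2 := by
    rw [abs_mul]
    calc |μ| * |inner ℝ (gradV v) (gradV z)| ≤ |μ| * (‖gradV v‖ * ‖gradV z‖) := by
          gcongr; exact abs_real_inner_le_norm _ _
      _ ≤ |μ| * (‖v‖ * ‖gradV z‖) := by gcongr; exact norm_gradV_le v
      _ = ‖v‖ * (|μ| * ‖gradV z‖) := by ring
      _ ≤ _ := mul_le_mul_sq_add hε
  have h3 : |convForm v v z| ≤ K * M ^ 2 := by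
    rw [convForm_antisymm, abs_neg]
    refine (hK v v).trans ?_
    rw [← sq]
    gcongr
  have h4 : |β * dampForm hr₁ hr₃ v z| ≤ ε * powNorm (r + 1) (embV v) +
      β * ((ε / β)⁻¹ ^ r * powNorm (r + 1) (embV z)) := by
    rw [abs_mul, abs_of_pos hβ]
    refine (mul_le_mul_of_nonneg_left (abs_dampForm_le hr₁ hr₃ hε' v z) hβ.le).trans (le_of_eq ?_)
    rw [mul_add, ← mul_assoc, mul_div_cancel₀ _ hβ.ne']
  rw [add_apply, cbfOp_apply]
  rw [abs_le] at h1 h2 h3 h4 ⊢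
  constructor <;> linarith [h1.1, h1.2, h2.1, h2.2, h3.1, h3.2, h4.1, h4.2]

end CBF

/-! ### Extraction of a weakly convergent Galerkin sequence. -/

namespace CBF

variable {d : ℕ} {O : Set (Vec d)} [Admissible O] {T μ β r : ℝ}

/-- A sequence of Galerkin approximations `u n`, with forces `g n`, of the Cauchy problem with data
`f`, `u₀`, that converges weakly in `H` to `w` at all times. -/
structure IsGalerkinLimit (hr₁ : 1 ≤ r) (hr₃ : r ≤ 3) (T μ β : ℝ) (f : ℝ → StrongDual ℝ (VSpace O))
    (u₀ : HSpace O) (φ : ℕ → divFreeTest O) (g : ℕ → ℝ → StrongDual ℝ (VSpace O))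
    (u : ℕ → ℝ → VSpace O) (w : ℝ → HSpace O) (K : ℝ) : Prop where
  dense : DenseRange fun k => testToV (φ k)
  continuous_force : ∀ n, Continuous (g n)
  tendsto_force : Tendsto (fun n => ∫ s, ‖g n s - f s‖ ^ 2 ∂timeMeasure T) atTop (𝓝 0)
  continuous : ∀ n, Continuous (u n)
  norm_le : ∀ n, ∀ t ∈ Icc 0 T, ‖embV (u n t)‖ ≤ K
  integral_norm_sq_le : ∀ n, ∫ s, ‖u n s‖ ^ 2 ∂timeMeasure T ≤ K
  integral_powNorm_le : ∀ n, ∫ s, powNorm (r + 1) (embV (u n s)) ∂timeMeasure T ≤ K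
  eq_add_integral : ∀ k, ∀ᶠ n in atTop, ∀ t ∈ Icc 0 T,
    inner ℝ (embV (u n t)) (embV (testToV (φ k))) = inner ℝ u₀ (embV (testToV (φ k))) +
      ∫ s in 0..t, (g n s + cbfOp hr₁ hr₃ μ β (u n s)) (testToV (φ k))
  energy_le : ∀ n, ∀ t ∈ Icc 0 T, ‖embV (u n t)‖ ^ 2 +
    2 * μ * (∫ s in 0..t, ‖gradV (u n s)‖ ^ 2) +
      2 * β * (∫ s in 0..t, powNorm (r + 1) (embV (u n s))) ≤
        ‖u₀‖ ^ 2 + 2 * ∫ s in 0..t, g n s (u n s)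
  weak : ∀ t ∈ Icc 0 T, ∀ z, Tendsto (fun n => inner ℝ (embV (u n t)) z) atTop (𝓝 (inner ℝ (w t) z))

theorem integral_norm_sq_le_of_eLpNorm_le {α E : Type*} {m : MeasurableSpace α} {ν : Measure α}
    [NormedAddCommGroup E] {F : α → E} (hF : MemLp F 2 ν) {ε : ℝ} (hε : 0 ≤ ε)
    (h : eLpNorm F 2 ν ≤ ENNReal.ofReal ε) : ∫ s, ‖F s‖ ^ 2 ∂ν ≤ ε ^ 2 := by
  rw [hF.eLpNorm_eq_integral_rpow_norm (by norm_num) (by norm_num),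
    ENNReal.ofReal_le_ofReal_iff hε] at h
  simp only [ENNReal.toReal_ofNat, Real.rpow_two] at h
  have h0 : 0 ≤ ∫ s, ‖F s‖ ^ 2 ∂ν := integral_nonneg fun _ => by positivity
  have h1 := pow_le_pow_left₀ (by positivity) h 2
  rwa [← Real.rpow_natCast, ← Real.rpow_mul h0, Nat.cast_ofNat, inv_mul_cancel₀ (by norm_num),
    Real.rpow_one] at h1

/-- The Galerkin systems are solved classically and need a force continuous in time; the uniform
bound G keeps the a priori estimates independent of n. -/
theorem exists_continuous_seq {E : Type*} [NormedAddCommGroup E] [NormedSpace ℝ E] {f : ℝ → E}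
    (hf : MemLp f 2 (timeMeasure T)) : ∃ (g : ℕ → ℝ → E) (G : ℝ), (∀ n, Continuous (g n)) ∧
      Tendsto (fun n => ∫ s, ‖g n s - f s‖ ^ 2 ∂timeMeasure T) atTop (𝓝 0) ∧
      ∀ n, ∫ s, ‖g n s‖ ^ 2 ∂timeMeasure T ≤ G := by
  have h : ∀ n : ℕ, ∃ g : ℝ → E, Continuous g ∧ MemLp g 2 (timeMeasure T) ∧
      ∫ s, ‖g s - f s‖ ^ 2 ∂timeMeasure T ≤ (1 / ((n : ℝ) + 1)) ^ 2 := by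
    intro n
    have hε : (0 : ℝ) < 1 / ((n : ℝ) + 1) := by positivity
    obtain ⟨g, h1, h2⟩ := hf.exists_boundedContinuous_eLpNorm_sub_le (by norm_num)
      (ENNReal.ofReal_pos.2 hε).ne'
    refine ⟨g, g.continuous, h2, ?_⟩
    rw [eLpNorm_sub_comm] at h1
    exact integral_norm_sq_le_of_eLpNorm_le (h2.sub hf) hε.le h1
  choose g hg hg2 hgf using h
  refine ⟨g, 2 * 1 + 2 * ∫ s, ‖f s‖ ^ 2 ∂timeMeasure T, hg, ?_, fun n => ?_⟩
  · have h0 := (tendsto_one_div_add_atTop_nhds_zero_nat (𝕜 := ℝ)).pow 2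
    rw [zero_pow two_ne_zero] at h0
    exact squeeze_zero (fun n => integral_nonneg fun _ => by positivity) hgf h0
  · have i1 : Integrable (fun s => ‖g n s - f s‖ ^ 2) (timeMeasure T) :=
      ((hg2 n).sub hf).integrable_norm_pow (by norm_num)
    have i2 : Integrable (fun s => ‖f s‖ ^ 2) (timeMeasure T) :=
      hf.integrable_norm_pow (by norm_num)
    have i3 : Integrable (fun s => ‖g n s‖ ^ 2) (timeMeasure T) :=
      (hg2 n).integrable_norm_pow (by norm_num)
    have h1 : ∫ s, ‖g n s‖ ^ 2 ∂timeMeasure T ≤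
        2 * (∫ s, ‖g n s - f s‖ ^ 2 ∂timeMeasure T) + 2 * ∫ s, ‖f s‖ ^ 2 ∂timeMeasure T := by
      rw [← integral_const_mul, ← integral_const_mul, ← integral_add (i1.const_mul 2)
        (i2.const_mul 2)]
      refine integral_mono i3 ((i1.const_mul 2).add (i2.const_mul 2)) fun s => ?_
      have a : ‖g n s‖ ≤ ‖g n s - f s‖ + ‖f s‖ := by
        simpa using norm_add_le (g n s - f s) (f s)
      simp only
      nlinarith [sq_nonneg (‖g n s - f s‖ - ‖f s‖), norm_nonneg (g n s),
        pow_le_pow_left₀ (norm_nonneg _) a 2]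
    have h2 : (1 / ((n : ℝ) + 1)) ^ 2 ≤ 1 := by
      refine pow_le_one₀ (by positivity) ?_
      rw [div_le_one (by positivity)]
      linarith [Nat.cast_nonneg (α := ℝ) n]
    linarith [hgf n]

theorem exists_isGalerkinLimit (hr₁ : 1 ≤ r) (hr₃ : r ≤ 3) (hT : 0 < T) (hμ : 0 < μ) (hβ : 0 < β)
    (u₀ : HSpace O) {f : ℝ → StrongDual ℝ (VSpace O)} (hf : MemLp f 2 (timeMeasure T)) :
    ∃ φ g u w K, IsGalerkinLimit hr₁ hr₃ T μ β f u₀ φ g u w K := by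
  obtain ⟨φ, hφ⟩ := exists_denseRange_testToV (O := O)
  obtain ⟨g, G, hg, hgf, hG⟩ := exists_continuous_seq hf
  obtain ⟨K, hK0, hK⟩ := exists_bound_of_energy_le hr₁ hr₃ hT hμ hβ u₀ G
  -- The n-th space is spanned by the fields of index less than n, so each field is admissible in
  -- the equation for all later n.
  have hu : ∀ n : ℕ, ∃ u : ℝ → VSpace O, _ := fun n => by
    have : FiniteDimensional ℝ (Submodule.span ℝ ((fun k => testToV (φ k)) '' Iio n)) :=
      FiniteDimensional.span_of_finite ℝ ((finite_Iio n).image _)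
    exact exists_galerkin_cbf hr₁ hr₃ hT hμ hβ u₀ (hg n)
      (Submodule.span ℝ ((fun k => testToV (φ k)) '' Iio n))
  choose u hu heq hu0 he using hu
  have hS : ∀ {k n : ℕ}, k < n →
      testToV (φ k) ∈ Submodule.span ℝ ((fun k => testToV (φ k)) '' Iio n) := fun h =>
    Submodule.subset_span ⟨_, h, rfl⟩
  have hb := fun n => hK (g n) (u n) (hg n) (hu n) (hG n) (he n)
  have hG0 : 0 ≤ G := (integral_nonneg fun _ => by positivity).trans (hG 0)
  -- The small multiple ε/(2(G + K + K + 1)) is matched to the bounds G, K, K of the three integrals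
  -- and costs at most ε/2; the constant C costs at most ε/2 on intervals shorter than δ.
  have hequi : ∀ k, ∀ ε > 0, ∃ δ > 0, ∀ᶠ n in atTop, ∀ s ∈ Icc 0 T, ∀ t ∈ Icc 0 T, |s - t| < δ →
      |inner ℝ (embV (u n s)) (embV (testToV (φ k))) -
        inner ℝ (embV (u n t)) (embV (testToV (φ k)))| ≤ ε := by
    intro k ε hε
    obtain ⟨C, hC0, hC⟩ := exists_abs_cbfOp_test_le (O := O) hr₁ hr₃ μ hβ (φ k) K
      (ε := ε / (2 * (G + K + K + 1))) (by positivity)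
    refine ⟨ε / (2 * (C + 1)), by positivity, (eventually_gt_atTop k).mono fun n hn => ?_⟩
    have key : ∀ a ∈ Icc 0 T, ∀ b ∈ Icc 0 T, a ≤ b → b - a < ε / (2 * (C + 1)) →
        |inner ℝ (embV (u n b)) (embV (testToV (φ k))) -
          inner ℝ (embV (u n a)) (embV (testToV (φ k)))| ≤ ε := by
      intro a ha b hb' hab hδ
      rw [heq n _ (hS hn) a ha b hb', add_sub_cancel_left]
      set ε' := ε / (2 * (G + K + K + 1)) with hε'
      set Q : ℝ → ℝ := fun s => ‖g n s‖ ^ 2 + ‖u n s‖ ^ 2 + powNorm (r + 1) (embV (u n s)) with hQ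
      have c1 : Continuous fun s => ‖g n s‖ ^ 2 := (hg n).norm.pow 2
      have c2 : Continuous fun s => ‖u n s‖ ^ 2 := (hu n).norm.pow 2
      have c12 : Continuous fun s => ‖g n s‖ ^ 2 + ‖u n s‖ ^ 2 := c1.add c2
      have c3 : Continuous fun s => powNorm (r + 1) (embV (u n s)) :=
        (continuous_powNorm_embV hr₁ hr₃).comp (hu n)
      have cQ : Continuous Q := c12.add c3
      have hQi : ∫ s, Q s ∂timeMeasure T ≤ G + K + K := by
        rw [hQ, integral_add (integrable_timeMeasure_of_continuous c12)
          (integrable_timeMeasure_of_continuous c3),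
          integral_add (integrable_timeMeasure_of_continuous c1)
          (integrable_timeMeasure_of_continuous c2)]
        exact add_le_add (add_le_add (hG n) (hb n).2.1) (hb n).2.2
      have hQab := (intervalIntegral_le_integral_timeMeasure
        (integrable_timeMeasure_of_continuous cQ) (fun s => by
          have := powNorm_nonneg (r + 1) (embV (u n s))
          positivity) ha hb' hab).trans hQi
      have h1 : |∫ s in a..b, (g n s + cbfOp hr₁ hr₃ μ β (u n s)) (testToV (φ k))| ≤
          ∫ s in a..b, (ε' * Q s + C) := by
        rw [← Real.norm_eq_abs]
        refine intervalIntegral.norm_integral_le_of_norm_le hab (ae_of_all _ fun s hs => ?_)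
          (((cQ.const_mul ε').add continuous_const).intervalIntegrable _ _)
        exact hC (g n s) (u n s) ((hb n).1 s ⟨ha.1.trans hs.1.le, hs.2.trans hb'.2⟩)
      rw [intervalIntegral.integral_add ((cQ.const_mul ε').intervalIntegrable _ _)
        (continuous_const.intervalIntegrable _ _), intervalIntegral.integral_const_mul,
        intervalIntegral.integral_const, smul_eq_mul] at h1
      have h2 : ε' * (∫ s in a..b, Q s) ≤ ε / 2 := by
        calc ε' * (∫ s in a..b, Q s) ≤ ε' * (G + K + K + 1) := by
              refine mul_le_mul_of_nonneg_left (by linarith) (by positivity)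
          _ = ε / 2 := by
              rw [hε']
              field_simp
      have h3 : (b - a) * C ≤ ε / 2 := by
        calc (b - a) * C ≤ ε / (2 * (C + 1)) * (C + 1) :=
              mul_le_mul hδ.le (by linarith) hC0 (by positivity)
          _ = ε / 2 := by field_simp
      linarith
    intro s hs t ht hst
    rcases le_total s t with h | h
    · rw [abs_sub_comm]
      refine key s hs t ht h ?_
      rwa [abs_sub_comm, abs_of_nonneg (by linarith)] at hst
    · refine key t ht s hs h ?_
      rwa [abs_of_nonneg (by linarith)] at hst
  obtain ⟨σ, hσ, hlim⟩ := exists_subseq_forall_tendsto hT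
    (y := fun n k t => inner ℝ (embV (u n t)) (embV (testToV (φ k))))
    (M := fun k => K * ‖embV (testToV (φ k))‖) (fun n k t ht =>
      (abs_real_inner_le_norm _ _).trans
        (mul_le_mul_of_nonneg_right ((hb n).1 t ht) (norm_nonneg _))) hequi
  have hdense : DenseRange fun k => embV (testToV (φ k)) :=
    (denseRange_embVL (O := O)).comp hφ (embVL O).continuous
  have hw : ∀ t, ∃ a : HSpace O, t ∈ Icc 0 T → ∀ z,
      Tendsto (fun n => inner ℝ (embV (u (σ n) t)) z) atTop (𝓝 (inner ℝ a z)) := by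
    intro t
    by_cases ht : t ∈ Icc 0 T
    · obtain ⟨a, -, ha⟩ := exists_weakLimit_of_dense (x := fun n => embV (u (σ n) t))
        (fun n => (hb (σ n)).1 t ht) hdense fun k => hlim k t ht
      exact ⟨a, fun _ => ha⟩
    · exact ⟨0, fun h => absurd h ht⟩
  choose w hw using hw
  refine ⟨φ, fun n => g (σ n), fun n => u (σ n), w, K, hφ, fun n => hg _,
    hgf.comp hσ.tendsto_atTop, fun n => hu _, fun n => (hb _).1, fun n => (hb _).2.1,
    fun n => (hb _).2.2, fun k => ?_, fun n => he _, fun t ht => hw t ht⟩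
  filter_upwards [hσ.tendsto_atTop.eventually_gt_atTop k] with n hn t ht
  rw [heq (σ n) _ (hS hn) 0 (left_mem_Icc.2 hT.le) t ht, hu0 (σ n) _ (hS hn)]

end CBF

/-! ### Convergence of the individual terms. -/

namespace CBF

/-- The common scheme of the limits: Q is only bounded in L¹ but carries an arbitrarily small
factor, while D tends to 0 in L¹ and may carry any factor. -/
theorem tendsto_integral_of_abs_sub_le {α : Type*} {m : MeasurableSpace α} {ν : Measure α}
    {F Q D : ℕ → α → ℝ} {F₀ : α → ℝ} (hF : ∀ n, Integrable (F n) ν) (hF₀ : Integrable F₀ ν)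
    (hQ : ∀ n, Integrable (Q n) ν) (hD : ∀ n, Integrable (D n) ν) {M : ℝ}
    (hM : ∀ n, ∫ s, Q n s ∂ν ≤ M) (hDt : Tendsto (fun n => ∫ s, D n s ∂ν) atTop (𝓝 0))
    (hle : ∀ ε > 0, ∃ C, ∀ n, ∀ᵐ s ∂ν, |F n s - F₀ s| ≤ ε * Q n s + C * D n s) :
    Tendsto (fun n => ∫ s, F n s ∂ν) atTop (𝓝 (∫ s, F₀ s ∂ν)) := by
  rw [Metric.tendsto_atTop]
  intro ε hε
  have hε' : 0 < ε / (2 * (|M| + 1)) := by positivity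
  obtain ⟨C, hC⟩ := hle _ hε'
  have h1 : Tendsto (fun n => C * ∫ s, D n s ∂ν) atTop (𝓝 0) := by
    simpa using hDt.const_mul C
  obtain ⟨N, hN⟩ := eventually_atTop.1 (h1.eventually_lt_const (half_pos hε))
  refine ⟨N, fun n hn => ?_⟩
  rw [dist_eq_norm, ← integral_sub (hF n) hF₀]
  have hi : Integrable (fun s => ε / (2 * (|M| + 1)) * Q n s + C * D n s) ν :=
    ((hQ n).const_mul _).add ((hD n).const_mul C)
  have h2 := norm_integral_le_of_norm_le (f := fun s => F n s - F₀ s) hi (hC n)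
  refine h2.trans_lt ?_
  have h3 : ∫ s, (ε / (2 * (|M| + 1)) * Q n s + C * D n s) ∂ν =
      ε / (2 * (|M| + 1)) * (∫ s, Q n s ∂ν) + C * ∫ s, D n s ∂ν := by
    rw [integral_add ((hQ n).const_mul _) ((hD n).const_mul C), integral_const_mul,
      integral_const_mul]
  rw [h3]
  have h4 : ε / (2 * (|M| + 1)) * (∫ s, Q n s ∂ν) ≤ ε / 2 := by
    calc ε / (2 * (|M| + 1)) * (∫ s, Q n s ∂ν) ≤ ε / (2 * (|M| + 1)) * (|M| + 1) := by
          refine mul_le_mul_of_nonneg_left ?_ hε'.le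
          linarith [hM n, le_abs_self M]
      _ = ε / 2 := by field_simp
  linarith [hN n hn]

variable {d : ℕ} {O : Set (Vec d)}

theorem lowerSemicontinuous_eLpNorm_field (p : ℝ≥0∞) {q : ℝ} (hq : 0 ≤ q) :
    LowerSemicontinuous fun w : HSpace O => eLpNorm (field w) p (volOn O) ^ q :=
  (ENNReal.continuous_rpow_const (y := q)).comp_lowerSemicontinuous
    (fun w => (lowerSemicontinuous_eLpNorm p (HSpace.toL2 w)).comp
      (HSpace.toL2 (O := O)).continuous.continuousAt)
    (ENNReal.monotone_rpow_of_nonneg hq)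

variable [Admissible O] {T μ β r : ℝ}

/-- Fatou's lemma for the `L^{r+1}` norms of a strongly convergent sequence. -/
theorem integrable_powNorm_of_tendsto (hr₁ : 1 ≤ r) (hr₃ : r ≤ 3) {α : Type*}
    {m : MeasurableSpace α} {ν : Measure α} {u : ℕ → α → VSpace O} {v : α → VSpace O}
    (hu : ∀ n, MemLp (u n) 2 ν) (hv : MemLp v 2 ν)
    (hui : ∀ n, Integrable (fun s => powNorm (r + 1) (embV (u n s))) ν)
    (huv : Tendsto (fun n => ∫ s, ‖embV (u n s) - embV (v s)‖ ^ 2 ∂ν) atTop (𝓝 0))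
    {R : ℕ → ℝ} {R₀ : ℝ} (hR : Tendsto R atTop (𝓝 R₀))
    (hle : ∀ n, ∫ s, powNorm (r + 1) (embV (u n s)) ∂ν ≤ R n) :
    Integrable (fun s => powNorm (r + 1) (embV (v s))) ν ∧
      ∫ s, powNorm (r + 1) (embV (v s)) ∂ν ≤ R₀ := by
  have hU : ∀ n, MemLp (fun s => embV (u n s)) 2 ν := fun n => (embVL O).comp_memLp' (hu n)
  have hV : MemLp (fun s => embV (v s)) 2 ν := (embVL O).comp_memLp' hv
  have hlp : Tendsto (fun n => eLpNorm ((fun s => embV (u n s)) - fun s => embV (v s)) 2 ν) atTop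
      (𝓝 0) := by
    have h1 : ∀ n, eLpNorm ((fun s => embV (u n s)) - fun s => embV (v s)) 2 ν =
        ENNReal.ofReal ((∫ s, ‖embV (u n s) - embV (v s)‖ ^ 2 ∂ν) ^ (2⁻¹ : ℝ)) := fun n => by
      rw [((hU n).sub hV).eLpNorm_eq_integral_rpow_norm (by norm_num) (by norm_num)]
      simp
    simp only [h1]
    have h2 := (huv.rpow_const (p := (2⁻¹ : ℝ)) (Or.inr (by norm_num)))
    rw [Real.zero_rpow (by norm_num)] at h2
    simpa using ENNReal.tendsto_ofReal h2
  -- Strong convergence in L²(H) gives convergence in H at almost every point of a subsequence.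
  -- There the L^{r+1} norm is lower semicontinuous, and Fatou's lemma compares the integral with
  -- the limit of the bounds R n, which may vary with n.
  obtain ⟨σ, hσ, hae⟩ := (tendstoInMeasure_of_tendsto_eLpNorm (by norm_num)
    (fun n => (hU n).1) hV.1 hlp).exists_seq_tendsto_ae
  have hR0 : 0 ≤ R₀ := ge_of_tendsto' hR fun n =>
    (integral_nonneg fun _ => powNorm_nonneg _ _).trans (hle n)
  have key : ∫⁻ s, ENNReal.ofReal (powNorm (r + 1) (embV (v s))) ∂ν ≤ ENNReal.ofReal R₀ := by
    calc ∫⁻ s, ENNReal.ofReal (powNorm (r + 1) (embV (v s))) ∂ν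
        ≤ ∫⁻ s, liminf (fun n => ENNReal.ofReal (powNorm (r + 1) (embV (u (σ n) s)))) atTop ∂ν := by
          refine lintegral_mono_ae ?_
          filter_upwards [hae] with s hs
          simp only [ofReal_powNorm hr₁ hr₃]
          have h1 := (lowerSemicontinuous_eLpNorm_field (O := O) (ENNReal.ofReal (r + 1))
            (q := r + 1) (by linarith)).le_liminf (embV (v s))
          exact h1.trans (liminf_le_liminf_of_le hs)
      _ ≤ liminf (fun n => ∫⁻ s, ENNReal.ofReal (powNorm (r + 1) (embV (u (σ n) s))) ∂ν) atTop :=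
          lintegral_liminf_le' fun n => (hui (σ n)).1.aemeasurable.ennreal_ofReal
      _ ≤ liminf (fun n => ENNReal.ofReal (R (σ n))) atTop := by
          refine liminf_le_liminf (Eventually.of_forall fun n => ?_)
          rw [← ofReal_integral_eq_lintegral_ofReal (hui (σ n))
            (ae_of_all _ fun _ => powNorm_nonneg _ _)]
          exact ENNReal.ofReal_le_ofReal (hle _)
      _ = ENNReal.ofReal R₀ :=
          (ENNReal.tendsto_ofReal (hR.comp hσ.tendsto_atTop)).liminf_eq
  have hm : AEStronglyMeasurable (fun s => powNorm (r + 1) (embV (v s))) ν :=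
    (continuous_powNorm_embV hr₁ hr₃).comp_aestronglyMeasurable hv.1
  have hi : Integrable (fun s => powNorm (r + 1) (embV (v s))) ν := by
    refine ⟨hm, ?_⟩
    rw [hasFiniteIntegral_iff_ofReal (ae_of_all _ fun _ => powNorm_nonneg _ _)]
    exact key.trans_lt ENNReal.ofReal_lt_top
  refine ⟨hi, ?_⟩
  rw [← ofReal_integral_eq_lintegral_ofReal hi (ae_of_all _ fun _ => powNorm_nonneg _ _)] at key
  exact (ENNReal.ofReal_le_ofReal_iff hR0).1 key

theorem integral_timeMeasure_mono {F : ℝ → ℝ} (hF : Integrable F (timeMeasure T))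
    (h0 : ∀ s, 0 ≤ F s) {t : ℝ} (ht : t ≤ T) :
    ∫ s, F s ∂timeMeasure t ≤ ∫ s, F s ∂timeMeasure T :=
  setIntegral_mono_set hF (ae_of_all _ h0) (Ioo_subset_Ioo_right ht).eventuallyLE

theorem timeMeasure_mono {t : ℝ} (ht : t ≤ T) : timeMeasure t ≤ timeMeasure T :=
  Measure.restrict_mono (Ioo_subset_Ioo_right ht) le_rfl

theorem memLp_timeMeasure_of_continuous {E : Type*} [NormedAddCommGroup E]
    [SecondCountableTopologyEither ℝ E] {F : ℝ → E} (hF : Continuous F) :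
    MemLp F 2 (timeMeasure T) := by
  refine (memLp_two_iff_integrable_sq_norm hF.aestronglyMeasurable).2 ?_
  exact integrable_timeMeasure_of_continuous (hF.norm.pow 2)

namespace IsGalerkinLimit

variable {hr₁ : 1 ≤ r} {hr₃ : r ≤ 3} {f : ℝ → StrongDual ℝ (VSpace O)} {u₀ : HSpace O}
  {φ : ℕ → divFreeTest O} {g : ℕ → ℝ → StrongDual ℝ (VSpace O)} {u : ℕ → ℝ → VSpace O}
  {w : ℝ → HSpace O} {K : ℝ}

/-- Shortening the horizon keeps all the properties, so statements proved at the final time hold at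
every time of [0, T]. -/
theorem mono (h : IsGalerkinLimit hr₁ hr₃ T μ β f u₀ φ g u w K) (hf : MemLp f 2 (timeMeasure T))
    {t : ℝ} (ht : t ∈ Icc 0 T) : IsGalerkinLimit hr₁ hr₃ t μ β f u₀ φ g u w K where
  dense := h.dense
  continuous_force := h.continuous_force
  tendsto_force := by
    refine squeeze_zero (fun n => integral_nonneg fun _ => by positivity) (fun n => ?_)
      h.tendsto_force
    exact integral_timeMeasure_mono
      (((memLp_timeMeasure_of_continuous (h.continuous_force n)).sub hf).integrable_norm_pow
        (by norm_num)) (fun _ => by positivity) ht.2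
  continuous := h.continuous
  norm_le n s hs := h.norm_le n s ⟨hs.1, hs.2.trans ht.2⟩
  integral_norm_sq_le n := (integral_timeMeasure_mono
    (integrable_timeMeasure_of_continuous ((h.continuous n).norm.pow 2))
    (fun _ => sq_nonneg _) ht.2).trans (h.integral_norm_sq_le n)
  integral_powNorm_le n := (integral_timeMeasure_mono
    (integrable_timeMeasure_of_continuous
      ((continuous_powNorm_embV hr₁ hr₃).comp (h.continuous n)))
    (fun _ => powNorm_nonneg _ _) ht.2).trans (h.integral_powNorm_le n)
  eq_add_integral k := (h.eq_add_integral k).mono fun n hn s hs => hn s ⟨hs.1, hs.2.trans ht.2⟩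
  energy_le n s hs := h.energy_le n s ⟨hs.1, hs.2.trans ht.2⟩
  weak s hs := h.weak s ⟨hs.1, hs.2.trans ht.2⟩

theorem norm_limit_le (h : IsGalerkinLimit hr₁ hr₃ T μ β f u₀ φ g u w K)
    {t : ℝ} (ht : t ∈ Icc 0 T) : ‖w t‖ ≤ K := by
  have hK0 : 0 ≤ K := (norm_nonneg _).trans (h.norm_le 0 t ht)
  have h1 : inner ℝ (w t) (w t) ≤ K * ‖w t‖ := le_of_tendsto' (h.weak t ht (w t)) fun n =>
    (real_inner_le_norm _ _).trans (mul_le_mul_of_nonneg_right (h.norm_le n t ht) (norm_nonneg _))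
  rw [real_inner_self_eq_norm_sq, sq] at h1
  rcases (norm_nonneg (w t)).eq_or_lt with h0 | h0
  · rwa [← h0]
  · exact le_of_mul_le_mul_right h1 h0

/-- The bound in L²(V) forces the pointwise weak limit to lie in V at almost every time and upgrades
the convergence to weak convergence in L²(V). -/
theorem exists_limit (h : IsGalerkinLimit hr₁ hr₃ T μ β f u₀ φ g u w K) :
    (∀ᵐ s ∂timeMeasure T, embV (asV (w s)) = w s) ∧
    MemLp (fun s => asV (w s)) 2 (timeMeasure T) ∧
      ∀ F : ℝ → StrongDual ℝ (VSpace O), MemLp F 2 (timeMeasure T) →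
        Tendsto (fun n => ∫ s, F s (u n s) ∂timeMeasure T) atTop
          (𝓝 (∫ s, F s (asV (w s)) ∂timeMeasure T)) := by
  have hdense : DenseRange fun k => embV (testToV (φ k)) :=
    (denseRange_embVL (O := O)).comp h.dense (embVL O).continuous
  have hI : ∀ᵐ s ∂timeMeasure T, s ∈ Icc 0 T := by
    filter_upwards [ae_restrict_mem measurableSet_Ioo] with s hs using Ioo_subset_Icc_self hs
  obtain ⟨v, hv, hvw, hF⟩ := exists_weakLimit_L2 (ν := timeMeasure T) (ι := embVL O) embV_injective
    hdense (u := u) (fun n => memLp_timeMeasure_of_continuous (h.continuous n))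
    h.integral_norm_sq_le (fun n => hI.mono fun s hs => h.norm_le n s hs) (w := w)
    (hI.mono fun s hs => h.weak s hs)
  have hvw' : ∀ᵐ s ∂timeMeasure T, v s = asV (w s) := hvw.mono fun s hs => by
    rw [← hs, embVL_apply, asV_embV]
  refine ⟨?_, hv.ae_eq hvw', fun F hFm => ?_⟩
  · filter_upwards [hvw, hvw'] with s h1 h2
    rw [← h2]
    exact h1
  · rw [← integral_congr_ae (hvw'.mono fun s hs => congrArg (F s) hs)]
    exact hF F hFm

theorem tendsto_integral_norm_sub_sq (h : IsGalerkinLimit hr₁ hr₃ T μ β f u₀ φ g u w K) :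
    Tendsto (fun n => ∫ s, ‖embV (u n s) - embV (asV (w s))‖ ^ 2 ∂timeMeasure T) atTop (𝓝 0) := by
  obtain ⟨hw, hv, -⟩ := h.exists_limit
  have hu := fun n => memLp_timeMeasure_of_continuous (T := T) (h.continuous n)
  have hI : ∀ᵐ s ∂timeMeasure T, s ∈ Icc 0 T := by
    filter_upwards [ae_restrict_mem measurableSet_Ioo] with s hs using Ioo_subset_Icc_self hs
  refine tendsto_integral_norm_embV_sub_sq (K := K)
    (M := 2 * K + 2 * ∫ s, ‖asV (w s)‖ ^ 2 ∂timeMeasure T) hu hv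
    (fun n => hI.mono fun s hs => h.norm_le n s hs) ?_ (fun n => ?_) ?_
  · filter_upwards [hI, hw] with s h1 h2
    rw [h2]
    exact h.norm_limit_le h1
  · have i1 : Integrable (fun s => ‖u n s‖ ^ 2) (timeMeasure T) :=
      (hu n).integrable_norm_pow (by norm_num)
    have i2 : Integrable (fun s => ‖asV (w s)‖ ^ 2) (timeMeasure T) :=
      hv.integrable_norm_pow (by norm_num)
    refine le_trans ?_ (add_le_add_left (mul_le_mul_of_nonneg_left (h.integral_norm_sq_le n)
      two_pos.le) _)
    rw [← integral_const_mul, ← integral_const_mul, ← integral_add (i1.const_mul 2)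
      (i2.const_mul 2)]
    refine integral_mono (((hu n).sub hv).integrable_norm_pow (by norm_num))
      ((i1.const_mul 2).add (i2.const_mul 2)) fun s => ?_
    have a := norm_sub_le (u n s) (asV (w s))
    simp only
    nlinarith [sq_nonneg (‖u n s‖ - ‖asV (w s)‖), pow_le_pow_left₀ (norm_nonneg _) a 2]
  · filter_upwards [hI, hw] with s h1 h2 z
    rw [h2]
    exact h.weak s h1 z

theorem integrable_powNorm (h : IsGalerkinLimit hr₁ hr₃ T μ β f u₀ φ g u w K) :
    Integrable (fun s => powNorm (r + 1) (embV (asV (w s)))) (timeMeasure T) := by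
  obtain ⟨hw, hv, -⟩ := h.exists_limit
  exact (integrable_powNorm_of_tendsto hr₁ hr₃
    (fun n => memLp_timeMeasure_of_continuous (h.continuous n)) hv
    (fun n => integrable_timeMeasure_of_continuous
      ((continuous_powNorm_embV hr₁ hr₃).comp (h.continuous n)))
    h.tendsto_integral_norm_sub_sq (tendsto_const_nhds (x := K)) h.integral_powNorm_le).1

/-- Strong convergence of the forces paired with weak convergence of the approximations. -/
theorem tendsto_integral_force (h : IsGalerkinLimit hr₁ hr₃ T μ β f u₀ φ g u w K)
    (hf : MemLp f 2 (timeMeasure T)) :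
    Tendsto (fun n => ∫ s, g n s (u n s) ∂timeMeasure T) atTop
      (𝓝 (∫ s, f s (asV (w s)) ∂timeMeasure T)) := by
  obtain ⟨hw, hv, hF⟩ := h.exists_limit
  have hu := fun n => memLp_timeMeasure_of_continuous (T := T) (h.continuous n)
  have hg := fun n => memLp_timeMeasure_of_continuous (T := T) (h.continuous_force n)
  have h1 : Tendsto (fun n => ∫ s, (g n s - f s) (u n s) ∂timeMeasure T) atTop
      (𝓝 (∫ s, (0 : ℝ) ∂timeMeasure T)) := by
    refine tendsto_integral_of_abs_sub_le (Q := fun n s => ‖u n s‖ ^ 2)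
      (D := fun n s => ‖g n s - f s‖ ^ 2) (fun n => integrable_dual_apply ((hg n).sub hf) (hu n))
      (integrable_const _) (fun n => (hu n).integrable_norm_pow (by norm_num))
      (fun n => ((hg n).sub hf).integrable_norm_pow (by norm_num)) h.integral_norm_sq_le
      h.tendsto_force fun ε hε => ⟨ε⁻¹, fun n => ae_of_all _ fun s => ?_⟩
    rw [sub_zero]
    refine ((g n s - f s).le_opNorm (u n s)).trans ?_
    rw [mul_comm]
    exact mul_le_mul_sq_add hε
  have h2 := h1.add (hF f hf)
  rw [integral_zero, zero_add] at h2
  refine h2.congr fun n => ?_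
  have i : Integrable (fun s => (g n s - f s) (u n s)) (timeMeasure T) :=
    integrable_dual_apply ((hg n).sub hf) (hu n)
  rw [← integral_add i (integrable_dual_apply hf (hu n))]
  simp

end IsGalerkinLimit

end CBF

/-! ### The energy inequality and the equation in the limit. -/

namespace CBF

variable {d : ℕ} {O : Set (Vec d)} [Admissible O] {T μ β r : ℝ}

namespace IsGalerkinLimit

variable {hr₁ : 1 ≤ r} {hr₃ : r ≤ 3} {f : ℝ → StrongDual ℝ (VSpace O)} {u₀ : HSpace O}
  {φ : ℕ → divFreeTest O} {g : ℕ → ℝ → StrongDual ℝ (VSpace O)} {u : ℕ → ℝ → VSpace O}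
  {w : ℝ → HSpace O} {K : ℝ}

/-- The quadratic terms are bounded below by 2⟨a, b⟩ - ‖b‖² ≤ ‖a‖², with b the limit, and these
linear expressions converge by weak convergence. What remains of the energy inequality is an upper
bound R n for the damping integral, to which Fatou's lemma applies with the limit of R n. -/
theorem energy_limit_le (h : IsGalerkinLimit hr₁ hr₃ T μ β f u₀ φ g u w K) (hT : 0 ≤ T)
    (hμ : 0 < μ) (hβ : 0 < β) (hf : MemLp f 2 (timeMeasure T)) :
    ‖w T‖ ^ 2 + 2 * μ * (∫ s, ‖gradV (asV (w s))‖ ^ 2 ∂timeMeasure T) +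
      2 * β * (∫ s, powNorm (r + 1) (embV (asV (w s))) ∂timeMeasure T) ≤
        ‖u₀‖ ^ 2 + 2 * ∫ s, f s (asV (w s)) ∂timeMeasure T := by
  obtain ⟨hw, hv, hF⟩ := h.exists_limit
  have hu := fun n => memLp_timeMeasure_of_continuous (T := T) (h.continuous n)
  have hTT : T ∈ Icc 0 T := ⟨hT, le_rfl⟩
  have t1 := hF (fun s => viscForm O (asV (w s))) ((viscForm O).comp_memLp' hv)
  have e1 : ∫ s, viscForm O (asV (w s)) (asV (w s)) ∂timeMeasure T =
      ∫ s, ‖gradV (asV (w s))‖ ^ 2 ∂timeMeasure T :=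
    integral_congr_ae (ae_of_all _ fun s => by
      simp only [viscForm_apply, real_inner_self_eq_norm_sq])
  rw [e1] at t1
  have t2 := h.weak T hTT (w T)
  rw [real_inner_self_eq_norm_sq] at t2
  have t3 := h.tendsto_integral_force hf
  set E := ∫ s, ‖gradV (asV (w s))‖ ^ 2 ∂timeMeasure T with hE
  set R : ℕ → ℝ := fun n => (‖u₀‖ ^ 2 + 2 * (∫ s, g n s (u n s) ∂timeMeasure T) -
    (2 * inner ℝ (embV (u n T)) (w T) - ‖w T‖ ^ 2) -
      2 * μ * (2 * (∫ s, viscForm O (asV (w s)) (u n s) ∂timeMeasure T) - E)) / (2 * β) with hR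
  have tR : Tendsto R atTop (𝓝 ((‖u₀‖ ^ 2 + 2 * (∫ s, f s (asV (w s)) ∂timeMeasure T) -
      (2 * ‖w T‖ ^ 2 - ‖w T‖ ^ 2) - 2 * μ * (2 * E - E)) / (2 * β))) :=
    ((((t3.const_mul 2).const_add _).sub ((t2.const_mul 2).sub_const _)).sub
      (((t1.const_mul 2).sub_const _).const_mul _)).div_const _
  have hle : ∀ n, ∫ s, powNorm (r + 1) (embV (u n s)) ∂timeMeasure T ≤ R n := by
    intro n
    have a1 := h.energy_le n T hTT
    rw [← integral_timeMeasure_eq hT, ← integral_timeMeasure_eq hT,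
      ← integral_timeMeasure_eq hT] at a1
    have a2 : 2 * inner ℝ (embV (u n T)) (w T) - ‖w T‖ ^ 2 ≤ ‖embV (u n T)‖ ^ 2 := by
      have := sq_nonneg ‖embV (u n T) - w T‖
      rw [norm_sub_sq_real] at this
      linarith
    have a3 : 2 * (∫ s, viscForm O (asV (w s)) (u n s) ∂timeMeasure T) - E ≤
        ∫ s, ‖gradV (u n s)‖ ^ 2 ∂timeMeasure T := by
      have i1 : Integrable (fun s => viscForm O (asV (w s)) (u n s)) (timeMeasure T) :=
        integrable_dual_apply ((viscForm O).comp_memLp' hv) (hu n)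
      have i2 : Integrable (fun s => ‖gradV (asV (w s))‖ ^ 2) (timeMeasure T) :=
        ((gradVL O).comp_memLp' hv).integrable_norm_pow (by norm_num)
      have i3 : Integrable (fun s => ‖gradV (u n s)‖ ^ 2) (timeMeasure T) :=
        ((gradVL O).comp_memLp' (hu n)).integrable_norm_pow (by norm_num)
      rw [hE, ← integral_const_mul, ← integral_sub (i1.const_mul 2) i2]
      refine integral_mono ((i1.const_mul 2).sub i2) i3 fun s => ?_
      have := sq_nonneg ‖gradV (asV (w s)) - gradV (u n s)‖
      rw [norm_sub_sq_real] at this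
      simp only [viscForm_apply]
      linarith
    have a4 := mul_le_mul_of_nonneg_left a3 (by positivity : 0 ≤ 2 * μ)
    rw [hR, le_div_iff₀ (by positivity)]
    linarith
  have key := (integrable_powNorm_of_tendsto hr₁ hr₃ hu hv
    (fun n => integrable_timeMeasure_of_continuous
      ((continuous_powNorm_embV hr₁ hr₃).comp (h.continuous n)))
    h.tendsto_integral_norm_sub_sq tR hle).2
  rw [le_div_iff₀ (by positivity)] at key
  linarith

/-- The viscous term is linear and converges weakly, so it is first added back and later subtracted.
The differences of force, convection and damping are then at most δ times bounded energies plus 1/δ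
times quantities tending to 0 in L¹. -/
theorem tendsto_integral_test (h : IsGalerkinLimit hr₁ hr₃ T μ β f u₀ φ g u w K) (hT : 0 ≤ T)
    (hβ : 0 < β) (hf : MemLp f 2 (timeMeasure T)) (ψ : divFreeTest O) :
    Tendsto (fun n => ∫ s, (g n s + cbfOp hr₁ hr₃ μ β (u n s)) (testToV ψ) ∂timeMeasure T) atTop
      (𝓝 (∫ s, (f s + cbfOp hr₁ hr₃ μ β (asV (w s))) (testToV ψ) ∂timeMeasure T)) := by
  obtain ⟨hw, hv, hF⟩ := h.exists_limit
  have hu := fun n => memLp_timeMeasure_of_continuous (T := T) (h.continuous n)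
  have hg := fun n => memLp_timeMeasure_of_continuous (T := T) (h.continuous_force n)
  have hpu : ∀ n, Integrable (fun s => powNorm (r + 1) (embV (u n s))) (timeMeasure T) := fun n =>
    integrable_timeMeasure_of_continuous ((continuous_powNorm_embV hr₁ hr₃).comp (h.continuous n))
  have hpv := h.integrable_powNorm
  have hI : ∀ᵐ s ∂timeMeasure T, s ∈ Icc 0 T := by
    filter_upwards [ae_restrict_mem measurableSet_Ioo] with s hs using Ioo_subset_Icc_self hs
  have hK0 : 0 ≤ K := (norm_nonneg _).trans (h.norm_le 0 T ⟨hT, le_rfl⟩)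
  set z := testToV ψ with hz
  obtain ⟨A, hA0, hA⟩ := exists_abs_convForm_sub_le ψ
  obtain ⟨B, hB0, hB⟩ := exists_abs_dampForm_sub_le hr₁ hr₃ ψ
  have iFn : ∀ n, Integrable (fun s => (g n s + cbfOp hr₁ hr₃ μ β (u n s)) z) (timeMeasure T) :=
    fun n => (integrable_add_cbfOp hr₁ hr₃ μ β ((hg n).integrable (by norm_num)) (hu n)
      (hpu n)).apply_continuousLinearMap z
  have iF : Integrable (fun s => (f s + cbfOp hr₁ hr₃ μ β (asV (w s))) z) (timeMeasure T) :=
    (integrable_add_cbfOp hr₁ hr₃ μ β (hf.integrable (by norm_num)) hv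
      hpv).apply_continuousLinearMap z
  have iVn : ∀ n, Integrable (fun s => μ * viscForm O z (u n s)) (timeMeasure T) := fun n =>
    (((viscForm O z).comp_memLp' (hu n)).integrable (by norm_num)).const_mul μ
  have iV : Integrable (fun s => μ * viscForm O z (asV (w s))) (timeMeasure T) :=
    (((viscForm O z).comp_memLp' hv).integrable (by norm_num)).const_mul μ
  have iD1 : ∀ n, Integrable (fun s => ‖g n s - f s‖ ^ 2) (timeMeasure T) := fun n =>
    ((hg n).sub hf).integrable_norm_pow (by norm_num)
  have iD2 : ∀ n, Integrable (fun s => ‖embV (u n s) - embV (asV (w s))‖ ^ 2) (timeMeasure T) :=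
    fun n => (((embVL O).comp_memLp' (hu n)).sub ((embVL O).comp_memLp' hv)).integrable_norm_pow
      (by norm_num)
  have iQ1 : ∀ n, Integrable (fun s => 1 + powNorm (r + 1) (embV (u n s))) (timeMeasure T) :=
    fun n => (integrable_const 1).add (hpu n)
  have t1 : Tendsto (fun n => ∫ s, ((g n s + cbfOp hr₁ hr₃ μ β (u n s)) z +
      μ * viscForm O z (u n s)) ∂timeMeasure T) atTop
      (𝓝 (∫ s, ((f s + cbfOp hr₁ hr₃ μ β (asV (w s))) z + μ * viscForm O z (asV (w s)))
        ∂timeMeasure T)) := by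
    refine tendsto_integral_of_abs_sub_le (Q := fun n s => 1 + powNorm (r + 1) (embV (u n s)) +
        powNorm (r + 1) (embV (asV (w s))))
      (D := fun n s => ‖g n s - f s‖ ^ 2 + ‖embV (u n s) - embV (asV (w s))‖ ^ 2)
      (M := (∫ s, (1 : ℝ) ∂timeMeasure T) + K +
        ∫ s, powNorm (r + 1) (embV (asV (w s))) ∂timeMeasure T)
      (fun n => (iFn n).add (iVn n)) (iF.add iV) (fun n => (iQ1 n).add hpv)
      (fun n => (iD1 n).add (iD2 n)) (fun n => ?_) ?_ fun ε hε => ?_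
    · rw [integral_add (iQ1 n) hpv, integral_add (integrable_const 1) (hpu n)]
      gcongr
      exact h.integral_powNorm_le n
    · have := h.tendsto_force.add h.tendsto_integral_norm_sub_sq
      rw [add_zero] at this
      exact this.congr fun n => (integral_add (iD1 n) (iD2 n)).symm
    -- The sum of the coefficients of δ in the three estimates; the extra 1 makes L positive, and δ
    -- = ε/L gives total weight ε.
    · set L : ℝ := ‖z‖ ^ 2 + 2 * A * K + β * B + 1 with hL
      have hL0 : 0 < L := by positivity
      set δ := ε / L with hδ
      have hδ0 : 0 < δ := by positivity
      refine ⟨δ⁻¹ * L, fun n => ?_⟩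
      filter_upwards [hI, hw] with s hs hws
      have n1 := h.norm_le n s hs
      have n2 : ‖embV (asV (w s))‖ ≤ K := by
        rw [hws]
        exact h.norm_limit_le hs
      set a := ‖embV (u n s) - embV (asV (w s))‖ with ha
      set b := ‖g n s - f s‖ with hb
      set p := powNorm (r + 1) (embV (u n s))
      set q := powNorm (r + 1) (embV (asV (w s)))
      have hp0 : 0 ≤ p := powNorm_nonneg _ _
      have hq0 : 0 ≤ q := powNorm_nonneg _ _
      have ha0 : 0 ≤ a := norm_nonneg _
      have b1 : |(g n s - f s) z| ≤ δ * ‖z‖ ^ 2 + δ⁻¹ * b ^ 2 := by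
        refine ((g n s - f s).le_opNorm z).trans ?_
        rw [mul_comm]
        exact mul_le_mul_sq_add hδ0
      have b2 : |convForm (u n s) (u n s) z - convForm (asV (w s)) (asV (w s)) z| ≤
          2 * A * K * (δ + δ⁻¹ * a ^ 2) := by
        refine (hA _ _).trans ?_
        have c1 := mul_le_mul_sq_add hδ0 (a := 1) (b := a)
        rw [one_pow, mul_one, one_mul] at c1
        calc A * (a * (‖embV (u n s)‖ + ‖embV (asV (w s))‖)) ≤ A * (a * (K + K)) := by gcongr
          _ = 2 * A * K * a := by ring
          _ ≤ _ := by gcongr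
      have b3 := hB δ hδ0 (u n s) (asV (w s))
      have b4 : |β * (dampForm hr₁ hr₃ (u n s) z - dampForm hr₁ hr₃ (asV (w s)) z)| ≤
          β * B * (δ * (1 + p + q) + δ⁻¹ * a ^ 2) := by
        rw [abs_mul, abs_of_pos hβ, mul_assoc]
        exact mul_le_mul_of_nonneg_left b3 hβ.le
      have e : (g n s + cbfOp hr₁ hr₃ μ β (u n s)) z + μ * viscForm O z (u n s) -
          ((f s + cbfOp hr₁ hr₃ μ β (asV (w s))) z + μ * viscForm O z (asV (w s))) =
          (g n s - f s) z - (convForm (u n s) (u n s) z - convForm (asV (w s)) (asV (w s)) z) -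
            β * (dampForm hr₁ hr₃ (u n s) z - dampForm hr₁ hr₃ (asV (w s)) z) := by
        simp only [add_apply, sub_apply, cbfOp_apply, viscForm_apply,
          real_inner_comm (gradV z)]
        ring
      rw [e]
      refine (abs_sub _ _).trans ((add_le_add ((abs_sub _ _).trans (add_le_add b1 b2)) b4).trans ?_)
      have hεδ : ε = δ * L := by rw [hδ, div_mul_cancel₀ _ hL0.ne']
      rw [hεδ]
      have hi : 0 < δ⁻¹ := by positivity
      have d1 : 0 ≤ δ * (‖z‖ ^ 2 + 2 * A * K) * (p + q) := by positivity
      have d2 : 0 ≤ δ * (1 + p + q) := by positivity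
      have d3 : 0 ≤ δ⁻¹ * (‖z‖ ^ 2 + 2 * A * K + β * B) * b ^ 2 := by positivity
      have d4 : 0 ≤ δ⁻¹ * (‖z‖ ^ 2 + 1) * a ^ 2 := by positivity
      rw [hL]
      linarith
  have t2 := (hF (fun _ => μ • viscForm O z) (memLp_const _))
  have t3 := t1.sub t2
  rw [integral_add iF iV] at t3
  have e3 : ∫ s, (μ • viscForm O z) (asV (w s)) ∂timeMeasure T =
    ∫ s, μ * viscForm O z (asV (w s)) ∂timeMeasure T := rfl
  rw [e3, add_sub_cancel_right] at t3
  refine t3.congr fun n => ?_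
  rw [integral_add (iFn n) (iVn n)]
  exact add_sub_cancel_right _ _

theorem inner_eq (h : IsGalerkinLimit hr₁ hr₃ T μ β f u₀ φ g u w K) (hT : 0 ≤ T)
    (hβ : 0 < β) (hf : MemLp f 2 (timeMeasure T)) (z : VSpace O) :
    inner ℝ (w T) (embV z) = inner ℝ u₀ (embV z) +
      ∫ s in 0..T, (f s + cbfOp hr₁ hr₃ μ β (asV (w s))) z := by
  have hTT : T ∈ Icc 0 T := ⟨hT, le_rfl⟩
  obtain ⟨hw, hv, hF⟩ := h.exists_limit
  have iF := integrable_add_cbfOp hr₁ hr₃ μ β (hf.integrable (by norm_num)) hv h.integrable_powNorm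
  refine h.dense.induction_on (p := fun z => inner ℝ (w T) (embV z) = inner ℝ u₀ (embV z) +
      ∫ s in 0..T, (f s + cbfOp hr₁ hr₃ μ β (asV (w s))) z) z ?_ fun k => ?_
  · refine isClosed_eq (continuous_const.inner (embVL O).continuous)
      ((continuous_const.inner (embVL O).continuous).add ?_)
    have : ∀ z, ∫ s in 0..T, (f s + cbfOp hr₁ hr₃ μ β (asV (w s))) z =
        (∫ s in 0..T, (f s + cbfOp hr₁ hr₃ μ β (asV (w s)))) z := fun z =>
      ((ContinuousLinearMap.intervalIntegral_apply
        (intervalIntegrable_of_timeMeasure iF ⟨le_rfl, hT⟩ hTT) z)).symm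
    simp only [this]
    exact ContinuousLinearMap.continuous _
  · refine tendsto_nhds_unique (h.weak T hTT _) ?_
    rw [← integral_timeMeasure_eq hT]
    refine ((h.tendsto_integral_test hT hβ hf (φ k)).const_add _).congr' ?_
    filter_upwards [h.eq_add_integral k] with n hn
    rw [hn T hTT, integral_timeMeasure_eq hT]

end IsGalerkinLimit

theorem exists_isWeakSolution (hT : 0 < T) (hμ : 0 < μ) (hβ : 0 < β) (hr₁ : 1 ≤ r) (hr₃ : r ≤ 3)
    (u₀ : HSpace O) (f : ℝ → StrongDual ℝ (VSpace O)) (hf : MemLp f 2 (timeMeasure T)) :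
    ∃ u : ℝ → HSpace O, IsWeakSolution T μ β r f u₀ u ∧ WeaklyContinuous T u ∧
      (∀ t ∈ Icc 0 T, energy μ β r u t ≤ energyInput f u₀ u t) ∧
      Tendsto (fun t => ‖u t - u₀‖) (𝓝[>] 0) (𝓝 0) := by
  obtain ⟨φ, g, u, w, K, h⟩ := exists_isGalerkinLimit hr₁ hr₃ hT hμ hβ u₀ hf
  obtain ⟨hw, hv, -⟩ := h.exists_limit
  have hp := h.integrable_powNorm
  have hft : ∀ t ∈ Icc 0 T, MemLp f 2 (timeMeasure t) := fun t ht =>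
    hf.mono_measure (timeMeasure_mono ht.2)
  have hK : ∀ t ∈ Icc 0 T, ‖w t‖ ≤ K := fun t ht => h.norm_limit_le ht
  have heq : ∀ t ∈ Icc 0 T, ∀ z : VSpace O, inner ℝ (w t) (embV z) = inner ℝ u₀ (embV z) +
      ∫ s in 0..t, (f s + cbfOp hr₁ hr₃ μ β (asV (w s))) z := fun t ht =>
    -- The limit equation at the final time, with t as the horizon.
    (h.mono hf ht).inner_eq ht.1 hβ (hft t ht)
  have hsol := isWeakSolution_of_inner_eq hr₁ hr₃ hβ hT hf hw hv hp (K := K) (by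
    filter_upwards [ae_restrict_mem measurableSet_Ioo] with s hs
    exact hK s (Ioo_subset_Icc_self hs)) heq
  have hc := weaklyContinuous_of_inner_eq hr₁ hr₃ hT (hf.integrable (by norm_num)) hv hp hK heq
  have he : ∀ t ∈ Icc 0 T, energy μ β r w t ≤ energyInput f u₀ w t := by
    intro t ht
    have h1 := (h.mono hf ht).energy_limit_le ht.1 hμ hβ (hft t ht)
    have hwt : ∀ᵐ s ∂timeMeasure t, embV (asV (w s)) = w s :=
      ae_mono (timeMeasure_mono ht.2) hw
    rw [integral_congr_ae (hwt.mono fun s hs => congrArg (powNorm (r + 1)) hs),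
      integral_timeMeasure_eq ht.1, integral_timeMeasure_eq ht.1,
      integral_timeMeasure_eq ht.1] at h1
    exact h1
  exact ⟨w, hsol, hc, he, tendsto_norm_sub_of_energy_le hT hμ hβ hf hv hc hsol.initial he⟩

end CBF
end

theorem mainTheorem5 (d : ℕ) (hd₂ : 2 ≤ d) (hd₄ : d ≤ 4)
    (O : Set (CBF.Vec d)) (hO : IsOpen O) (hOb : Bornology.IsBounded O)
    (T μ β r : ℝ) (hT : 0 < T) (hμ : 0 < μ) (hβ : 0 < β) (hr₁ : 1 ≤ r) (hr₃ : r ≤ 3)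
    (u₀ : CBF.HSpace O) (f : ℝ → StrongDual ℝ (CBF.VSpace O))
    (hf : MemLp f 2 (CBF.timeMeasure T)) :
    (∃ u : ℝ → CBF.HSpace O,
      CBF.IsWeakSolution T μ β r f u₀ u ∧
      CBF.WeaklyContinuous T u ∧
      (∀ t ∈ Icc 0 T, CBF.energy μ β r u t ≤ CBF.energyInput f u₀ u t) ∧
      Tendsto (fun t => ‖u t - u₀‖) (𝓝[>] 0) (𝓝 0)) ∧
    (d = 2 →
      (∀ u : ℝ → CBF.HSpace O, CBF.IsWeakSolution T μ β r f u₀ u → CBF.WeaklyContinuous T u →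
        ∀ t ∈ Icc 0 T, CBF.energy μ β r u t = CBF.energyInput f u₀ u t) ∧
      (∀ u₁ u₂ : ℝ → CBF.HSpace O, CBF.IsWeakSolution T μ β r f u₀ u₁ →
        CBF.IsWeakSolution T μ β r f u₀ u₂ → ∀ᵐ t ∂CBF.timeMeasure T, u₁ t = u₂ t)) := by
  have : CBF.Admissible O := ⟨hd₂, hd₄, hO, hOb⟩
  refine ⟨CBF.exists_isWeakSolution hT hμ hβ hr₁ hr₃ u₀ f hf, fun hd => ⟨fun u h hw t ht => ?_,
    fun u₁ u₂ h₁ h₂ => h₁.ae_eq_of_two hd h₂ hr₁ hr₃ hT hμ hβ hf⟩⟩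
  exact h.energy_eq hd hw hr₁ hr₃ hT hμ hβ hf ht
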